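/- **Conventions.** Let $k$ be a field and $H$ a ribbon Hopf algebra over $k$ with invertible antipode $S$, universal $R$-matrix $R=\sum R_{1}\otimes R_{2}$ (so $R\Delta=\Delta^{\mathrm{op}}R$, $(\Delta\otimes\mathrm{id})(R)=R_{13}R_{23}$, $(\mathrm{id}\otimes\Delta)(R)=R_{13}R_{12}$), flip $R'=\sum R_2\otimes R_1$, and ribbon element $v$ (central, $v^2=uS(u)$ with $u=\sum S(R_2)R_1$, $S(v)=v$, $\varepsilon(v)=1$, $\Delta(v)R'R=v\otimes v$). Let $H^\circ$ be the restricted dual, spanned by the matrix coefficients ${}_V\phi^i_j$ of finite-dimensional $H$-modules $V$ (with chosen bases), and let $H\otimes H$ act on the right of $H^\circ$ by $\big(\varphi\cdot(x\otimes y)\big)(h)=\varphi\big(x\,h\,S(y)\big)$. In the formulas below, $a_i\otimes b_i$ ($i=1,2,3$) denote independent copies of $R$, $\bar a\otimes\bar b$ denotes $R^{-1}$, and summation is understood. * $\mathcal L_{0,1}$ is the vector space $H^\circ$ with unit $\varepsilon$ and product $(\varphi\psi)(h)=\sum\varphi\big(h_{(1)}S(b_1b_2)\big)\,\psi\big(a_1h_{(2)}S(a_2)\big)$.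 It is a right $H$-module-algebra for $\mathrm{coad}^r(h)(\varphi)=\varphi\cdot\Delta(h)=\varphi\big(h_{(1)}\,?\,S(h_{(2)})\big)$. * $\mathcal L_{1,0}$ is the vector space $\mathcal L_{0,1}\otimes\mathcal L_{0,1}$ with product $(\beta\otimes\alpha)(\beta'\otimes\alpha')=\sum\beta\,\big(\beta'\cdot(a_1a_2\otimes a_3\bar b)\big)\otimes\big(\alpha\cdot(b_2\bar a\otimes b_1b_3)\big)\,\alpha'$ and the diagonal right $H$-action. * $\mathcal L_{g,n}$ ($g,n\ge 0$) is the braided tensor product $\mathcal L_{1,0}^{\widetilde\otimes g}\,\widetilde\otimes\,\mathcal L_{0,1}^{\widetilde\otimes n}$ of right $H$-module-algebras, where $(m\otimes n)(m'\otimes n')=\sum m\,\mathrm{coad}^r(R_1)(m')\otimes\mathrm{coad}^r(R_2)(n)\,n'$, with the diagonal right $H$-action $\mathrm{coad}^r$. Put $h\blacktriangle x=\mathrm{coad}^r(S^{-1}(h))(x)$ for $h\in H$, $x\in\mathcal L_{g,n}$. * For a finite-dimensional $H$-module $V$ with a basis, ${}_VB(i),{}_VA(i)$ ($1\le i\le g$)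 and ${}_VM(g+j)$ ($1\le j\le n$) are the matrices with entries in $\mathcal L_{g,n}$ obtained by placing the matrix $({}_V\phi^k_l)_{k,l}$ in, respectively, the first and the second tensor factor of the $i$-th copy of $\mathcal L_{1,0}$, and in the $j$-th copy of $\mathcal L_{0,1}$. With $v_V$ the matrix of the action of $v$ on $V$ and products in increasing order, the boundary matrix is $${}_VC=\prod_{i=1}^{g}v_V^{2}\,{}_VB(i)\,{}_VA(i)^{-1}\,{}_VB(i)^{-1}\,{}_VA(i)\ \prod_{j=1}^{n}{}_VM(g+j).$$ * $\Phi_{0,1}:\mathcal L_{0,1}\to H$, $\Phi_{0,1}(\varphi)=(\varphi\otimes\mathrm{id})(RR')$, is an algebra morphism; let $H'\subseteq H$ be its image, a subalgebra of $H$. **Theorem.** Assume that $\Phi_{0,1}$ is injective, and let $g,n\ge 0$. Then the matrices ${}_VB(i)$ and ${}_VA(i)$ are invertible for all $V$ and $i$, and $\Delta(H')\subseteq H'\otimes H$. There is a unique linear map $\mu:H'\to\mathcal L_{g,n}$ such that $$\mu\big(\Phi_{0,1}({}_V\phi^k_l)\big)={}_VC^k_l$$ for all finite-dimensional $H$-modules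 $V$ (with a basis) and all $k,l$, and $\mu$ is a morphism of algebras. Moreover, for all $h'\in H'$ and $x\in\mathcal L_{g,n}$, $$\mu(h')\,x=\sum\big(h'_{(2)}\blacktriangle x\big)\,\mu\big(h'_{(1)}\big),\qquad \Delta(h')=\sum h'_{(1)}\otimes h'_{(2)}\in H'\otimes H.$$ -/

import Mathlib

open scoped TensorProduct

noncomputable section

namespace GraphAlgebra

universe u v w

section Quasitriangular

/-- A quasitriangular structure (universal `R`-matrix) on a Hopf algebra `H`:
an invertible `R ∈ H ⊗ H` with `R Δ(h) = Δᵒᵖ(h) R`, `(Δ ⊗ id)(R) = R₁₃ R₂₃` and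
`(id ⊗ Δ)(R) = R₁₃ R₁₂`. -/
structure RMatrix (k : Type u) (H : Type v) [Field k] [Ring H] [HopfAlgebra k H] where
  R : H ⊗[k] H
  isUnit_R : IsUnit R
  R_mul_comul : ∀ h : H,
    R * Coalgebra.comul (R := k) h = TensorProduct.comm k H H (Coalgebra.comul (R := k) h) * R
  comul_id_R :
    TensorProduct.assoc k H H H ((Coalgebra.comul (R := k) (A := H)).rTensor H R) =
      Algebra.TensorProduct.map (AlgHom.id k H) Algebra.TensorProduct.includeRight R *
        (Algebra.TensorProduct.includeRight : H ⊗[k] H →ₐ[k] H ⊗[k] (H ⊗[k] H)) R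
  id_comul_R :
    (Coalgebra.comul (R := k) (A := H)).lTensor H R =
      Algebra.TensorProduct.map (AlgHom.id k H) Algebra.TensorProduct.includeRight R *
        Algebra.TensorProduct.map (AlgHom.id k H) Algebra.TensorProduct.includeLeft R

variable {k : Type u} {H : Type v} [Field k] [Ring H] [HopfAlgebra k H]
variable {E : Type*} [Ring E] [Algebra k E]

/-- For `X = ∑ x₁ ⊗ x₂`, the element `∑ f(x₁) g(x₂)`. When `f`, `g` are embeddings of `D` as the
`i`-th and `j`-th legs of a tensor power, this is the usual `X_{ij}`. -/
def leg {D : Type*} [Ring D] [Algebra k D] (X : D ⊗[k] D) (f g : D →ₗ[k] E) : E :=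
  LinearMap.mul' k E (TensorProduct.map f g X)

section legGeneral
variable {D : Type*} [Ring D] [Algebra k D]

@[simp] lemma leg_tmul (a b : D) (f g : D →ₗ[k] E) : leg (a ⊗ₜ[k] b) f g = f a * g b := by
  simp [leg]

@[simp] lemma leg_add (X Y : D ⊗[k] D) (f g : D →ₗ[k] E) :
    leg (X + Y) f g = leg X f g + leg Y f g := by
  simp [leg]

@[simp] lemma leg_zero (f g : D →ₗ[k] E) : leg (0 : D ⊗[k] D) f g = 0 := by
  simp [leg]

lemma commute_leg (X : D ⊗[k] D) (f g : D →ₗ[k] E) {e : E}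
    (hf : ∀ x, Commute e (f x)) (hg : ∀ x, Commute e (g x)) : Commute e (leg X f g) := by
  induction X with
  | zero => simp
  | tmul a b => rw [leg_tmul]; exact (hf a).mul_right (hg b)
  | add X Y hX hY => rw [leg_add]; exact hX.add_right hY

lemma leg_commute_leg {D' : Type*} [Ring D'] [Algebra k D'] (X : D ⊗[k] D) (Y : D' ⊗[k] D')
    (f g : D →ₗ[k] E) (f' g' : D' →ₗ[k] E)
    (h1 : ∀ x y, Commute (f x) (f' y)) (h2 : ∀ x y, Commute (f x) (g' y))
    (h3 : ∀ x y, Commute (g x) (f' y)) (h4 : ∀ x y, Commute (g x) (g' y)) :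
    Commute (leg X f g) (leg Y f' g') :=
  commute_leg _ _ _
    (fun x => (commute_leg _ _ _ (fun y => (h1 y x).symm) (fun y => (h3 y x).symm)).symm)
    (fun x => (commute_leg _ _ _ (fun y => (h2 y x).symm) (fun y => (h4 y x).symm)).symm)

lemma leg_eq_lift (X : D ⊗[k] D) (f g : D →ₐ[k] E) (h : ∀ x y, Commute (f x) (g y)) :
    leg X f.toLinearMap g.toLinearMap = Algebra.TensorProduct.lift f g h X := by
  induction X with
  | zero => simp
  | tmul a b => simp
  | add X Y hX hY => simp [hX, hY]

lemma leg_mul (X Y : D ⊗[k] D) (f g : D →ₐ[k] E) (h : ∀ x y, Commute (f x) (g y)) :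
    leg (X * Y) f.toLinearMap g.toLinearMap =
      leg X f.toLinearMap g.toLinearMap * leg Y f.toLinearMap g.toLinearMap := by
  simp only [leg_eq_lift _ _ _ h, map_mul]

lemma leg_one (f g : D →ₐ[k] E) : leg (1 : D ⊗[k] D) f.toLinearMap g.toLinearMap = 1 := by
  rw [Algebra.TensorProduct.one_def]; simp

lemma leg_comm (X : D ⊗[k] D) (f g : D →ₗ[k] E) (h : ∀ x y, Commute (f x) (g y)) :
    leg (TensorProduct.comm k D D X) f g = leg X g f := by
  induction X with
  | zero => simp
  | tmul a b => simpa using (h b a).eq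
  | add X Y hX hY => simp [hX, hY]

lemma map_leg {E' : Type*} [Ring E'] [Algebra k E'] (F : E →ₐ[k] E') (X : D ⊗[k] D)
    (f g : D →ₗ[k] E) : F (leg X f g) = leg X (F.toLinearMap ∘ₗ f) (F.toLinearMap ∘ₗ g) := by
  induction X with
  | zero => simp
  | tmul a b => simp
  | add X Y hX hY => simp [hX, hY]

end legGeneral

/-- The convolution product `x ↦ ∑ f(x₁) g(x₂)`. -/
def conv (f g : H →ₗ[k] E) : H →ₗ[k] E :=
  LinearMap.mul' k E ∘ₗ TensorProduct.map f g ∘ₗ Coalgebra.comul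

lemma conv_apply (f g : H →ₗ[k] E) (h : H) : conv f g h = leg (Coalgebra.comul (R := k) h) f g :=
  rfl

lemma conv_assoc (f g h : H →ₗ[k] E) : conv (conv f g) h = conv f (conv g h) :=
  congrArg WithConv.ofConv
    (mul_assoc (WithConv.toConv f) (WithConv.toConv g) (WithConv.toConv h))

/-- the convolution unit -/
def unitCounit : H →ₐ[k] E := (Algebra.ofId k E).comp (Bialgebra.counitAlgHom k H)

lemma commute_unitCounit (x : H) (e : E) :
    Commute (unitCounit (k := k) (H := H) (E := E) x) e := by
  simpa [unitCounit, Algebra.ofId_apply] using Algebra.commute_algebraMap_left _ _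

lemma unitCounit_conv (f : H →ₗ[k] E) : conv (unitCounit (k := k) (H := H) (E := E)).toLinearMap f = f :=
  congrArg WithConv.ofConv (one_mul (WithConv.toConv f))

lemma conv_unitCounit (f : H →ₗ[k] E) : conv f (unitCounit (k := k) (H := H) (E := E)).toLinearMap = f :=
  congrArg WithConv.ofConv (mul_one (WithConv.toConv f))

lemma commute_conv (f g : H →ₗ[k] E) {e : E}
    (hf : ∀ x, Commute e (f x)) (hg : ∀ x, Commute e (g x)) (x : H) : Commute e (conv f g x) :=
  commute_leg _ _ _ hf hg

lemma map_conv {E' : Type*} [Ring E'] [Algebra k E'] (F : E →ₐ[k] E')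
    (f g : H →ₗ[k] E) :
    F.toLinearMap ∘ₗ conv f g = conv (F.toLinearMap ∘ₗ f) (F.toLinearMap ∘ₗ g) := by
  ext x; exact map_leg F _ f g

lemma conv_antipode (f : H →ₐ[k] E) :
    conv f.toLinearMap (f.toLinearMap ∘ₗ HopfAlgebra.antipode k) =
      (unitCounit (k := k) (H := H) (E := E)).toLinearMap := by
  have h1 : conv (LinearMap.id : H →ₗ[k] H) (HopfAlgebra.antipode k) =
      (unitCounit (k := k) (H := H) (E := H)).toLinearMap :=
    congrArg WithConv.ofConv (LinearMap.id_mul_antipode (R := k) (C := H))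
  have h2 := map_conv f (LinearMap.id : H →ₗ[k] H) (HopfAlgebra.antipode k)
  rw [h1] at h2
  rw [LinearMap.comp_id] at h2
  rw [← h2]; ext x; simp [unitCounit, Algebra.ofId_apply]

lemma antipode_conv (f : H →ₐ[k] E) :
    conv (f.toLinearMap ∘ₗ HopfAlgebra.antipode k) f.toLinearMap =
      (unitCounit (k := k) (H := H) (E := E)).toLinearMap := by
  have h1 : conv (HopfAlgebra.antipode k) (LinearMap.id : H →ₗ[k] H)  =
      (unitCounit (k := k) (H := H) (E := H)).toLinearMap :=
    congrArg WithConv.ofConv (LinearMap.antipode_mul_id (R := k) (C := H))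
  have h2 := map_conv f (HopfAlgebra.antipode k) (LinearMap.id : H →ₗ[k] H)
  rw [h1] at h2
  rw [LinearMap.comp_id] at h2
  rw [← h2]; ext x; simp [unitCounit, Algebra.ofId_apply]

namespace RMatrix
variable (Q : RMatrix k H)

/-- The inverse of `R`. -/
def Rinv : H ⊗[k] H := ↑(Q.isUnit_R.unit⁻¹)

lemma R_mul_Rinv : Q.R * Q.Rinv = 1 := Q.isUnit_R.mul_val_inv
lemma Rinv_mul_R : Q.Rinv * Q.R = 1 := Q.isUnit_R.val_inv_mul

lemma leg_Rinv_mul (f g : H →ₐ[k] E) (h : ∀ x y, Commute (f x) (g y)) :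
    leg Q.Rinv f.toLinearMap g.toLinearMap * leg Q.R f.toLinearMap g.toLinearMap = 1 := by
  rw [← leg_mul _ _ _ _ h, Rinv_mul_R, leg_one]

lemma leg_mul_Rinv (f g : H →ₐ[k] E) (h : ∀ x y, Commute (f x) (g y)) :
    leg Q.R f.toLinearMap g.toLinearMap * leg Q.Rinv f.toLinearMap g.toLinearMap = 1 := by
  rw [← leg_mul _ _ _ _ h, R_mul_Rinv, leg_one]

/-- trilinear evaluation -/
def leg3 (f g h : H →ₗ[k] E) : H ⊗[k] (H ⊗[k] H) →ₗ[k] E :=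
  LinearMap.mul' k E ∘ₗ TensorProduct.map f (LinearMap.mul' k E ∘ₗ TensorProduct.map g h)

lemma leg_R_conv_left (f g : H →ₗ[k] E) (h : H →ₐ[k] E) (hg : ∀ x y, Commute (g x) (h y)) :
    leg Q.R (conv f g) h.toLinearMap = leg Q.R f h.toLinearMap * leg Q.R g h.toLinearMap := by
  have key := congrArg (leg3 f g h.toLinearMap) Q.comul_id_R
  have e1 : ∀ X : H ⊗[k] H, leg3 f g h.toLinearMap
      (TensorProduct.assoc k H H H ((Coalgebra.comul (R := k) (A := H)).rTensor H X)) =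
      leg X (conv f g) h.toLinearMap := by
    intro X
    induction X with
    | zero => simp
    | add X Y hX hY => simp only [map_add, hX, hY, leg_add]
    | tmul a b =>
      simp only [LinearMap.rTensor_tmul, leg_tmul, conv_apply]
      generalize Coalgebra.comul (R := k) a = Z
      induction Z with
      | zero => simp
      | add X Y hX hY => simp only [TensorProduct.add_tmul, map_add, hX, hY, leg_add, add_mul]
      | tmul c d => simp [leg3, mul_assoc]
  have e2 : ∀ X Y : H ⊗[k] H, leg3 f g h.toLinearMap
      (Algebra.TensorProduct.map (AlgHom.id k H) Algebra.TensorProduct.includeRight X *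
        (Algebra.TensorProduct.includeRight : H ⊗[k] H →ₐ[k] H ⊗[k] (H ⊗[k] H)) Y) =
      leg X f h.toLinearMap * leg Y g h.toLinearMap := by
    intro X Y
    induction X with
    | zero => simp
    | add X Y hX hY => simp only [map_add, hX, hY, leg_add, add_mul]
    | tmul a b =>
      induction Y with
      | zero => simp
      | add X Y hX hY => simp only [map_add, hX, hY, leg_add, mul_add]
      | tmul c d =>
        have := (hg c b).eq
        simp [leg3, mul_assoc]
        rw [← mul_assoc (g c), this, mul_assoc]
  rw [e1, e2] at key
  exact key

lemma id_comul_aux (f g h : H →ₗ[k] E) (X : H ⊗[k] H) : leg3 f g h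
      ((Coalgebra.comul (R := k) (A := H)).lTensor H X) = leg X f (conv g h) := by
  induction X with
  | zero => simp
  | add X Y hX hY => simp only [map_add, hX, hY, leg_add]
  | tmul a b =>
    simp [leg3, conv]

lemma leg_R_conv_right (f : H →ₐ[k] E) (g h : H →ₗ[k] E)
    (hf : ∀ x y, Commute (h x) (f y)) (hg : ∀ x y, Commute (h x) (g y)) :
    leg Q.R f.toLinearMap (conv g h) = leg Q.R f.toLinearMap h * leg Q.R f.toLinearMap g := by
  have key := congrArg (leg3 f.toLinearMap g h) Q.id_comul_R
  have e2 : ∀ X Y : H ⊗[k] H, leg3 f.toLinearMap g h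
      (Algebra.TensorProduct.map (AlgHom.id k H) Algebra.TensorProduct.includeRight X *
        Algebra.TensorProduct.map (AlgHom.id k H) Algebra.TensorProduct.includeLeft Y) =
      leg X f.toLinearMap h * leg Y f.toLinearMap g := by
    intro X Y
    induction X with
    | zero => simp
    | add X Y hX hY => simp only [map_add, hX, hY, leg_add, add_mul]
    | tmul a b =>
      induction Y with
      | zero => simp
      | add X Y hX hY => simp only [map_add, hX, hY, leg_add, mul_add]
      | tmul c d =>
        simp [leg3, mul_assoc]
        rw [← (hg b d).eq, ← mul_assoc (f c), ← (hf b c).eq, mul_assoc]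
  rw [id_comul_aux, e2] at key
  exact key

/-- The same for an anti-homomorphism in the first slot. -/
lemma leg_R_conv_right_anti (f : H →ₗ[k] E) (g h : H →ₗ[k] E)
    (hanti : ∀ x y, f (x * y) = f y * f x) (hg : ∀ x y, Commute (f x) (g y)) :
    leg Q.R f (conv g h) = leg Q.R f g * leg Q.R f h := by
  have key := congrArg (leg3 f g h) Q.id_comul_R
  have e2 : ∀ X Y : H ⊗[k] H, leg3 f g h
      (Algebra.TensorProduct.map (AlgHom.id k H) Algebra.TensorProduct.includeRight X *
        Algebra.TensorProduct.map (AlgHom.id k H) Algebra.TensorProduct.includeLeft Y) =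
      leg Y f g * leg X f h := by
    intro X Y
    induction X with
    | zero => simp
    | add X Y hX hY => simp only [map_add, hX, hY, leg_add, add_mul, mul_add]
    | tmul a b =>
      induction Y with
      | zero => simp
      | add X Y hX hY => simp only [map_add, hX, hY, leg_add, mul_add, add_mul]
      | tmul c d =>
        simp [leg3, mul_assoc, hanti]
        rw [← mul_assoc (f a), (hg a d).eq, mul_assoc]
  rw [id_comul_aux, e2] at key
  exact key

lemma leg_R_mul_conv (f g : H →ₐ[k] E) (h : ∀ x y, Commute (f x) (g y)) (x : H) :
    leg Q.R f.toLinearMap g.toLinearMap * conv f.toLinearMap g.toLinearMap x =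
      conv g.toLinearMap f.toLinearMap x * leg Q.R f.toLinearMap g.toLinearMap := by
  rw [conv_apply, ← leg_mul _ _ _ _ h, Q.R_mul_comul, leg_mul _ _ _ _ h, leg_comm _ _ _ h]
  rfl

lemma yang_baxter (f g h : H →ₐ[k] E) (hfg : ∀ x y, Commute (f x) (g y))
    (hfh : ∀ x y, Commute (f x) (h y)) (hgh : ∀ x y, Commute (g x) (h y)) :
    leg Q.R f.toLinearMap g.toLinearMap * leg Q.R f.toLinearMap h.toLinearMap *
        leg Q.R g.toLinearMap h.toLinearMap =
      leg Q.R g.toLinearMap h.toLinearMap * leg Q.R f.toLinearMap h.toLinearMap *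
        leg Q.R f.toLinearMap g.toLinearMap := by
  rw [mul_assoc, ← Q.leg_R_conv_left _ _ h hgh, ← Q.leg_R_conv_left _ _ h hfh]
  have : ∀ X : H ⊗[k] H, leg Q.R f.toLinearMap g.toLinearMap *
      leg X (conv f.toLinearMap g.toLinearMap) h.toLinearMap =
      leg X (conv g.toLinearMap f.toLinearMap) h.toLinearMap *
        leg Q.R f.toLinearMap g.toLinearMap := by
    intro X
    induction X with
    | zero => simp
    | add X Y hX hY => simp only [leg_add, mul_add, add_mul, hX, hY]
    | tmul a b =>
      have hc : Commute (h b) (leg Q.R f.toLinearMap g.toLinearMap) :=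
        commute_leg _ _ _ (fun x => (hfh x b).symm) (fun x => (hgh x b).symm)
      simp only [leg_tmul]
      rw [← mul_assoc, Q.leg_R_mul_conv f g hfg, mul_assoc, mul_assoc]
      exact congrArg _ hc.eq.symm
  exact this Q.R

lemma leg_counit_left (g : H →ₐ[k] E) :
    leg Q.R (unitCounit (k := k) (H := H) (E := E)).toLinearMap g.toLinearMap = 1 := by
  -- work in a tensor product so that the two homomorphisms commute
  let f' : H →ₐ[k] H ⊗[k] E := Algebra.TensorProduct.includeLeft
  let g' : H →ₐ[k] H ⊗[k] E := Algebra.TensorProduct.includeRight.comp g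
  have hc : ∀ x y, Commute (f' x) (g' y) := fun x y => by
    simp [f', g', Commute, SemiconjBy]
  have h1 := Q.leg_R_conv_left (unitCounit (k := k) (H := H) (E := H ⊗[k] E)).toLinearMap
    f'.toLinearMap g' hc
  rw [unitCounit_conv] at h1
  have h2 := congrArg (· * leg Q.Rinv f'.toLinearMap g'.toLinearMap) h1
  simp only [mul_assoc, Q.leg_mul_Rinv f' g' hc, mul_one] at h2
  let F : H ⊗[k] E →ₐ[k] E :=
    Algebra.TensorProduct.lift unitCounit (AlgHom.id k E) (fun x y => commute_unitCounit _ _)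
  have h3 := congrArg F h2
  rw [map_one, map_leg] at h3
  rw [h3]
  congr 1
  · ext x; simp [F, unitCounit, Algebra.ofId_apply]
  · ext x; simp [F, g', unitCounit]

lemma leg_counit_right (f : H →ₐ[k] E) :
    leg Q.R f.toLinearMap (unitCounit (k := k) (H := H) (E := E)).toLinearMap = 1 := by
  let g' : H →ₐ[k] H ⊗[k] E := Algebra.TensorProduct.includeLeft
  let f' : H →ₐ[k] H ⊗[k] E := Algebra.TensorProduct.includeRight.comp f
  have hc : ∀ x y, Commute (f' x) (g' y) := fun x y => by
    simp [f', g', Commute, SemiconjBy]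
  have h1 := Q.leg_R_conv_right f' g'.toLinearMap
    (unitCounit (k := k) (H := H) (E := H ⊗[k] E)).toLinearMap
    (fun x y => by rw [AlgHom.toLinearMap_apply]; exact commute_unitCounit _ _)
    (fun x y => by rw [AlgHom.toLinearMap_apply]; exact commute_unitCounit _ _)
  rw [conv_unitCounit] at h1
  have h2 := congrArg (· * leg Q.Rinv f'.toLinearMap g'.toLinearMap) h1
  simp only [mul_assoc, Q.leg_mul_Rinv f' g' hc, mul_one] at h2
  let F : H ⊗[k] E →ₐ[k] E :=
    Algebra.TensorProduct.lift unitCounit (AlgHom.id k E) (fun x y => commute_unitCounit _ _)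
  have h3 := congrArg F h2
  rw [map_one, map_leg] at h3
  rw [h3]
  congr 1
  · ext x; simp [F, f', unitCounit]
  · ext x; simp [F, unitCounit, Algebra.ofId_apply]

lemma antipode_leg_mul (f g : H →ₐ[k] E) (h : ∀ x y, Commute (f x) (g y)) :
    leg Q.R (f.toLinearMap ∘ₗ HopfAlgebra.antipode k) g.toLinearMap *
      leg Q.R f.toLinearMap g.toLinearMap = 1 := by
  rw [← Q.leg_R_conv_left _ _ g h, antipode_conv, leg_counit_left]

/-- `(S ⊗ S)(R) = R`. -/
lemma leg_antipode_antipode (f g : H →ₐ[k] E) (h : ∀ x y, Commute (f x) (g y)) :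
    leg Q.R (f.toLinearMap ∘ₗ HopfAlgebra.antipode k) (g.toLinearMap ∘ₗ HopfAlgebra.antipode k) =
      leg Q.R f.toLinearMap g.toLinearMap := by
  have h1 := Q.leg_R_conv_right_anti (f.toLinearMap ∘ₗ HopfAlgebra.antipode k) g.toLinearMap
    (g.toLinearMap ∘ₗ HopfAlgebra.antipode k)
    (fun x y => by simp [HopfAlgebra.antipode_mul_antidistrib]) (fun x y => h _ _)
  have h0 : leg Q.R (f.toLinearMap ∘ₗ HopfAlgebra.antipode k)
      (unitCounit (k := k) (H := H) (E := E)).toLinearMap = 1 := by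
    have e : ∀ X : H ⊗[k] H, leg X (f.toLinearMap ∘ₗ HopfAlgebra.antipode k)
        (unitCounit (k := k) (H := H) (E := E)).toLinearMap =
        (f.toLinearMap ∘ₗ HopfAlgebra.antipode k)
          (leg X (AlgHom.id k H).toLinearMap (unitCounit (k := k) (H := H)).toLinearMap) := by
      intro X
      induction X with
      | zero => simp
      | add X Y hX hY => rw [leg_add, hX, hY, leg_add, map_add]
      | tmul a b =>
        simp [unitCounit, Algebra.ofId_apply, ← Algebra.commutes, ← Algebra.smul_def]
    rw [e, leg_counit_right]
    simp
  rw [conv_antipode, h0] at h1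
  have h2 := Q.antipode_leg_mul f g h
  have hu : IsUnit (leg Q.R f.toLinearMap g.toLinearMap) :=
    ⟨⟨_, _, Q.leg_mul_Rinv f g h, Q.leg_Rinv_mul f g h⟩, rfl⟩
  have h3 := congrArg (leg Q.R f.toLinearMap g.toLinearMap * ·) h1
  have h4 : leg Q.R f.toLinearMap g.toLinearMap *
      leg Q.R (f.toLinearMap ∘ₗ HopfAlgebra.antipode k) g.toLinearMap = 1 := by
    obtain ⟨u, hu⟩ := hu
    rw [← hu] at h2 ⊢
    exact Units.mul_eq_one_iff_inv_eq.mpr (Units.eq_inv_of_mul_eq_one_right h2).symm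
  simp only [← mul_assoc, h4, one_mul, mul_one] at h3
  exact h3.symm

end RMatrix
end Quasitriangular

section ModuleAlgebras

variable {k : Type u} [Field k] {D : Type v} [Ring D] [Algebra k D]

/-- A right module-algebra over an algebra `D` equipped with algebra morphisms `δ : D → D ⊗ D`
(coproduct) and `ε : D → k` (counit): a `k`-algebra with a right action `x · d = act x d` of `D`
such that `1 · d = ε(d) 1` and `(x y) · d = ∑ (x · d₁)(y · d₂)`. -/
structure ModAlg (δ : D →ₐ[k] D ⊗[k] D) (ε : D →ₐ[k] k) where
  carrier : Type w
  [ring : Ring carrier]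
  [algebra : Algebra k carrier]
  act : carrier →ₗ[k] D →ₗ[k] carrier
  act_one : ∀ x, act x 1 = x
  act_mul : ∀ x d e, act x (d * e) = act (act x d) e
  one_act : ∀ d, act 1 d = algebraMap k carrier (ε d)
  mul_act : ∀ x y d, act (x * y) d =
    LinearMap.mul' k carrier (TensorProduct.map (act x) (act y) (δ d))

attribute [instance] ModAlg.ring ModAlg.algebra

namespace ModAlg

variable {δ : D →ₐ[k] D ⊗[k] D} {ε : D →ₐ[k] k} (A : ModAlg.{u, v, w} δ ε)

/-- `∑ (x · X₁)(y · X₂)` for `X = ∑ X₁ ⊗ X₂`. -/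
def ev2 (x y : A.carrier) : D ⊗[k] D →ₗ[k] A.carrier :=
  LinearMap.mul' k A.carrier ∘ₗ TensorProduct.map (A.act x) (A.act y)

@[simp] lemma ev2_tmul (x y : A.carrier) (a b : D) :
    A.ev2 x y (a ⊗ₜ[k] b) = A.act x a * A.act y b := by simp [ev2]

lemma mul_act' (x y : A.carrier) (d : D) : A.act (x * y) d = A.ev2 x y (δ d) := A.mul_act x y d

lemma ev2_mul (x y : A.carrier) (a b : D) (Y : D ⊗[k] D) :
    A.ev2 (A.act x a) (A.act y b) Y = A.ev2 x y (a ⊗ₜ[k] b * Y) := by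
  induction Y with
  | zero => simp
  | add X Y hX hY => simp only [map_add, mul_add, hX, hY]
  | tmul c d => simp [A.act_mul]

lemma act_ev2 (x y : A.carrier) (X : D ⊗[k] D) (d : D) :
    A.act (A.ev2 x y X) d = A.ev2 x y (X * δ d) := by
  induction X with
  | zero => simp
  | add X Y hX hY => simp only [map_add, add_mul, LinearMap.add_apply, hX, hY]
  | tmul a b => rw [ev2_tmul, mul_act', ev2_mul]

/-- trilinear version of `ev2` -/
def ev3 (x y z : A.carrier) : D ⊗[k] (D ⊗[k] D) →ₗ[k] A.carrier :=
  LinearMap.mul' k A.carrier ∘ₗ TensorProduct.map (A.act x) (A.ev2 y z)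

lemma ev3_assoc (x y z : A.carrier) (X : D ⊗[k] D) (b : D) :
    A.ev3 x y z (TensorProduct.assoc k D D D (X ⊗ₜ[k] b)) = A.ev2 x y X * A.act z b := by
  induction X with
  | zero => simp
  | add X Y hX hY => simp only [map_add, TensorProduct.add_tmul, add_mul, hX, hY]
  | tmul a b => simp [ev3, mul_assoc]

end ModAlg

/-- An invertible `J ∈ D ⊗ D` is a twist if `(J ⊗ 1)(δ ⊗ id)(J) = (1 ⊗ J)(id ⊗ δ)(J)` and
`(ε ⊗ id)(J) = (id ⊗ ε)(J) = 1`. -/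
structure IsTwist (δ : D →ₐ[k] D ⊗[k] D) (ε : D →ₐ[k] k) (J : D ⊗[k] D) : Prop where
  isUnit : IsUnit J
  cocycle : Algebra.TensorProduct.assoc k k k D D D
      ((J ⊗ₜ[k] (1 : D)) * Algebra.TensorProduct.map δ (AlgHom.id k D) J) =
    ((1 : D) ⊗ₜ[k] J) * Algebra.TensorProduct.map (AlgHom.id k D) δ J
  counit_left : Algebra.TensorProduct.lid k D
      (Algebra.TensorProduct.map ε (AlgHom.id k D) J) = 1
  counit_right : Algebra.TensorProduct.rid k k D
      (Algebra.TensorProduct.map (AlgHom.id k D) ε J) = 1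

/-- Conjugation by a unit. -/
def conjHom {B : Type*} [Ring B] [Algebra k B] (c : Bˣ) (f : D →ₐ[k] B) : D →ₐ[k] B where
  toFun d := ↑c * f d * ↑c⁻¹
  map_one' := by simp
  map_mul' x y := by simp [mul_assoc]
  map_zero' := by simp
  map_add' x y := by simp [mul_add, add_mul]
  commutes' r := by
    simp only [AlgHom.commutes]
    rw [← Algebra.commutes, mul_assoc, Units.mul_inv, mul_one]

lemma conjHom_apply {B : Type*} [Ring B] [Algebra k B] (c : Bˣ) (f : D →ₐ[k] B) (d : D) :
    conjHom c f d = ↑c * f d * ↑c⁻¹ := rfl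

/-- The twisted coproduct `d ↦ J δ(d) J⁻¹`. -/
def twistComul (δ : D →ₐ[k] D ⊗[k] D) {J : D ⊗[k] D} (hJ : IsUnit J) : D →ₐ[k] D ⊗[k] D :=
  conjHom hJ.unit δ

namespace ModAlg

variable {δ : D →ₐ[k] D ⊗[k] D} {ε : D →ₐ[k] k} (A : ModAlg.{u, v, w} δ ε)

lemma ev2_ev2_left (x y z : A.carrier) (J X : D ⊗[k] D) :
    A.ev2 (A.ev2 x y J) z X = A.ev3 x y z (Algebra.TensorProduct.assoc k k k D D D
      ((J ⊗ₜ[k] (1 : D)) * Algebra.TensorProduct.map δ (AlgHom.id k D) X)) := by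
  induction X with
  | zero => simp
  | add X Y hX hY => simp only [map_add, mul_add, hX, hY]
  | tmul a b =>
    simp only [ev2_tmul, act_ev2, Algebra.TensorProduct.map_tmul, AlgHom.id_apply,
      Algebra.TensorProduct.tmul_mul_tmul, one_mul]
    exact (A.ev3_assoc x y z _ _).symm

lemma ev2_ev2_right (x y z : A.carrier) (J X : D ⊗[k] D) :
    A.ev2 x (A.ev2 y z J) X = A.ev3 x y z
      (((1 : D) ⊗ₜ[k] J) * Algebra.TensorProduct.map (AlgHom.id k D) δ X) := by
  induction X with
  | zero => simp
  | add X Y hX hY => simp only [map_add, mul_add, hX, hY]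
  | tmul a b => simp [act_ev2, ev3]

lemma ev2_one_left (x : A.carrier) (X : D ⊗[k] D) :
    A.ev2 1 x X = A.act x (Algebra.TensorProduct.lid k D
      (Algebra.TensorProduct.map ε (AlgHom.id k D) X)) := by
  induction X with
  | zero => simp
  | add X Y hX hY => simp only [map_add, hX, hY]
  | tmul a b => simp [A.one_act, ← Algebra.smul_def]

lemma ev2_one_right (x : A.carrier) (X : D ⊗[k] D) :
    A.ev2 x 1 X = A.act x (Algebra.TensorProduct.rid k k D
      (Algebra.TensorProduct.map (AlgHom.id k D) ε X)) := by
  induction X with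
  | zero => simp
  | add X Y hX hY => simp only [map_add, hX, hY]
  | tmul a b => simp [A.one_act, ← Algebra.commutes, ← Algebra.smul_def]

/-- The unital associative ring with underlying vector space `V`, product `m` and unit `e`. -/
@[reducible] def ringOf {V : Type w} [AddCommGroup V] [Module k V] (m : V →ₗ[k] V →ₗ[k] V) (e : V)
    (assoc : ∀ x y z, m (m x y) z = m x (m y z)) (one_m : ∀ x, m e x = x) (m_one : ∀ x, m x e = x) :
    Ring V :=
  { ‹AddCommGroup V› with
    mul := fun x y => m x y
    one := e
    mul_assoc := assoc
    one_mul := one_m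
    mul_one := m_one
    left_distrib := fun x y z => (m x).map_add y z
    right_distrib := fun x y z => m.map_add₂ x y z
    zero_mul := fun x => m.map_zero₂ x
    mul_zero := fun x => (m x).map_zero }

/-- The corresponding `k`-algebra structure. -/
@[reducible] def algebraOf {V : Type w} [AddCommGroup V] [Module k V] (m : V →ₗ[k] V →ₗ[k] V)
    (e : V) (assoc : ∀ x y z, m (m x y) z = m x (m y z)) (one_m : ∀ x, m e x = x)
    (m_one : ∀ x, m x e = x) : @Algebra k V _ (ringOf m e assoc one_m m_one).toSemiring :=
  letI := ringOf m e assoc one_m m_one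
  { smul := fun r x => r • x
    algebraMap :=
      { toFun := fun r => r • e
        map_one' := one_smul k e
        map_mul' := fun r s => by
          change (r * s) • e = m (r • e) (s • e)
          rw [LinearMap.map_smul₂, map_smul, one_m, mul_smul]
        map_zero' := zero_smul k e
        map_add' := fun r s => add_smul r s e }
    commutes' := fun r x => by
      change m (r • e) x = m x (r • e)
      rw [LinearMap.map_smul₂, map_smul, one_m, m_one]
    smul_def' := fun r x => by
      change r • x = m (r • e) x
      rw [LinearMap.map_smul₂, one_m] }

/-- A module-algebra from a vector space, a bilinear associative unital product and an action. -/
def ofBilinear (δ : D →ₐ[k] D ⊗[k] D) (ε : D →ₐ[k] k)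
    (V : Type w) [AddCommGroup V] [Module k V] (m : V →ₗ[k] V →ₗ[k] V) (e : V)
    (assoc : ∀ x y z, m (m x y) z = m x (m y z)) (one_m : ∀ x, m e x = x) (m_one : ∀ x, m x e = x)
    (act : V →ₗ[k] D →ₗ[k] V) (act_one : ∀ x, act x 1 = x)
    (act_mul : ∀ x d d', act x (d * d') = act (act x d) d')
    (one_act : ∀ d, act e d = ε d • e)
    (mul_act : ∀ x y d, act (m x y) d =
      TensorProduct.lift m (TensorProduct.map (act x) (act y) (δ d))) :
    ModAlg.{u, v, w} δ ε :=
  letI := ringOf m e assoc one_m m_one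
  letI := algebraOf m e assoc one_m m_one
  { carrier := V
    ring := ringOf m e assoc one_m m_one
    algebra := algebraOf m e assoc one_m m_one
    act := act
    act_one := act_one
    act_mul := act_mul
    one_act := one_act
    mul_act := fun x y d => by
      refine (mul_act x y d).trans ?_
      congr 1 }

/-- The twisted product `x *_J y = ∑ (x · J₁)(y · J₂)`. -/
def twistMul (J : D ⊗[k] D) : A.carrier →ₗ[k] A.carrier →ₗ[k] A.carrier :=
  LinearMap.mk₂ k (fun x y => LinearMap.mul' k A.carrier (TensorProduct.map (A.act x) (A.act y) J))
    (by simp [TensorProduct.map_add_left]) (by simp [TensorProduct.map_smul_left])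
    (by simp [TensorProduct.map_add_right]) (by simp [TensorProduct.map_smul_right])

lemma twistMul_apply (J : D ⊗[k] D) (x y : A.carrier) : A.twistMul J x y = A.ev2 x y J := rfl

lemma lift_twistMul (J : D ⊗[k] D) (x y : A.carrier) (X : D ⊗[k] D) :
    TensorProduct.lift (A.twistMul J) (TensorProduct.map (A.act x) (A.act y) X) =
      A.ev2 x y (X * J) := by
  induction X with
  | zero => simp
  | add X Y hX hY => simp only [map_add, add_mul, hX, hY]
  | tmul a b => simp [twistMul_apply, ev2_mul]

/-- The twist of a module-algebra by `J`: the same space with the same action and unit and the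
product `x *_J y = ∑ (x · J₁)(y · J₂)`; it is a module-algebra for the twisted coproduct. -/
def twist {J : D ⊗[k] D} (hJ : IsTwist δ ε J) : ModAlg.{u, v, w} (twistComul δ hJ.isUnit) ε :=
  ofBilinear _ _ A.carrier (A.twistMul J) 1
    (fun x y z => by simp only [twistMul_apply, ev2_ev2_left, ev2_ev2_right, hJ.cocycle])
    (fun x => by rw [twistMul_apply, ev2_one_left, hJ.counit_left, A.act_one])
    (fun x => by rw [twistMul_apply, ev2_one_right, hJ.counit_right, A.act_one])
    A.act A.act_one A.act_mul (fun d => by rw [A.one_act, Algebra.algebraMap_eq_smul_one])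
    (fun x y d => by
      rw [lift_twistMul, twistMul_apply, act_ev2, twistComul, conjHom_apply, mul_assoc]
      have : (↑hJ.isUnit.unit⁻¹ : D ⊗[k] D) * J = 1 := hJ.isUnit.val_inv_mul
      rw [this, mul_one]; rfl)

end ModAlg
end ModuleAlgebras

section RestrictedDual

variable (k : Type u) (H : Type v) [Field k] [Ring H] [HopfAlgebra k H]

/-- `Δ(S(y)) = ∑ S(y₂) ⊗ S(y₁)`. -/
lemma comul_antipode (y : H) :
    Coalgebra.comul (R := k) (HopfAlgebra.antipode k y) =
      TensorProduct.map (HopfAlgebra.antipode k) (HopfAlgebra.antipode k)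
        (TensorProduct.comm k H H (Coalgebra.comul (R := k) y)) := by
  let i1 : H →ₐ[k] H ⊗[k] H := Algebra.TensorProduct.includeLeft
  let i2 : H →ₐ[k] H ⊗[k] H := Algebra.TensorProduct.includeRight
  let c : H →ₐ[k] H ⊗[k] H := Bialgebra.comulAlgHom k H
  let s : H →ₗ[k] H := HopfAlgebra.antipode k
  let G : H →ₗ[k] H ⊗[k] H := conv (i2.toLinearMap ∘ₗ s) (i1.toLinearMap ∘ₗ s)
  have hc : c.toLinearMap = conv i1.toLinearMap i2.toLinearMap := by
    ext x
    rw [conv_apply]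
    change Coalgebra.comul (R := k) x = _
    generalize Coalgebra.comul (R := k) x = X
    induction X with
    | zero => simp
    | add X Y hX hY => rw [leg_add, ← hX, ← hY]
    | tmul a b => simp [i1, i2]
  have h1 : conv c.toLinearMap G = (unitCounit (k := k) (H := H) (E := H ⊗[k] H)).toLinearMap := by
    rw [hc, conv_assoc, ← conv_assoc i2.toLinearMap, conv_antipode, unitCounit_conv, conv_antipode]
  have h2 := antipode_conv c
  have h3 : c.toLinearMap ∘ₗ s = G := by
    calc c.toLinearMap ∘ₗ s = conv (c.toLinearMap ∘ₗ s) (conv c.toLinearMap G) := by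
          rw [h1, conv_unitCounit]
      _ = G := by rw [← conv_assoc, h2, unitCounit_conv]
  have h4 := LinearMap.congr_fun h3 y
  refine h4.trans ?_
  change conv _ _ _ = _
  rw [conv_apply]
  generalize Coalgebra.comul (R := k) y = X
  induction X with
  | zero => simp
  | add X Y hX hY => rw [leg_add, hX, hY]; simp
  | tmul a b => simp [i1, i2, s]

variable {k H}

/-- The matrix coefficient `h ↦ ρ(h)ᵢⱼ` of a finite-dimensional `H`-module, the module being given
in a basis by its matrix representation `ρ`. The dual `Hom(H, k)` is regarded as an algebra for the
convolution product `φ ⋆ ψ = (φ ⊗ ψ) ∘ Δ`, with unit `ε`. -/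
def matrixCoeff {d : ℕ} (ρ : H →ₐ[k] Matrix (Fin d) (Fin d) k) (i j : Fin d) :
    WithConv (H →ₗ[k] k) :=
  WithConv.toConv (Matrix.entryLinearMap k k i j ∘ₗ ρ.toLinearMap)

@[simp] lemma matrixCoeff_apply {d : ℕ} (ρ : H →ₐ[k] Matrix (Fin d) (Fin d) k) (i j : Fin d)
    (h : H) : (matrixCoeff ρ i j).ofConv h = ρ h i j := rfl

variable (k H) in
/-- The span of the matrix coefficients of all finite-dimensional `H`-modules. -/
def coeffSpan : Submodule k (WithConv (H →ₗ[k] k)) :=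
  Submodule.span k {φ | ∃ (d : ℕ) (ρ : H →ₐ[k] Matrix (Fin d) (Fin d) k) (i j : Fin d),
    φ = matrixCoeff ρ i j}

lemma matrixCoeff_mem {d : ℕ} (ρ : H →ₐ[k] Matrix (Fin d) (Fin d) k) (i j : Fin d) :
    matrixCoeff ρ i j ∈ coeffSpan k H :=
  Submodule.subset_span ⟨d, ρ, i, j, rfl⟩

/-- The tensor product of two matrix representations. -/
def tensorRep {d e : ℕ} (ρ : H →ₐ[k] Matrix (Fin d) (Fin d) k)
    (σ : H →ₐ[k] Matrix (Fin e) (Fin e) k) : H →ₐ[k] Matrix (Fin (d * e)) (Fin (d * e)) k :=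
  (Matrix.reindexAlgEquiv k k finProdFinEquiv).toAlgHom.comp
    ((Matrix.kroneckerAlgEquiv (Fin d) (Fin e) k).toAlgHom.comp
      ((Algebra.TensorProduct.map ρ σ).comp (Bialgebra.comulAlgHom k H)))

lemma tensorRep_apply {d e : ℕ} (ρ : H →ₐ[k] Matrix (Fin d) (Fin d) k)
    (σ : H →ₐ[k] Matrix (Fin e) (Fin e) k) (i j : Fin d) (p q : Fin e) :
    matrixCoeff ρ i j * matrixCoeff σ p q =
      matrixCoeff (tensorRep ρ σ) (finProdFinEquiv (i, p)) (finProdFinEquiv (j, q)) := by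
  ext h
  simp only [LinearMap.convMul_apply, matrixCoeff_apply, tensorRep, AlgHom.comp_apply,
    Bialgebra.comulAlgHom_apply]
  generalize Coalgebra.comul (R := k) h = X
  induction X with
  | zero => simp
  | add X Y hX hY => simp only [map_add, hX, hY, Matrix.add_apply]
  | tmul a b => simp

lemma one_mem_coeffSpan : (1 : WithConv (H →ₗ[k] k)) ∈ coeffSpan k H := by
  have : (1 : WithConv (H →ₗ[k] k)) = matrixCoeff
      ((Algebra.ofId k (Matrix (Fin 1) (Fin 1) k)).comp (Bialgebra.counitAlgHom k H)) 0 0 := by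
    ext h
    simp [Algebra.ofId_apply, Matrix.algebraMap_matrix_apply]
  rw [this]
  exact matrixCoeff_mem _ _ _

lemma mul_mem_coeffSpan {φ ψ : WithConv (H →ₗ[k] k)} (hφ : φ ∈ coeffSpan k H)
    (hψ : ψ ∈ coeffSpan k H) : φ * ψ ∈ coeffSpan k H := by
  have h : coeffSpan k H * coeffSpan k H ≤ coeffSpan k H := by
    rw [coeffSpan, Submodule.span_mul_span, Submodule.span_le]
    rintro _ ⟨_, ⟨d, ρ, i, j, rfl⟩, _, ⟨e, σ, p, q, rfl⟩, rfl⟩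
    change matrixCoeff ρ i j * matrixCoeff σ p q ∈ _
    rw [tensorRep_apply]
    exact matrixCoeff_mem _ _ _
  exact h (Submodule.mul_mem_mul hφ hψ)

variable (k H) in
/-- The restricted dual `H°`, spanned by the matrix coefficients of finite-dimensional `H`-modules,
with the convolution product. -/
def restrictedDual : Subalgebra k (WithConv (H →ₗ[k] k)) :=
  (coeffSpan k H).toSubalgebra one_mem_coeffSpan fun _ _ => mul_mem_coeffSpan

/-- `X = ∑ x ⊗ y ↦ (h ↦ ∑ x h S(y))`. -/
def sandwich : H ⊗[k] H →ₗ[k] H →ₗ[k] H :=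
  TensorProduct.lift (LinearMap.mk₂ k
    (fun x y => LinearMap.mulLeft k x ∘ₗ LinearMap.mulRight k (HopfAlgebra.antipode k y))
    (fun x x' y => by ext; simp [add_mul]) (fun c x y => by ext; simp)
    (fun x y y' => by ext; simp [mul_add]) (fun c x y => by ext; simp))

@[simp] lemma sandwich_tmul (x y h : H) :
    sandwich (k := k) (x ⊗ₜ[k] y) h = x * (h * HopfAlgebra.antipode k y) := rfl

lemma comp_sandwich_mem {φ : WithConv (H →ₗ[k] k)} (hφ : φ ∈ coeffSpan k H) (X : H ⊗[k] H) :
    WithConv.toConv (φ.ofConv ∘ₗ sandwich X) ∈ coeffSpan k H := by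
  induction X with
  | zero =>
    have : WithConv.toConv (φ.ofConv ∘ₗ sandwich (0 : H ⊗[k] H)) = 0 := by ext; simp
    rw [this]; exact Submodule.zero_mem _
  | add X Y hX hY =>
    have : WithConv.toConv (φ.ofConv ∘ₗ sandwich (X + Y)) =
      WithConv.toConv (φ.ofConv ∘ₗ sandwich X) + WithConv.toConv (φ.ofConv ∘ₗ sandwich Y) := by
      ext; simp
    rw [this]; exact Submodule.add_mem _ hX hY
  | tmul x y =>
    induction hφ using Submodule.span_induction with
    | mem φ h =>
      obtain ⟨d, ρ, i, j, rfl⟩ := h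
      have : WithConv.toConv ((matrixCoeff ρ i j).ofConv ∘ₗ sandwich (x ⊗ₜ[k] y)) =
          ∑ p, ∑ q, (ρ x i p * ρ (HopfAlgebra.antipode k y) q j) • matrixCoeff ρ p q := by
        ext h
        simp [Matrix.mul_apply, Finset.mul_sum, WithConv.ofConv_sum, LinearMap.sum_apply,
          mul_comm, mul_left_comm]
      rw [this]
      exact Submodule.sum_mem _ fun p _ => Submodule.sum_mem _ fun q _ =>
        Submodule.smul_mem _ _ (matrixCoeff_mem _ _ _)
    | zero =>
      have : WithConv.toConv ((0 : WithConv (H →ₗ[k] k)).ofConv ∘ₗ sandwich (x ⊗ₜ[k] y)) = 0 := by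
        ext; simp
      rw [this]; exact Submodule.zero_mem _
    | add φ ψ _ _ hφ hψ => exact Submodule.add_mem _ hφ hψ
    | smul c φ _ hφ => exact Submodule.smul_mem _ c hφ

/-- The right action of `H ⊗ H` on `H°`: `(φ · (x ⊗ y))(h) = φ(x h S(y))`, that is
`φ · (x ⊗ y) = S(y) ▷ φ ◁ x` in terms of the coregular actions. -/
def dualAct : restrictedDual k H →ₗ[k] H ⊗[k] H →ₗ[k] restrictedDual k H :=
  LinearMap.mk₂ k
    (fun φ X => ⟨WithConv.toConv (φ.1.ofConv ∘ₗ sandwich X), comp_sandwich_mem φ.2 X⟩)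
    (fun φ ψ X => rfl) (fun c φ X => rfl)
    (fun φ X Y => by ext; simp) (fun c φ X => by ext; simp)

lemma dualAct_apply (φ : restrictedDual k H) (X : H ⊗[k] H) (h : H) :
    (dualAct φ X).1.ofConv h = φ.1.ofConv (sandwich X h) := rfl

variable (k H) in
/-- The coproduct of `H ⊗ H^cop`: `x ⊗ y ↦ ∑ (x₁ ⊗ y₂) ⊗ (x₂ ⊗ y₁)`. -/
def comulHHcop : H ⊗[k] H →ₐ[k] (H ⊗[k] H) ⊗[k] (H ⊗[k] H) :=
  (Algebra.TensorProduct.tensorTensorTensorComm k k k k H H H H).toAlgHom.comp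
    (Algebra.TensorProduct.map (Bialgebra.comulAlgHom k H)
      ((Algebra.TensorProduct.comm k H H).toAlgHom.comp (Bialgebra.comulAlgHom k H)))

variable (k H) in
/-- The counit of `H ⊗ H`. -/
def counitHH : H ⊗[k] H →ₐ[k] k :=
  (Algebra.TensorProduct.lmul' k).comp
    (Algebra.TensorProduct.map (Bialgebra.counitAlgHom k H) (Bialgebra.counitAlgHom k H))

@[simp] lemma counitHH_tmul (x y : H) : counitHH k H (x ⊗ₜ[k] y) =
    Coalgebra.counit (R := k) x * Coalgebra.counit (R := k) y := rfl

lemma dual_mul_act_aux (φ ψ : restrictedDual k H) (h : H) (X Y : H ⊗[k] H) :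
    LinearMap.mul' k k (TensorProduct.map φ.1.ofConv ψ.1.ofConv
      (X * Coalgebra.comul (R := k) h * TensorProduct.map (HopfAlgebra.antipode k)
        (HopfAlgebra.antipode k) (TensorProduct.comm k H H Y))) =
    (LinearMap.mul' k (restrictedDual k H) (TensorProduct.map (dualAct φ) (dualAct ψ)
      (Algebra.TensorProduct.tensorTensorTensorComm k k k k H H H H
        (X ⊗ₜ[k] TensorProduct.comm k H H Y)))).1.ofConv h := by
  induction X with
  | zero => simp
  | add X X' hX hX' =>
    simp only [add_mul, TensorProduct.add_tmul, map_add, hX, hX']; rfl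
  | tmul a b =>
    induction Y with
    | zero => simp
    | add X X' hX hX' =>
      simp only [mul_add, TensorProduct.tmul_add, map_add, hX, hX']; rfl
    | tmul c d =>
      change _ = LinearMap.mul' k k (TensorProduct.map
        (φ.1.ofConv ∘ₗ sandwich (a ⊗ₜ[k] d)) (ψ.1.ofConv ∘ₗ sandwich (b ⊗ₜ[k] c))
          (Coalgebra.comul (R := k) h))
      generalize Coalgebra.comul (R := k) h = Z
      induction Z with
      | zero => simp
      | add X X' hX hX' => simp only [mul_add, add_mul, map_add, hX, hX']
      | tmul e f => simp [mul_assoc]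

variable (k H) in
/-- `H°` as a right module-algebra over `H ⊗ H^cop`. -/
def dualModAlg : ModAlg.{u, v, max u v} (comulHHcop k H) (counitHH k H) where
  carrier := restrictedDual k H
  act := dualAct
  act_one φ := by
    ext h
    rw [dualAct_apply, Algebra.TensorProduct.one_def]; simp
  act_mul φ X Y := by
    ext h
    simp only [dualAct_apply]
    congr 1
    induction X with
    | zero => simp
    | add X X' hX hX' => simp only [add_mul, map_add, LinearMap.add_apply, hX, hX']
    | tmul a b =>
      induction Y with
      | zero => simp
      | add X X' hX hX' => simp only [mul_add, map_add, LinearMap.add_apply, hX, hX']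
      | tmul c d => simp [HopfAlgebra.antipode_mul_antidistrib, mul_assoc]
  one_act X := by
    ext h
    rw [dualAct_apply]
    induction X with
    | zero => simp
    | add X Y hX hY => simp only [map_add, LinearMap.add_apply, hX, hY]; rfl
    | tmul a b =>
      simp [Algebra.algebraMap_eq_smul_one]
      ring
  mul_act φ ψ X := by
    ext h
    rw [dualAct_apply]
    induction X with
    | zero => simp
    | add X Y hX hY => simp only [map_add, LinearMap.add_apply, hX, hY]; rfl
    | tmul x y =>
      rw [sandwich_tmul]
      change LinearMap.mul' k k (TensorProduct.map φ.1.ofConv ψ.1.ofConv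
        (Coalgebra.comul (R := k) (x * (h * HopfAlgebra.antipode k y)))) = _
      rw [Bialgebra.comul_mul, Bialgebra.comul_mul, comul_antipode, ← mul_assoc]
      exact dual_mul_act_aux φ ψ h _ _

end RestrictedDual

section LoopAlgebra

variable {k : Type u} {H : Type v} [Field k] [Ring H] [HopfAlgebra k H]

/-- `x ↦ ∑ x₁ ⊗ x₂` placed on the legs `i` and `j`. -/
def convAt {ι E : Type*} [Ring E] [Algebra k E] (l : ι → (H →ₐ[k] E)) (i j : ι) : H →ₗ[k] E :=
  conv (l i).toLinearMap (l j).toLinearMap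

/-- The images of the legs commute. -/
def Comm {ι : Type*} {E : Type*} [Ring E] [Algebra k E] (l : ι → (H →ₐ[k] E)) : Prop :=
  ∀ i j, i ≠ j → ∀ x y, Commute (l i x) (l j y)

variable (k H) in
/-- The embedding of `H` as one of the four legs of `(H ⊗ H) ⊗ (H ⊗ H)` (numbered from `0`). -/
def leg4 : Fin 4 → (H →ₐ[k] (H ⊗[k] H) ⊗[k] (H ⊗[k] H))
  | 0 => Algebra.TensorProduct.includeLeft.comp Algebra.TensorProduct.includeLeft
  | 1 => Algebra.TensorProduct.includeLeft.comp Algebra.TensorProduct.includeRight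
  | 2 => Algebra.TensorProduct.includeRight.comp Algebra.TensorProduct.includeLeft
  | 3 => Algebra.TensorProduct.includeRight.comp Algebra.TensorProduct.includeRight

lemma leg4_commute : Comm (leg4 k H) := by
  intro i j hij x y
  fin_cases i <;> fin_cases j <;>
    first
    | exact absurd rfl hij
    | simp [leg4, Commute, SemiconjBy]

variable (k H) in
/-- The embedding of `H` as one of the six legs of `(H ⊗ H) ⊗ ((H ⊗ H) ⊗ (H ⊗ H))`. -/
def leg6 : Fin 6 → (H →ₐ[k] (H ⊗[k] H) ⊗[k] ((H ⊗[k] H) ⊗[k] (H ⊗[k] H)))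
  | 0 => Algebra.TensorProduct.includeLeft.comp Algebra.TensorProduct.includeLeft
  | 1 => Algebra.TensorProduct.includeLeft.comp Algebra.TensorProduct.includeRight
  | 2 => Algebra.TensorProduct.includeRight.comp (leg4 k H 0)
  | 3 => Algebra.TensorProduct.includeRight.comp (leg4 k H 1)
  | 4 => Algebra.TensorProduct.includeRight.comp (leg4 k H 2)
  | 5 => Algebra.TensorProduct.includeRight.comp (leg4 k H 3)

lemma leg6_commute : Comm (E := (H ⊗[k] H) ⊗[k] ((H ⊗[k] H) ⊗[k] (H ⊗[k] H)))
    (leg6 k H) := by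
  intro i j hij x y
  fin_cases i <;> fin_cases j <;>
    first
    | exact absurd rfl hij
    | simp [leg6, leg4, Commute, SemiconjBy]

namespace RMatrix
variable (Q : RMatrix k H) {ι E : Type*} [Ring E] [Algebra k E] {l : ι → (H →ₐ[k] E)}

/-- `R_{ij}` -/
def at' (l : ι → (H →ₐ[k] E)) (i j : ι) : E := leg Q.R (l i).toLinearMap (l j).toLinearMap

/-- `R_{ij}⁻¹` -/
def invAt (l : ι → (H →ₐ[k] E)) (i j : ι) : E := leg Q.Rinv (l i).toLinearMap (l j).toLinearMap

lemma at_mul_inv (hl : Comm l) {i j : ι} (h : i ≠ j) : Q.at' l i j * Q.invAt l i j = 1 :=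
  Q.leg_mul_Rinv _ _ (hl i j h)
lemma inv_mul_at (hl : Comm l) {i j : ι} (h : i ≠ j) : Q.invAt l i j * Q.at' l i j = 1 :=
  Q.leg_Rinv_mul _ _ (hl i j h)
lemma isUnit_at (hl : Comm l) {i j : ι} (h : i ≠ j) : IsUnit (Q.at' l i j) :=
  ⟨⟨_, _, Q.at_mul_inv hl h, Q.inv_mul_at hl h⟩, rfl⟩
lemma isUnit_inv (hl : Comm l) {i j : ι} (h : i ≠ j) : IsUnit (Q.invAt l i j) :=
  ⟨⟨_, _, Q.inv_mul_at hl h, Q.at_mul_inv hl h⟩, rfl⟩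

lemma at_comm (hl : Comm l) {i j p q : ι} (h1 : i ≠ p) (h2 : i ≠ q) (h3 : j ≠ p) (h4 : j ≠ q) :
    Commute (Q.at' l i j) (Q.at' l p q) :=
  leg_commute_leg _ _ _ _ _ _ (hl i p h1) (hl i q h2) (hl j p h3) (hl j q h4)
lemma at_comm_inv (hl : Comm l) {i j p q : ι} (h1 : i ≠ p) (h2 : i ≠ q) (h3 : j ≠ p) (h4 : j ≠ q) :
    Commute (Q.at' l i j) (Q.invAt l p q) :=
  leg_commute_leg _ _ _ _ _ _ (hl i p h1) (hl i q h2) (hl j p h3) (hl j q h4)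
lemma at_comm_leg (hl : Comm l) {i j p : ι} (h1 : i ≠ p) (h2 : j ≠ p) (x : H) :
    Commute (Q.at' l i j) (l p x) :=
  (commute_leg _ _ _ (hl p i h1.symm x) (hl p j h2.symm x)).symm
lemma at_yb (hl : Comm l) {i j p : ι} (h1 : i ≠ j) (h2 : i ≠ p) (h3 : j ≠ p) :
    Q.at' l i j * Q.at' l i p * Q.at' l j p = Q.at' l j p * Q.at' l i p * Q.at' l i j :=
  Q.yang_baxter _ _ _ (hl i j h1) (hl i p h2) (hl j p h3)

lemma leg_eq_of_map {T : Type*} [Ring T] [Algebra k T] (X : H ⊗[k] H) (G : T →ₐ[k] E)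
    {a b : H →ₐ[k] T} {c d : H →ₗ[k] E} (h1 : ∀ x, G (a x) = c x) (h2 : ∀ x, G (b x) = d x) :
    G (leg X a.toLinearMap b.toLinearMap) = leg X c d := by
  rw [map_leg]
  congr 1 <;> ext x <;> simp [h1, h2]

lemma map_at {T κ : Type*} [Ring T] [Algebra k T] (G : T →ₐ[k] E) {l' : κ → (H →ₐ[k] T)}
    {a b : κ} {c d : ι} (h1 : ∀ x, G (l' a x) = l c x) (h2 : ∀ x, G (l' b x) = l d x) :
    G (Q.at' l' a b) = Q.at' l c d := leg_eq_of_map _ G h1 h2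
lemma map_invAt {T κ : Type*} [Ring T] [Algebra k T] (G : T →ₐ[k] E) {l' : κ → (H →ₐ[k] T)}
    {a b : κ} {c d : ι} (h1 : ∀ x, G (l' a x) = l c x) (h2 : ∀ x, G (l' b x) = l d x) :
    G (Q.invAt l' a b) = Q.invAt l c d := leg_eq_of_map _ G h1 h2

/-- `G(R_{ab})` when `G` maps the leg `a` to `∑ x₁ ⊗ x₂` on the legs `c`, `d`. -/
lemma map_at_conv_left {T κ : Type*} [Ring T] [Algebra k T] (G : T →ₐ[k] E) {l' : κ → (H →ₐ[k] T)}
    (hl : Comm l) {a b : κ} {c d e : ι}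
    (h1 : ∀ x, G (l' a x) = convAt l c d x)
    (h2 : ∀ x, G (l' b x) = l e x) (h : d ≠ e) :
    G (Q.at' l' a b) = Q.at' l c e * Q.at' l d e :=
  (leg_eq_of_map (d := (l e).toLinearMap) _ G h1 h2).trans (Q.leg_R_conv_left _ _ _ (hl d e h))
lemma map_at_conv_right {T κ : Type*} [Ring T] [Algebra k T] (G : T →ₐ[k] E)
    {l' : κ → (H →ₐ[k] T)} (hl : Comm l) {a b : κ} {c d e : ι}
    (h1 : ∀ x, G (l' a x) = l e x)
    (h2 : ∀ x, G (l' b x) = convAt l c d x) (h : d ≠ e) (h' : d ≠ c) :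
    G (Q.at' l' a b) = Q.at' l e d * Q.at' l e c :=
  (leg_eq_of_map (c := (l e).toLinearMap) _ G h1 h2).trans
    (Q.leg_R_conv_right _ _ _ (hl d e h) (hl d c h'))

lemma map_at_counit_left {T κ : Type*} [Ring T] [Algebra k T] (G : T →ₐ[k] E)
    (l' : κ → (H →ₐ[k] T)) (a b : κ) (h1 : ∀ x, G (l' a x) = unitCounit (k := k) x) :
    G (Q.at' l' a b) = 1 :=
  (leg_eq_of_map (c := unitCounit.toLinearMap) (d := (G.comp (l' b)).toLinearMap) Q.R G h1
    (fun _ => rfl)).trans (Q.leg_counit_left _)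
lemma map_at_counit_right {T κ : Type*} [Ring T] [Algebra k T] (G : T →ₐ[k] E)
    (l' : κ → (H →ₐ[k] T)) (a b : κ) (h1 : ∀ x, G (l' b x) = unitCounit (k := k) x) :
    G (Q.at' l' a b) = 1 :=
  (leg_eq_of_map (d := unitCounit.toLinearMap) (c := (G.comp (l' a)).toLinearMap) Q.R G
    (fun _ => rfl) h1).trans (Q.leg_counit_right _)

lemma map_invAt_eq {T κ : Type*} [Ring T] [Algebra k T] (G : T →ₐ[k] E) {l' : κ → (H →ₐ[k] T)}
    (hl' : Comm l') {a b : κ} (h : a ≠ b) {x y : E} (h1 : G (Q.at' l' a b) = x) (h2 : x * y = 1) :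
    G (Q.invAt l' a b) = y := by
  have h3 := congrArg G (Q.inv_mul_at hl' h)
  rw [map_mul, map_one, h1] at h3
  calc _ = G (Q.invAt l' a b) * (x * y) := by rw [h2, mul_one]
    _ = y := by rw [← mul_assoc, h3, one_mul]

/-- The twist `R₃₂ R₄₂` (legs numbered from `1`). -/
def Fat (l : Fin 4 → (H →ₐ[k] E)) : E := Q.at' l 2 1 * Q.at' l 3 1

/-- `R₃₂ R₃₁ R₄₂ R₁₄⁻¹` (legs numbered from `1`). -/
def gamAt (l : Fin 4 → (H →ₐ[k] E)) : E :=
  Q.at' l 2 1 * Q.at' l 2 0 * Q.at' l 3 1 * Q.invAt l 0 3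

/-- The twist `F = R₃₂ R₄₂` of `H ⊗ H^cop` (legs numbered from `1`). -/
def F : (H ⊗[k] H) ⊗[k] (H ⊗[k] H) := Q.Fat (leg4 k H)

/-- The element `γ = R₃₂ R₃₁ R₄₂ R₁₄⁻¹` (legs numbered from `1`). -/
def gam : (H ⊗[k] H) ⊗[k] (H ⊗[k] H) := Q.gamAt (leg4 k H)

end RMatrix

/-! Images of the legs under the maps that occur in the twist and bicharacter equations. -/

lemma comulHHcop_left (x : H) : comulHHcop k H (x ⊗ₜ[k] 1) =
    convAt (leg4 k H) 0 2 x := by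
  rw [convAt, conv_apply]
  change Algebra.TensorProduct.tensorTensorTensorComm k k k k H H H H
    (Coalgebra.comul (R := k) x ⊗ₜ[k] TensorProduct.comm k H H (Coalgebra.comul (R := k) 1)) = _
  generalize Coalgebra.comul (R := k) x = X
  induction X with
  | zero => simp
  | add X Y hX hY => rw [leg_add, ← hX, ← hY, TensorProduct.add_tmul, map_add]
  | tmul a b => simp [leg4, Algebra.TensorProduct.one_def]

lemma comulHHcop_right (x : H) : comulHHcop k H (1 ⊗ₜ[k] x) =
    convAt (leg4 k H) 3 1 x := by
  rw [convAt, conv_apply]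
  change Algebra.TensorProduct.tensorTensorTensorComm k k k k H H H H
    (Coalgebra.comul (R := k) 1 ⊗ₜ[k] TensorProduct.comm k H H (Coalgebra.comul (R := k) x)) = _
  generalize Coalgebra.comul (R := k) x = X
  induction X with
  | zero => simp
  | add X Y hX hY => rw [leg_add, ← hX, ← hY, map_add, TensorProduct.tmul_add, map_add]
  | tmul a b => simp [leg4, Algebra.TensorProduct.one_def]

lemma map_conv' {E E' : Type*} [Ring E] [Algebra k E] [Ring E'] [Algebra k E'] (G : E →ₐ[k] E')
    {ι κ : Type*} {l : ι → (H →ₐ[k] E)} {l' : κ → (H →ₐ[k] E')} {i j : ι} {p q : κ}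
    (h1 : G.comp (l i) = l' p) (h2 : G.comp (l j) = l' q) (x : H) :
    G (convAt l i j x) =
      convAt l' p q x := by
  rw [convAt, convAt, ← h1, ← h2]
  exact map_leg G _ _ _

section maps
variable {D : Type*} [Ring D] [Algebra k D] (δ : D →ₐ[k] D ⊗[k] D)

/-- `X ↦ X ⊗ 1` -/
def mapL : D ⊗[k] D →ₐ[k] D ⊗[k] (D ⊗[k] D) :=
  (Algebra.TensorProduct.assoc k k k _ _ _).toAlgHom.comp Algebra.TensorProduct.includeLeft
/-- `X ↦ 1 ⊗ X` -/
def mapR : D ⊗[k] D →ₐ[k] D ⊗[k] (D ⊗[k] D) := Algebra.TensorProduct.includeRight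
/-- `X ↦ X₁₃` -/
def mapM : D ⊗[k] D →ₐ[k] D ⊗[k] (D ⊗[k] D) :=
  Algebra.TensorProduct.map (AlgHom.id k _) Algebra.TensorProduct.includeRight
/-- `δ ⊗ id` -/
def comL : D ⊗[k] D →ₐ[k] D ⊗[k] (D ⊗[k] D) :=
  (Algebra.TensorProduct.assoc k k k _ _ _).toAlgHom.comp
    (Algebra.TensorProduct.map δ (AlgHom.id k _))
/-- `id ⊗ δ` -/
def comR : D ⊗[k] D →ₐ[k] D ⊗[k] (D ⊗[k] D) := Algebra.TensorProduct.map (AlgHom.id k _) δ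

lemma comL_left (d : D) : comL δ (d ⊗ₜ[k] 1) = mapL (δ d) := rfl
lemma comL_right (d : D) : comL δ (1 ⊗ₜ[k] d) = 1 ⊗ₜ[k] (1 ⊗ₜ[k] d) := by
  change Algebra.TensorProduct.assoc k k k D D D (δ 1 ⊗ₜ[k] d) = _
  rw [map_one]; rfl
lemma comR_right (d : D) : comR δ (1 ⊗ₜ[k] d) = mapR (δ d) := rfl
lemma comR_left (d : D) : comR δ (d ⊗ₜ[k] 1) = d ⊗ₜ[k] 1 := by
  change d ⊗ₜ[k] (δ 1) = _
  rw [map_one]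

end maps

/-- positions of the legs of `X ⊗ 1` -/
def posL (i : Fin 4) : Fin 6 := Fin.castLE (by decide) i
/-- positions of the legs of `1 ⊗ X` -/
def posR (i : Fin 4) : Fin 6 := Fin.natAdd 2 i
/-- positions of the legs of `X₁₃` -/
def posM : Fin 4 → Fin 6 := ![0, 1, 4, 5]

lemma mapL_leg (i : Fin 4) : (mapL (k := k) (D := H ⊗[k] H)).comp (leg4 k H i) = leg6 k H (posL i) := by
  fin_cases i <;> rfl
lemma mapR_leg (i : Fin 4) : (mapR (k := k) (D := H ⊗[k] H)).comp (leg4 k H i) = leg6 k H (posR i) := by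
  fin_cases i <;> rfl
lemma mapM_leg (i : Fin 4) : (mapM (k := k) (D := H ⊗[k] H)).comp (leg4 k H i) = leg6 k H (posM i) := by
  fin_cases i <;> rfl

lemma mapL_conv (i j : Fin 4) (x : H) : mapL (convAt (leg4 k H) i j x) =
    convAt (leg6 k H) (posL i) (posL j) x :=
  map_conv' (E := (H ⊗[k] H) ⊗[k] (H ⊗[k] H))
    (E' := (H ⊗[k] H) ⊗[k] ((H ⊗[k] H) ⊗[k] (H ⊗[k] H))) (l := leg4 k H) (l' := leg6 k H)
    mapL (mapL_leg i) (mapL_leg j) x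
lemma mapR_conv (i j : Fin 4) (x : H) : mapR (convAt (leg4 k H) i j x) =
    convAt (leg6 k H) (posR i) (posR j) x :=
  map_conv' (E := (H ⊗[k] H) ⊗[k] (H ⊗[k] H))
    (E' := (H ⊗[k] H) ⊗[k] ((H ⊗[k] H) ⊗[k] (H ⊗[k] H))) (l := leg4 k H) (l' := leg6 k H)
    mapR (mapR_leg i) (mapR_leg j) x

namespace RMatrix
variable (Q : RMatrix k H)

lemma word_F {M : Type*} [Monoid M] {r32 r42 r52 r54 r62 r64 : M}
    (y1 : r54 * r52 * r42 = r42 * r52 * r54) (y2 : r64 * r62 * r42 = r42 * r62 * r64)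
    (c1 : Commute r32 r54) (c2 : Commute r52 r64) (c3 : Commute r32 r64) :
    r32 * r42 * (r52 * r54 * (r62 * r64)) = r54 * r64 * (r32 * r52 * (r62 * r42)) := by
  calc r32 * r42 * (r52 * r54 * (r62 * r64))
      = r32 * (r42 * r52 * r54) * (r62 * r64) := by simp only [mul_assoc]
    _ = (r32 * r54) * r52 * (r42 * r62 * r64) := by rw [← y1]; simp only [mul_assoc]
    _ = r54 * r32 * (r52 * r64) * r62 * r42 := by rw [← y2, c1.eq]; simp only [mul_assoc]
    _ = r54 * (r32 * r64) * r52 * r62 * r42 := by rw [c2.eq]; simp only [mul_assoc]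
    _ = _ := by rw [c3.eq]; simp only [mul_assoc]

/-- The twist equation for `F`, in terms of the images of the legs. -/
lemma twist_core {T E : Type*} [Ring T] [Algebra k T] [Ring E] [Algebra k E]
    {t : Fin 4 → (H →ₐ[k] T)} {l : Fin 6 → (H →ₐ[k] E)} (hl : Comm l) (mL mR cL cR : T →ₐ[k] E)
    (hmL : ∀ i, mL.comp (t i) = l (posL i)) (hmR : ∀ i, mR.comp (t i) = l (posR i))
    (hL1 : ∀ x, cL (t 1 x) = convAt l 3 1 x)
    (hL2 : ∀ x, cL (t 2 x) = l 4 x) (hL3 : ∀ x, cL (t 3 x) = l 5 x)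
    (hR1 : ∀ x, cR (t 1 x) = l 1 x)
    (hR2 : ∀ x, cR (t 2 x) = convAt l 2 4 x)
    (hR3 : ∀ x, cR (t 3 x) = convAt l 5 3 x) :
    mL (Q.Fat t) * cL (Q.Fat t) = mR (Q.Fat t) * cR (Q.Fat t) := by
  have gL := fun i x => AlgHom.congr_fun (hmL i) x
  have gR := fun i x => AlgHom.congr_fun (hmR i) x
  simp only [Fat, map_mul]
  rw [Q.map_at mL (gL 2) (gL 1), Q.map_at mL (gL 3) (gL 1),
    Q.map_at mR (gR 2) (gR 1), Q.map_at mR (gR 3) (gR 1),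
    Q.map_at_conv_right cL hl hL2 hL1 (by decide) (by decide),
    Q.map_at_conv_right cL hl hL3 hL1 (by decide) (by decide),
    Q.map_at_conv_left cR hl hR2 hR1 (by decide),
    Q.map_at_conv_left cR hl hR3 hR1 (by decide)]
  refine word_F (Q.at_yb hl ?_ ?_ ?_) (Q.at_yb hl ?_ ?_ ?_) (Q.at_comm hl ?_ ?_ ?_ ?_)
      (Q.at_comm hl ?_ ?_ ?_ ?_) (Q.at_comm hl ?_ ?_ ?_ ?_) <;> decide

lemma isTwist_F : IsTwist (comulHHcop k H) (counitHH k H) Q.F where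
  isUnit := (Q.isUnit_at leg4_commute (by decide)).mul (Q.isUnit_at leg4_commute (by decide))
  cocycle := by
    have e1 : Algebra.TensorProduct.assoc k k k (H ⊗[k] H) (H ⊗[k] H) (H ⊗[k] H)
      ((Q.F ⊗ₜ[k] (1 : H ⊗[k] H)) * Algebra.TensorProduct.map (comulHHcop k H) (AlgHom.id k _) Q.F)
      = mapL Q.F * comL (comulHHcop k H) Q.F := by
      rw [map_mul]; rfl
    refine e1.trans ?_
    refine Q.twist_core (l := (leg6 k H)) leg6_commute mapL mapR (comL (comulHHcop k H))
      (comR (comulHHcop k H)) mapL_leg mapR_leg (fun x => ?_) (fun x => ?_) (fun x => ?_)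
      (fun x => ?_) (fun x => ?_) (fun x => ?_)
    · exact (comL_left _ _).trans ((congrArg mapL (comulHHcop_right x)).trans
        (mapL_conv 3 1 x))
    · exact comL_right _ _
    · exact comL_right _ _
    · exact comR_left _ _
    · exact (comR_right _ _).trans ((congrArg mapR (comulHHcop_left x)).trans
        (mapR_conv 0 2 x))
    · exact (comR_right _ _).trans ((congrArg mapR (comulHHcop_right x)).trans
        (mapR_conv 3 1 x))
  counit_left := by
    let Ψ : (H ⊗[k] H) ⊗[k] (H ⊗[k] H) →ₐ[k] H ⊗[k] H :=
      (Algebra.TensorProduct.lid k (H ⊗[k] H)).toAlgHom.comp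
        (Algebra.TensorProduct.map (counitHH k H) (AlgHom.id k (H ⊗[k] H)))
    have h1 : ∀ x, Ψ (leg4 k H 1 x) = unitCounit (k := k) x := fun x => by
      simp [Ψ, leg4, unitCounit, Algebra.ofId_apply, Algebra.algebraMap_eq_smul_one]
    have h2 := fun i => Q.map_at_counit_right Ψ (leg4 k H) i 1 h1
    refine (map_mul Ψ (Q.at' (leg4 k H) 2 1) (Q.at' (leg4 k H) 3 1)).trans ?_
    rw [h2 2, h2 3, mul_one]
  counit_right := by
    let Ψ : (H ⊗[k] H) ⊗[k] (H ⊗[k] H) →ₐ[k] H ⊗[k] H :=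
      (Algebra.TensorProduct.rid k k (H ⊗[k] H)).toAlgHom.comp
        (Algebra.TensorProduct.map (AlgHom.id k (H ⊗[k] H)) (counitHH k H))
    have h1 : ∀ x, Ψ (leg4 k H 2 x) = unitCounit (k := k) x := fun x => by
      simp [Ψ, leg4, unitCounit, Algebra.ofId_apply, Algebra.algebraMap_eq_smul_one]
    have h2 : ∀ x, Ψ (leg4 k H 3 x) = unitCounit (k := k) x := fun x => by
      simp [Ψ, leg4, unitCounit, Algebra.ofId_apply, Algebra.algebraMap_eq_smul_one]
    refine (map_mul Ψ (Q.at' (leg4 k H) 2 1) (Q.at' (leg4 k H) 3 1)).trans ?_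
    rw [Q.map_at_counit_left Ψ (leg4 k H) 2 1 h1, Q.map_at_counit_left Ψ (leg4 k H) 3 1 h2, mul_one]

end RMatrix
end LoopAlgebra

section Bicharacter

variable {k : Type u} {H : Type v} [Field k] [Ring H] [HopfAlgebra k H]

/-- A bicharacter for `(D, δ, ε)`: an element `χ ∈ D ⊗ D` with `(δ ⊗ id)(χ) = χ₂₃ χ₁₃`,
`(id ⊗ δ)(χ) = χ₁₂ χ₁₃` and `(ε ⊗ id)(χ) = (id ⊗ ε)(χ) = 1`. -/
structure IsBichar {D : Type*} [Ring D] [Algebra k D] (δ : D →ₐ[k] D ⊗[k] D) (ε : D →ₐ[k] k)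
    (χ : D ⊗[k] D) : Prop where
  left : comL δ χ = mapR χ * mapM χ
  right : comR δ χ = mapL χ * mapM χ
  counit_left : Algebra.TensorProduct.lid k D
      (Algebra.TensorProduct.map ε (AlgHom.id k D) χ) = 1
  counit_right : Algebra.TensorProduct.rid k k D
      (Algebra.TensorProduct.map (AlgHom.id k D) ε χ) = 1

section slide
variable {E : Type*} [Ring E] [Algebra k E]

/-- `e P(x) = P'(x) e` for all `x` -/
def Slide (e : E) (P P' : H →ₗ[k] E) : Prop := ∀ x, e * P x = P' x * e

lemma Slide.conv {e : E} {P P' R R' : H →ₗ[k] E} (h : Slide e P P') (h' : Slide e R R') :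
    Slide e (conv P R) (conv P' R') := by
  intro x
  rw [conv_apply, conv_apply]
  generalize Coalgebra.comul (R := k) x = X
  induction X with
  | zero => simp
  | add X Y hX hY => rw [leg_add, leg_add, mul_add, add_mul, hX, hY]
  | tmul a b => rw [leg_tmul, leg_tmul, ← mul_assoc, h, mul_assoc, h', mul_assoc]

lemma Slide.mul {e e' : E} {P P' P'' : H →ₗ[k] E} (h : Slide e P' P) (h' : Slide e' P'' P') :
    Slide (e * e') P'' P := fun x => by rw [mul_assoc, h', ← mul_assoc, h, mul_assoc]

lemma Slide.inv {e i : E} (h1 : e * i = 1) (h2 : i * e = 1) {P P' : H →ₗ[k] E}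
    (h : Slide e P P') : Slide i P' P := fun x => by
  calc i * P' x = i * (P' x * e) * i := by rw [mul_assoc, mul_assoc, h1, mul_one]
    _ = P x * i := by rw [← h x, ← mul_assoc, h2, one_mul]

variable {ι : Type*} {l : ι → (H →ₐ[k] E)}

/-- `x ↦ ∑ x₁ ⊗ x₂ ⊗ x₃ ⊗ x₄` placed on the given legs -/
def conv4 (l : ι → (H →ₐ[k] E)) (a b c d : ι) : H →ₗ[k] E :=
  conv (convAt l a b) (convAt l c d)

lemma conv4_eq (a b c d : ι) :
    conv4 l a b c d = conv (l a).toLinearMap (conv (convAt l b c) (l d).toLinearMap) := by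
  simp only [conv4, convAt, conv_assoc]

lemma slide_at (Q : RMatrix k H) (hl : Comm l) {i j : ι} (h : i ≠ j) :
    Slide (Q.at' l i j) (convAt l i j) (convAt l j i) :=
  Q.leg_R_mul_conv _ _ (hl i j h)

lemma slide_leg {e : E} {a : ι} (h : ∀ x, Commute e (l a x)) :
    Slide e (l a).toLinearMap (l a).toLinearMap := h

lemma slide_conv4_l {e : E} {a b a' b' c d : ι} (h : Slide e (convAt l a b) (convAt l a' b'))
    (hc : ∀ x, Commute e (l c x)) (hd : ∀ x, Commute e (l d x)) :
    Slide e (conv4 l a b c d) (conv4 l a' b' c d) :=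
  h.conv ((slide_leg hc).conv (slide_leg hd))

lemma slide_conv4_r {e : E} {a b c d c' d' : ι} (h : Slide e (convAt l c d) (convAt l c' d'))
    (hc : ∀ x, Commute e (l a x)) (hd : ∀ x, Commute e (l b x)) :
    Slide e (conv4 l a b c d) (conv4 l a b c' d') :=
  ((slide_leg hc).conv (slide_leg hd)).conv h

lemma slide_conv4_m {e : E} {a b c d b' c' : ι} (h : Slide e (convAt l b c) (convAt l b' c'))
    (hc : ∀ x, Commute e (l a x)) (hd : ∀ x, Commute e (l d x)) :
    Slide e (conv4 l a b c d) (conv4 l a b' c' d) := by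
  rw [conv4_eq, conv4_eq]
  exact (slide_leg hc).conv (h.conv (slide_leg hd))

end slide

namespace RMatrix
variable (Q : RMatrix k H)

section core
variable {E : Type*} [Ring E] [Algebra k E]

lemma inv_comm_leg {ι : Type*} {l : ι → (H →ₐ[k] E)} (hl : Comm l) {i j p : ι} (h1 : i ≠ p)
    (h2 : j ≠ p) (x : H) : Commute (Q.invAt l i j) (l p x) :=
  (commute_leg _ _ _ (hl p i h1.symm x) (hl p j h2.symm x)).symm

lemma slide_F {l : Fin 4 → (H →ₐ[k] E)} (hl : Comm l) :
    Slide (Q.Fat l) (conv4 l 0 2 3 1) (conv4 l 0 1 2 3) := by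
  refine Slide.mul (P' := conv4 l 0 2 1 3) ?_ ?_
  · exact slide_conv4_m (slide_at Q hl (by decide)) (Q.at_comm_leg hl (by decide) (by decide))
      (Q.at_comm_leg hl (by decide) (by decide))
  · exact slide_conv4_r (slide_at Q hl (by decide)) (Q.at_comm_leg hl (by decide) (by decide))
      (Q.at_comm_leg hl (by decide) (by decide))

lemma slide_gam {l : Fin 4 → (H →ₐ[k] E)} (hl : Comm l) :
    Slide (Q.gamAt l) (conv4 l 2 3 0 1) (conv4 l 0 1 2 3) := by
  refine Slide.mul (P' := conv4 l 2 0 3 1) (Slide.mul (P' := conv4 l 2 0 1 3)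
    (Slide.mul (P' := conv4 l 0 2 1 3) ?_ ?_) ?_) ?_
  · exact slide_conv4_m (slide_at Q hl (by decide)) (Q.at_comm_leg hl (by decide) (by decide))
      (Q.at_comm_leg hl (by decide) (by decide))
  · exact slide_conv4_l (slide_at Q hl (by decide)) (Q.at_comm_leg hl (by decide) (by decide))
      (Q.at_comm_leg hl (by decide) (by decide))
  · exact slide_conv4_r (slide_at Q hl (by decide)) (Q.at_comm_leg hl (by decide) (by decide))
      (Q.at_comm_leg hl (by decide) (by decide))
  · exact slide_conv4_m (Slide.inv (Q.at_mul_inv hl (by decide)) (Q.inv_mul_at hl (by decide))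
      (slide_at Q hl (by decide))) (Q.inv_comm_leg hl (by decide) (by decide))
      (Q.inv_comm_leg hl (by decide) (by decide))

/-- Conjugation by `F` on the first leg. -/
lemma Fat_conj_left {l : Fin 4 → (H →ₐ[k] E)} (hl : Comm l) (u : Eˣ) (hu : (u : E) = Q.Fat l)
    (x : H) : u * convAt l 0 2 x * ↑u⁻¹ * Q.at' l 2 1 = Q.at' l 2 1 * convAt l 0 2 x := by
  have h1 : (↑u⁻¹ : E) * Q.at' l 2 1 = Q.invAt l 3 1 := by
    have : (↑u⁻¹ : E) * (Q.at' l 2 1 * Q.at' l 3 1) = 1 := by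
      rw [← Fat, ← hu, Units.inv_mul]
    calc (↑u⁻¹ : E) * Q.at' l 2 1
        = ↑u⁻¹ * (Q.at' l 2 1 * (Q.at' l 3 1 * Q.invAt l 3 1)) := by
          rw [Q.at_mul_inv hl (by decide), mul_one]
      _ = _ := by rw [← mul_assoc (Q.at' l 2 1), ← mul_assoc, this, one_mul]
  have h2 : Commute (Q.invAt l 3 1) (convAt l 0 2 x) :=
    commute_conv _ _ (Q.inv_comm_leg hl (by decide) (by decide))
      (Q.inv_comm_leg hl (by decide) (by decide)) x
  rw [mul_assoc, h1, hu, Fat, mul_assoc, ← h2.eq, mul_assoc, ← mul_assoc (Q.at' l 3 1),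
    Q.at_mul_inv hl (by decide), one_mul]

lemma Fat_conj_right {l : Fin 4 → (H →ₐ[k] E)} (hl : Comm l) (u : Eˣ) (hu : (u : E) = Q.Fat l)
    (x : H) : u * convAt l 3 1 x * ↑u⁻¹ * Q.at' l 2 1 = Q.at' l 2 1 * convAt l 1 3 x := by
  have h1 : (↑u⁻¹ : E) * Q.at' l 2 1 = Q.invAt l 3 1 := by
    have : (↑u⁻¹ : E) * (Q.at' l 2 1 * Q.at' l 3 1) = 1 := by
      rw [← Fat, ← hu, Units.inv_mul]
    calc (↑u⁻¹ : E) * Q.at' l 2 1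
        = ↑u⁻¹ * (Q.at' l 2 1 * (Q.at' l 3 1 * Q.invAt l 3 1)) := by
          rw [Q.at_mul_inv hl (by decide), mul_one]
      _ = _ := by rw [← mul_assoc (Q.at' l 2 1), ← mul_assoc, this, one_mul]
  have h2 := slide_at Q hl (i := 3) (j := 1) (by decide) x
  rw [mul_assoc, h1, hu, Fat, mul_assoc, mul_assoc, ← mul_assoc (Q.at' l 3 1), h2, mul_assoc,
    Q.at_mul_inv hl (by decide), mul_one]

lemma word_left {M : Type*} [Monoid M] {r21 r43 r41 r42 r40 r53 r51 i25 i05 r25 : M}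
    (y1 : r42 * r41 * r21 = r21 * r41 * r42) (y2 : r25 * r21 * r51 = r51 * r21 * r25)
    (e1 : r25 * i25 = 1) (e2 : i25 * r25 = 1)
    (c1 : Commute i05 r21) (c2 : Commute i25 r41) (c3 : Commute i25 r40) (c4 : Commute r53 r41)
    (c5 : Commute r40 r21) (c6 : Commute r53 r21) (c7 : Commute r53 r40) (c8 : Commute r43 r21) :
    r21 * (r43 * r41 * (r42 * r40) * (r53 * r51) * (i25 * i05)) =
      r43 * r42 * r53 * i25 * (r41 * r40 * r51 * i05) * r21 := by
  have y2' : ∀ z, i25 * (r51 * (r21 * z)) = r21 * (r51 * (i25 * z)) := by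
    intro z
    have : i25 * (r51 * r21) = r21 * r51 * i25 := by
      calc i25 * (r51 * r21) = i25 * (r51 * r21 * r25) * i25 := by
            simp only [mul_assoc, e1, mul_one]
        _ = _ := by rw [← y2]; simp only [← mul_assoc, e2, one_mul]
    calc _ = i25 * (r51 * r21) * z := by simp only [mul_assoc]
      _ = _ := by rw [this]; simp only [mul_assoc]
  have y1' : ∀ z, r42 * (r41 * (r21 * z)) = r21 * (r41 * (r42 * z)) := by
    intro z; simp only [← mul_assoc, y1]
  simp only [mul_assoc]
  rw [c1.eq, c2.left_comm, c3.left_comm, y2', c4.left_comm, c5.left_comm, c6.left_comm, y1',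
    c7.left_comm, c8.left_comm]

lemma word_right {M : Type*} [Monoid M] {r43 r21 r41 r20 r40 r31 r51 i03 i05 r03 : M}
    (y1 : r43 * r41 * r31 = r31 * r41 * r43) (y2 : r40 * r43 * r03 = r03 * r43 * r40)
    (e1 : r03 * i03 = 1) (e2 : i03 * r03 = 1)
    (c1 : Commute i05 r43) (c2 : Commute r51 r43) (c3 : Commute i03 r41) (c4 : Commute r20 r43)
    (c5 : Commute i03 r51) (c6 : Commute r21 r43) (c7 : Commute r20 r41) (c8 : Commute r31 r40) :
    r43 * (r21 * r41 * (r20 * r40) * (r31 * r51) * (i03 * i05)) =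
      r21 * r20 * r31 * i03 * (r41 * r40 * r51 * i05) * r43 := by
  have y2' : ∀ z, i03 * (r40 * (r43 * z)) = r43 * (r40 * (i03 * z)) := by
    intro z
    have : i03 * (r40 * r43) = r43 * r40 * i03 := by
      calc i03 * (r40 * r43) = i03 * (r40 * r43 * r03) * i03 := by
            simp only [mul_assoc, e1, mul_one]
        _ = _ := by rw [y2]; simp only [← mul_assoc, e2, one_mul]
    calc _ = i03 * (r40 * r43) * z := by simp only [mul_assoc]
      _ = _ := by rw [this]; simp only [mul_assoc]
  have y1' : ∀ z, r31 * (r41 * (r43 * z)) = r43 * (r41 * (r31 * z)) := by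
    intro z; simp only [← mul_assoc, y1]
  simp only [mul_assoc]
  rw [c1.eq, c2.left_comm, c3.left_comm, y2', y1', c4.left_comm, c5.left_comm, c6.left_comm,
    c7.left_comm, c8.left_comm]

variable {T : Type*} [Ring T] [Algebra k T] {t : Fin 4 → (H →ₐ[k] T)} {l : Fin 6 → (H →ₐ[k] E)}

lemma bichar_left_core (ht : Comm t) (hl : Comm l) (mR mM G : T →ₐ[k] E)
    (hmR : ∀ i, mR.comp (t i) = l (posR i)) (hmM : ∀ i, mM.comp (t i) = l (posM i))
    (h0 : ∀ x, G (t 0 x) = convAt l 0 2 x) (h1 : ∀ x, G (t 1 x) = convAt l 1 3 x)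
    (h2 : ∀ x, G (t 2 x) = l 4 x) (h3 : ∀ x, G (t 3 x) = l 5 x) :
    Q.at' l 2 1 * G (Q.gamAt t) = mR (Q.gamAt t) * mM (Q.gamAt t) * Q.at' l 2 1 := by
  have gR := fun i x => AlgHom.congr_fun (hmR i) x
  have gM := fun i x => AlgHom.congr_fun (hmM i) x
  simp only [gamAt, map_mul]
  rw [Q.map_at mR (gR 2) (gR 1), Q.map_at mR (gR 2) (gR 0), Q.map_at mR (gR 3) (gR 1),
    Q.map_invAt mR (gR 0) (gR 3), Q.map_at mM (gM 2) (gM 1), Q.map_at mM (gM 2) (gM 0),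
    Q.map_at mM (gM 3) (gM 1), Q.map_invAt mM (gM 0) (gM 3),
    Q.map_at_conv_right G hl h2 h1 (by decide) (by decide),
    Q.map_at_conv_right G hl h2 h0 (by decide) (by decide),
    Q.map_at_conv_right G hl h3 h1 (by decide) (by decide),
    Q.map_invAt_eq G ht (a := 0) (b := 3) (by decide)
      (Q.map_at_conv_left G hl h0 h3 (by decide)) (y := Q.invAt l 2 5 * Q.invAt l 0 5)
      (by rw [mul_assoc, ← mul_assoc (Q.at' l 2 5), Q.at_mul_inv hl (by decide), one_mul,
        Q.at_mul_inv hl (by decide)])]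
  refine word_left (r25 := Q.at' l 2 5) (Q.at_yb hl ?_ ?_ ?_) (Q.at_yb hl ?_ ?_ ?_)
    (Q.at_mul_inv hl ?_) (Q.inv_mul_at hl ?_)
    (Q.at_comm_inv hl ?_ ?_ ?_ ?_).symm (Q.at_comm_inv hl ?_ ?_ ?_ ?_).symm
    (Q.at_comm_inv hl ?_ ?_ ?_ ?_).symm (Q.at_comm hl ?_ ?_ ?_ ?_) (Q.at_comm hl ?_ ?_ ?_ ?_)
    (Q.at_comm hl ?_ ?_ ?_ ?_) (Q.at_comm hl ?_ ?_ ?_ ?_) (Q.at_comm hl ?_ ?_ ?_ ?_) <;> decide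

lemma bichar_right_core (ht : Comm t) (hl : Comm l) (mL mM G : T →ₐ[k] E)
    (hmL : ∀ i, mL.comp (t i) = l (posL i)) (hmM : ∀ i, mM.comp (t i) = l (posM i))
    (h0 : ∀ x, G (t 0 x) = l 0 x) (h1 : ∀ x, G (t 1 x) = l 1 x)
    (h2 : ∀ x, G (t 2 x) = convAt l 2 4 x) (h3 : ∀ x, G (t 3 x) = convAt l 3 5 x) :
    Q.at' l 4 3 * G (Q.gamAt t) = mL (Q.gamAt t) * mM (Q.gamAt t) * Q.at' l 4 3 := by
  have gL := fun i x => AlgHom.congr_fun (hmL i) x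
  have gM := fun i x => AlgHom.congr_fun (hmM i) x
  simp only [gamAt, map_mul]
  rw [Q.map_at mL (gL 2) (gL 1), Q.map_at mL (gL 2) (gL 0), Q.map_at mL (gL 3) (gL 1),
    Q.map_invAt mL (gL 0) (gL 3), Q.map_at mM (gM 2) (gM 1), Q.map_at mM (gM 2) (gM 0),
    Q.map_at mM (gM 3) (gM 1), Q.map_invAt mM (gM 0) (gM 3),
    Q.map_at_conv_left G hl h2 h1 (by decide),
    Q.map_at_conv_left G hl h2 h0 (by decide),
    Q.map_at_conv_left G hl h3 h1 (by decide),
    Q.map_invAt_eq G ht (a := 0) (b := 3) (by decide)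
      (Q.map_at_conv_right G hl h0 h3 (by decide) (by decide))
      (y := Q.invAt l 0 3 * Q.invAt l 0 5)
      (by rw [mul_assoc, ← mul_assoc (Q.at' l 0 3), Q.at_mul_inv hl (by decide), one_mul,
        Q.at_mul_inv hl (by decide)])]
  refine word_right (r03 := Q.at' l 0 3) (Q.at_yb hl ?_ ?_ ?_) (Q.at_yb hl ?_ ?_ ?_)
    (Q.at_mul_inv hl ?_) (Q.inv_mul_at hl ?_)
    (Q.at_comm_inv hl ?_ ?_ ?_ ?_).symm (Q.at_comm hl ?_ ?_ ?_ ?_)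
    (Q.at_comm_inv hl ?_ ?_ ?_ ?_).symm (Q.at_comm hl ?_ ?_ ?_ ?_)
    (Q.at_comm_inv hl ?_ ?_ ?_ ?_).symm (Q.at_comm hl ?_ ?_ ?_ ?_) (Q.at_comm hl ?_ ?_ ?_ ?_)
    (Q.at_comm hl ?_ ?_ ?_ ?_) <;> decide

/-- An equation can be checked after conjugation by a unit. -/
lemma conj_core (c : Eˣ) (G : T →ₐ[k] E) (X : T) (Y : E)
    (h : c * conjHom c⁻¹ G X = Y * c) : G X = Y := by
  rw [conjHom_apply, inv_inv, ← mul_assoc, Units.mul_inv_cancel_left] at h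
  exact c.isUnit.mul_right_cancel h

lemma conj_eq (c : Eˣ) (G : T →ₐ[k] E) (X : T) (Y : E) (h : G X * c = c * Y) :
    conjHom c⁻¹ G X = Y := by
  rw [conjHom_apply, inv_inv, mul_assoc, h, Units.inv_mul_cancel_left]

/-- The unit `R_{ij}`. -/
def unitAt {ι : Type*} {l : ι → (H →ₐ[k] E)} (hl : Comm l) {i j : ι}
    (h : i ≠ j) : Eˣ := ⟨Q.at' l i j, Q.invAt l i j, Q.at_mul_inv hl h, Q.inv_mul_at hl h⟩

lemma map_conj (m : T →ₐ[k] E) {pos : Fin 4 → Fin 6} (hm : ∀ i, m.comp (t i) = l (pos i))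
    (i j p q : Fin 4) (x : H) (X : T)
    (h : X * Q.at' t i j = Q.at' t i j * convAt t p q x) :
    m X * Q.at' l (pos i) (pos j) = Q.at' l (pos i) (pos j) * convAt l (pos p) (pos q) x := by
  rw [← map_conv' m (hm p) (hm q), ← Q.map_at m (fun x => AlgHom.congr_fun (hm i) x)
    (fun x => AlgHom.congr_fun (hm j) x), ← map_mul, h, map_mul]

lemma gam_left_abs (ht : Comm t) (hl : Comm l) (mL mR mM cL : T →ₐ[k] E)
    (hmL : ∀ i, mL.comp (t i) = l (posL i)) (hmR : ∀ i, mR.comp (t i) = l (posR i))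
    (hmM : ∀ i, mM.comp (t i) = l (posM i)) (d0 d1 : H → T)
    (h0 : ∀ x, cL (t 0 x) = mL (d0 x)) (h1 : ∀ x, cL (t 1 x) = mL (d1 x))
    (h0' : ∀ x, d0 x * Q.at' t 2 1 = Q.at' t 2 1 * convAt t 0 2 x)
    (h1' : ∀ x, d1 x * Q.at' t 2 1 = Q.at' t 2 1 * convAt t 1 3 x)
    (h2 : ∀ x, cL (t 2 x) = l 4 x) (h3 : ∀ x, cL (t 3 x) = l 5 x) :
    cL (Q.gamAt t) = mR (Q.gamAt t) * mM (Q.gamAt t) := by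
  refine conj_core (Q.unitAt hl (i := 2) (j := 1) (by decide)) _ _ _ ?_
  refine Q.bichar_left_core ht hl _ _ _ hmR hmM (fun x => conj_eq _ _ _ _ ?_)
    (fun x => conj_eq _ _ _ _ ?_) (fun x => conj_eq _ _ _ _ ?_) (fun x => conj_eq _ _ _ _ ?_)
  · rw [h0]; exact Q.map_conj mL hmL 2 1 0 2 x _ (h0' x)
  · rw [h1]; exact Q.map_conj mL hmL 2 1 1 3 x _ (h1' x)
  · rw [h2]; exact (Q.at_comm_leg hl (i := 2) (j := 1) (p := 4) (by decide) (by decide) x).eq.symm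
  · rw [h3]; exact (Q.at_comm_leg hl (i := 2) (j := 1) (p := 5) (by decide) (by decide) x).eq.symm

lemma gam_right_abs (ht : Comm t) (hl : Comm l) (mL mR mM cR : T →ₐ[k] E)
    (hmL : ∀ i, mL.comp (t i) = l (posL i)) (hmR : ∀ i, mR.comp (t i) = l (posR i))
    (hmM : ∀ i, mM.comp (t i) = l (posM i)) (d0 d1 : H → T)
    (h0 : ∀ x, cR (t 2 x) = mR (d0 x)) (h1 : ∀ x, cR (t 3 x) = mR (d1 x))
    (h0' : ∀ x, d0 x * Q.at' t 2 1 = Q.at' t 2 1 * convAt t 0 2 x)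
    (h1' : ∀ x, d1 x * Q.at' t 2 1 = Q.at' t 2 1 * convAt t 1 3 x)
    (h2 : ∀ x, cR (t 0 x) = l 0 x) (h3 : ∀ x, cR (t 1 x) = l 1 x) :
    cR (Q.gamAt t) = mL (Q.gamAt t) * mM (Q.gamAt t) := by
  refine conj_core (Q.unitAt hl (i := 4) (j := 3) (by decide)) _ _ _ ?_
  refine Q.bichar_right_core ht hl _ _ _ hmL hmM (fun x => conj_eq _ _ _ _ ?_)
    (fun x => conj_eq _ _ _ _ ?_) (fun x => conj_eq _ _ _ _ ?_) (fun x => conj_eq _ _ _ _ ?_)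
  · rw [h2]; exact (Q.at_comm_leg hl (i := 4) (j := 3) (p := 0) (by decide) (by decide) x).eq.symm
  · rw [h3]; exact (Q.at_comm_leg hl (i := 4) (j := 3) (p := 1) (by decide) (by decide) x).eq.symm
  · rw [h0]; exact Q.map_conj mR hmR 2 1 0 2 x _ (h0' x)
  · rw [h1]; exact Q.map_conj mR hmR 2 1 1 3 x _ (h1' x)

lemma gam_counit_left {T : Type*} [Ring T] [Algebra k T] {t : Fin 4 → (H →ₐ[k] T)}
    (ht : Comm t) (G : T →ₐ[k] E)
    (h0 : ∀ x, G (t 0 x) = unitCounit (k := k) x) (h1 : ∀ x, G (t 1 x) = unitCounit (k := k) x) :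
    G (Q.gamAt t) = 1 := by
  rw [gamAt, map_mul, map_mul, map_mul, Q.map_at_counit_right G t 2 1 h1,
    Q.map_at_counit_right G t 2 0 h0, Q.map_at_counit_right G t 3 1 h1,
    Q.map_invAt_eq G ht (a := 0) (b := 3) (by decide) (Q.map_at_counit_left G t 0 3 h0) (mul_one 1)]
  simp

lemma gam_counit_right {T : Type*} [Ring T] [Algebra k T] {t : Fin 4 → (H →ₐ[k] T)}
    (ht : Comm t) (G : T →ₐ[k] E)
    (h2 : ∀ x, G (t 2 x) = unitCounit (k := k) x) (h3 : ∀ x, G (t 3 x) = unitCounit (k := k) x) :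
    G (Q.gamAt t) = 1 := by
  rw [gamAt, map_mul, map_mul, map_mul, Q.map_at_counit_left G t 2 1 h2,
    Q.map_at_counit_left G t 2 0 h2, Q.map_at_counit_left G t 3 1 h3,
    Q.map_invAt_eq G ht (a := 0) (b := 3) (by decide) (Q.map_at_counit_right G t 0 3 h3)
      (mul_one 1)]
  simp

lemma R'_left_abs {T : Type*} [Ring T] [Algebra k T] {t : Fin 2 → (H →ₐ[k] T)}
    {l : Fin 3 → (H →ₐ[k] E)} (hl : Comm l) (mR mM cL : T →ₐ[k] E)
    (r0 : ∀ x, mR (t 0 x) = l 1 x) (r1 : ∀ x, mR (t 1 x) = l 2 x)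
    (m0 : ∀ x, mM (t 0 x) = l 0 x) (m1 : ∀ x, mM (t 1 x) = l 2 x)
    (c0 : ∀ x, cL (t 0 x) = convAt l 0 1 x) (c1 : ∀ x, cL (t 1 x) = l 2 x) :
    cL (Q.at' t 1 0) = mR (Q.at' t 1 0) * mM (Q.at' t 1 0) := by
  rw [Q.map_at_conv_right cL hl c1 c0 (by decide) (by decide), Q.map_at mR r1 r0,
    Q.map_at mM m1 m0]

lemma R'_right_abs {T : Type*} [Ring T] [Algebra k T] {t : Fin 2 → (H →ₐ[k] T)}
    {l : Fin 3 → (H →ₐ[k] E)} (hl : Comm l) (mL mM cR : T →ₐ[k] E)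
    (r0 : ∀ x, mL (t 0 x) = l 0 x) (r1 : ∀ x, mL (t 1 x) = l 1 x)
    (m0 : ∀ x, mM (t 0 x) = l 0 x) (m1 : ∀ x, mM (t 1 x) = l 2 x)
    (c0 : ∀ x, cR (t 0 x) = l 0 x) (c1 : ∀ x, cR (t 1 x) = convAt l 1 2 x) :
    cR (Q.at' t 1 0) = mL (Q.at' t 1 0) * mM (Q.at' t 1 0) := by
  rw [Q.map_at_conv_left cR hl c1 c0 (by decide), Q.map_at mL r1 r0, Q.map_at mM m1 m0]

end core

/-- The coproduct `X ↦ F (x₁ ⊗ y₂ ⊗ x₂ ⊗ y₁) F⁻¹` for `X = x ⊗ y` of the twist of `H ⊗ H^cop`. -/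
def comulF : H ⊗[k] H →ₐ[k] (H ⊗[k] H) ⊗[k] (H ⊗[k] H) :=
  twistComul (comulHHcop k H) Q.isTwist_F.isUnit

lemma comulF_left (x : H) : Q.comulF (x ⊗ₜ[k] 1) * Q.at' (leg4 k H) 2 1 =
    Q.at' (leg4 k H) 2 1 * convAt (leg4 k H) 0 2 x := by
  rw [← Q.Fat_conj_left leg4_commute Q.isTwist_F.isUnit.unit rfl, ← comulHHcop_left]
  rfl

lemma comulF_right (x : H) : Q.comulF (1 ⊗ₜ[k] x) * Q.at' (leg4 k H) 2 1 =
    Q.at' (leg4 k H) 2 1 * convAt (leg4 k H) 1 3 x := by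
  rw [← Q.Fat_conj_right leg4_commute Q.isTwist_F.isUnit.unit rfl, ← comulHHcop_right]
  rfl

lemma gam_left : comL Q.comulF Q.gam = mapR Q.gam * mapM Q.gam :=
  Q.gam_left_abs (t := leg4 k H) (l := leg6 k H) leg4_commute leg6_commute mapL mapR mapM
    (comL Q.comulF) mapL_leg mapR_leg mapM_leg (fun x => Q.comulF (x ⊗ₜ[k] 1))
    (fun x => Q.comulF (1 ⊗ₜ[k] x)) (fun _ => comL_left _ _) (fun _ => comL_left _ _)
    Q.comulF_left Q.comulF_right (fun _ => comL_right _ _) (fun _ => comL_right _ _)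

lemma gam_right : comR Q.comulF Q.gam = mapL Q.gam * mapM Q.gam :=
  Q.gam_right_abs (t := leg4 k H) (l := leg6 k H) leg4_commute leg6_commute mapL mapR mapM
    (comR Q.comulF) mapL_leg mapR_leg mapM_leg (fun x => Q.comulF (x ⊗ₜ[k] 1))
    (fun x => Q.comulF (1 ⊗ₜ[k] x)) (fun _ => comR_right _ _) (fun _ => comR_right _ _)
    Q.comulF_left Q.comulF_right (fun _ => comR_left _ _) (fun _ => comR_left _ _)

lemma comulHHcop_eq (X : H ⊗[k] H) : comulHHcop k H X =
    leg X (convAt (leg4 k H) 0 2) (convAt (leg4 k H) 3 1) := by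
  induction X with
  | zero => simp
  | add X Y hX hY => rw [map_add, hX, hY, leg_add]
  | tmul a b =>
    rw [leg_tmul, ← comulHHcop_left, ← comulHHcop_right, ← map_mul]
    simp

lemma includeLeft_comul (x : H) :
    (Algebra.TensorProduct.includeLeft : H ⊗[k] H →ₐ[k] (H ⊗[k] H) ⊗[k] (H ⊗[k] H))
      (Coalgebra.comul (R := k) x) = convAt (leg4 k H) 0 1 x := by
  rw [convAt, conv_apply]
  generalize Coalgebra.comul (R := k) x = X
  induction X with
  | zero => simp
  | add X Y hX hY => rw [leg_add, ← hX, ← hY, map_add]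
  | tmul a b => simp [leg4, Algebra.TensorProduct.one_def]

lemma includeRight_comul (x : H) :
    (Algebra.TensorProduct.includeRight : H ⊗[k] H →ₐ[k] (H ⊗[k] H) ⊗[k] (H ⊗[k] H))
      (Coalgebra.comul (R := k) x) = convAt (leg4 k H) 2 3 x := by
  rw [convAt, conv_apply]
  generalize Coalgebra.comul (R := k) x = X
  induction X with
  | zero => simp
  | add X Y hX hY => rw [leg_add, ← hX, ← hY, map_add]
  | tmul a b => simp [leg4, Algebra.TensorProduct.one_def]

lemma map_comul_comul (X : H ⊗[k] H) :
    Algebra.TensorProduct.map (Bialgebra.comulAlgHom k H) (Bialgebra.comulAlgHom k H) X =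
      leg X (convAt (leg4 k H) 0 1) (convAt (leg4 k H) 2 3) := by
  induction X with
  | zero => simp
  | add X Y hX hY => rw [map_add, hX, hY, leg_add]
  | tmul a b =>
    rw [leg_tmul, ← includeLeft_comul, ← includeRight_comul]
    simp

lemma comulF_comul (h : H) : Q.comulF (Bialgebra.comulAlgHom k H h) =
    Algebra.TensorProduct.map (Bialgebra.comulAlgHom k H) (Bialgebra.comulAlgHom k H)
      (Coalgebra.comul (R := k) h) := by
  have h1 := Q.slide_F (l := leg4 k H) leg4_commute h
  have h2 : comulHHcop k H (Bialgebra.comulAlgHom k H h) = conv4 (leg4 k H) 0 2 3 1 h :=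
    comulHHcop_eq _
  rw [map_comul_comul]
  change _ = conv4 (leg4 k H) 0 1 2 3 h
  rw [comulF, twistComul, conjHom_apply, h2]
  refine (congrArg (· * _) h1).trans ?_
  rw [mul_assoc]
  refine (congrArg (_ * ·) Q.isTwist_F.isUnit.mul_val_inv).trans (mul_one _)

lemma comul_mul_gam (h : H) :
    Algebra.TensorProduct.map (Bialgebra.comulAlgHom k H) (Bialgebra.comulAlgHom k H)
      (Coalgebra.comul (R := k) h) * Q.gam =
    Q.gam * Algebra.TensorProduct.map (Bialgebra.comulAlgHom k H) (Bialgebra.comulAlgHom k H)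
      (TensorProduct.comm k H H (Coalgebra.comul (R := k) h)) := by
  rw [map_comul_comul, map_comul_comul, leg_comm]
  · exact (Q.slide_gam (l := leg4 k H) leg4_commute h).symm
  · intro x y
    rw [← includeLeft_comul, ← includeRight_comul]
    simp [Commute, SemiconjBy]

lemma isBichar_gam : IsBichar Q.comulF (counitHH k H) Q.gam where
  left := Q.gam_left
  right := Q.gam_right
  counit_left := by
    let Ψ : (H ⊗[k] H) ⊗[k] (H ⊗[k] H) →ₐ[k] H ⊗[k] H :=
      (Algebra.TensorProduct.lid k (H ⊗[k] H)).toAlgHom.comp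
        (Algebra.TensorProduct.map (counitHH k H) (AlgHom.id k (H ⊗[k] H)))
    exact Q.gam_counit_left (t := leg4 k H) leg4_commute Ψ
      (fun x => by
        simp [Ψ, leg4, unitCounit, Algebra.ofId_apply, Algebra.algebraMap_eq_smul_one])
      (fun x => by
        simp [Ψ, leg4, unitCounit, Algebra.ofId_apply, Algebra.algebraMap_eq_smul_one])
  counit_right := by
    let Ψ : (H ⊗[k] H) ⊗[k] (H ⊗[k] H) →ₐ[k] H ⊗[k] H :=
      (Algebra.TensorProduct.rid k k (H ⊗[k] H)).toAlgHom.comp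
        (Algebra.TensorProduct.map (AlgHom.id k (H ⊗[k] H)) (counitHH k H))
    exact Q.gam_counit_right (t := leg4 k H) leg4_commute Ψ
      (fun x => by
        simp [Ψ, leg4, unitCounit, Algebra.ofId_apply, Algebra.algebraMap_eq_smul_one])
      (fun x => by
        simp [Ψ, leg4, unitCounit, Algebra.ofId_apply, Algebra.algebraMap_eq_smul_one])

/-- The element `R' = ∑ R₂ ⊗ R₁`. -/
def R' : H ⊗[k] H := TensorProduct.comm k H H Q.R

variable (k H) in
/-- The embeddings of `H` as the two legs of `H ⊗ H`. -/
def leg2 : Fin 2 → (H →ₐ[k] H ⊗[k] H)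
  | 0 => Algebra.TensorProduct.includeLeft
  | 1 => Algebra.TensorProduct.includeRight

variable (k H) in
/-- The embeddings of `H` as the three legs of `H ⊗ (H ⊗ H)`. -/
def leg3' : Fin 3 → (H →ₐ[k] H ⊗[k] (H ⊗[k] H))
  | 0 => Algebra.TensorProduct.includeLeft
  | 1 => Algebra.TensorProduct.includeRight.comp Algebra.TensorProduct.includeLeft
  | 2 => Algebra.TensorProduct.includeRight.comp Algebra.TensorProduct.includeRight

lemma leg3'_commute : Comm (leg3' k H) := by
  intro i j hij x y
  fin_cases i <;> fin_cases j <;>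
    first
    | exact absurd rfl hij
    | simp [leg3', Commute, SemiconjBy]

lemma R'_eq : Q.R' = Q.at' (leg2 k H) 1 0 := by
  rw [R', at']
  generalize Q.R = X
  induction X with
  | zero => simp
  | add X Y hX hY => rw [leg_add, map_add, hX, hY]
  | tmul a b => simp [leg2]

lemma mapL_comul (x : H) : mapL (Coalgebra.comul (R := k) x) = convAt (leg3' k H) 0 1 x := by
  rw [convAt, conv_apply]
  generalize Coalgebra.comul (R := k) x = X
  induction X with
  | zero => simp
  | add X Y hX hY => rw [leg_add, ← hX, ← hY, map_add]
  | tmul a b => simp [leg3', mapL]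

lemma mapR_comul (x : H) : mapR (Coalgebra.comul (R := k) x) = convAt (leg3' k H) 1 2 x := by
  rw [convAt, conv_apply]
  generalize Coalgebra.comul (R := k) x = X
  induction X with
  | zero => simp
  | add X Y hX hY => rw [leg_add, ← hX, ← hY, map_add]
  | tmul a b => simp [leg3', mapR]

lemma isBichar_R' :
    IsBichar (Bialgebra.comulAlgHom k H) (Bialgebra.counitAlgHom k H) Q.R' where
  left := by
    rw [R'_eq]
    exact Q.R'_left_abs (t := leg2 k H) (l := leg3' k H) leg3'_commute mapR mapM (comL (Bialgebra.comulAlgHom k H))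
      (fun _ => rfl) (fun _ => rfl) (fun _ => rfl) (fun _ => rfl)
      (fun x => (comL_left _ x).trans (mapL_comul x)) (fun x => comL_right _ x)
  right := by
    rw [R'_eq]
    exact Q.R'_right_abs (t := leg2 k H) (l := leg3' k H) leg3'_commute mapL mapM (comR (Bialgebra.comulAlgHom k H))
      (fun _ => rfl) (fun _ => rfl) (fun _ => rfl) (fun _ => rfl)
      (fun x => comR_left _ x) (fun x => (comR_right _ x).trans (mapR_comul x))
  counit_left := by
    let Ψ : H ⊗[k] H →ₐ[k] H := (Algebra.TensorProduct.lid k H).toAlgHom.comp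
      (Algebra.TensorProduct.map (Bialgebra.counitAlgHom k H) (AlgHom.id k H))
    rw [R'_eq]
    exact Q.map_at_counit_right Ψ (leg2 k H) 1 0 (fun x => by
      simp [Ψ, leg2, unitCounit, Algebra.ofId_apply, Algebra.algebraMap_eq_smul_one])
  counit_right := by
    let Ψ : H ⊗[k] H →ₐ[k] H := (Algebra.TensorProduct.rid k k H).toAlgHom.comp
      (Algebra.TensorProduct.map (AlgHom.id k H) (Bialgebra.counitAlgHom k H))
    rw [R'_eq]
    exact Q.map_at_counit_left Ψ (leg2 k H) 1 0 (fun x => by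
      simp [Ψ, leg2, unitCounit, Algebra.ofId_apply, Algebra.algebraMap_eq_smul_one])

lemma comul_mul_R' (h : H) : Coalgebra.comul (R := k) h * Q.R' =
    Q.R' * TensorProduct.comm k H H (Coalgebra.comul (R := k) h) := by
  have h1 := congrArg (Algebra.TensorProduct.comm k H H) (Q.R_mul_comul h)
  rw [map_mul, map_mul] at h1
  have h2 : Algebra.TensorProduct.comm k H H
      (TensorProduct.comm k H H (Coalgebra.comul (R := k) h)) = Coalgebra.comul (R := k) h :=
    (TensorProduct.comm k H H).symm_apply_apply _
  rw [h2] at h1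
  exact h1.symm

end RMatrix
end Bicharacter

section TwistedTensor

variable {k : Type u} [Field k] {D : Type v} [Ring D] [Algebra k D]

namespace ModAlg

variable {δ : D →ₐ[k] D ⊗[k] D} {ε : D →ₐ[k] k} (M N : ModAlg.{u, v, w} δ ε)

/-- `∑ m (m' · X₂) ⊗ (n · X₁) n'` for `X = ∑ X₁ ⊗ X₂`. -/
def twCore (X : D ⊗[k] D) (m : M.carrier) (n : N.carrier) (m' : M.carrier) (n' : N.carrier) :
    M.carrier ⊗[k] N.carrier :=
  TensorProduct.map (LinearMap.mul k M.carrier m) ((LinearMap.mul k N.carrier).flip n')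
    (TensorProduct.comm k N.carrier M.carrier (TensorProduct.map (N.act n) (M.act m') X))

variable {M N}

@[simp] lemma twCore_tmul (a b : D) (m : M.carrier) (n : N.carrier) (m' : M.carrier)
    (n' : N.carrier) : twCore M N (a ⊗ₜ[k] b) m n m' n' =
      (m * M.act m' b) ⊗ₜ[k] (N.act n a * n') := by simp [twCore]

@[simp] lemma twCore_add (X Y : D ⊗[k] D) (m : M.carrier) (n : N.carrier) (m' : M.carrier)
    (n' : N.carrier) : twCore M N (X + Y) m n m' n' =
      twCore M N X m n m' n' + twCore M N Y m n m' n' := by simp [twCore]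

@[simp] lemma twCore_zero (m : M.carrier) (n : N.carrier) (m' : M.carrier)
    (n' : N.carrier) : twCore M N (0 : D ⊗[k] D) m n m' n' = 0 := by simp [twCore]

lemma twCore_sum (s : Finset (D × D)) (m : M.carrier) (n : N.carrier) (m' : M.carrier)
    (n' : N.carrier) : twCore M N (∑ i ∈ s, i.1 ⊗ₜ[k] i.2) m n m' n' =
      ∑ i ∈ s, (m * M.act m' i.2) ⊗ₜ[k] (N.act n i.1 * n') := by simp [twCore]

variable (M N) in
/-- The twisted product `(m ⊗ n)(m' ⊗ n') = ∑ m (m' · X₂) ⊗ (n · X₁) n'` on `M ⊗ N`. -/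
def twMul (X : D ⊗[k] D) :
    M.carrier ⊗[k] N.carrier →ₗ[k] M.carrier ⊗[k] N.carrier →ₗ[k] M.carrier ⊗[k] N.carrier :=
  TensorProduct.lift (LinearMap.mk₂ k
    (fun m n => TensorProduct.lift (LinearMap.mk₂ k (fun m' n' => twCore M N X m n m' n')
      (by simp [twCore, TensorProduct.map_add_right]) (by simp [twCore, TensorProduct.map_smul_right])
      (by simp [twCore, TensorProduct.map_add_right])
      (by simp [twCore, TensorProduct.map_smul_right])))
    (fun m m₂ n => by ext; simp [twCore, TensorProduct.map_add_left])
    (fun c m n => by ext; simp [twCore, TensorProduct.map_smul_left])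
    (fun m n n₂ => by ext; simp [twCore, TensorProduct.map_add_left])
    (fun c m n => by ext; simp [twCore, TensorProduct.map_smul_left]))

@[simp] lemma twMul_tmul (X : D ⊗[k] D) (m : M.carrier) (n : N.carrier) (m' : M.carrier)
    (n' : N.carrier) : twMul M N X (m ⊗ₜ[k] n) (m' ⊗ₜ[k] n') = twCore M N X m n m' n' := rfl

/-- `∑ m (m'' · Z₃) ⊗ (n · Z₁)(n' · Z₂) n''` -/
def aCore (m m'' : M.carrier) (n n' n'' : N.carrier) :
    D ⊗[k] (D ⊗[k] D) →ₗ[k] M.carrier ⊗[k] N.carrier :=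
  TensorProduct.map (LinearMap.mul k M.carrier m) ((LinearMap.mul k N.carrier).flip n'') ∘ₗ
    (TensorProduct.comm k N.carrier M.carrier).toLinearMap ∘ₗ
    (LinearMap.mul' k N.carrier).rTensor M.carrier ∘ₗ
    (TensorProduct.assoc k N.carrier N.carrier M.carrier).symm.toLinearMap ∘ₗ
    TensorProduct.map (N.act n) (TensorProduct.map (N.act n') (M.act m''))

@[simp] lemma aCore_tmul (m m'' : M.carrier) (n n' n'' : N.carrier) (a b c : D) :
    aCore m m'' n n' n'' (a ⊗ₜ[k] (b ⊗ₜ[k] c)) =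
      (m * M.act m'' c) ⊗ₜ[k] (N.act n a * N.act n' b * n'') := by simp [aCore]

/-- `∑ m (m' · W₂)(m'' · W₃) ⊗ (n · W₁) n'` -/
def bCore (m m' m'' : M.carrier) (n n' : N.carrier) :
    D ⊗[k] (D ⊗[k] D) →ₗ[k] M.carrier ⊗[k] N.carrier :=
  TensorProduct.map (LinearMap.mul k M.carrier m) ((LinearMap.mul k N.carrier).flip n') ∘ₗ
    (TensorProduct.comm k N.carrier M.carrier).toLinearMap ∘ₗ
    TensorProduct.map (N.act n) (M.ev2 m' m'')

@[simp] lemma bCore_tmul (m m' m'' : M.carrier) (n n' : N.carrier) (a b c : D) :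
    bCore m m' m'' n n' (a ⊗ₜ[k] (b ⊗ₜ[k] c)) =
      (m * (M.act m' b * M.act m'' c)) ⊗ₜ[k] (N.act n a * n') := by simp [bCore]

lemma twCore_mul_left (X : D ⊗[k] D) (m m'' : M.carrier) (n n' n'' : N.carrier) :
    twCore M N X m (n * n') m'' n'' = aCore m m'' n n' n'' (comL δ X) := by
  induction X with
  | zero => simp
  | add X Y hX hY => rw [twCore_add, hX, hY, map_add, map_add]
  | tmul a b =>
    have : comL δ (a ⊗ₜ[k] b) = TensorProduct.assoc k D D D (δ a ⊗ₜ[k] b) := rfl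
    rw [twCore_tmul, this, mul_act']
    generalize δ a = Y
    induction Y with
    | zero => simp
    | add X Y hX hY =>
      simp only [map_add, TensorProduct.add_tmul, add_mul, TensorProduct.tmul_add, hX, hY]
    | tmul c d => simp

lemma twCore_mul_right (X : D ⊗[k] D) (m m' m'' : M.carrier) (n n' : N.carrier) :
    twCore M N X m n (m' * m'') n' = bCore m m' m'' n n' (comR δ X) := by
  induction X with
  | zero => simp
  | add X Y hX hY => rw [twCore_add, hX, hY, map_add, map_add]
  | tmul a b =>
    have : comR δ (a ⊗ₜ[k] b) = a ⊗ₜ[k] δ b := rfl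
    rw [twCore_tmul, this, mul_act']
    generalize δ b = Y
    induction Y with
    | zero => simp
    | add X Y hX hY =>
      simp only [map_add, TensorProduct.add_tmul, mul_add, TensorProduct.tmul_add, hX, hY]
    | tmul c d => simp

lemma twMul_assoc {χ : D ⊗[k] D} (hχ : IsBichar δ ε χ) (x y z : M.carrier ⊗[k] N.carrier) :
    twMul M N χ (twMul M N χ x y) z = twMul M N χ x (twMul M N χ y z) := by
  induction x with
  | zero => simp
  | add x x' hx hx' => simp only [map_add, LinearMap.add_apply, hx, hx']
  | tmul m n =>
  induction y with
  | zero => simp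
  | add x x' hx hx' => simp only [map_add, LinearMap.add_apply, hx, hx']
  | tmul m' n' =>
  induction z with
  | zero => simp
  | add x x' hx hx' => simp only [map_add, hx, hx']
  | tmul m'' n'' =>
  obtain ⟨s, hs⟩ := TensorProduct.exists_finset χ
  have h1 : twMul M N χ (twMul M N χ (m ⊗ₜ n) (m' ⊗ₜ n')) (m'' ⊗ₜ n'') =
      ∑ i ∈ s, aCore (m * M.act m' i.2) m'' (N.act n i.1) n' n'' (mapR χ * mapM χ) := by
    rw [twMul_tmul, ← hχ.left]
    conv_lhs => rw [congrArg (fun X => twMul M N χ (twCore M N X m n m' n')) hs]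
    rw [twCore_sum, map_sum, LinearMap.sum_apply]
    exact Finset.sum_congr rfl fun i _ => by rw [twMul_tmul, twCore_mul_left]
  have h2 : twMul M N χ (m ⊗ₜ n) (twMul M N χ (m' ⊗ₜ n') (m'' ⊗ₜ n'')) =
      ∑ j ∈ s, bCore m m' (M.act m'' j.2) n (N.act n' j.1 * n'') (mapL χ * mapM χ) := by
    rw [twMul_tmul, ← hχ.right]
    conv_lhs => rw [congrArg (fun X => twMul M N χ (m ⊗ₜ n) (twCore M N X m' n' m'' n'')) hs]
    rw [twCore_sum, map_sum]
    exact Finset.sum_congr rfl fun i _ => by rw [twMul_tmul, twCore_mul_right]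
  have h3 : ∀ i j l : D × D, aCore (m * M.act m' i.2) m'' (N.act n i.1) n' n''
        (mapR (j.1 ⊗ₜ[k] j.2) * mapM (l.1 ⊗ₜ[k] l.2)) =
      bCore m m' (M.act m'' j.2) n (N.act n' j.1 * n'')
        (mapL (i.1 ⊗ₜ[k] i.2) * mapM (l.1 ⊗ₜ[k] l.2)) := by
    intro i j l
    simp [mapL, mapR, mapM, mul_assoc, ← M.act_mul, ← N.act_mul]
  rw [h1, h2]
  simp only [congrArg mapR hs, congrArg mapL hs, congrArg mapM hs, map_sum, Finset.sum_mul_sum, h3]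
  exact Finset.sum_comm

lemma twMul_one_left {χ : D ⊗[k] D} (hχ : IsBichar δ ε χ) (x : M.carrier ⊗[k] N.carrier) :
    twMul M N χ (1 ⊗ₜ 1) x = x := by
  induction x with
  | zero => simp
  | add x x' hx hx' => simp only [map_add, hx, hx']
  | tmul m n =>
    have : ∀ X : D ⊗[k] D, twCore M N X 1 1 m n = M.act m (Algebra.TensorProduct.lid k D
      (Algebra.TensorProduct.map ε (AlgHom.id k D) X)) ⊗ₜ[k] n := by
      intro X
      induction X with
      | zero => simp
      | add X Y hX hY => rw [twCore_add, hX, hY, map_add, map_add, map_add, TensorProduct.add_tmul]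
      | tmul a b =>
        simp [N.one_act, Algebra.algebraMap_eq_smul_one, TensorProduct.smul_tmul]
    rw [twMul_tmul, this, hχ.counit_left, M.act_one]

lemma twMul_one_right {χ : D ⊗[k] D} (hχ : IsBichar δ ε χ) (x : M.carrier ⊗[k] N.carrier) :
    twMul M N χ x (1 ⊗ₜ 1) = x := by
  induction x with
  | zero => simp
  | add x x' hx hx' => simp only [map_add, LinearMap.add_apply, hx, hx']
  | tmul m n =>
    have : ∀ X : D ⊗[k] D, twCore M N X m n 1 1 = m ⊗ₜ[k] N.act n (Algebra.TensorProduct.rid k k D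
      (Algebra.TensorProduct.map (AlgHom.id k D) ε X)) := by
      intro X
      induction X with
      | zero => simp
      | add X Y hX hY => rw [twCore_add, hX, hY, map_add, map_add, map_add, TensorProduct.tmul_add]
      | tmul a b =>
        simp [M.one_act, Algebra.algebraMap_eq_smul_one, TensorProduct.smul_tmul]
    rw [twMul_tmul, this, hχ.counit_right, N.act_one]

section action
variable {H : Type v} [Ring H] [HopfAlgebra k H] (f : H →ₐ[k] D)

/-- `∑ f(h₁) ⊗ f(h₂)` -/
def comulMap : H →ₐ[k] D ⊗[k] D :=
  (Algebra.TensorProduct.map f f).comp (Bialgebra.comulAlgHom k H)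

variable (M N) in
/-- The diagonal action `(m ⊗ n) · h = ∑ m · f(h₁) ⊗ n · f(h₂)`. -/
def twAct : M.carrier ⊗[k] N.carrier →ₗ[k] H →ₗ[k] M.carrier ⊗[k] N.carrier :=
  TensorProduct.lift (LinearMap.mk₂ k
    (fun m n => TensorProduct.map (M.act m) (N.act n) ∘ₗ (comulMap f).toLinearMap)
    (fun _ _ _ => by ext; simp [TensorProduct.map_add_left])
    (fun _ _ _ => by ext; simp [TensorProduct.map_smul_left])
    (fun _ _ _ => by ext; simp [TensorProduct.map_add_right])
    (fun _ _ _ => by ext; simp [TensorProduct.map_smul_right]))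

lemma twAct_tmul (m : M.carrier) (n : N.carrier) (h : H) : twAct M N f (m ⊗ₜ n) h =
    TensorProduct.map (M.act m) (N.act n) (comulMap f h) := rfl

lemma twAct_one (x : M.carrier ⊗[k] N.carrier) : twAct M N f x 1 = x := by
  induction x with
  | zero => simp
  | add x x' hx hx' => simp only [map_add, LinearMap.add_apply, hx, hx']
  | tmul m n => simp [twAct_tmul, Algebra.TensorProduct.one_def, M.act_one, N.act_one]

lemma twAct_mul (x : M.carrier ⊗[k] N.carrier) (h h' : H) :
    twAct M N f x (h * h') = twAct M N f (twAct M N f x h) h' := by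
  induction x with
  | zero => simp
  | add x x' hx hx' => simp only [map_add, LinearMap.add_apply, hx, hx']
  | tmul m n =>
    rw [twAct_tmul, twAct_tmul, map_mul]
    generalize comulMap f h = X
    induction X with
    | zero => simp
    | add X Y hX hY => simp only [map_add, add_mul, LinearMap.add_apply, hX, hY]
    | tmul a b =>
      rw [TensorProduct.map_tmul, twAct_tmul]
      generalize comulMap f h' = Y
      induction Y with
      | zero => simp
      | add X Y hX hY => simp only [map_add, mul_add, hX, hY]
      | tmul c d => simp [M.act_mul, N.act_mul]

lemma one_twAct (hε : ∀ h, ε (f h) = Coalgebra.counit (R := k) h) (h : H) :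
    twAct M N f (1 ⊗ₜ 1) h = Coalgebra.counit (R := k) h • (1 ⊗ₜ[k] 1) := by
  have h1 : ∀ X : H ⊗[k] H, TensorProduct.map (M.act 1) (N.act 1)
      (Algebra.TensorProduct.map f f X) = Coalgebra.counit (R := k) (TensorProduct.lid k H
        ((Coalgebra.counit (R := k) (A := H)).rTensor H X)) • (1 ⊗ₜ[k] 1) := by
    intro X
    induction X with
    | zero => simp
    | add X Y hX hY => simp only [map_add, hX, hY, add_smul]
    | tmul a b =>
      rw [Algebra.TensorProduct.map_tmul, TensorProduct.map_tmul, M.one_act, N.one_act, hε, hε,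
        Algebra.algebraMap_eq_smul_one, Algebra.algebraMap_eq_smul_one,
        TensorProduct.smul_tmul_smul]
      simp
  refine (h1 (Coalgebra.comul (R := k) h)).trans ?_
  rw [Coalgebra.rTensor_counit_comul]
  simp

/-- `a ⊗ b ↦ 1 ⊗ b ⊗ a ⊗ 1` -/
def midFlip : D ⊗[k] D →ₐ[k] (D ⊗[k] D) ⊗[k] (D ⊗[k] D) :=
  (Algebra.TensorProduct.map Algebra.TensorProduct.includeRight
    Algebra.TensorProduct.includeLeft).comp (Algebra.TensorProduct.comm k D D).toAlgHom

@[simp] lemma midFlip_tmul (a b : D) :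
    midFlip (k := k) (a ⊗ₜ[k] b) = ((1 : D) ⊗ₜ[k] b) ⊗ₜ[k] (a ⊗ₜ[k] (1 : D)) := rfl

/-- `f` followed by the embedding of a leg -/
def lam : Fin 4 → (H →ₐ[k] (D ⊗[k] D) ⊗[k] (D ⊗[k] D))
  | 0 => (Algebra.TensorProduct.includeLeft.comp Algebra.TensorProduct.includeLeft).comp f
  | 1 => (Algebra.TensorProduct.includeLeft.comp Algebra.TensorProduct.includeRight).comp f
  | 2 => (Algebra.TensorProduct.includeRight.comp Algebra.TensorProduct.includeLeft).comp f
  | 3 => (Algebra.TensorProduct.includeRight.comp Algebra.TensorProduct.includeRight).comp f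

lemma lam_apply (x : H) : lam f 0 x = (f x ⊗ₜ[k] (1 : D)) ⊗ₜ[k] ((1 : D) ⊗ₜ[k] (1 : D)) ∧
    lam f 1 x = ((1 : D) ⊗ₜ[k] f x) ⊗ₜ[k] ((1 : D) ⊗ₜ[k] (1 : D)) ∧
    lam f 2 x = ((1 : D) ⊗ₜ[k] (1 : D)) ⊗ₜ[k] (f x ⊗ₜ[k] (1 : D)) ∧
    lam f 3 x = ((1 : D) ⊗ₜ[k] (1 : D)) ⊗ₜ[k] ((1 : D) ⊗ₜ[k] f x) := ⟨rfl, rfl, rfl, rfl⟩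

lemma midFlip_slide {χ : D ⊗[k] D} (hf : ∀ h, comulMap f h * χ =
      χ * Algebra.TensorProduct.map f f (TensorProduct.comm k H H (Coalgebra.comul (R := k) h))) :
    Slide (midFlip (k := k) χ) (conv4 (lam f) 0 1 2 3) (conv4 (lam f) 0 2 1 3) := by
  have h21 : ∀ x, convAt (lam f) 2 1 x = midFlip (comulMap f x) := by
    intro x
    rw [convAt, conv_apply, comulMap, AlgHom.comp_apply, Bialgebra.comulAlgHom_apply]
    generalize Coalgebra.comul (R := k) x = X
    induction X with
    | zero => simp
    | add X Y hX hY => rw [leg_add, hX, hY, map_add, map_add]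
    | tmul a b => simp [lam_apply]
  have h12 : ∀ x, convAt (lam f) 1 2 x = midFlip (Algebra.TensorProduct.map f f
      (TensorProduct.comm k H H (Coalgebra.comul (R := k) x))) := by
    intro x
    rw [convAt, conv_apply]
    generalize Coalgebra.comul (R := k) x = X
    induction X with
    | zero => simp
    | add X Y hX hY => rw [leg_add, hX, hY, map_add, map_add, map_add]
    | tmul a b => simp [lam_apply]
  have hc : ∀ (X : D ⊗[k] D) (x : H), Commute (midFlip (k := k) X) (lam f 0 x) ∧
      Commute (midFlip (k := k) X) (lam f 3 x) := by
    intro X x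
    induction X with
    | zero => simp
    | add X Y hX hY => rw [map_add]; exact ⟨hX.1.add_left hY.1, hX.2.add_left hY.2⟩
    | tmul a b => simp [lam_apply, Commute, SemiconjBy]
  refine slide_conv4_m (fun x => ?_) (fun x => (hc χ x).1) (fun x => (hc χ x).2)
  rw [h21, h12, ← map_mul, ← map_mul, hf]

variable (M N) in
/-- `∑ (m · W₁)(m' · W₂) ⊗ (n · W₃)(n' · W₄)` -/
def ev4 (m m' : M.carrier) (n n' : N.carrier) :
    (D ⊗[k] D) ⊗[k] (D ⊗[k] D) →ₗ[k] M.carrier ⊗[k] N.carrier :=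
  TensorProduct.map (M.ev2 m m') (N.ev2 n n')

lemma twAct_mul_left (X : D ⊗[k] D) (m m' : M.carrier) (n n' : N.carrier) (h : H) :
    twAct M N f (twCore M N X m n m' n') h = ev4 M N m m' n n' (midFlip X *
      Algebra.TensorProduct.map δ δ (comulMap f h)) := by
  induction X with
  | zero => simp
  | add X Y hX hY => simp only [twCore_add, map_add, LinearMap.add_apply, add_mul, hX, hY]
  | tmul a b =>
    rw [twCore_tmul, twAct_tmul]
    generalize comulMap f h = Y
    induction Y with
    | zero => simp
    | add X Y hX hY => simp only [map_add, mul_add, hX, hY]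
    | tmul c d =>
      have e1 := M.ev2_mul m m' 1 b (δ c)
      have e2 := N.ev2_mul n n' a 1 (δ d)
      rw [M.act_one] at e1
      rw [N.act_one] at e2
      simp [ev4, mul_act', e1, e2]

lemma twAct_mul_right (X U V : D ⊗[k] D) (m m' : M.carrier) (n n' : N.carrier) :
    twMul M N X (TensorProduct.map (M.act m) (N.act n) U)
      (TensorProduct.map (M.act m') (N.act n') V) =
    ev4 M N m m' n n' (Algebra.TensorProduct.tensorTensorTensorComm k k k k D D D D (U ⊗ₜ[k] V) *
      midFlip X) := by
  induction U with
  | zero => simp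
  | add U U' hX hY =>
    simp only [map_add, LinearMap.add_apply, TensorProduct.add_tmul, add_mul, hX, hY]
  | tmul a b =>
  induction V with
  | zero => simp
  | add U U' hX hY => simp only [map_add, TensorProduct.tmul_add, add_mul, hX, hY]
  | tmul c d =>
  rw [TensorProduct.map_tmul, TensorProduct.map_tmul, twMul_tmul]
  induction X with
  | zero => simp
  | add X Y hX hY => simp only [twCore_add, map_add, mul_add, hX, hY]
  | tmul p q => simp [ev4, ← M.act_mul, ← N.act_mul]

lemma map_comulMap (hδ : ∀ h, δ (f h) = comulMap f h) (h : H) :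
    Algebra.TensorProduct.map δ δ (comulMap f h) = conv4 (lam f) 0 1 2 3 h := by
  have e1 : ∀ x, (comulMap f x) ⊗ₜ[k] (1 : D ⊗[k] D) = convAt (lam f) 0 1 x := by
    intro x
    rw [convAt, conv_apply, comulMap, AlgHom.comp_apply, Bialgebra.comulAlgHom_apply]
    generalize Coalgebra.comul (R := k) x = X
    induction X with
    | zero => simp
    | add X Y hX hY => rw [leg_add, map_add, TensorProduct.add_tmul, hX, hY]
    | tmul a b => simp [lam_apply, Algebra.TensorProduct.one_def]
  have e2 : ∀ x, (1 : D ⊗[k] D) ⊗ₜ[k] (comulMap f x) = convAt (lam f) 2 3 x := by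
    intro x
    rw [convAt, conv_apply, comulMap, AlgHom.comp_apply, Bialgebra.comulAlgHom_apply]
    generalize Coalgebra.comul (R := k) x = X
    induction X with
    | zero => simp
    | add X Y hX hY => rw [leg_add, map_add, TensorProduct.tmul_add, hX, hY]
    | tmul a b => simp [lam_apply, Algebra.TensorProduct.one_def]
  rw [conv4, conv_apply, comulMap, AlgHom.comp_apply, Bialgebra.comulAlgHom_apply]
  generalize Coalgebra.comul (R := k) h = X
  induction X with
  | zero => simp
  | add X Y hX hY => rw [leg_add, map_add, map_add, hX, hY]
  | tmul a b => rw [leg_tmul, ← e1, ← e2]; simp [hδ]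

lemma shuffle_comulMap (X : H ⊗[k] H) :
    Algebra.TensorProduct.tensorTensorTensorComm k k k k D D D D
      (Algebra.TensorProduct.map (comulMap f) (comulMap f) X) =
      leg X (convAt (lam f) 0 2) (convAt (lam f) 1 3) := by
  have e1 : ∀ x, Algebra.TensorProduct.tensorTensorTensorComm k k k k D D D D
      ((comulMap f x) ⊗ₜ[k] (1 : D ⊗[k] D)) = convAt (lam f) 0 2 x := by
    intro x
    rw [convAt, conv_apply, comulMap, AlgHom.comp_apply, Bialgebra.comulAlgHom_apply]
    generalize Coalgebra.comul (R := k) x = X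
    induction X with
    | zero => simp
    | add X Y hX hY => rw [leg_add, map_add, TensorProduct.add_tmul, map_add, hX, hY]
    | tmul a b => simp [lam_apply, Algebra.TensorProduct.one_def]
  have e2 : ∀ x, Algebra.TensorProduct.tensorTensorTensorComm k k k k D D D D
      ((1 : D ⊗[k] D) ⊗ₜ[k] (comulMap f x)) = convAt (lam f) 1 3 x := by
    intro x
    rw [convAt, conv_apply, comulMap, AlgHom.comp_apply, Bialgebra.comulAlgHom_apply]
    generalize Coalgebra.comul (R := k) x = X
    induction X with
    | zero => simp
    | add X Y hX hY => rw [leg_add, map_add, TensorProduct.tmul_add, map_add, hX, hY]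
    | tmul a b => simp [lam_apply, Algebra.TensorProduct.one_def]
  induction X with
  | zero => simp
  | add X Y hX hY => rw [leg_add, map_add, map_add, hX, hY]
  | tmul a b => rw [leg_tmul, ← e1, ← e2, ← map_mul]; simp

/-- The twisted tensor product of two `D`-module-algebras by a bicharacter `χ`, as a module-algebra
over a Hopf algebra `H` that acts through `f : H → D`: the product is
`(m ⊗ n)(m' ⊗ n') = ∑ m (m' · χ₂) ⊗ (n · χ₁) n'` and the action is
`(m ⊗ n) · h = ∑ m · f(h₁) ⊗ n · f(h₂)`. -/
def twTensor (M N : ModAlg.{u, v, w} δ ε) {χ : D ⊗[k] D} (hχ : IsBichar δ ε χ)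
    (hδ : ∀ h, δ (f h) = comulMap f h) (hε : ∀ h, ε (f h) = Coalgebra.counit (R := k) h)
    (hf : ∀ h, comulMap f h * χ =
      χ * Algebra.TensorProduct.map f f (TensorProduct.comm k H H (Coalgebra.comul (R := k) h))) :
    ModAlg.{u, v, w} (Bialgebra.comulAlgHom k H) (Bialgebra.counitAlgHom k H) :=
  ofBilinear _ _ (M.carrier ⊗[k] N.carrier) (twMul M N χ) (1 ⊗ₜ 1) (twMul_assoc hχ)
    (twMul_one_left hχ) (twMul_one_right hχ) (twAct M N f) (twAct_one f) (twAct_mul f)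
    (one_twAct f hε)
    (fun x y h => by
      induction x with
      | zero => simp
      | add x x' hx hx' =>
        simp only [map_add, LinearMap.add_apply, hx, hx', TensorProduct.map_add_left]
      | tmul m n =>
      induction y with
      | zero => simp
      | add x x' hx hx' =>
        simp only [map_add, LinearMap.add_apply, hx, hx', TensorProduct.map_add_right]
      | tmul m' n' =>
      rw [twMul_tmul, twAct_mul_left, map_comulMap f hδ, midFlip_slide f hf, conv4_eq]
      have h1 : conv (lam f 0).toLinearMap (conv (convAt (lam f) 2 1) (lam f 3).toLinearMap) =
          conv4 (lam f) 0 2 1 3 := by rw [conv4_eq]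
      rw [h1, conv4, conv_apply, ← shuffle_comulMap, Bialgebra.comulAlgHom_apply]
      generalize Coalgebra.comul (R := k) h = X
      induction X with
      | zero => simp
      | add X Y hX hY => simp only [map_add, add_mul, hX, hY]
      | tmul a b =>
        rw [TensorProduct.map_tmul, TensorProduct.lift.tmul, twAct_tmul, twAct_tmul,
          twAct_mul_right]
        rfl)

end action
end ModAlg
end TwistedTensor

section GraphAlgebras

variable {k : Type u} [Field k]

namespace ModAlg

section
variable {D : Type v} [Ring D] [Algebra k D] {δ : D →ₐ[k] D ⊗[k] D} {ε : D →ₐ[k] k}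
variable {H : Type v} [Ring H] [HopfAlgebra k H] (f : H →ₐ[k] D)

/-- Restriction of the action along a morphism compatible with coproducts and counits. -/
def restrict (A : ModAlg.{u, v, w} δ ε) (hδ : ∀ h, δ (f h) = comulMap f h)
    (hε : ∀ h, ε (f h) = Coalgebra.counit (R := k) h) :
    ModAlg.{u, v, w} (Bialgebra.comulAlgHom k H) (Bialgebra.counitAlgHom k H) where
  carrier := A.carrier
  act := (LinearMap.lcomp k A.carrier f.toLinearMap) ∘ₗ A.act
  act_one x := by simp [A.act_one]
  act_mul x d e := by simp [A.act_mul]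
  one_act d := by simp [A.one_act, hε]
  mul_act x y d := by
    change A.act (x * y) (f d) = _
    rw [A.mul_act, hδ]
    change LinearMap.mul' k A.carrier (TensorProduct.map (A.act x) (A.act y)
      (Algebra.TensorProduct.map f f (Coalgebra.comul (R := k) d))) = _
    rw [Bialgebra.comulAlgHom_apply]
    generalize Coalgebra.comul (R := k) d = X
    induction X with
    | zero => simp
    | add X Y hX hY => simp only [map_add, hX, hY]
    | tmul a b => simp

variable {f} {M N : ModAlg.{u, v, w} δ ε} {χ : D ⊗[k] D} (hχ : IsBichar δ ε χ)
    (hδ : ∀ h, δ (f h) = comulMap f h) (hε : ∀ h, ε (f h) = Coalgebra.counit (R := k) h)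
    (hf : ∀ h, comulMap f h * χ =
      χ * Algebra.TensorProduct.map f f (TensorProduct.comm k H H (Coalgebra.comul (R := k) h)))

/-- The embedding `m ↦ m ⊗ 1`. -/
def inl : M.carrier →ₐ[k] (twTensor f M N hχ hδ hε hf).carrier :=
  AlgHom.ofLinearMap ((TensorProduct.mk k M.carrier N.carrier).flip 1 :) rfl (fun x y => by
    change _ = twMul M N χ (x ⊗ₜ 1) (y ⊗ₜ 1)
    have : ∀ X : D ⊗[k] D, twCore M N X x 1 y 1 = (x * M.act y (Algebra.TensorProduct.lid k D
      (Algebra.TensorProduct.map ε (AlgHom.id k D) X))) ⊗ₜ[k] 1 := by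
      intro X
      induction X with
      | zero => simp
      | add X Y hX hY =>
        rw [twCore_add, hX, hY, map_add, map_add, map_add, mul_add, TensorProduct.add_tmul]
      | tmul a b =>
        simp [N.one_act, Algebra.algebraMap_eq_smul_one, TensorProduct.smul_tmul]
    rw [twMul_tmul, this, hχ.counit_left, M.act_one]
    rfl)

/-- The embedding `n ↦ 1 ⊗ n`. -/
def inr : N.carrier →ₐ[k] (twTensor f M N hχ hδ hε hf).carrier :=
  AlgHom.ofLinearMap (TensorProduct.mk k M.carrier N.carrier 1 :) rfl (fun x y => by
    change _ = twMul M N χ (1 ⊗ₜ x) (1 ⊗ₜ y)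
    have : ∀ X : D ⊗[k] D, twCore M N X 1 x 1 y = 1 ⊗ₜ[k] (N.act x (Algebra.TensorProduct.rid k k D
      (Algebra.TensorProduct.map (AlgHom.id k D) ε X)) * y) := by
      intro X
      induction X with
      | zero => simp
      | add X Y hX hY =>
        rw [twCore_add, hX, hY, map_add, map_add, map_add, add_mul, TensorProduct.tmul_add]
      | tmul a b =>
        simp [M.one_act, Algebra.algebraMap_eq_smul_one, TensorProduct.smul_tmul]
    rw [twMul_tmul, this, hχ.counit_right, N.act_one]
    rfl)

end

end ModAlg

variable (k) (H : Type v) [Ring H] [HopfAlgebra k H]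

/-- Right `H`-module-algebras. -/
abbrev HModAlg := ModAlg.{u, v, max u v} (Bialgebra.comulAlgHom k H) (Bialgebra.counitAlgHom k H)

/-- The trivial `H`-module-algebra `k`. -/
def HModAlg.unit : HModAlg k H where
  carrier := ULift.{v} k
  act := LinearMap.mk₂ k (fun x d => Coalgebra.counit (R := k) d • x)
    (by simp) (by simp [smul_smul, mul_comm]) (by simp [add_smul]) (by simp [mul_smul])
  act_one x := by simp
  act_mul x d e := by simp [smul_smul]
  one_act d := by simp [Algebra.algebraMap_eq_smul_one]
  mul_act x y d := by
    have h1 : ∀ X : H ⊗[k] H, LinearMap.mul' k (ULift.{v} k) (TensorProduct.map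
        (LinearMap.mk₂ k (fun x d => Coalgebra.counit (R := k) d • x)
          (by simp) (by simp [smul_smul, mul_comm]) (by simp [add_smul])
          (by simp [mul_smul]) x)
        (LinearMap.mk₂ k (fun x d => Coalgebra.counit (R := k) d • x)
          (by simp) (by simp [smul_smul, mul_comm]) (by simp [add_smul])
          (by simp [mul_smul]) y) X) = Coalgebra.counit (R := k) (TensorProduct.lid k H
        ((Coalgebra.counit (R := k) (A := H)).rTensor H X)) • (x * y) := by
      intro X
      induction X with
      | zero => simp
      | add X Y hX hY => simp only [map_add, hX, hY, add_smul]
      | tmul a b => simp [smul_smul, mul_comm]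
    refine Eq.trans ?_ (h1 (Coalgebra.comul (R := k) d)).symm
    rw [Coalgebra.rTensor_counit_comul]
    simp

variable {k H} (Q : RMatrix k H)

namespace RMatrix

/-- The Drinfeld element `u = ∑ S(R₂) R₁`. -/
def drinfeld : H :=
  LinearMap.mul' k H (TensorProduct.map (HopfAlgebra.antipode k) LinearMap.id Q.R')

/-- The loop algebra `L_{0,1}`: the twist of `H°` by `F`, with the right action of `H` obtained from
that of `H ⊗ H` along `Δ`. Explicitly `φ · h = ∑ S(h₂) ▷ φ ◁ h₁`. -/
def L01A : ModAlg.{u, v, max u v} Q.comulF (counitHH k H) := (dualModAlg k H).twist Q.isTwist_F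

lemma counitHH_comul (h : H) :
    counitHH k H (Bialgebra.comulAlgHom k H h) = Coalgebra.counit (R := k) h := by
  have h1 : ∀ X : H ⊗[k] H, counitHH k H X = Coalgebra.counit (R := k) (TensorProduct.lid k H
        ((Coalgebra.counit (R := k) (A := H)).rTensor H X)) := by
    intro X
    induction X with
    | zero => simp
    | add X Y hX hY => simp only [map_add, hX, hY]
    | tmul a b => simp
  refine (h1 (Coalgebra.comul (R := k) h)).trans ?_
  rw [Coalgebra.rTensor_counit_comul]
  simp

/-- `L_{0,1}` as a right `H`-module-algebra. -/
def L01 : HModAlg k H :=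
  Q.L01A.restrict (Bialgebra.comulAlgHom k H) Q.comulF_comul counitHH_comul

/-- The handle algebra `L_{1,0}`: the space `L_{0,1} ⊗ L_{0,1}` with the product
`(β ⊗ α)(β' ⊗ α') = ∑ β (β' · γ₂) ⊗ (α · γ₁) α'`. -/
def L10 : HModAlg k H :=
  ModAlg.twTensor (Bialgebra.comulAlgHom k H) Q.L01A Q.L01A Q.isBichar_gam Q.comulF_comul
    counitHH_comul Q.comul_mul_gam

lemma map_id_id (X : H ⊗[k] H) :
    Algebra.TensorProduct.map (AlgHom.id k H) (AlgHom.id k H) X = X := by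
  rw [Algebra.TensorProduct.map_id]; rfl

/-- The braided tensor product of two right `H`-module-algebras:
`(m ⊗ n)(m' ⊗ n') = ∑ m (m' · R₁) ⊗ (n · R₂) n'`, `(m ⊗ n) · h = ∑ m · h₁ ⊗ n · h₂`. -/
def braided (M N : HModAlg k H) : HModAlg k H :=
  ModAlg.twTensor (AlgHom.id k H) M N Q.isBichar_R' (fun _ => (map_id_id _).symm) (fun _ => rfl)
    (fun h => by
      rw [map_id_id, ModAlg.comulMap, AlgHom.comp_apply, map_id_id]
      exact Q.comul_mul_R' h)

/-- The embedding `m ↦ m ⊗ 1` in a braided tensor product. -/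
def braidedInl (M N : HModAlg k H) : M.carrier →ₐ[k] (Q.braided M N).carrier :=
  ModAlg.inl _ _ _ _

/-- The embedding `n ↦ 1 ⊗ n` in a braided tensor product. -/
def braidedInr (M N : HModAlg k H) : N.carrier →ₐ[k] (Q.braided M N).carrier :=
  ModAlg.inr _ _ _ _

/-- The braided tensor power `A^{⊗ n}`. -/
def braidedPow (A : HModAlg k H) : ℕ → HModAlg k H
  | 0 => HModAlg.unit k H
  | n + 1 => Q.braided (braidedPow A n) A

/-- The graph algebra `L_{g,n}`, the braided tensor product of `g` copies of `L_{1,0}` and `n` copies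
of `L_{0,1}`. -/
def graphAlg (g n : ℕ) : HModAlg k H := Q.braided (Q.braidedPow Q.L10 g) (Q.braidedPow Q.L01 n)

/-- The embedding of the `i`-th factor in a braided tensor power. -/
def powEmb (A : HModAlg k H) : (n : ℕ) → Fin n → (A.carrier →ₐ[k] (Q.braidedPow A n).carrier)
  | 0 => fun i => i.elim0
  | n + 1 => Fin.lastCases (Q.braidedInr (Q.braidedPow A n) A)
      (fun i => (Q.braidedInl (Q.braidedPow A n) A).comp (powEmb A n i))

/-- `β ↦ β ⊗ 1` -/
def iB : Q.L01.carrier →ₐ[k] Q.L10.carrier := ModAlg.inl (M := Q.L01A) (N := Q.L01A) _ _ _ _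

/-- `α ↦ 1 ⊗ α` -/
def iA : Q.L01.carrier →ₐ[k] Q.L10.carrier := ModAlg.inr (M := Q.L01A) (N := Q.L01A) _ _ _ _

section
variable (g n : ℕ)

/-- The embedding of the copy `B(i)` of `L_{0,1}` in `L_{g,n}`. -/
def embB (i : Fin g) : Q.L01.carrier →ₐ[k] (Q.graphAlg g n).carrier :=
  (Q.braidedInl _ _).comp ((Q.powEmb Q.L10 g i).comp Q.iB)

/-- The embedding of the copy `A(i)` of `L_{0,1}` in `L_{g,n}`. -/
def embA (i : Fin g) : Q.L01.carrier →ₐ[k] (Q.graphAlg g n).carrier :=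
  (Q.braidedInl _ _).comp ((Q.powEmb Q.L10 g i).comp Q.iA)

/-- The embedding of the copy `M(g + j)` of `L_{0,1}` in `L_{g,n}`. -/
def embM (j : Fin n) : Q.L01.carrier →ₐ[k] (Q.graphAlg g n).carrier :=
  (Q.braidedInr _ _).comp (Q.powEmb Q.L01 n j)

/-- The matrix `M` of the matrix coefficients of a representation, with entries in `L_{0,1}`. -/
def coeffMatrix {d : ℕ} (ρ : H →ₐ[k] Matrix (Fin d) (Fin d) k) :
    Matrix (Fin d) (Fin d) Q.L01.carrier :=
  Matrix.of fun i j => (⟨matrixCoeff ρ i j, matrixCoeff_mem ρ i j⟩ : restrictedDual k H)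

/-- The matrix `B(i)`. -/
def matB {d : ℕ} (ρ : H →ₐ[k] Matrix (Fin d) (Fin d) k) (i : Fin g) :
    Matrix (Fin d) (Fin d) (Q.graphAlg g n).carrier := (Q.coeffMatrix ρ).map (Q.embB g n i)

/-- The matrix `A(i)`. -/
def matA {d : ℕ} (ρ : H →ₐ[k] Matrix (Fin d) (Fin d) k) (i : Fin g) :
    Matrix (Fin d) (Fin d) (Q.graphAlg g n).carrier := (Q.coeffMatrix ρ).map (Q.embA g n i)

/-- The matrix `M(g + j)`. -/
def matM {d : ℕ} (ρ : H →ₐ[k] Matrix (Fin d) (Fin d) k) (j : Fin n) :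
    Matrix (Fin d) (Fin d) (Q.graphAlg g n).carrier := (Q.coeffMatrix ρ).map (Q.embM g n j)

/-- The matrix `C = ∏ᵢ v² B(i) A(i)⁻¹ B(i)⁻¹ A(i) ∏ⱼ M(g + j)` (products in increasing order). -/
def boundaryMatrix (v : H) {d : ℕ} (ρ : H →ₐ[k] Matrix (Fin d) (Fin d) k) :
    Matrix (Fin d) (Fin d) (Q.graphAlg g n).carrier :=
  (List.ofFn fun i : Fin g =>
      (ρ (v ^ 2)).map (algebraMap k (Q.graphAlg g n).carrier) * Q.matB g n ρ i *
        Ring.inverse (Q.matA g n ρ i) * Ring.inverse (Q.matB g n ρ i) * Q.matA g n ρ i).prod *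
    (List.ofFn fun j : Fin n => Q.matM g n ρ j).prod

end

/-! The morphism `Φ_{0,1}`. -/

/-- `φ ↦ (φ ⊗ id)(X)` -/
def applyLeft (X : H ⊗[k] H) : restrictedDual k H →ₗ[k] H where
  toFun φ := TensorProduct.lid k H (φ.1.ofConv.rTensor H X)
  map_add' φ ψ := by
    change TensorProduct.lid k H ((φ.1.ofConv + ψ.1.ofConv).rTensor H X) = _
    rw [LinearMap.rTensor_add]; simp
  map_smul' c φ := by
    change TensorProduct.lid k H ((c • φ.1.ofConv).rTensor H X) = _
    rw [LinearMap.rTensor_smul]; simp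

/-- `φ ⊗ ψ ⊗ id` -/
def apply3 (φ ψ : restrictedDual k H) : H ⊗[k] (H ⊗[k] H) →ₗ[k] H :=
  (TensorProduct.lid k H).toLinearMap ∘ₗ
    TensorProduct.map φ.1.ofConv ((TensorProduct.lid k H).toLinearMap ∘ₗ ψ.1.ofConv.rTensor H)

lemma apply3_tmul (φ ψ : restrictedDual k H) (a b c : H) :
    apply3 φ ψ (a ⊗ₜ[k] (b ⊗ₜ[k] c)) = φ.1.ofConv a • ψ.1.ofConv b • c := by
  simp [apply3, smul_smul, mul_comm]

lemma apply3_mul (φ ψ : restrictedDual k H) (X Y : H ⊗[k] H) :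
    apply3 φ ψ (mapM X * mapR Y) = applyLeft X φ * applyLeft Y ψ := by
  induction X with
  | zero => simp [applyLeft]
  | add X X' h h' =>
    have : ∀ X X' : H ⊗[k] H, applyLeft (X + X') φ = applyLeft X φ + applyLeft X' φ := by
      intro X X'; simp [applyLeft]
    rw [map_add, add_mul, map_add, h, h', this, add_mul]
  | tmul a b =>
  induction Y with
  | zero => simp [applyLeft]
  | add X X' h h' =>
    have : ∀ X X' : H ⊗[k] H, applyLeft (X + X') ψ = applyLeft X ψ + applyLeft X' ψ := by
      intro X X'; simp [applyLeft]
    rw [map_add, mul_add, map_add, h, h', this, mul_add]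
  | tmul c d => simp [mapM, mapR, apply3_tmul, applyLeft, smul_smul, mul_comm]

/-- `∑ f(X₁) W g(S(X₂))` -/
def sand {E : Type*} [Ring E] [Algebra k E] (f g : H →ₐ[k] E) (W : E) : H ⊗[k] H →ₗ[k] E :=
  LinearMap.mul' k E ∘ₗ TensorProduct.map (LinearMap.mulRight k W ∘ₗ f.toLinearMap)
    (g.toLinearMap ∘ₗ HopfAlgebra.antipode k)

lemma sand_tmul {E : Type*} [Ring E] [Algebra k E] (f g : H →ₐ[k] E) (W : E) (a b : H) :
    sand f g W (a ⊗ₜ[k] b) = f a * W * g (HopfAlgebra.antipode k b) := by simp [sand]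

lemma sand_add {E : Type*} [Ring E] [Algebra k E] (f g : H →ₐ[k] E) (W W' : E) (X : H ⊗[k] H) :
    sand f g (W + W') X = sand f g W X + sand f g W' X := by
  induction X with
  | zero => simp
  | add X Y hX hY => rw [map_add, map_add, map_add, hX, hY]; abel
  | tmul a b => simp [sand_tmul, mul_add, add_mul]

lemma sand_mul {E : Type*} [Ring E] [Algebra k E] (f g : H →ₐ[k] E) (A W B : E) (X : H ⊗[k] H)
    (hA : ∀ x, Commute A (f x)) (hB : ∀ x, Commute B (g x)) :
    sand f g (A * W * B) X = A * sand f g W X * B := by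
  induction X with
  | zero => simp
  | add X Y hX hY => rw [map_add, map_add, hX, hY, mul_add, add_mul]
  | tmul a b =>
    rw [sand_tmul, sand_tmul]
    calc f a * (A * W * B) * g (HopfAlgebra.antipode k b)
        = (f a * A) * W * (B * g (HopfAlgebra.antipode k b)) := by simp only [mul_assoc]
      _ = _ := by rw [← (hA a).eq, (hB _).eq]; simp only [mul_assoc]

lemma applyLeft_add (U V : H ⊗[k] H) (φ : restrictedDual k H) :
    applyLeft (U + V) φ = applyLeft U φ + applyLeft V φ := by simp [applyLeft]

/-- `(x₁ ⊗ y₁) ⊗ (x₂ ⊗ y₂) ↦ (φ · (x₁ ⊗ y₁)) ⋆ (ψ · (x₂ ⊗ y₂))` -/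
def dualEv2 (φ ψ : restrictedDual k H) : (H ⊗[k] H) ⊗[k] (H ⊗[k] H) →ₗ[k] restrictedDual k H :=
  LinearMap.mul' k (restrictedDual k H) ∘ₗ TensorProduct.map (dualAct φ) (dualAct ψ)

lemma applyLeft_ev2 (φ ψ : restrictedDual k H) (X Y U : H ⊗[k] H) :
    applyLeft U (dualEv2 φ ψ
      (leg X (leg4 k H 2).toLinearMap (leg4 k H 1).toLinearMap *
        leg Y (leg4 k H 3).toLinearMap (leg4 k H 1).toLinearMap)) =
    apply3 φ ψ (sand (leg3' k H 1) (leg3' k H 0) (comL (Bialgebra.comulAlgHom k H) U *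
      leg Y ((leg3' k H 1).toLinearMap ∘ₗ HopfAlgebra.antipode k)
        ((leg3' k H 0).toLinearMap ∘ₗ HopfAlgebra.antipode k)) X) := by
  induction X with
  | zero => rw [leg_zero, zero_mul, map_zero, map_zero, map_zero, map_zero]
  | add X X' h h' => rw [leg_add, add_mul, map_add, map_add, h, h', map_add, map_add]
  | tmul a b =>
  induction Y with
  | zero =>
    rw [leg_zero, leg_zero, mul_zero, mul_zero, map_zero, map_zero, sand_tmul, mul_zero, zero_mul,
      map_zero]
  | add X X' h h' => rw [leg_add, mul_add, map_add, map_add, h, h', leg_add, mul_add, sand_add,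
      map_add]
  | tmul c d =>
  induction U with
  | zero =>
    rw [map_zero, zero_mul, sand_tmul, mul_zero, zero_mul, map_zero]
    simp [applyLeft]
  | add X X' h h' => rw [applyLeft_add, h, h', map_add, add_mul, sand_add, map_add]
  | tmul p q =>
  have e1 : leg (a ⊗ₜ[k] b) (leg4 k H 2).toLinearMap (leg4 k H 1).toLinearMap *
        leg (c ⊗ₜ[k] d) (leg4 k H 3).toLinearMap (leg4 k H 1).toLinearMap =
      ((1 : H) ⊗ₜ[k] (b * d)) ⊗ₜ[k] (a ⊗ₜ[k] c) := by simp [leg4]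
  rw [e1]
  change LinearMap.mul' k k (TensorProduct.map (φ.1.ofConv ∘ₗ sandwich ((1 : H) ⊗ₜ[k] (b * d)))
    (ψ.1.ofConv ∘ₗ sandwich (a ⊗ₜ[k] c)) (Coalgebra.comul (R := k) p)) • q = _
  have e2 : comL (Bialgebra.comulAlgHom k H) (p ⊗ₜ[k] q) =
    TensorProduct.assoc k H H H (Coalgebra.comul (R := k) p ⊗ₜ[k] q) := rfl
  rw [e2]
  generalize Coalgebra.comul (R := k) p = Z
  induction Z with
  | zero =>
    rw [TensorProduct.zero_tmul, map_zero, map_zero, map_zero, zero_smul, zero_mul, sand_tmul,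
      mul_zero, zero_mul, map_zero]
  | add X X' h h' =>
    rw [map_add, map_add, add_smul, h, h', TensorProduct.add_tmul, map_add, add_mul, sand_add,
      map_add]
  | tmul r s =>
    rw [sand_tmul, leg_tmul]
    simp only [LinearMap.comp_apply, AlgHom.toLinearMap_apply, leg3', AlgHom.comp_apply,
      Algebra.TensorProduct.includeLeft_apply, Algebra.TensorProduct.includeRight_apply,
      TensorProduct.assoc_tmul, Algebra.TensorProduct.tmul_mul_tmul, one_mul, mul_one,
      apply3_tmul, TensorProduct.map_tmul, LinearMap.mul'_apply, sandwich_tmul,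
      HopfAlgebra.antipode_mul_antidistrib, mul_smul, mul_assoc]

lemma word_phi {M : Type*} [Monoid M] {r02 r12 r21 r20 r10 : M}
    (y1 : r21 * r20 * r10 = r10 * r20 * r21) (y2 : r12 * r10 * r20 = r20 * r10 * r12) :
    r02 * r12 * (r21 * r20) * r10 = r02 * r20 * r10 * (r12 * r21) := by
  calc r02 * r12 * (r21 * r20) * r10 = r02 * r12 * (r21 * r20 * r10) := by simp only [mul_assoc]
    _ = r02 * (r12 * r10 * r20) * r21 := by rw [y1]; simp only [mul_assoc]
    _ = _ := by rw [y2]; simp only [mul_assoc]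

lemma sand_R {E : Type*} [Ring E] [Algebra k E] (f g : H →ₐ[k] E) :
    sand f g (leg Q.R f.toLinearMap g.toLinearMap) Q.R = 1 := by
  -- `∑ a_p a_q ⊗ b_q S(b_p) = 1 ⊗ 1`
  let T : H ⊗[k] (H ⊗[k] H) →ₗ[k] E := leg3 f.toLinearMap g.toLinearMap
    (g.toLinearMap ∘ₗ HopfAlgebra.antipode k)
  have key := congrArg T Q.id_comul_R
  have h1 := id_comul_aux f.toLinearMap g.toLinearMap
    (g.toLinearMap ∘ₗ HopfAlgebra.antipode k) Q.R
  rw [conv_antipode, leg_counit_right] at h1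
  have h2 : ∀ X Y : H ⊗[k] H, T
      (Algebra.TensorProduct.map (AlgHom.id k H) Algebra.TensorProduct.includeRight X *
        Algebra.TensorProduct.map (AlgHom.id k H) Algebra.TensorProduct.includeLeft Y) =
      sand f g (leg Y f.toLinearMap g.toLinearMap) X := by
    intro X Y
    induction X with
    | zero => simp
    | add X Y hX hY => simp only [map_add, hX, hY, add_mul]
    | tmul a b =>
      induction Y with
      | zero => simp [sand_tmul]
      | add X Y hX hY => simp only [map_add, hX, hY, leg_add, mul_add, sand_add]
      | tmul c d => simp [T, leg3, sand_tmul, mul_assoc]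
  rw [h2] at key
  exact key.symm.trans h1

lemma phi_core {T E : Type*} [Ring T] [Algebra k T] [Ring E] [Algebra k E]
    {t : Fin 2 → (H →ₐ[k] T)} {l : Fin 3 → (H →ₐ[k] E)} (hl : Comm l) (mR mM cL : T →ₐ[k] E)
    (r0 : ∀ x, mR (t 0 x) = l 1 x) (r1 : ∀ x, mR (t 1 x) = l 2 x)
    (m0 : ∀ x, mM (t 0 x) = l 0 x) (m1 : ∀ x, mM (t 1 x) = l 2 x)
    (c0 : ∀ x, cL (t 0 x) = convAt l 0 1 x) (c1 : ∀ x, cL (t 1 x) = l 2 x) :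
    sand (l 1) (l 0) (cL (Q.at' t 0 1 * Q.at' t 1 0) *
      leg Q.R ((l 1).toLinearMap ∘ₗ HopfAlgebra.antipode k)
        ((l 0).toLinearMap ∘ₗ HopfAlgebra.antipode k)) Q.R =
      mM (Q.at' t 0 1 * Q.at' t 1 0) * mR (Q.at' t 0 1 * Q.at' t 1 0) := by
  have e : leg Q.R ((l 1).toLinearMap ∘ₗ HopfAlgebra.antipode k)
        ((l 0).toLinearMap ∘ₗ HopfAlgebra.antipode k) = Q.at' l 1 0 :=
    Q.leg_antipode_antipode _ _ (hl 1 0 (by decide))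
  rw [e, map_mul, map_mul, map_mul, Q.map_at_conv_left cL hl c0 c1 (by decide),
    Q.map_at_conv_right cL hl c1 c0 (by decide) (by decide), Q.map_at mR r0 r1, Q.map_at mR r1 r0,
    Q.map_at mM m0 m1, Q.map_at mM m1 m0,
    word_phi (Q.at_yb hl (by decide) (by decide) (by decide))
      (Q.at_yb hl (by decide) (by decide) (by decide)), sand_mul]
  · have hs : sand (l 1) (l 0) (Q.at' l 1 0) Q.R = 1 := Q.sand_R _ _
    rw [hs, mul_one]
  · intro x
    exact (Q.at_comm_leg hl (by decide) (by decide) x).mul_left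
      (Q.at_comm_leg hl (by decide) (by decide) x)
  · intro x
    exact (Q.at_comm_leg hl (by decide) (by decide) x).mul_left
      (Q.at_comm_leg hl (by decide) (by decide) x)

lemma R_eq : Q.R = Q.at' (leg2 k H) 0 1 := by
  rw [at']
  generalize Q.R = X
  induction X with
  | zero => simp
  | add X Y hX hY => rw [leg_add, ← hX, ← hY]
  | tmul a b => simp [leg2]

lemma phi_mul (φ ψ : restrictedDual k H) :
    applyLeft (Q.R * Q.R') (dualEv2 φ ψ Q.F) =
      applyLeft (Q.R * Q.R') φ * applyLeft (Q.R * Q.R') ψ := by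
  have h := applyLeft_ev2 φ ψ Q.R Q.R (Q.R * Q.R')
  refine h.trans ?_
  rw [← apply3_mul]
  congr 1
  have h1 : Q.R * Q.R' = Q.at' (leg2 k H) 0 1 * Q.at' (leg2 k H) 1 0 := by rw [← R_eq, ← R'_eq]
  rw [h1]
  exact Q.phi_core (t := leg2 k H) (l := leg3' k H) leg3'_commute mapR mapM
    (comL (Bialgebra.comulAlgHom k H)) (fun _ => rfl) (fun _ => rfl) (fun _ => rfl) (fun _ => rfl)
    (fun x => (comL_left _ x).trans (mapL_comul x)) (fun x => comL_right _ x)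

lemma phi_one : applyLeft (Q.R * Q.R') (1 : restrictedDual k H) = 1 := by
  let Ψ : H ⊗[k] H →ₐ[k] H := (Algebra.TensorProduct.lid k H).toAlgHom.comp
    (Algebra.TensorProduct.map (Bialgebra.counitAlgHom k H) (AlgHom.id k H))
  have h0 : ∀ X : H ⊗[k] H, applyLeft X (1 : restrictedDual k H) = Ψ X := by
    intro X
    induction X with
    | zero => simp [applyLeft]
    | add X Y hX hY => rw [applyLeft_add, map_add, hX, hY]
    | tmul a b => simp [applyLeft, Ψ]
  have h1 : ∀ x, Ψ (leg2 k H 0 x) = unitCounit (k := k) x := fun x => by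
    simp [Ψ, leg2, unitCounit, Algebra.ofId_apply, Algebra.algebraMap_eq_smul_one]
  rw [h0, map_mul, R'_eq, R_eq, Q.map_at_counit_left Ψ (leg2 k H) 0 1 h1,
    Q.map_at_counit_right Ψ (leg2 k H) 1 0 h1, mul_one]

/-- The algebra morphism `Φ_{0,1} : L_{0,1} → H`, `φ ↦ (φ ⊗ id)(R R')`. -/
def Phi : Q.L01.carrier →ₐ[k] H :=
  AlgHom.ofLinearMap (applyLeft (Q.R * Q.R') :) Q.phi_one Q.phi_mul

end RMatrix

/-- A ribbon structure on a Hopf algebra `H`: a universal `R`-matrix together with a ribbon element,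
that is a central `v ∈ H` such that `v² = u S(u)`, `S(v) = v`, `ε(v) = 1` and
`Δ(v) (R' R) = v ⊗ v`, where `u = ∑ S(R₂) R₁` is the Drinfeld element. -/
structure Ribbon (k : Type u) (H : Type v) [Field k] [Ring H] [HopfAlgebra k H] extends
    RMatrix k H where
  v : H
  central : ∀ h : H, v * h = h * v
  sq_eq : v ^ 2 = toRMatrix.drinfeld * HopfAlgebra.antipode k toRMatrix.drinfeld
  antipode_v : HopfAlgebra.antipode k v = v
  counit_v : Coalgebra.counit (R := k) v = 1
  comul_v : Coalgebra.comul (R := k) v * (toRMatrix.R' * R) = v ⊗ₜ[k] v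

/-- The action `h ▲ x = x · S⁻¹(h)` of `H` on `L_{g,n}`, where `x · h` is the right (diagonal
coadjoint) action; it is a left action. -/
def RMatrix.leftAct {k : Type u} {H : Type v} [Field k] [Ring H] [HopfAlgebra k H]
    (Q : RMatrix k H) (hS : Function.Bijective (HopfAlgebra.antipode k : H →ₗ[k] H)) {g n : ℕ}
    (h : H) (x : (Q.graphAlg g n).carrier) : (Q.graphAlg g n).carrier :=
  (Q.graphAlg g n).act x ((LinearEquiv.ofBijective (HopfAlgebra.antipode k) hS).symm h)

end GraphAlgebras

end GraphAlgebra

end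

/-! The theorem is a statement about families of matrices `X ρ` over L_{g,n}, one for each
finite-dimensional representation ρ of H, and four properties of such a family do all the work:
naturality with respect to intertwiners, the fusion relation (X_ρ ⊗ 1) s (1 ⊗ X_σ) = X_{ρ⊗σ} s with
s the matrix of R' on ρ ⊗ σ, equivariance under H, and the moment equation X_ρ c_ρ(x) = c'_ρ(x) X_ρ
for all x. Here c_ρ(x) = ∑ ρ(R₂)(x · R₁), and c'_ρ is the same expression for R'⁻¹. These properties
form `IsMomentFamily`, and the boundary matrices have them (`isMomentFamily_boundaryFamily`).

From such a family the moment map is obtained as follows. A natural family is the same thing as a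
linear map on H°, since matrix coefficients satisfy no linear relations other than those forced by
intertwiners (`IsNatural.eq_zero`, `IsNatural.exists_linearMap`). The fusion relation says that this
linear map is multiplicative on L_{0,1}, whose product is a twist of the convolution product
(`IsFused.exists_algHom`). Composition with the inverse of Φ on its image gives μ. Expanding Δ in
the two R-matrices of Φ(M) gives Δ(Φ(M)) = R (Φ(M) ⊗ 1) R', with the new copy of H in the outer
factors (`map_coprodMat`), so Δ(H') lies in H' ⊗ H; pairing this expression with x, the quantum
moment map identity becomes the moment equation (`IsMomentFamily.actPairing_coprodMat`).

The boundary family is built from its factors. For an equivariant family the coaction on its entries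
is conjugation by an R-matrix (`coactSnd_mul_sMat`), so the moment equation becomes a relation
between matrices. For a loop algebra it is the reflection equation, a consequence of fusion and
naturality. In a braided tensor product the exchange relation of the factors says that each family
commutes with the appropriate coaction on the other factor, and therefore products of moment
families are moment families (`IsMomentFamily.braided`).

The handle is the essential case. There the family is D A with D = v² B A⁻¹ B⁻¹. The inverses exist
because a fused natural family is invertible by duality (`IsFused.isUnit`). The conjugates B A B⁻¹
satisfy the fusion relation only up to the square of the double braiding, and Δ(v)R'R = v ⊗ v shows
that v² corrects precisely this defect (`word_fusion`). Finally D commutes with the opposite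
coaction on A and carries s B₂ r to the opposite coaction on B, which yields the moment equation on
the generators (`IsHandle.isMomentFamily`). -/

open scoped TensorProduct

noncomputable section

namespace GraphAlgebra

universe u v w

/-! ### Matrices over a noncommutative algebra and their two tensor legs -/

section MatrixLegs

variable {k : Type u} [Field k] {L : Type w} [Ring L] [Algebra k L]
variable {ι κ : Type} [Fintype ι] [DecidableEq ι] [Fintype κ] [DecidableEq κ]

/-- A matrix of scalars as a matrix over `L`. -/
def scalarMat (L : Type w) [Ring L] [Algebra k L] : Matrix ι ι k →ₐ[k] Matrix ι ι L :=
  (Algebra.ofId k L).mapMatrix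

lemma scalarMat_apply (K : Matrix ι ι k) (i j : ι) :
    scalarMat L K i j = algebraMap k L (K i j) := rfl

lemma scalarMat_mul_apply {κ : Type*} (K : Matrix ι ι k) (X : Matrix ι κ L) (i : ι) (j : κ) :
    (scalarMat L K * X) i j = ∑ l, K i l • X l j := by
  simp [Matrix.mul_apply, scalarMat_apply, Algebra.smul_def]

lemma mul_scalarMat_apply {κ : Type*} (X : Matrix κ ι L) (K : Matrix ι ι k) (i : κ) (j : ι) :
    (X * scalarMat L K) i j = ∑ l, K l j • X i l := by
  simp [Matrix.mul_apply, scalarMat_apply, Algebra.smul_def, Algebra.commutes]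

variable (k L ι κ) in
/-- `X ↦ X ⊗ 1` -/
def fstHom : Matrix ι ι L →ₐ[k] Matrix (ι × κ) (ι × κ) L :=
  AlgHom.mk ((Matrix.blockDiagonalRingHom ι κ L).comp (Pi.constRingHom κ (Matrix ι ι L))) (by
    intro c
    ext ⟨i, p⟩ ⟨j, q⟩
    simp [Matrix.blockDiagonal_apply, Matrix.algebraMap_matrix_apply]
    by_cases h : p = q <;> by_cases h' : i = j <;> simp [h, h'])

variable (k L ι κ) in
/-- Exchange of the two tensor factors. -/
def swapHom : Matrix (κ × ι) (κ × ι) L →ₐ[k] Matrix (ι × κ) (ι × κ) L :=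
  (Matrix.reindexAlgEquiv k L (Equiv.prodComm κ ι)).toAlgHom

variable (k L ι κ) in
/-- `X ↦ 1 ⊗ X` -/
def sndHom : Matrix κ κ L →ₐ[k] Matrix (ι × κ) (ι × κ) L :=
  (swapHom k L ι κ).comp (fstHom k L κ ι)

lemma fstHom_apply (X : Matrix ι ι L) (a b : ι × κ) :
    fstHom k L ι κ X a b = if a.2 = b.2 then X a.1 b.1 else 0 := by
  change Matrix.blockDiagonal _ a b = _
  rw [Matrix.blockDiagonal_apply']
  rfl

lemma swapHom_apply (X : Matrix (κ × ι) (κ × ι) L) (a b : ι × κ) :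
    swapHom k L ι κ X a b = X a.swap b.swap := rfl

lemma sndHom_apply (X : Matrix κ κ L) (a b : ι × κ) :
    sndHom k L ι κ X a b = if a.1 = b.1 then X a.2 b.2 else 0 := by
  change swapHom k L ι κ (fstHom k L κ ι X) a b = _
  rw [swapHom_apply, fstHom_apply]
  rfl

lemma swapHom_fstHom (X : Matrix κ κ L) :
    swapHom k L ι κ (fstHom k L κ ι X) = sndHom k L ι κ X := rfl

lemma swapHom_sndHom (X : Matrix ι ι L) :
    swapHom k L ι κ (sndHom k L κ ι X) = fstHom k L ι κ X := by
  ext a b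
  rw [swapHom_apply, sndHom_apply, fstHom_apply]
  rfl

lemma fstHom_mul_apply {μ : Type*} (X : Matrix ι ι L) (Z : Matrix (ι × κ) μ L) (a : ι × κ) (b : μ) :
    (fstHom k L ι κ X * Z) a b = ∑ l, X a.1 l * Z (l, a.2) b := by
  simp [Matrix.mul_apply, fstHom_apply, Fintype.sum_prod_type]

lemma mul_fstHom_apply {μ : Type*} (X : Matrix ι ι L) (Z : Matrix μ (ι × κ) L) (a : μ) (b : ι × κ) :
    (Z * fstHom k L ι κ X) a b = ∑ l, Z a (l, b.2) * X l b.1 := by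
  simp [Matrix.mul_apply, fstHom_apply, Fintype.sum_prod_type]

lemma sndHom_mul_apply {μ : Type*} (X : Matrix κ κ L) (Z : Matrix (ι × κ) μ L) (a : ι × κ) (b : μ) :
    (sndHom k L ι κ X * Z) a b = ∑ l, X a.2 l * Z (a.1, l) b := by
  simp [Matrix.mul_apply, sndHom_apply, Fintype.sum_prod_type]

lemma mul_sndHom_apply {μ : Type*} (X : Matrix κ κ L) (Z : Matrix μ (ι × κ) L) (a : μ) (b : ι × κ) :
    (Z * sndHom k L ι κ X) a b = ∑ l, Z a (b.1, l) * X l b.2 := by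
  simp [Matrix.mul_apply, sndHom_apply, Fintype.sum_prod_type]

lemma fstHom_mul_sndHom_apply (X : Matrix ι ι L) (Y : Matrix κ κ L) (a b : ι × κ) :
    (fstHom k L ι κ X * sndHom k L ι κ Y) a b = X a.1 b.1 * Y a.2 b.2 := by
  simp [fstHom_mul_apply, sndHom_apply]

lemma sndHom_mul_fstHom_apply (X : Matrix ι ι L) (Y : Matrix κ κ L) (a b : ι × κ) :
    (sndHom k L ι κ Y * fstHom k L ι κ X) a b = Y a.2 b.2 * X a.1 b.1 := by
  simp [sndHom_mul_apply, fstHom_apply]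

/-- Over a noncommutative `L` the two legs need not commute unless the entries do. Scalar matrices
always qualify; for the generating matrices R-matrices take the place of this commutation. -/
lemma commute_fst_snd (X : Matrix ι ι L) (Y : Matrix κ κ L)
    (h : ∀ i j p q, Commute (X i j) (Y p q)) :
    Commute (fstHom k L ι κ X) (sndHom k L ι κ Y) := by
  ext a b
  rw [fstHom_mul_sndHom_apply, sndHom_mul_fstHom_apply]
  exact h _ _ _ _

lemma commute_fst_scalar (X : Matrix ι ι L) (K : Matrix κ κ k) :
    Commute (fstHom k L ι κ X) (sndHom k L ι κ (scalarMat L K)) :=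
  commute_fst_snd _ _ fun _ _ _ _ => Algebra.commute_algebraMap_right _ _

lemma commute_scalar_snd (K : Matrix ι ι k) (Y : Matrix κ κ L) :
    Commute (fstHom k L ι κ (scalarMat L K)) (sndHom k L ι κ Y) :=
  commute_fst_snd _ _ fun _ _ _ _ => Algebra.commute_algebraMap_left _ _

lemma scalarMat_fstHom (K : Matrix ι ι k) :
    scalarMat L (fstHom k k ι κ K) = fstHom k L ι κ (scalarMat L K) := by
  ext a b
  rw [scalarMat_apply, fstHom_apply, fstHom_apply, apply_ite (algebraMap k L), map_zero]
  rfl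

lemma scalarMat_sndHom (K : Matrix κ κ k) :
    scalarMat L (sndHom k k ι κ K) = sndHom k L ι κ (scalarMat L K) := by
  ext a b
  rw [scalarMat_apply, sndHom_apply, sndHom_apply, apply_ite (algebraMap k L), map_zero]
  rfl

lemma map_fstHom {L' : Type*} [Ring L'] [Algebra k L'] (F : L →ₐ[k] L') (X : Matrix ι ι L) :
    (fstHom k L ι κ X).map F = fstHom k L' ι κ (X.map F) := by
  ext a b
  simp only [Matrix.map_apply, fstHom_apply]
  rw [apply_ite F, map_zero]

lemma map_sndHom {L' : Type*} [Ring L'] [Algebra k L'] (F : L →ₐ[k] L') (X : Matrix κ κ L) :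
    (sndHom k L ι κ X).map F = sndHom k L' ι κ (X.map F) := by
  ext a b
  simp only [Matrix.map_apply, sndHom_apply]
  rw [apply_ite F, map_zero]

lemma map_scalarMat {L' : Type*} [Ring L'] [Algebra k L'] (F : L →ₐ[k] L') (K : Matrix ι ι k) :
    (scalarMat L K).map F = scalarMat L' K := by
  ext a b
  simp [scalarMat_apply]

end MatrixLegs

/-! ### Representations, their tensor products and the R-matrices acting on them -/

section Reps

variable {k : Type u} [Field k] {H : Type v} [Ring H] [HopfAlgebra k H]
variable {L : Type w} [Ring L] [Algebra k L]
variable {ι κ : Type} [Fintype ι] [DecidableEq ι] [Fintype κ] [DecidableEq κ]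

/-- A matrix representation regarded as a morphism to the matrices over `L`. -/
def repL (L : Type w) [Ring L] [Algebra k L] (ρ : H →ₐ[k] Matrix ι ι k) : H →ₐ[k] Matrix ι ι L :=
  (scalarMat L).comp ρ

/-- `x ↦ ρ(x) ⊗ 1` -/
def repFst (L : Type w) [Ring L] [Algebra k L] (κ : Type) [Fintype κ] [DecidableEq κ]
    (ρ : H →ₐ[k] Matrix ι ι k) : H →ₐ[k] Matrix (ι × κ) (ι × κ) L :=
  (fstHom k L ι κ).comp (repL L ρ)

/-- `x ↦ 1 ⊗ σ(x)` -/
def repSnd (L : Type w) [Ring L] [Algebra k L] (ι : Type) [Fintype ι] [DecidableEq ι]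
    (σ : H →ₐ[k] Matrix κ κ k) : H →ₐ[k] Matrix (ι × κ) (ι × κ) L :=
  (sndHom k L ι κ).comp (repL L σ)

variable (ρ : H →ₐ[k] Matrix ι ι k) (σ : H →ₐ[k] Matrix κ κ k)

lemma commute_repFst_repSnd (x y : H) :
    Commute (repFst L κ ρ x) (repSnd L ι σ y) := commute_fst_scalar _ _

lemma commute_repSnd_repFst (x y : H) :
    Commute (repSnd L ι σ x) (repFst L κ ρ y) := (commute_fst_scalar _ _).symm

lemma commute_repFst_sndHom (x : H) (Y : Matrix κ κ L) :
    Commute (repFst L κ ρ x) (sndHom k L ι κ Y) := commute_scalar_snd _ _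

lemma commute_fstHom_repSnd (X : Matrix ι ι L) (x : H) :
    Commute (fstHom k L ι κ X) (repSnd L ι σ x) := commute_fst_scalar _ _

/-- The tensor product of two matrix representations. -/
def tensRep : H →ₐ[k] Matrix (ι × κ) (ι × κ) k :=
  (Algebra.TensorProduct.lift (repFst k κ ρ) (repSnd k ι σ) (commute_repFst_repSnd ρ σ)).comp
    (Bialgebra.comulAlgHom k H)

lemma tensRep_apply (x : H) :
    tensRep ρ σ x = conv (repFst k κ ρ).toLinearMap (repSnd k ι σ).toLinearMap x :=
  (leg_eq_lift _ _ _ (commute_repFst_repSnd ρ σ)).symm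

lemma repL_tensRep (x : H) : repL L (tensRep ρ σ) x =
    conv (repFst L κ ρ).toLinearMap (repSnd L ι σ).toLinearMap x := by
  change scalarMat L (tensRep ρ σ x) = _
  rw [tensRep_apply]
  exact RMatrix.leg_eq_of_map (T := Matrix (ι × κ) (ι × κ) k) _ _ (fun _ => scalarMat_fstHom _)
    (fun _ => scalarMat_sndHom _)

variable (k H) in
/-- The trivial representation. -/
def trivRep : H →ₐ[k] Matrix Unit Unit k := unitCounit

lemma trivRep_apply (x : H) (i j : Unit) :
    trivRep k H x i j = Coalgebra.counit (R := k) x := by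
  simp [trivRep, unitCounit, Algebra.ofId_apply, Matrix.algebraMap_matrix_apply]

namespace RMatrix
variable (Q : RMatrix k H)

/-- `∑ ρ(X₁) ⊗ σ(X₂)` for `X = R`. -/
def rMat (L : Type w) [Ring L] [Algebra k L] (ρ : H →ₐ[k] Matrix ι ι k)
    (σ : H →ₐ[k] Matrix κ κ k) : Matrix (ι × κ) (ι × κ) L :=
  leg Q.R (repFst L κ ρ).toLinearMap (repSnd L ι σ).toLinearMap

/-- `∑ ρ(X₂) ⊗ σ(X₁)` for `X = R`. -/
def sMat (L : Type w) [Ring L] [Algebra k L] (ρ : H →ₐ[k] Matrix ι ι k)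
    (σ : H →ₐ[k] Matrix κ κ k) : Matrix (ι × κ) (ι × κ) L :=
  leg Q.R (repSnd L ι σ).toLinearMap (repFst L κ ρ).toLinearMap

lemma isUnit_rMat : IsUnit (Q.rMat L ρ σ) :=
  ⟨⟨_, _, Q.leg_mul_Rinv _ _ (commute_repFst_repSnd ρ σ),
    Q.leg_Rinv_mul _ _ (commute_repFst_repSnd ρ σ)⟩, rfl⟩

lemma isUnit_sMat : IsUnit (Q.sMat L ρ σ) :=
  ⟨⟨_, _, Q.leg_mul_Rinv _ _ (commute_repSnd_repFst ρ σ),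
    Q.leg_Rinv_mul _ _ (commute_repSnd_repFst ρ σ)⟩, rfl⟩

/-- The flip of the tensor factors exchanges the two R-matrices, so that a relation proved for one
order of the legs yields its mirror image for the other. -/
lemma swapHom_sMat : swapHom k L ι κ (Q.sMat L σ ρ) = Q.rMat L ρ σ := by
  exact RMatrix.leg_eq_of_map _ _ (fun _ => swapHom_sndHom _) (fun _ => rfl)

lemma scalarMat_rMat : scalarMat L (Q.rMat k ρ σ) = Q.rMat L ρ σ := by
  exact RMatrix.leg_eq_of_map (T := Matrix (ι × κ) (ι × κ) k) _ _ (fun _ => scalarMat_fstHom _)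
    (fun _ => scalarMat_sndHom _)

lemma scalarMat_sMat : scalarMat L (Q.sMat k ρ σ) = Q.sMat L ρ σ := by
  exact RMatrix.leg_eq_of_map (T := Matrix (ι × κ) (ι × κ) k) _ _ (fun _ => scalarMat_sndHom _)
    (fun _ => scalarMat_fstHom _)

lemma map_sMat {L' : Type*} [Ring L'] [Algebra k L'] (F : L →ₐ[k] L') :
    (Q.sMat L ρ σ).map F = Q.sMat L' ρ σ := by
  rw [← scalarMat_sMat, map_scalarMat, scalarMat_sMat]

end RMatrix
end Reps

/-! ### Natural families and the fusion relation -/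

section Families

variable {k : Type u} [Field k] {H : Type v} [Ring H] [HopfAlgebra k H]
variable {L : Type w} [Ring L] [Algebra k L]

variable (k H L) in
/-- A family of square matrices over `L` indexed by the matrix representations of `H`. -/
abbrev MatFamily := ∀ ⦃ι : Type⦄ [Fintype ι] [DecidableEq ι],
  (H →ₐ[k] Matrix ι ι k) → Matrix ι ι L

/-- Compatibility with intertwiners. -/
def IsNatural (X : MatFamily k H L) : Prop :=
  ∀ ⦃ι κ : Type⦄ [Fintype ι] [DecidableEq ι] [Fintype κ] [DecidableEq κ]
    (ρ : H →ₐ[k] Matrix ι ι k) (σ : H →ₐ[k] Matrix κ κ k) (T : Matrix ι κ k),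
    (∀ h, ρ h * T = T * σ h) → X ρ * T.map (algebraMap k L) = T.map (algebraMap k L) * X σ

/-- The fusion relation `X_{ρ ⊗ σ} R' = (X_ρ ⊗ 1) R' (1 ⊗ X_σ)`. -/
structure IsFused (Q : RMatrix k H) (X : MatFamily k H L) : Prop where
  triv : X (trivRep k H) = 1
  fusion : ∀ ⦃ι κ : Type⦄ [Fintype ι] [DecidableEq ι] [Fintype κ] [DecidableEq κ]
    (ρ : H →ₐ[k] Matrix ι ι k) (σ : H →ₐ[k] Matrix κ κ k),
    fstHom k L ι κ (X ρ) * Q.sMat L ρ σ * sndHom k L ι κ (X σ) = X (tensRep ρ σ) * Q.sMat L ρ σ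

lemma IsNatural.mul {X Y : MatFamily k H L} (hX : IsNatural X) (hY : IsNatural Y) :
    IsNatural (fun _ _ _ ρ => X ρ * Y ρ) := fun _ _ _ _ _ _ ρ σ T h => by
  rw [Matrix.mul_assoc, hY ρ σ T h, ← Matrix.mul_assoc, hX ρ σ T h, Matrix.mul_assoc]

lemma IsNatural.inverse {X : MatFamily k H L} (hX : IsNatural X)
    (hu : ∀ ⦃ι : Type⦄ [Fintype ι] [DecidableEq ι] (ρ : H →ₐ[k] Matrix ι ι k), IsUnit (X ρ)) :
    IsNatural (fun _ _ _ ρ => Ring.inverse (X ρ)) := fun _ _ _ _ _ _ ρ σ T h => by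
  calc Ring.inverse (X ρ) * T.map (algebraMap k L)
      = Ring.inverse (X ρ) * (T.map (algebraMap k L) * X σ) * Ring.inverse (X σ) := by
        rw [Matrix.mul_assoc, Matrix.mul_assoc, Ring.mul_inverse_cancel _ (hu σ), Matrix.mul_one]
    _ = _ := by
        rw [← hX ρ σ T h, ← Matrix.mul_assoc, Ring.inverse_mul_cancel _ (hu ρ), Matrix.one_mul]

lemma IsNatural.map {L' : Type*} [Ring L'] [Algebra k L'] (F : L →ₐ[k] L') {X : MatFamily k H L}
    (hX : IsNatural X) : IsNatural (fun _ _ _ ρ => (X ρ).map F) := fun ι κ _ _ _ _ ρ σ T h => by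
  have e : T.map (algebraMap k L') = (T.map (algebraMap k L)).map F := by
    ext; simp
  rw [e, ← Matrix.map_mul, ← Matrix.map_mul, hX ρ σ T h]

lemma isNatural_one : IsNatural (fun _ _ _ _ => 1 : MatFamily k H L) := fun _ _ _ _ _ _ _ _ _ _ => by
  rw [Matrix.one_mul, Matrix.mul_one]

/-- The family of the actions of a central element. -/
lemma isNatural_repL (v : H) : IsNatural (fun _ _ _ ρ => repL L ρ v : MatFamily k H L) :=
  fun ι κ _ _ _ _ ρ σ T h => by
    have h1 := congrArg (fun Z => Z.map (algebraMap k L)) (h v)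
    simp only [Matrix.map_mul] at h1
    exact h1

lemma IsFused.map {Q : RMatrix k H} {L' : Type*} [Ring L'] [Algebra k L'] (F : L →ₐ[k] L')
    {X : MatFamily k H L} (hX : IsFused Q X) : IsFused Q (fun _ _ _ ρ => (X ρ).map F) where
  triv := by
    rw [hX.triv]; exact map_one F.mapMatrix
  fusion ι κ _ _ _ _ ρ σ := by
    rw [← map_fstHom, ← map_sndHom, ← Q.map_sMat ρ σ F, ← Matrix.map_mul, ← Matrix.map_mul,
      ← Matrix.map_mul, hX.fusion ρ σ]

lemma isFused_one (Q : RMatrix k H) : IsFused Q (fun _ _ _ _ => 1 : MatFamily k H L) where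
  triv := rfl
  fusion ι κ _ _ _ _ ρ σ := by simp

/-- Naturality with respect to the braiding: `R X_{ρ ⊗ σ} = (1 ⊗ X_σ) R (X_ρ ⊗ 1)`. -/
lemma IsFused.fusion' {Q : RMatrix k H} {X : MatFamily k H L} (hX : IsFused Q X)
    (hn : IsNatural X) {ι κ : Type} [Fintype ι] [DecidableEq ι] [Fintype κ] [DecidableEq κ]
    (ρ : H →ₐ[k] Matrix ι ι k) (σ : H →ₐ[k] Matrix κ κ k) :
    sndHom k L ι κ (X σ) * Q.rMat L ρ σ * fstHom k L ι κ (X ρ) =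
      Q.rMat L ρ σ * X (tensRep ρ σ) := by
  have h1 := congrArg (swapHom k L ι κ) (hX.fusion σ ρ)
  simp only [map_mul, Q.swapHom_sMat, swapHom_fstHom, swapHom_sndHom] at h1
  rw [h1]
  -- The braiding: R followed by the flip, the flip being absorbed into the reindexing of the rows.
  -- It intertwines ρ ⊗ σ with σ ⊗ ρ because RΔ = ΔᵒᵖR, so naturality applies to it.
  let T : Matrix (κ × ι) (ι × κ) k := (Q.rMat k ρ σ).submatrix Prod.swap id
  have hT : ∀ h, tensRep σ ρ h * T = T * tensRep ρ σ h := by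
    intro h
    have h2 : Q.rMat k ρ σ * tensRep ρ σ h = swapHom k k ι κ (tensRep σ ρ h) * Q.rMat k ρ σ := by
      have h3 : swapHom k k ι κ (tensRep σ ρ h) =
          conv (repSnd k ι σ).toLinearMap (repFst k κ ρ).toLinearMap h := by
        rw [tensRep_apply]
        exact RMatrix.leg_eq_of_map _ _ (fun _ => swapHom_fstHom _) (fun _ => swapHom_sndHom _)
      rw [h3, tensRep_apply]
      exact Q.leg_R_mul_conv _ _ (commute_repFst_repSnd ρ σ) h
    have h4 : (Q.rMat k ρ σ * tensRep ρ σ h).submatrix Prod.swap id = T * tensRep ρ σ h := rfl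
    rw [← h4, h2]
    ext a b
    simp only [Matrix.mul_apply, Matrix.submatrix_apply, T, swapHom_apply, id]
    exact Fintype.sum_equiv (Equiv.prodComm κ ι) _ _ (fun _ => rfl)
  have h5 := hn _ _ T hT
  have h6 : T.map (algebraMap k L) = (Q.rMat L ρ σ).submatrix Prod.swap id := by
    rw [← Q.scalarMat_rMat]; rfl
  rw [h6] at h5
  -- Undo the reindexing of the rows to return from the braiding to R.
  have h7 := congrArg (fun Z => Z.submatrix Prod.swap id) h5
  have h8 : (fun Z : Matrix (κ × ι) (ι × κ) L => Z.submatrix Prod.swap id)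
      ((Q.rMat L ρ σ).submatrix Prod.swap id * X (tensRep ρ σ)) =
      Q.rMat L ρ σ * X (tensRep ρ σ) := rfl
  refine Eq.trans ?_ (h7.trans h8)
  ext a b
  simp only [Matrix.mul_apply, Matrix.submatrix_apply, swapHom_apply, id]
  exact Fintype.sum_equiv (Equiv.prodComm ι κ) _ _ (fun _ => rfl)

end Families

/-! ### Invertibility of fused families by duality -/

section Invertibility

variable {k : Type u} [Field k] {H : Type v} [Ring H] [HopfAlgebra k H]
variable {L : Type w} [Ring L] [Algebra k L]
variable {ι : Type} [Fintype ι] [DecidableEq ι]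

/-- The dual `h ↦ ρ(A(h))ᵀ` of a representation with respect to an anti-automorphism `A`. -/
def dualRep (A : H →ₗ[k] H) (h1 : A 1 = 1) (hA : ∀ x y, A (x * y) = A y * A x)
    (ρ : H →ₐ[k] Matrix ι ι k) : H →ₐ[k] Matrix ι ι k :=
  AlgHom.ofLinearMap ((Matrix.transposeLinearEquiv ι ι k k).toLinearMap ∘ₗ ρ.toLinearMap ∘ₗ A)
    (by simp [h1]) (fun x y => by simp [hA])

lemma dualRep_apply (A : H →ₗ[k] H) (h1 : A 1 = 1) (hA : ∀ x y, A (x * y) = A y * A x)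
    (ρ : H →ₐ[k] Matrix ι ι k) (x : H) (i j : ι) : dualRep A h1 hA ρ x i j = ρ (A x) j i := rfl

variable (k ι) in
/-- The coevaluation. -/
def coevMat : Matrix (ι × ι) Unit k := Matrix.of fun a _ => if a.1 = a.2 then 1 else 0

/-- ∑ h₁ S(h₂) = ε(h) makes the coevaluation vector of V ⊗ V* invariant. -/
lemma tensRep_mul_coev (ρ : H →ₐ[k] Matrix ι ι k) (h : H) :
    tensRep ρ (dualRep (HopfAlgebra.antipode k) HopfAlgebra.antipode_one
      HopfAlgebra.antipode_mul_antidistrib ρ) h * coevMat k ι = coevMat k ι * trivRep k H h := by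
  have h1 : ∀ X : H ⊗[k] H, ∀ a : ι × ι, (leg X (repFst k ι ρ).toLinearMap
      (repSnd k ι (dualRep (HopfAlgebra.antipode k) HopfAlgebra.antipode_one
        HopfAlgebra.antipode_mul_antidistrib ρ)).toLinearMap * coevMat k ι) a () =
      leg X ρ.toLinearMap (ρ.toLinearMap ∘ₗ HopfAlgebra.antipode k) a.1 a.2 := by
    intro X a
    induction X with
    | zero => simp
    | add X Y hX hY => rw [leg_add, leg_add, Matrix.add_mul, Matrix.add_apply, hX, hY]; rfl
    | tmul x y =>
      rw [leg_tmul, leg_tmul, Matrix.mul_assoc]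
      refine (fstHom_mul_apply (k := k) _ _ _ _).trans ?_
      refine (Finset.sum_congr rfl fun l _ => congrArg _ (sndHom_mul_apply (k := k) _ _ _ _)).trans ?_
      simp [coevMat, Matrix.mul_apply, repL, scalarMat_apply, dualRep_apply]
  ext a ⟨⟩
  rw [tensRep_apply, conv_apply, h1, ← conv_apply, conv_antipode]
  simp [coevMat, Matrix.mul_apply, trivRep_apply, unitCounit, Algebra.ofId_apply,
    Matrix.algebraMap_matrix_apply]

/-- The transposed coevaluation is an evaluation map on V ⊗ V', with the dual V' on the right. Its
invariance requires ∑ A(h₂) h₁ = ε(h), an identity satisfied by the inverse antipode rather than by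
the antipode. -/
lemma coev_mul_tensRep (A : H →ₗ[k] H) (h1 : A 1 = 1) (hA : ∀ x y, A (x * y) = A y * A x)
    (hAS : ∀ x, leg (TensorProduct.comm k H H (Coalgebra.comul (R := k) x)) A LinearMap.id =
      algebraMap k H (Coalgebra.counit (R := k) x))
    (ρ : H →ₐ[k] Matrix ι ι k) (h : H) :
    trivRep k H h * (coevMat k ι).transpose =
      (coevMat k ι).transpose * tensRep ρ (dualRep A h1 hA ρ) h := by
  have e : ∀ X : H ⊗[k] H, ∀ a : ι × ι, ((coevMat k ι).transpose * leg X (repFst k ι ρ).toLinearMap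
      (repSnd k ι (dualRep A h1 hA ρ)).toLinearMap) () a =
      ρ (leg (TensorProduct.comm k H H X) A LinearMap.id) a.2 a.1 := by
    intro X a
    induction X with
    | zero => simp
    | add X Y hX hY =>
      rw [leg_add, map_add, leg_add, Matrix.mul_add, Matrix.add_apply, hX, hY, map_add]; rfl
    | tmul x y =>
      rw [leg_tmul, TensorProduct.comm_tmul, leg_tmul, ← Matrix.mul_assoc]
      refine (mul_sndHom_apply (k := k) _ _ _ _).trans ?_
      refine (Finset.sum_congr rfl fun l _ =>
        congrArg (· * _) (mul_fstHom_apply (k := k) _ _ _ _)).trans ?_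
      simp [coevMat, Matrix.mul_apply, repL, scalarMat_apply, dualRep_apply, mul_comm]
  ext ⟨⟩ a
  rw [tensRep_apply, conv_apply, e, hAS]
  simp [coevMat, Matrix.mul_apply, trivRep_apply, Matrix.algebraMap_matrix_apply, eq_comm]

/-- Naturality for the coevaluation k → V ⊗ V*, combined with the fusion relation, produces a right
inverse of `X ρ`. Naturality for the evaluation V ⊗ V' → k, combined with the mirrored relation
`fusion'`, produces a left inverse. The second dual is formed with S⁻¹, which is where bijectivity
of the antipode enters. -/
lemma IsFused.isUnit {Q : RMatrix k H} {X : MatFamily k H L} (hX : IsFused Q X)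
    (hn : IsNatural X) (hS : Function.Bijective (HopfAlgebra.antipode k : H →ₗ[k] H))
    (ρ : H →ₐ[k] Matrix ι ι k) : IsUnit (X ρ) := by
  have hright : ∃ Z, X ρ * Z = 1 := by
    set ρ' := dualRep (HopfAlgebra.antipode k) HopfAlgebra.antipode_one
      HopfAlgebra.antipode_mul_antidistrib ρ
    have h1 := hn _ _ (coevMat k ι) (tensRep_mul_coev ρ)
    rw [hX.triv, Matrix.mul_one] at h1
    obtain ⟨s', hs1, -⟩ := isUnit_iff_exists.mp (Q.isUnit_sMat (L := L) ρ ρ')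
    have h2 : X (tensRep ρ ρ') =
        fstHom k L ι ι (X ρ) * (Q.sMat L ρ ρ' * sndHom k L ι ι (X ρ') * s') := by
      rw [← mul_assoc, ← mul_assoc, hX.fusion, mul_assoc, hs1, mul_one]
    rw [h2, Matrix.mul_assoc] at h1
    -- Since `X ρ` is the leftmost factor in `h2`, row (i, j) of `h1` reads ∑ X_{il} Z_{lj} =
    -- δ_{ij}; this dictates the witness Z.
    refine ⟨Matrix.of fun p j => ((Q.sMat L ρ ρ' * sndHom k L ι ι (X ρ') * s') *
      (coevMat k ι).map (algebraMap k L)) (p, j) (), ?_⟩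
    ext i j
    have h3 := congrFun (congrFun h1 (i, j)) ()
    rw [fstHom_mul_apply] at h3
    rw [Matrix.mul_apply]
    refine h3.trans ?_
    simp [coevMat, Matrix.one_apply]
  have hleft : ∃ Z, Z * X ρ = 1 := by
    let e := LinearEquiv.ofBijective (HopfAlgebra.antipode k) hS
    have he : ∀ x, HopfAlgebra.antipode k (e.symm x) = x := e.apply_symm_apply
    have h1 : e.symm 1 = 1 := hS.1 (by rw [he, HopfAlgebra.antipode_one])
    have hA : ∀ x y, e.symm (x * y) = e.symm y * e.symm x := fun x y =>
      hS.1 (by rw [he, HopfAlgebra.antipode_mul_antidistrib, he, he])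
    have hAS : ∀ x, leg (TensorProduct.comm k H H (Coalgebra.comul (R := k) x))
        e.symm.toLinearMap LinearMap.id = algebraMap k H (Coalgebra.counit (R := k) x) := by
      intro x
      -- Under S the sum ∑ S⁻¹(x₂) x₁ becomes ∑ S(x₁) x₂.
      apply hS.1
      have e1 : ∀ X : H ⊗[k] H, HopfAlgebra.antipode k (leg (TensorProduct.comm k H H X)
          e.symm.toLinearMap LinearMap.id) =
          leg X (HopfAlgebra.antipode k) (AlgHom.id k H).toLinearMap := by
        intro X
        induction X with
        | zero => simp
        | add X Y hX hY => rw [map_add, leg_add, map_add, hX, hY, leg_add]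
        | tmul a b => simp [HopfAlgebra.antipode_mul_antidistrib, he]
      have e2 := LinearMap.congr_fun (antipode_conv (AlgHom.id k H)) x
      rw [e1]
      refine e2.trans ?_
      rw [Algebra.algebraMap_eq_smul_one, map_smul, HopfAlgebra.antipode_one]
      simp [unitCounit, Algebra.ofId_apply, Algebra.algebraMap_eq_smul_one]
    set ρ' := dualRep e.symm.toLinearMap h1 hA ρ
    have h2 := hn _ _ ((coevMat k ι).transpose) (coev_mul_tensRep e.symm.toLinearMap h1 hA hAS ρ)
    rw [hX.triv, Matrix.one_mul] at h2
    obtain ⟨r', -, hr1⟩ := isUnit_iff_exists.mp (Q.isUnit_rMat (L := L) ρ ρ')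
    have h3 : X (tensRep ρ ρ') =
        (r' * sndHom k L ι ι (X ρ') * Q.rMat L ρ ρ') * fstHom k L ι ι (X ρ) := by
      rw [mul_assoc, mul_assoc, ← mul_assoc (sndHom k L ι ι (X ρ')), hX.fusion' hn, ← mul_assoc,
        hr1, one_mul]
    rw [h3, ← Matrix.mul_assoc] at h2
    -- Now `X ρ` is the rightmost factor in `h3`, and column (p, q) of `h2` gives ∑ Z_{ql} X_{lp} =
    -- δ_{pq}.
    refine ⟨Matrix.of fun q l => ((coevMat k ι).transpose.map (algebraMap k L) *
      (r' * sndHom k L ι ι (X ρ') * Q.rMat L ρ ρ')) () (l, q), ?_⟩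
    ext q p
    have h4 := congrFun (congrFun h2 ()) (p, q)
    rw [mul_fstHom_apply] at h4
    rw [Matrix.mul_apply]
    refine h4.symm.trans ?_
    simp [coevMat, Matrix.one_apply, eq_comm]
  obtain ⟨Z, hZ⟩ := hright
  obtain ⟨Z', hZ'⟩ := hleft
  have : Z' = Z := left_inv_eq_right_inv hZ' hZ
  exact ⟨⟨X ρ, Z, hZ, this ▸ hZ'⟩, rfl⟩

end Invertibility

/-! ### The second universal R-matrix R'⁻¹ -/

section Opposite

variable {k : Type u} [Field k] {H : Type v} [Ring H] [HopfAlgebra k H]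

namespace RMatrix
variable (Q : RMatrix k H)

/-- The inverse flipped universal `R`-matrix `R'⁻¹`. -/
def opp : RMatrix k H where
  R := Algebra.TensorProduct.comm k H H Q.Rinv
  isUnit_R := (IsUnit.map (Algebra.TensorProduct.comm k H H)
    ⟨⟨_, _, Q.Rinv_mul_R, Q.R_mul_Rinv⟩, rfl⟩ :)
  R_mul_comul h := by
    have h1 : Coalgebra.comul (R := k) h * Q.Rinv =
        Q.Rinv * TensorProduct.comm k H H (Coalgebra.comul (R := k) h) := by
      calc _ = Q.Rinv * (Q.R * Coalgebra.comul (R := k) h) * Q.Rinv := by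
            rw [← mul_assoc, Q.Rinv_mul_R, one_mul]
        _ = _ := by rw [Q.R_mul_comul, mul_assoc, mul_assoc, Q.R_mul_Rinv, mul_one]
    have h2 := congrArg (Algebra.TensorProduct.comm k H H) h1
    rw [map_mul, map_mul] at h2
    have h3 : Algebra.TensorProduct.comm k H H
        (TensorProduct.comm k H H (Coalgebra.comul (R := k) h)) = Coalgebra.comul (R := k) h :=
      (TensorProduct.comm k H H).symm_apply_apply _
    rw [h3] at h2
    exact h2.symm
  comul_id_R := by
    have h1 : Q.R' * Algebra.TensorProduct.comm k H H Q.Rinv = 1 := by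
      change Algebra.TensorProduct.comm k H H Q.R * _ = 1
      rw [← map_mul, Q.R_mul_Rinv, map_one]
    have h1' : Algebra.TensorProduct.comm k H H Q.Rinv * Q.R' = 1 := by
      change _ * Algebra.TensorProduct.comm k H H Q.R = 1
      rw [← map_mul, Q.Rinv_mul_R, map_one]
    -- R' obeys the coproduct rules with the two factors in the opposite order; taking inverses
    -- restores the order required of a universal R-matrix.
    have h2 := Q.isBichar_R'.left
    have h3 := congrArg (comL (Bialgebra.comulAlgHom k H)) h1'
    rw [map_mul, map_one, h2] at h3
    have h4 : (mapR Q.R' * mapM Q.R') * (mapM (Algebra.TensorProduct.comm k H H Q.Rinv) *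
        mapR (Algebra.TensorProduct.comm k H H Q.Rinv)) = 1 := by
      rw [mul_assoc, ← mul_assoc (mapM Q.R'), ← map_mul, h1, map_one, one_mul, ← map_mul, h1,
        map_one]
    exact left_inv_eq_right_inv h3 h4
  id_comul_R := by
    have h1 : Q.R' * Algebra.TensorProduct.comm k H H Q.Rinv = 1 := by
      change Algebra.TensorProduct.comm k H H Q.R * _ = 1
      rw [← map_mul, Q.R_mul_Rinv, map_one]
    have h1' : Algebra.TensorProduct.comm k H H Q.Rinv * Q.R' = 1 := by
      change _ * Algebra.TensorProduct.comm k H H Q.R = 1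
      rw [← map_mul, Q.Rinv_mul_R, map_one]
    have h2 := Q.isBichar_R'.right
    have h3 := congrArg (comR (Bialgebra.comulAlgHom k H)) h1'
    rw [map_mul, map_one, h2] at h3
    have h4 : (mapL Q.R' * mapM Q.R') * (mapM (Algebra.TensorProduct.comm k H H Q.Rinv) *
        mapL (Algebra.TensorProduct.comm k H H Q.Rinv)) = 1 := by
      rw [mul_assoc, ← mul_assoc (mapM Q.R'), ← map_mul, h1, map_one, one_mul, ← map_mul, h1,
        map_one]
    refine (left_inv_eq_right_inv h3 h4).trans ?_
    congr 1
    generalize Algebra.TensorProduct.comm k H H Q.Rinv = X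
    induction X with
    | zero => simp
    | add X Y hX hY => rw [map_add, map_add, hX, hY]
    | tmul a b => simp [mapL]

/-- Here the legs are only linear, which is what actions on module-algebras and compositions with
the antipode require. -/
lemma leg_eq_of_map' {E E' : Type*} [Ring E] [Algebra k E] [Ring E'] [Algebra k E']
    (G : E →ₐ[k] E') (X : H ⊗[k] H) {a b : H →ₗ[k] E} {c d : H →ₗ[k] E'}
    (h1 : ∀ x, G (a x) = c x) (h2 : ∀ x, G (b x) = d x) : G (leg X a b) = leg X c d := by
  rw [map_leg]
  congr 1 <;> ext x <;> simp [h1, h2]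

lemma leg_opp {E : Type*} [Ring E] [Algebra k E] (f g : H →ₗ[k] E)
    (h : ∀ x y, Commute (f x) (g y)) : leg Q.opp.R f g = leg Q.Rinv g f :=
  leg_comm _ _ _ h

end RMatrix
end Opposite

/-! ### Equivariant matrices -/

section Coaction

variable {k : Type u} [Field k] {H : Type v} [Ring H] [HopfAlgebra k H]
variable (L : ModAlg.{u, v, w} (Bialgebra.comulAlgHom k H) (Bialgebra.counitAlgHom k H))
variable {ι κ : Type}

/-- The entrywise action on matrices. -/
def actMat (X : Matrix ι ι L.carrier) : H →ₗ[k] Matrix ι ι L.carrier where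
  toFun h := X.map fun x => L.act x h
  map_add' _ _ := by ext; simp
  map_smul' _ _ := by ext; simp

lemma actMat_apply (X : Matrix ι ι L.carrier) (h : H) (i j : ι) :
    actMat L X h i j = L.act (X i j) h := rfl

variable [Fintype ι] [DecidableEq ι] [Fintype κ] [DecidableEq κ]

lemma leg_apply (Z : H ⊗[k] H) (f g : H →ₗ[k] Matrix ι ι L.carrier) (i j : ι) :
    leg Z f g i j = ∑ l, leg Z (Matrix.entryLinearMap k L.carrier i l ∘ₗ f)
      (Matrix.entryLinearMap k L.carrier l j ∘ₗ g) := by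
  induction Z with
  | zero => simp
  | add X Y hX hY => simp only [leg_add, Matrix.add_apply, hX, hY, Finset.sum_add_distrib]
  | tmul a b => simp [Matrix.mul_apply]

/-- The module-algebra axiom, summed over the inner index. In this form equivariance can be
manipulated through associativity of convolution alone. -/
lemma actMat_mul (X Y : Matrix ι ι L.carrier) :
    actMat L (X * Y) = conv (actMat L X) (actMat L Y) := by
  ext h i j
  rw [conv_apply, leg_apply, actMat_apply, Matrix.mul_apply, map_sum, LinearMap.sum_apply]
  exact Finset.sum_congr rfl fun l _ => L.mul_act _ _ _

lemma actMat_scalarMat (K : Matrix ι ι k) (h : H) :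
    actMat L (scalarMat L.carrier K) h = Coalgebra.counit (R := k) h • scalarMat L.carrier K := by
  ext i j
  rw [actMat_apply, scalarMat_apply, Algebra.algebraMap_eq_smul_one, map_smul,
    LinearMap.smul_apply, L.one_act, Matrix.smul_apply, scalarMat_apply,
    Algebra.algebraMap_eq_smul_one, Algebra.algebraMap_eq_smul_one, smul_comm]
  rfl

/-- Equivariance `∑ (X · h₁) ρ(h₂) = ρ(h) X`, i.e. `X · h = ∑ ρ(h₁) X ρ(S(h₂))`. -/
def IsEquivariant (ρ : H →ₐ[k] Matrix ι ι k) (X : Matrix ι ι L.carrier) : Prop :=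
  ∀ h, conv (actMat L X) (repL L.carrier ρ).toLinearMap h = repL L.carrier ρ h * X

variable {L}

lemma conv_mulRight {E : Type*} [Ring E] [Algebra k E] (f g : H →ₗ[k] E) (e : E) :
    conv f (LinearMap.mulRight k e ∘ₗ g) = LinearMap.mulRight k e ∘ₗ conv f g := by
  ext h
  rw [LinearMap.comp_apply, conv_apply, conv_apply]
  generalize Coalgebra.comul (R := k) h = Z
  induction Z with
  | zero => simp
  | add X Y hX hY => rw [leg_add, hX, hY, leg_add, map_add]
  | tmul a b => simp [mul_assoc]

lemma IsEquivariant.eq {ρ : H →ₐ[k] Matrix ι ι k} {X : Matrix ι ι L.carrier}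
    (hX : IsEquivariant L ρ X) : conv (actMat L X) (repL L.carrier ρ).toLinearMap =
      LinearMap.mulRight k X ∘ₗ (repL L.carrier ρ).toLinearMap :=
  LinearMap.ext hX

/-- Equivariance of `X` says that convolving the action on `X` with ρ amounts to following ρ by
right multiplication by `X`. In the convolution of three factors, `Y` is absorbed first and `X`
next. -/
lemma IsEquivariant.mul {ρ : H →ₐ[k] Matrix ι ι k} {X Y : Matrix ι ι L.carrier}
    (hX : IsEquivariant L ρ X) (hY : IsEquivariant L ρ Y) : IsEquivariant L ρ (X * Y) := by
  intro h
  rw [actMat_mul, conv_assoc, hY.eq, conv_mulRight, hX.eq]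
  simp [mul_assoc]

lemma actMat_one_conv (f : H →ₗ[k] Matrix ι ι L.carrier) :
    conv (actMat L 1) f = f := by
  have : actMat L (1 : Matrix ι ι L.carrier) =
      (unitCounit (k := k) (H := H) (E := Matrix ι ι L.carrier)).toLinearMap := by
    ext h : 1
    rw [← map_one (scalarMat (k := k) L.carrier), actMat_scalarMat, map_one]
    simp [unitCounit, Algebra.ofId_apply, Algebra.algebraMap_eq_smul_one]
  rw [this, unitCounit_conv]

lemma isEquivariant_one (ρ : H →ₐ[k] Matrix ι ι k) :
    IsEquivariant L ρ (1 : Matrix ι ι L.carrier) := by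
  intro h
  rw [actMat_one_conv, mul_one]; rfl

/-- Write ρ as ρ X X⁻¹ and use the equivariance of `X` backwards: the action on X⁻¹ then meets the
action on X, and together they act on X⁻¹X = 1 by the counit. -/
lemma IsEquivariant.inverse {ρ : H →ₐ[k] Matrix ι ι k} {X : Matrix ι ι L.carrier}
    (hX : IsEquivariant L ρ X) (hu : IsUnit X) : IsEquivariant L ρ (Ring.inverse X) := by
  intro h
  have h1 : LinearMap.mulRight k (Ring.inverse X) ∘ₗ LinearMap.mulRight k X ∘ₗ
      (repL L.carrier ρ).toLinearMap = (repL L.carrier ρ).toLinearMap := by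
    ext x : 1
    simp [mul_assoc, Ring.mul_inverse_cancel _ hu]
  have h2 : conv (actMat L (Ring.inverse X)) (repL L.carrier ρ).toLinearMap =
      LinearMap.mulRight k (Ring.inverse X) ∘ₗ (repL L.carrier ρ).toLinearMap := by
    conv_lhs => rw [← h1]
    rw [conv_mulRight, ← hX.eq, ← conv_assoc, ← actMat_mul, Ring.inverse_mul_cancel _ hu,
      actMat_one_conv]
  exact LinearMap.congr_fun h2 h

/-- The entries of ρ(v) are scalars, on which H acts by the counit, so equivariance reduces to ρ(v)
commuting with ρ(h). -/
lemma isEquivariant_central (ρ : H →ₐ[k] Matrix ι ι k) {v : H} (hv : ∀ h, v * h = h * v) :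
    IsEquivariant L ρ (repL L.carrier ρ v) := by
  intro h
  rw [← map_mul, ← hv h, map_mul]
  have h1 : actMat L (repL L.carrier ρ v) = LinearMap.mulLeft k (repL L.carrier ρ v) ∘ₗ
      (unitCounit (k := k) (H := H) (E := Matrix ι ι L.carrier)).toLinearMap := by
    ext h : 1
    refine (actMat_scalarMat L _ _).trans ?_
    simp [unitCounit, Algebra.ofId_apply, Algebra.algebraMap_eq_smul_one, repL]
  have h2 : ∀ Z : H ⊗[k] H, leg Z (actMat L (repL L.carrier ρ v)) (repL L.carrier ρ).toLinearMap =
      repL L.carrier ρ v * leg Z (unitCounit (k := k) (H := H) (E := Matrix ι ι L.carrier)).toLinearMap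
        (repL L.carrier ρ).toLinearMap := by
    intro Z
    rw [h1]
    induction Z with
    | zero => simp
    | add X Y hX hY => rw [leg_add, hX, hY, leg_add, mul_add]
    | tmul a b => simp [mul_assoc]
  rw [conv_apply, h2, ← conv_apply, unitCounit_conv]
  rfl

lemma IsEquivariant.map {L' : ModAlg.{u, v, w} (Bialgebra.comulAlgHom k H)
    (Bialgebra.counitAlgHom k H)} {F : L.carrier →ₐ[k] L'.carrier}
    (hF : ∀ x h, F (L.act x h) = L'.act (F x) h)
    {ρ : H →ₐ[k] Matrix ι ι k} {X : Matrix ι ι L.carrier} (hX : IsEquivariant L ρ X) :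
    IsEquivariant L' ρ (X.map F) := by
  intro h
  have h1 := congrArg F.mapMatrix (hX h)
  rw [map_mul] at h1
  have h2 : F.mapMatrix (repL L.carrier ρ h) = repL L'.carrier ρ h := map_scalarMat F _
  have h3 : F.mapMatrix X = X.map F := rfl
  rw [h2, h3] at h1
  rw [← h1]
  refine (RMatrix.leg_eq_of_map' (E := Matrix ι ι L.carrier) (E' := Matrix ι ι L'.carrier)
    F.mapMatrix _ ?_ ?_).symm
  · intro x
    ext i j
    exact hF _ _
  · intro x
    exact map_scalarMat F _

namespace RMatrix
variable (Q : RMatrix k H)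

variable (L) in
/-- The coaction `x ↦ ∑ ρ(R₂) (x · R₁)`, with values in the matrices over `L`. -/
def coactLin (ρ : H →ₐ[k] Matrix ι ι k) (x : L.carrier) : Matrix ι ι L.carrier :=
  leg Q.R ((Matrix.scalarAlgHom ι k).toLinearMap ∘ₗ L.act x) (repL L.carrier ρ).toLinearMap

end RMatrix
end Coaction

/-! ### The coaction on matrices, and the moment equation -/

section Coaction

variable {k : Type u} [Field k] {H : Type v} [Ring H] [HopfAlgebra k H]
variable {L : ModAlg.{u, v, w} (Bialgebra.comulAlgHom k H) (Bialgebra.counitAlgHom k H)}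
variable {ι κ : Type} [Fintype ι] [DecidableEq ι] [Fintype κ] [DecidableEq κ]

lemma scalar_mul_apply {A : Type*} [Ring A] [Algebra k A] (x : A) (Z : Matrix ι ι A) (i j : ι) :
    (Matrix.scalarAlgHom ι k x * Z) i j = x * Z i j := by
  change (Matrix.scalar ι x * Z) i j = _
  rw [Matrix.scalar_apply, Matrix.diagonal_mul]

lemma mul_scalar_apply {A : Type*} [Ring A] [Algebra k A] (x : A) (Z : Matrix ι ι A) (i j : ι) :
    (Z * Matrix.scalarAlgHom ι k x) i j = Z i j * x := by
  change (Z * Matrix.scalar ι x) i j = _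
  rw [Matrix.scalar_apply, Matrix.mul_diagonal]

lemma commute_scalar_repL (ρ : H →ₐ[k] Matrix ι ι k) (x : L.carrier) (h : H) :
    Commute (Matrix.scalarAlgHom ι k x) (repL L.carrier ρ h) := by
  ext i j
  rw [scalar_mul_apply, mul_scalar_apply]
  exact (Algebra.commutes _ _).symm

namespace RMatrix
variable (Q : RMatrix k H)

/-- (Δ ⊗ id)(R) = R₁₃R₂₃ converts the module-algebra axiom into multiplicativity. The two copies of
R separate because scalar matrices over L commute with the matrices ρ(h). -/
lemma coactLin_mul (ρ : H →ₐ[k] Matrix ι ι k) (x y : L.carrier) :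
    Q.coactLin L ρ (x * y) = Q.coactLin L ρ x * Q.coactLin L ρ y := by
  rw [coactLin, coactLin, coactLin, ← Q.leg_R_conv_left]
  · congr 1
    ext h : 1
    rw [LinearMap.comp_apply, L.mul_act]
    change Matrix.scalarAlgHom ι k (leg _ _ _) = _
    exact leg_eq_of_map' _ _ (fun _ => rfl) (fun _ => rfl)
  · intro a b
    exact commute_scalar_repL _ _ _

lemma coactLin_one (ρ : H →ₐ[k] Matrix ι ι k) : Q.coactLin L ρ 1 = 1 := by
  have h : (Matrix.scalarAlgHom ι k).toLinearMap ∘ₗ L.act 1 =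
      (unitCounit (k := k) (H := H) (E := Matrix ι ι L.carrier)).toLinearMap := by
    ext h : 1
    rw [LinearMap.comp_apply, L.one_act]
    exact AlgHom.commutes (Matrix.scalarAlgHom ι k : L.carrier →ₐ[k] Matrix ι ι L.carrier) _
  rw [coactLin, h, leg_counit_left]

variable (L) in
/-- The coaction `x ↦ ∑ ρ(R₂) (x · R₁)` as a morphism of algebras. -/
def coact (ρ : H →ₐ[k] Matrix ι ι k) : L.carrier →ₐ[k] Matrix ι ι L.carrier :=
  AlgHom.ofLinearMap
    { toFun := Q.coactLin L ρ
      map_add' := fun x y => by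
        simp only [coactLin, leg, map_add, LinearMap.comp_add, TensorProduct.map_add_left,
          LinearMap.add_apply]
      map_smul' := fun c x => by
        simp only [coactLin, leg, map_smul, LinearMap.comp_smul, TensorProduct.map_smul_left,
          LinearMap.smul_apply, RingHom.id_apply] }
    (Q.coactLin_one ρ) (Q.coactLin_mul ρ)

lemma coact_apply (ρ : H →ₐ[k] Matrix ι ι k) (x : L.carrier) : Q.coact L ρ x =
    leg Q.R ((Matrix.scalarAlgHom ι k).toLinearMap ∘ₗ L.act x) (repL L.carrier ρ).toLinearMap :=
  rfl

lemma coact_map {L' : ModAlg.{u, v, w} (Bialgebra.comulAlgHom k H)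
    (Bialgebra.counitAlgHom k H)} {F : L.carrier →ₐ[k] L'.carrier}
    (hF : ∀ x h, F (L.act x h) = L'.act (F x) h) (ρ : H →ₐ[k] Matrix ι ι k) (x : L.carrier) :
    Q.coact L' ρ (F x) = (Q.coact L ρ x).map F := by
  rw [coact_apply, coact_apply]
  refine (RMatrix.leg_eq_of_map' (E := Matrix ι ι L.carrier) (E' := Matrix ι ι L'.carrier)
    F.mapMatrix _ ?_ ?_).symm
  · intro h
    refine Eq.trans (b := Matrix.scalar ι (F (L.act x h))) ?_ ?_
    · change (Matrix.scalar ι (L.act x h)).map F = _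
      rw [Matrix.scalar_apply, Matrix.scalar_apply, Matrix.diagonal_map (map_zero F)]
    · rw [hF]; rfl
  · intro h
    exact map_scalarMat F _

variable (L) in
/-- The coaction on the entries of a matrix. -/
def coactSnd (ρ : H →ₐ[k] Matrix ι ι k) (X : Matrix κ κ L.carrier) :
    Matrix (ι × κ) (ι × κ) L.carrier :=
  leg Q.R ((sndHom k L.carrier ι κ).toLinearMap ∘ₗ actMat L X) (repFst L.carrier κ ρ).toLinearMap

lemma coactSnd_apply (ρ : H →ₐ[k] Matrix ι ι k) (X : Matrix κ κ L.carrier) (a b : ι × κ) :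
    Q.coactSnd L ρ X a b = Q.coact L ρ (X a.2 b.2) a.1 b.1 := by
  rw [coactSnd, coact_apply]
  generalize Q.R = Z
  induction Z with
  | zero => simp
  | add X Y hX hY => rw [leg_add, leg_add, Matrix.add_apply, Matrix.add_apply, hX, hY]
  | tmul x y =>
    rw [leg_tmul, leg_tmul]
    refine (sndHom_mul_fstHom_apply (k := k) _ _ _ _).trans ?_
    exact (scalar_mul_apply (k := k) _ _ _ _).symm

/-- For an equivariant matrix, the coaction on its entries is conjugation of 1 ⊗ X by `sMat`. The
rule for (Δ ⊗ id)(R) merges the coaction and `sMat` into a single R with expanded first leg, and the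
equivariance of X applies there. This is how statements about the action become R-matrix relations.
-/
lemma coactSnd_mul_sMat (ρ : H →ₐ[k] Matrix ι ι k) {σ : H →ₐ[k] Matrix κ κ k}
    {X : Matrix κ κ L.carrier} (hX : IsEquivariant L σ X) :
    Q.coactSnd L ρ X * Q.sMat L.carrier ρ σ =
      Q.sMat L.carrier ρ σ * sndHom k L.carrier ι κ X := by
  refine (Q.leg_R_conv_left ((sndHom k L.carrier ι κ).toLinearMap ∘ₗ actMat L X)
    (repSnd L.carrier ι σ).toLinearMap (repFst L.carrier κ ρ)
    (commute_repSnd_repFst ρ σ)).symm.trans ?_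
  have h1 : conv ((sndHom k L.carrier ι κ).toLinearMap ∘ₗ actMat L X)
      (repSnd L.carrier ι σ).toLinearMap = LinearMap.mulRight k (sndHom k L.carrier ι κ X) ∘ₗ
        (repSnd L.carrier ι σ).toLinearMap := by
    ext h : 1
    have h2 : sndHom k L.carrier ι κ (conv (actMat L X) (repL L.carrier σ).toLinearMap h) =
        conv ((sndHom k L.carrier ι κ).toLinearMap ∘ₗ actMat L X)
          (repSnd L.carrier ι σ).toLinearMap h :=
      leg_eq_of_map' (E := Matrix κ κ L.carrier) (E' := Matrix (ι × κ) (ι × κ) L.carrier) _ _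
        (fun _ => rfl) (fun _ => rfl)
    rw [← h2, hX h, map_mul]
    rfl
  rw [h1, sMat]
  generalize Q.R = Z
  induction Z with
  | zero => rw [leg_zero, leg_zero, zero_mul]
  | add X Y hX hY => rw [leg_add, leg_add, hX, hY, add_mul]
  | tmul x y =>
    rw [leg_tmul, leg_tmul, LinearMap.comp_apply, LinearMap.mulRight_apply, mul_assoc, mul_assoc]
    congr 1
    exact (commute_repFst_sndHom ρ y X).eq.symm

/-- The second pair of indices is a spectator, so a relation between matrices on two legs is a
collection of relations in the first leg, one for each entry of `X`. It translates between moment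
equations and R-matrix relations. -/
lemma fst_mul_coactSnd_iff (ρ : H →ₐ[k] Matrix ι ι k) (Q' : RMatrix k H)
    (Y Y' : Matrix ι ι L.carrier) (X : Matrix κ κ L.carrier) :
    fstHom k L.carrier ι κ Y * Q.coactSnd L ρ X =
        Q'.coactSnd L ρ X * fstHom k L.carrier ι κ Y' ↔
      ∀ p q, Y * Q.coact L ρ (X p q) = Q'.coact L ρ (X p q) * Y' := by
  have e1 : ∀ a b, (fstHom k L.carrier ι κ Y * Q.coactSnd L ρ X) a b =
      (Y * Q.coact L ρ (X a.2 b.2)) a.1 b.1 := fun a b => by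
    rw [fstHom_mul_apply, Matrix.mul_apply]
    exact Finset.sum_congr rfl fun l _ => by rw [coactSnd_apply]
  have e2 : ∀ a b, (Q'.coactSnd L ρ X * fstHom k L.carrier ι κ Y') a b =
      (Q'.coact L ρ (X a.2 b.2) * Y') a.1 b.1 := fun a b => by
    rw [mul_fstHom_apply, Matrix.mul_apply]
    exact Finset.sum_congr rfl fun l _ => by rw [coactSnd_apply]
  constructor
  · intro h p q
    ext i j
    have := congrFun (congrFun h (i, p)) (j, q)
    rwa [e1, e2] at this
  · intro h
    ext a b
    rw [e1, e2, h]

lemma opp_sMat {L : Type w} [Ring L] [Algebra k L] (ρ : H →ₐ[k] Matrix ι ι k)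
    (σ : H →ₐ[k] Matrix κ κ k) : Q.opp.sMat L ρ σ * Q.rMat L ρ σ = 1 := by
  rw [sMat, Q.leg_opp _ _ (commute_repSnd_repFst ρ σ), rMat]
  exact Q.leg_Rinv_mul _ _ (commute_repFst_repSnd ρ σ)

lemma rMat_mul_opp {L : Type w} [Ring L] [Algebra k L] (ρ : H →ₐ[k] Matrix ι ι k)
    (σ : H →ₐ[k] Matrix κ κ k) : Q.rMat L ρ σ * Q.opp.sMat L ρ σ = 1 := by
  rw [sMat, Q.leg_opp _ _ (commute_repSnd_repFst ρ σ), rMat]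
  exact Q.leg_mul_Rinv _ _ (commute_repFst_repSnd ρ σ)

/-- The conjugation formula for R'⁻¹, whose `sMat` is the inverse of `rMat` for R. -/
lemma rMat_mul_opp_coactSnd (ρ : H →ₐ[k] Matrix ι ι k) {σ : H →ₐ[k] Matrix κ κ k}
    {X : Matrix κ κ L.carrier} (hX : IsEquivariant L σ X) :
    Q.rMat L.carrier ρ σ * Q.opp.coactSnd L ρ X =
      sndHom k L.carrier ι κ X * Q.rMat L.carrier ρ σ := by
  have h1 := Q.opp.coactSnd_mul_sMat ρ hX
  calc _ = Q.rMat L.carrier ρ σ * (Q.opp.coactSnd L ρ X * Q.opp.sMat L.carrier ρ σ) *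
        Q.rMat L.carrier ρ σ := by
        rw [mul_assoc, mul_assoc, Q.opp_sMat, mul_one]
    _ = _ := by rw [h1, ← mul_assoc, Q.rMat_mul_opp, one_mul]

/-- A matrix braided with `x` commutes with the coaction on `x`. -/
lemma commute_coact {ρ : H →ₐ[k] Matrix ι ι k} {Y : Matrix ι ι L.carrier}
    (hY : IsEquivariant L ρ Y) (x : L.carrier)
    (h : ∀ i j d, Y i j * L.act x d = leg Q.R (L.act (L.act x d)) (L.act (Y i j))) :
    Commute Y (Q.coact L ρ x) := by
  let f : L.carrier → H →ₗ[k] Matrix ι ι L.carrier :=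
    fun x => (Matrix.scalarAlgHom ι k).toLinearMap ∘ₗ L.act x
  have h' : ∀ d, Y * f x d = leg Q.R (f (L.act x d)) (actMat L Y) := by
    intro d
    ext i j
    have e : ∀ Z : H ⊗[k] H, leg Z (f (L.act x d)) (actMat L Y) i j =
        leg Z (L.act (L.act x d)) (L.act (Y i j)) := by
      intro Z
      induction Z with
      | zero => simp
      | add X Y hX hY => rw [leg_add, leg_add, Matrix.add_apply, hX, hY]
      | tmul a b =>
        rw [leg_tmul, leg_tmul]
        exact scalar_mul_apply (k := k) _ _ _ _
    rw [e, ← h]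
    exact mul_scalar_apply (k := k) _ _ _ _
  -- Evaluate (id ⊗ Δ)(R) = R₁₃R₁₂ with x in the first slot and with the action on Y and ρ in the
  -- two others. On the left, equivariance turns the convolution into right multiplication by Y. On
  -- the right, R₁₂ is consumed by the exchange of x with Y, and R₁₃ remains as the coaction on x.
  have key := congrArg (leg3 (f x) (actMat L Y) (repL L.carrier ρ).toLinearMap) Q.id_comul_R
  rw [id_comul_aux, hY.eq] at key
  have e2 : ∀ X : H ⊗[k] H, leg3 (f x) (actMat L Y) (repL L.carrier ρ).toLinearMap
      (Algebra.TensorProduct.map (AlgHom.id k H) Algebra.TensorProduct.includeRight X *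
        Algebra.TensorProduct.map (AlgHom.id k H) Algebra.TensorProduct.includeLeft Q.R) =
      Y * leg X (f x) (repL L.carrier ρ).toLinearMap := by
    intro X
    induction X with
    | zero => simp
    | add X Y hX hY => simp only [map_add, hX, hY, leg_add, add_mul, mul_add]
    | tmul a b =>
      rw [leg_tmul, ← mul_assoc, h']
      generalize Q.R = Z
      induction Z with
      | zero => simp
      | add X Y hX hY => simp only [map_add, hX, hY, leg_add, add_mul, mul_add]
      | tmul c d => simp [leg3, f, mul_assoc, L.act_mul]
  rw [e2] at key
  have e3 : ∀ X : H ⊗[k] H, leg X (f x) (LinearMap.mulRight k Y ∘ₗ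
      (repL L.carrier ρ).toLinearMap) = leg X (f x) (repL L.carrier ρ).toLinearMap * Y := by
    intro X
    induction X with
    | zero => simp
    | add X Y hX hY => simp only [hX, hY, leg_add, add_mul]
    | tmul c d => simp [mul_assoc]
  rw [e3] at key
  exact key.symm

end RMatrix

/-- Families that satisfy the fusion relation, compatibly with the action, and whose entries
form a quantum moment map. -/
structure IsMomentFamily (Q : RMatrix k H)
    (L : ModAlg.{u, v, w} (Bialgebra.comulAlgHom k H) (Bialgebra.counitAlgHom k H))
    (X : MatFamily k H L.carrier) : Prop where
  natural : IsNatural X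
  fused : IsFused Q X
  equivariant : ∀ ⦃ι : Type⦄ [Fintype ι] [DecidableEq ι] (ρ : H →ₐ[k] Matrix ι ι k),
    IsEquivariant L ρ (X ρ)
  moment : ∀ ⦃ι : Type⦄ [Fintype ι] [DecidableEq ι] (ρ : H →ₐ[k] Matrix ι ι k) (x : L.carrier),
    X ρ * Q.coact L ρ x = Q.opp.coact L ρ x * X ρ

/-- In X₁Y₁ s X₂Y₂ the matrix Y₁ must pass s X₂. Since s X₂ equals the coaction on X times s, and Y₁
commutes with this coaction by hypothesis, the fusion relations of X and of Y can be applied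
separately. -/
lemma IsFused.mul {Q : RMatrix k H} {X Y : MatFamily k H L.carrier} (hX : IsFused Q X)
    (hY : IsFused Q Y)
    (hXe : ∀ ⦃ι : Type⦄ [Fintype ι] [DecidableEq ι] (ρ : H →ₐ[k] Matrix ι ι k),
      IsEquivariant L ρ (X ρ))
    (hXY : ∀ ⦃ι κ : Type⦄ [Fintype ι] [DecidableEq ι] [Fintype κ] [DecidableEq κ]
      (ρ : H →ₐ[k] Matrix ι ι k) (σ : H →ₐ[k] Matrix κ κ k) (p q : κ),
      Commute (Y ρ) (Q.coact L ρ (X σ p q))) :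
    IsFused Q (fun _ _ _ ρ => X ρ * Y ρ) where
  triv := by rw [hX.triv, hY.triv, mul_one]
  fusion ι κ _ _ _ _ ρ σ := by
    have h1 := (Q.fst_mul_coactSnd_iff ρ Q (Y ρ) (Y ρ) (X σ)).2 (fun p q => hXY ρ σ p q)
    have h2 := Q.coactSnd_mul_sMat ρ (hXe σ)
    obtain ⟨s', hs1, -⟩ := isUnit_iff_exists.mp (Q.isUnit_sMat (L := L.carrier) ρ σ)
    have h3 : Q.coactSnd L ρ (X σ) =
        Q.sMat L.carrier ρ σ * sndHom k L.carrier ι κ (X σ) * s' := by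
      rw [← h2, mul_assoc, hs1, mul_one]
    rw [map_mul, map_mul]
    calc fstHom k L.carrier ι κ (X ρ) * fstHom k L.carrier ι κ (Y ρ) * Q.sMat L.carrier ρ σ *
          (sndHom k L.carrier ι κ (X σ) * sndHom k L.carrier ι κ (Y σ))
        = fstHom k L.carrier ι κ (X ρ) * (fstHom k L.carrier ι κ (Y ρ) *
          (Q.sMat L.carrier ρ σ * sndHom k L.carrier ι κ (X σ))) *
            sndHom k L.carrier ι κ (Y σ) := by simp only [mul_assoc]
      _ = (fstHom k L.carrier ι κ (X ρ) * Q.sMat L.carrier ρ σ * sndHom k L.carrier ι κ (X σ)) *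
          s' * (fstHom k L.carrier ι κ (Y ρ) * Q.sMat L.carrier ρ σ *
            sndHom k L.carrier ι κ (Y σ)) := by
          rw [← h2, ← mul_assoc (fstHom k L.carrier ι κ (Y ρ)), h1, h3]
          simp only [mul_assoc]
      _ = _ := by
          rw [hX.fusion, hY.fusion, mul_assoc (X (tensRep ρ σ)), hs1]
          simp only [mul_assoc, one_mul]

end Coaction

/-! ### Moment families in braided tensor products -/

section Braided

variable {k : Type u} [Field k] {H : Type v} [Ring H] [HopfAlgebra k H] (Q : RMatrix k H)
variable (M N : HModAlg k H)

namespace RMatrix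

/-- The unit of the other factor absorbs its half of Δ(h) through the counit. -/
lemma braided_act_inl (m : M.carrier) (h : H) :
    Q.braidedInl M N (M.act m h) = (Q.braided M N).act (Q.braidedInl M N m) h := by
  change M.act m h ⊗ₜ[k] (1 : N.carrier) = TensorProduct.map (M.act m) (N.act 1)
    (Algebra.TensorProduct.map (AlgHom.id k H) (AlgHom.id k H) (Coalgebra.comul (R := k) h))
  rw [map_id_id]
  have e : ∀ X : H ⊗[k] H, TensorProduct.map (M.act m) (N.act 1) X = M.act m
      (TensorProduct.rid k H ((Coalgebra.counit (R := k) (A := H)).lTensor H X)) ⊗ₜ[k] 1 := by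
    intro X
    induction X with
    | zero => simp
    | add X Y hX hY => simp only [map_add, hX, hY, TensorProduct.add_tmul]
    | tmul a b => simp [N.one_act, Algebra.algebraMap_eq_smul_one, TensorProduct.smul_tmul]
  rw [e, Coalgebra.lTensor_counit_comul]
  simp

lemma braided_act_inr (n : N.carrier) (h : H) :
    Q.braidedInr M N (N.act n h) = (Q.braided M N).act (Q.braidedInr M N n) h := by
  change (1 : M.carrier) ⊗ₜ[k] N.act n h = TensorProduct.map (M.act 1) (N.act n)
    (Algebra.TensorProduct.map (AlgHom.id k H) (AlgHom.id k H) (Coalgebra.comul (R := k) h))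
  rw [map_id_id]
  have e : ∀ X : H ⊗[k] H, TensorProduct.map (M.act 1) (N.act n) X = 1 ⊗ₜ[k] N.act n
      (TensorProduct.lid k H ((Coalgebra.counit (R := k) (A := H)).rTensor H X)) := by
    intro X
    induction X with
    | zero => simp
    | add X Y hX hY => simp only [map_add, hX, hY, TensorProduct.tmul_add]
    | tmul a b => simp [M.one_act, Algebra.algebraMap_eq_smul_one, TensorProduct.smul_tmul]
  rw [e, Coalgebra.rTensor_counit_comul]
  simp

end RMatrix

/-- The two units meet in the middle, so χ acts through its counit only: factors already in normal
order multiply without correction. -/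
lemma ModAlg.twCore_one_one {D : Type v} [Ring D] [Algebra k D] {δ : D →ₐ[k] D ⊗[k] D}
    {ε : D →ₐ[k] k} {M N : ModAlg.{u, v, w} δ ε} {χ : D ⊗[k] D} (hχ : IsBichar δ ε χ)
    (m : M.carrier) (n : N.carrier) : ModAlg.twCore M N χ m 1 1 n = m ⊗ₜ[k] n := by
  have h : ∀ X : D ⊗[k] D, ModAlg.twCore M N X m 1 1 n = m ⊗ₜ[k] (N.act 1
      (Algebra.TensorProduct.rid k k D (Algebra.TensorProduct.map (AlgHom.id k D) ε X)) * n) := by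
    intro X
    induction X with
    | zero => simp
    | add X Y hX hY =>
      rw [ModAlg.twCore_add, hX, hY, map_add, map_add, map_add, add_mul, TensorProduct.tmul_add]
    | tmul a b =>
      simp [M.one_act, Algebra.algebraMap_eq_smul_one, TensorProduct.smul_tmul]
  rw [h, hχ.counit_right, N.act_one, one_mul]

namespace RMatrix

lemma braided_inl_mul_inr (m : M.carrier) (n : N.carrier) :
    Q.braidedInl M N m * Q.braidedInr M N n = (m ⊗ₜ[k] n : M.carrier ⊗[k] N.carrier) :=
  ModAlg.twCore_one_one Q.isBichar_R' m n

variable {M N} in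
lemma braided_induction {P : (Q.braided M N).carrier → Prop}
    (h : ∀ m n, P (Q.braidedInl M N m * Q.braidedInr M N n))
    (hadd : ∀ x y, P x → P y → P (x + y)) (x : (Q.braided M N).carrier) : P x := by
  have h0 : P 0 := by simpa using h 0 0
  change M.carrier ⊗[k] N.carrier at x
  induction x with
  | zero => exact h0
  | add x y hx hy => exact hadd x y hx hy
  | tmul m n => exact Q.braided_inl_mul_inr M N m n ▸ h m n

/-- The exchange relation of the braided product. It is an instance of the hypothesis of
`commute_coact`. -/
lemma braided_inr_mul_inl (m : M.carrier) (n : N.carrier) :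
    Q.braidedInr M N n * Q.braidedInl M N m = leg Q.R
      ((Q.braidedInl M N).toLinearMap ∘ₗ M.act m) ((Q.braidedInr M N).toLinearMap ∘ₗ N.act n) := by
  have h : ∀ X : H ⊗[k] H, ModAlg.twCore M N (TensorProduct.comm k H H X) 1 n m 1 =
      (leg X ((Q.braidedInl M N).toLinearMap ∘ₗ M.act m)
        ((Q.braidedInr M N).toLinearMap ∘ₗ N.act n) : (Q.braided M N).carrier) := by
    intro X
    induction X with
    | zero => rw [map_zero, ModAlg.twCore_zero, leg_zero]; rfl
    | add X Y hX hY => rw [map_add, ModAlg.twCore_add, hX, hY, leg_add]; rfl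
    | tmul a b =>
      rw [leg_tmul, TensorProduct.comm_tmul, ModAlg.twCore_tmul, one_mul, mul_one]
      exact (Q.braided_inl_mul_inr M N _ _).symm
  exact h Q.R

/-- The exchange relation solved for the other order: it has the same form, with the factors
interchanged and R replaced by R'⁻¹. This is why the opposite coaction appears on one side of the
moment equation. -/
lemma braided_inl_mul_inr' (m : M.carrier) (n : N.carrier) :
    Q.braidedInl M N m * Q.braidedInr M N n = leg Q.opp.R
      ((Q.braidedInr M N).toLinearMap ∘ₗ N.act n) ((Q.braidedInl M N).toLinearMap ∘ₗ M.act m) := by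
  let F : H ⊗[k] H →ₗ[k] (Q.braided M N).carrier :=
    { toFun := fun X => leg X ((Q.braidedInl M N).toLinearMap ∘ₗ M.act m)
        ((Q.braidedInr M N).toLinearMap ∘ₗ N.act n)
      map_add' := fun X Y => leg_add _ _ _ _
      map_smul' := fun c X => by simp [leg] }
  have hF : ∀ a b, F (a ⊗ₜ[k] b) = Q.braidedInl M N (M.act m a) * Q.braidedInr M N (N.act n b) :=
    fun a b => leg_tmul a b ((Q.braidedInl M N).toLinearMap ∘ₗ M.act m)
      ((Q.braidedInr M N).toLinearMap ∘ₗ N.act n)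
  have h2 : ∀ X : H ⊗[k] H, leg (TensorProduct.comm k H H X)
      ((Q.braidedInr M N).toLinearMap ∘ₗ N.act n) ((Q.braidedInl M N).toLinearMap ∘ₗ M.act m) =
      F (X * Q.R) := by
    intro X
    induction X with
    | zero => simp
    | add X Y hX hY => rw [map_add, leg_add, hX, hY, add_mul, map_add]
    | tmul a b =>
      rw [TensorProduct.comm_tmul, leg_tmul]
      refine (Q.braided_inr_mul_inl M N _ _).trans ?_
      generalize Q.R = Z
      induction Z with
      | zero => simp
      | add X Y hX hY => rw [leg_add, hX, hY, mul_add, map_add]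
      | tmul c d => simp [hF, M.act_mul, N.act_mul]
  refine Eq.trans ?_ (h2 Q.Rinv).symm
  rw [Q.Rinv_mul_R, Algebra.TensorProduct.one_def, hF, M.act_one, N.act_one]

end RMatrix

variable {M N}

/-- The product of two moment families in a braided tensor product. -/
lemma IsMomentFamily.braided {Q : RMatrix k H} {X : MatFamily k H M.carrier}
    {Y : MatFamily k H N.carrier} (hX : IsMomentFamily Q M X) (hY : IsMomentFamily Q N Y) :
    IsMomentFamily Q (Q.braided M N) (fun _ _ _ ρ =>
      (X ρ).map (Q.braidedInl M N) * (Y ρ).map (Q.braidedInr M N)) := by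
  have hXe : ∀ ⦃ι : Type⦄ [Fintype ι] [DecidableEq ι] (ρ : H →ₐ[k] Matrix ι ι k),
      IsEquivariant (Q.braided M N) ρ ((X ρ).map (Q.braidedInl M N)) := fun _ _ _ ρ =>
    (hX.equivariant ρ).map (Q.braided_act_inl M N)
  have hYe : ∀ ⦃ι : Type⦄ [Fintype ι] [DecidableEq ι] (ρ : H →ₐ[k] Matrix ι ι k),
      IsEquivariant (Q.braided M N) ρ ((Y ρ).map (Q.braidedInr M N)) := fun _ _ _ ρ =>
    (hY.equivariant ρ).map (Q.braided_act_inr M N)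
  -- The right-hand family commutes with the coaction on the left factor, by the exchange relation
  -- for R.
  have hYc : ∀ ⦃ι : Type⦄ [Fintype ι] [DecidableEq ι] (ρ : H →ₐ[k] Matrix ι ι k) (m : M.carrier),
      Commute ((Y ρ).map (Q.braidedInr M N))
        (Q.coact (Q.braided M N) ρ (Q.braidedInl M N m)) := by
    intro ι _ _ ρ m
    refine Q.commute_coact (hYe ρ) _ fun i j d => ?_
    rw [← Q.braided_act_inl]
    refine (Q.braided_inr_mul_inl M N _ _).trans ?_
    congr 1 <;> ext h <;> simp [Q.braided_act_inl, Q.braided_act_inr]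
  -- The left-hand family commutes with the opposite coaction on the right factor, by the exchange
  -- relation for R'⁻¹.
  have hXc : ∀ ⦃ι : Type⦄ [Fintype ι] [DecidableEq ι] (ρ : H →ₐ[k] Matrix ι ι k) (n : N.carrier),
      Commute ((X ρ).map (Q.braidedInl M N))
        (Q.opp.coact (Q.braided M N) ρ (Q.braidedInr M N n)) := by
    intro ι _ _ ρ n
    refine Q.opp.commute_coact (hXe ρ) _ fun i j d => ?_
    rw [← Q.braided_act_inr]
    refine (Q.braided_inl_mul_inr' M N _ _).trans ?_
    congr 1 <;> ext h <;> simp [Q.braided_act_inl, Q.braided_act_inr]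
  refine ⟨(hX.natural.map _).mul (hY.natural.map _),
    (hX.fused.map _).mul (hY.fused.map _) hXe fun _ _ _ _ _ _ ρ σ p q => hYc ρ (X σ p q),
    fun _ _ _ ρ => (hXe ρ).mul (hYe ρ), fun ι _ _ ρ x => ?_⟩
  induction x using Q.braided_induction with
  | hadd x y hx hy => rw [map_add, mul_add, hx, hy, map_add, add_mul]
  | h m n =>
    have h1 : (X ρ).map (Q.braidedInl M N) * Q.coact (Q.braided M N) ρ (Q.braidedInl M N m) =
        Q.opp.coact (Q.braided M N) ρ (Q.braidedInl M N m) * (X ρ).map (Q.braidedInl M N) := by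
      rw [Q.coact_map (Q.braided_act_inl M N), Q.opp.coact_map (Q.braided_act_inl M N),
        ← Matrix.map_mul, hX.moment, Matrix.map_mul]
    have h2 : (Y ρ).map (Q.braidedInr M N) * Q.coact (Q.braided M N) ρ (Q.braidedInr M N n) =
        Q.opp.coact (Q.braided M N) ρ (Q.braidedInr M N n) * (Y ρ).map (Q.braidedInr M N) := by
      rw [Q.coact_map (Q.braided_act_inr M N), Q.opp.coact_map (Q.braided_act_inr M N),
        ← Matrix.map_mul, hY.moment, Matrix.map_mul]
    rw [map_mul, map_mul]
    -- Y passes the coaction on m, the moment equations of the two factors are applied, and X passes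
    -- the opposite coaction on n.
    calc _ = (X ρ).map (Q.braidedInl M N) * ((Y ρ).map (Q.braidedInr M N) *
          Q.coact (Q.braided M N) ρ (Q.braidedInl M N m)) *
            Q.coact (Q.braided M N) ρ (Q.braidedInr M N n) := by simp only [mul_assoc]
      _ = (X ρ).map (Q.braidedInl M N) * Q.coact (Q.braided M N) ρ (Q.braidedInl M N m) *
          ((Y ρ).map (Q.braidedInr M N) * Q.coact (Q.braided M N) ρ (Q.braidedInr M N n)) := by
          rw [(hYc ρ m).eq]; simp only [mul_assoc]
      _ = Q.opp.coact (Q.braided M N) ρ (Q.braidedInl M N m) * ((X ρ).map (Q.braidedInl M N) *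
          Q.opp.coact (Q.braided M N) ρ (Q.braidedInr M N n)) *
            (Y ρ).map (Q.braidedInr M N) := by
          rw [h1, h2]; simp only [mul_assoc]
      _ = _ := by rw [(hXc ρ n).eq]; simp only [mul_assoc]

/-- Every element of the unit algebra is a scalar, and both coactions fix scalars. -/
lemma isMomentFamily_unit (Q : RMatrix k H) :
    IsMomentFamily Q (HModAlg.unit k H) (fun _ _ _ _ => 1) where
  natural := isNatural_one
  fused := isFused_one Q
  equivariant _ _ _ ρ := isEquivariant_one ρ
  moment ι _ _ ρ x := by
    have hx : x = algebraMap k (HModAlg.unit k H).carrier (ULift.down.{v} x) := by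
      rw [Algebra.algebraMap_eq_smul_one]
      exact ULift.down_injective (mul_one (ULift.down.{v} x)).symm
    rw [hx, AlgHom.commutes, AlgHom.commutes, one_mul, mul_one]

lemma IsMomentFamily.pow {Q : RMatrix k H} {X : MatFamily k H M.carrier}
    (hX : IsMomentFamily Q M X) (n : ℕ) : IsMomentFamily Q (Q.braidedPow M n) (fun _ _ _ ρ =>
      (List.ofFn fun i : Fin n => (X ρ).map (Q.powEmb M n i)).prod) := by
  induction n with
  | zero => exact isMomentFamily_unit Q
  | succ n ih =>
    -- The newest copy of `M` is the right-hand factor of the braided power, so the product is split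
    -- at its last factor.
    have e : (fun ι _ _ ρ => (List.ofFn fun i : Fin (n + 1) =>
        (X ρ).map (Q.powEmb M (n + 1) i)).prod : MatFamily k H (Q.braidedPow M (n + 1)).carrier) =
        (fun ι _ _ ρ => ((List.ofFn fun i : Fin n => (X ρ).map (Q.powEmb M n i)).prod).map
          (Q.braidedInl (Q.braidedPow M n) M) * (X ρ).map (Q.braidedInr (Q.braidedPow M n) M) :
          MatFamily k H (Q.braided (Q.braidedPow M n) M).carrier) := by
      funext ι _ _ ρ
      rw [List.ofFn_succ', List.concat_eq_append, List.prod_append, List.prod_singleton]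
      have e : ∀ Z : Matrix ι ι (Q.braidedPow M n).carrier,
        Matrix.map Z (Q.braidedInl (Q.braidedPow M n) M) =
        (Q.braidedInl (Q.braidedPow M n) M).mapMatrix Z := fun _ => rfl
      rw [e, map_list_prod, List.map_ofFn]
      congr 1
      · congr 2
        funext i
        have e1 : Q.powEmb M (n + 1) i.castSucc = (Q.braidedInl _ _).comp (Q.powEmb M n i) :=
          Fin.lastCases_castSucc (n := n) (motive := fun _ => M.carrier →ₐ[k]
            (Q.braided (Q.braidedPow M n) M).carrier) (last := Q.braidedInr _ _)
            (cast := fun i => (Q.braidedInl _ _).comp (Q.powEmb M n i)) i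
        rw [e1]
        rfl
      · have e1 : Q.powEmb M (n + 1) (Fin.last n) = Q.braidedInr _ _ :=
          Fin.lastCases_last (n := n) (motive := fun _ => M.carrier →ₐ[k]
            (Q.braided (Q.braidedPow M n) M).carrier) (last := Q.braidedInr _ _)
            (cast := fun i => (Q.braidedInl _ _).comp (Q.powEmb M n i))
        rw [e1]
        rfl
    exact e ▸ ih.braided hX

end Braided

/-! ### R-matrices acting by left and right multiplication -/

section SidedOperators

variable {k : Type u} [Field k] {H : Type v} [Ring H] [HopfAlgebra k H]
variable {E : Type w} [Ring E] [Algebra k E]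

/-- Left multiplication by `f(x)`. -/
def opL (f : H →ₐ[k] E) : H →ₐ[k] Module.End k E := (Algebra.lmul k E).comp f

/-- Right multiplication by `f(S(x))`. -/
def opR (f : H →ₐ[k] E) : H →ₐ[k] Module.End k E :=
  AlgHom.ofLinearMap ((LinearMap.mul k E).flip ∘ₗ f.toLinearMap ∘ₗ HopfAlgebra.antipode k)
    (by ext; simp) (fun x y => by ext; simp [HopfAlgebra.antipode_mul_antidistrib, mul_assoc])

@[simp] lemma opL_apply (f : H →ₐ[k] E) (x : H) (Z : E) : opL f x Z = f x * Z := rfl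
@[simp] lemma opR_apply (f : H →ₐ[k] E) (x : H) (Z : E) :
    opR f x Z = Z * f (HopfAlgebra.antipode k x) := rfl

/-- The operators of left and right multiplication by the legs `f` and `g`. -/
def sidedOps (f g : H →ₐ[k] E) : Fin 4 → (H →ₐ[k] Module.End k E)
  | 0 => opL f
  | 1 => opR f
  | 2 => opL g
  | 3 => opR g

lemma sidedOps_commute {f g : H →ₐ[k] E} (h : ∀ x y, Commute (f x) (g y)) :
    Comm (sidedOps f g) := by
  have h' : ∀ x y, g y * f x = f x * g y := fun x y => (h x y).eq.symm
  have h1 : ∀ x y (Z : E), g y * (f x * Z) = f x * (g y * Z) := fun x y Z => by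
    rw [← mul_assoc, h', mul_assoc]
  intro i j hij x y
  refine LinearMap.ext fun Z => ?_
  fin_cases i <;> fin_cases j <;>
    first
    | exact absurd rfl hij
    | simp [sidedOps, Module.End.mul_apply, mul_assoc, h', h1]

/-- The action of `(H ⊗ H) ⊗ (H ⊗ H)` by left and right multiplications. -/
def sidedHom (f g : H →ₐ[k] E) (h : ∀ x y, Commute (f x) (g y)) :
    (H ⊗[k] H) ⊗[k] (H ⊗[k] H) →ₐ[k] Module.End k E :=
  Algebra.TensorProduct.lift
    (Algebra.TensorProduct.lift (sidedOps f g 0) (sidedOps f g 1)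
      (sidedOps_commute h 0 1 (by decide)))
    (Algebra.TensorProduct.lift (sidedOps f g 2) (sidedOps f g 3)
      (sidedOps_commute h 2 3 (by decide)))
    (fun X Y => by
      induction X with
      | zero => simp
      | add X X' hX hX' => rw [map_add]; exact hX.add_left hX'
      | tmul a b =>
      induction Y with
      | zero => simp
      | add X X' hX hX' => rw [map_add]; exact hX.add_right hX'
      | tmul c d =>
        rw [Algebra.TensorProduct.lift_tmul, Algebra.TensorProduct.lift_tmul]
        exact ((sidedOps_commute h 0 2 (by decide) _ _).mul_right
          (sidedOps_commute h 0 3 (by decide) _ _)).mul_left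
          ((sidedOps_commute h 1 2 (by decide) _ _).mul_right
          (sidedOps_commute h 1 3 (by decide) _ _)))

lemma sidedHom_tmul (f g : H →ₐ[k] E) (h : ∀ x y, Commute (f x) (g y)) (a b c d : H) (Z : E) :
    sidedHom f g h ((a ⊗ₜ[k] b) ⊗ₜ[k] (c ⊗ₜ[k] d)) Z =
      f a * ((g c * (Z * g (HopfAlgebra.antipode k d))) * f (HopfAlgebra.antipode k b)) := by
  simp [sidedHom, sidedOps, Module.End.mul_apply]

lemma sidedHom_leg4 (f g : H →ₐ[k] E) (h : ∀ x y, Commute (f x) (g y)) (i : Fin 4) (x : H) :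
    sidedHom f g h (leg4 k H i x) = sidedOps f g i x := by
  fin_cases i <;> simp [leg4, sidedHom, Algebra.TensorProduct.one_def]

namespace RMatrix
variable (Q : RMatrix k H)

lemma Rinv_eq : Q.Rinv = TensorProduct.map (HopfAlgebra.antipode k) LinearMap.id Q.R := by
  let i1 : H →ₐ[k] H ⊗[k] H := Algebra.TensorProduct.includeLeft
  let i2 : H →ₐ[k] H ⊗[k] H := Algebra.TensorProduct.includeRight
  have hc : ∀ x y, Commute (i1 x) (i2 y) := fun x y => by simp [i1, i2, Commute, SemiconjBy]
  have h1 := Q.antipode_leg_mul i1 i2 hc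
  have h2 : ∀ X : H ⊗[k] H, leg X i1.toLinearMap i2.toLinearMap = X := by
    intro X
    induction X with
    | zero => simp
    | add X Y hX hY => rw [leg_add, hX, hY]
    | tmul a b => simp [i1, i2]
  have h3 : ∀ X : H ⊗[k] H, leg X (i1.toLinearMap ∘ₗ HopfAlgebra.antipode k) i2.toLinearMap =
      TensorProduct.map (HopfAlgebra.antipode k) LinearMap.id X := by
    intro X
    induction X with
    | zero => simp
    | add X Y hX hY => rw [leg_add, hX, hY, map_add]
    | tmul a b => simp [i1, i2]
  rw [h2, h3] at h1
  exact (left_inv_eq_right_inv h1 Q.R_mul_Rinv).symm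

lemma map_antipode_R :
    TensorProduct.map (HopfAlgebra.antipode k) (HopfAlgebra.antipode k) Q.R = Q.R := by
  let i1 : H →ₐ[k] H ⊗[k] H := Algebra.TensorProduct.includeLeft
  let i2 : H →ₐ[k] H ⊗[k] H := Algebra.TensorProduct.includeRight
  have hc : ∀ x y, Commute (i1 x) (i2 y) := fun x y => by simp [i1, i2, Commute, SemiconjBy]
  have h1 := Q.leg_antipode_antipode i1 i2 hc
  have h2 : ∀ X : H ⊗[k] H, leg X i1.toLinearMap i2.toLinearMap = X := by
    intro X
    induction X with
    | zero => simp
    | add X Y hX hY => rw [leg_add, hX, hY]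
    | tmul a b => simp [i1, i2]
  have h3 : ∀ X : H ⊗[k] H, leg X (i1.toLinearMap ∘ₗ HopfAlgebra.antipode k)
      (i2.toLinearMap ∘ₗ HopfAlgebra.antipode k) =
      TensorProduct.map (HopfAlgebra.antipode k) (HopfAlgebra.antipode k) X := by
    intro X
    induction X with
    | zero => simp
    | add X Y hX hY => rw [leg_add, hX, hY, map_add]
    | tmul a b => simp [i1, i2]
  rwa [h2, h3] at h1

lemma map_id_antipode_Rinv :
    TensorProduct.map LinearMap.id (HopfAlgebra.antipode k) Q.Rinv = Q.R := by
  rw [Rinv_eq, ← LinearMap.comp_apply, ← TensorProduct.map_comp]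
  exact Q.map_antipode_R

/-- `∑ F(X₁) G(S(X₂))` for `X = R⁻¹`. -/
lemma leg_Rinv_comp_antipode (F G : H →ₗ[k] E) :
    leg Q.Rinv F (G ∘ₗ HopfAlgebra.antipode k) = leg Q.R F G := by
  have h : ∀ X : H ⊗[k] H, leg X F (G ∘ₗ HopfAlgebra.antipode k) =
      leg (TensorProduct.map LinearMap.id (HopfAlgebra.antipode k) X) F G := by
    intro X
    induction X with
    | zero => simp
    | add X Y hX hY => rw [leg_add, hX, hY, map_add, leg_add]
    | tmul a b => simp
  rw [h, map_id_antipode_Rinv]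

/-- Left multiplication by `f` and right multiplication by `g ∘ S` can be pushed to the junction of
`X` and `Y`, because `X` commutes with `f` and `Y` with `g`. The antipode turns R⁻¹ into R by (id ⊗
S)(R⁻¹) = R, so the operator of R⁻¹ inserts an R between `X` and `Y`. -/
lemma leg_Rinv_opR (f g : H →ₐ[k] E) {X Y : E} (hX : ∀ x, Commute X (f x))
    (hY : ∀ x, Commute Y (g x)) :
    leg Q.Rinv (opL f).toLinearMap (opR g).toLinearMap (X * Y) =
      X * leg Q.R f.toLinearMap g.toLinearMap * Y := by
  have h : (opR g).toLinearMap = ((LinearMap.mul k E).flip ∘ₗ g.toLinearMap) ∘ₗ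
    HopfAlgebra.antipode k := rfl
  rw [h]
  have h1 := Q.leg_Rinv_comp_antipode (E := Module.End k E) (opL f).toLinearMap
    ((LinearMap.mul k E).flip ∘ₗ g.toLinearMap)
  rw [h1]
  generalize Q.R = Z
  induction Z with
  | zero => simp
  | add X Y hX hY => rw [leg_add, leg_add, LinearMap.add_apply, hX, hY, mul_add, add_mul]
  | tmul a b =>
    simp only [leg_tmul, Module.End.mul_apply, AlgHom.toLinearMap_apply, LinearMap.comp_apply,
      LinearMap.flip_apply, LinearMap.mul_apply', opL_apply]
    rw [mul_assoc X Y, (hY b).eq, ← mul_assoc, ← mul_assoc, ← mul_assoc, (hX a).eq]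

lemma at_opL_opL (f g : H →ₐ[k] E) (Z : E) : Q.at' (sidedOps f g) 2 0 Z =
    leg Q.R g.toLinearMap f.toLinearMap * Z := by
  change leg Q.R (opL g).toLinearMap (opL f).toLinearMap Z = _
  generalize Q.R = X
  induction X with
  | zero => simp
  | add X Y hX hY => rw [leg_add, leg_add, LinearMap.add_apply, hX, hY, add_mul]
  | tmul a b => simp [Module.End.mul_apply, mul_assoc]

/-- Right multiplications compose in the reverse order, which the commutation of the legs repairs;
the two antipodes disappear by (S ⊗ S)(R) = R. -/
lemma at_opR_opR {f g : H →ₐ[k] E} (hc : ∀ x y, Commute (f x) (g y)) (Z : E) :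
    Q.at' (sidedOps f g) 3 1 Z = Z * leg Q.R g.toLinearMap f.toLinearMap := by
  rw [← Q.leg_antipode_antipode g f (fun x y => (hc y x).symm)]
  change leg Q.R (opR g).toLinearMap (opR f).toLinearMap Z = _
  generalize Q.R = X
  induction X with
  | zero => simp
  | add X Y hX hY => rw [leg_add, leg_add, LinearMap.add_apply, hX, hY, mul_add]
  | tmul a b =>
    simp only [leg_tmul, Module.End.mul_apply, AlgHom.toLinearMap_apply, LinearMap.comp_apply,
      opR_apply]
    rw [mul_assoc, (hc _ _).eq]

lemma invAt_opL_opR {f g : H →ₐ[k] E} {X Y : E} (hX : ∀ x, Commute X (g x))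
    (hY : ∀ x, Commute Y (f x)) : Q.invAt (sidedOps f g) 2 1 (X * Y) =
      X * leg Q.R g.toLinearMap f.toLinearMap * Y :=
  Q.leg_Rinv_opR g f hX hY

lemma invAt_opL_opR' {f g : H →ₐ[k] E} {X Y : E} (hX : ∀ x, Commute X (f x))
    (hY : ∀ x, Commute Y (g x)) : Q.invAt (sidedOps f g) 0 3 (X * Y) =
      X * leg Q.R f.toLinearMap g.toLinearMap * Y :=
  Q.leg_Rinv_opR f g hX hY

end RMatrix
end SidedOperators

/-! ### Matrix coefficients under the two-sided action -/

section MatrixCoefficients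

variable {k : Type u} [Field k] {H : Type v} [Ring H] [HopfAlgebra k H]
variable {ι κ : Type} [Fintype ι] [DecidableEq ι] [Fintype κ] [DecidableEq κ]

/-- The matrix coefficients of a matrix representation indexed by a finite type. -/
def coeffDual (ρ : H →ₐ[k] Matrix ι ι k) (i j : ι) : restrictedDual k H :=
  ⟨WithConv.toConv (Matrix.entryLinearMap k k i j ∘ₗ ρ.toLinearMap), by
    -- The restricted dual is spanned by coefficients with indices in `Fin d`, hence the transport
    -- along `Fintype.equivFin`.
    have h := matrixCoeff_mem ((Matrix.reindexAlgEquiv k k (Fintype.equivFin ι)).toAlgHom.comp ρ)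
      (Fintype.equivFin ι i) (Fintype.equivFin ι j)
    have e : matrixCoeff ((Matrix.reindexAlgEquiv k k (Fintype.equivFin ι)).toAlgHom.comp ρ)
      (Fintype.equivFin ι i) (Fintype.equivFin ι j) =
        WithConv.toConv (Matrix.entryLinearMap k k i j ∘ₗ ρ.toLinearMap) := by
      ext h
      simp
    exact e ▸ h⟩

lemma coeffDual_apply (ρ : H →ₐ[k] Matrix ι ι k) (i j : ι) (h : H) :
    (coeffDual ρ i j).1.ofConv h = ρ h i j := rfl

lemma restrictedDual_ext {φ ψ : restrictedDual k H} (h : ∀ x, φ.1.ofConv x = ψ.1.ofConv x) :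
    φ = ψ := by
  ext x
  exact h x

lemma restrictedDual_sum_apply {α : Type*} (s : Finset α) (f : α → restrictedDual k H) (h : H) :
    (∑ a ∈ s, f a).1.ofConv h = ∑ a ∈ s, (f a).1.ofConv h := by
  classical
  induction s using Finset.induction_on with
  | empty => simp
  | insert a s ha ih =>
    rw [Finset.sum_insert ha, Finset.sum_insert ha, ← ih]; rfl

/-- By ρ(x h S(y)) = ρ(x) ρ(h) ρ(S(y)), the two-sided action on coefficients is multiplication of
the coefficient matrix by scalar matrices on either side. Consequently every formula for products in
the twisted algebras becomes a formula for sided operators on matrices. -/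
lemma dualAct_coeffDual (ρ : H →ₐ[k] Matrix ι ι k) (i j : ι) (x y : H) :
    dualAct (coeffDual ρ i j) (x ⊗ₜ[k] y) =
      ∑ p, ∑ q, (ρ x i p * ρ (HopfAlgebra.antipode k y) q j) • coeffDual ρ p q := by
  refine restrictedDual_ext fun h => ?_
  rw [dualAct_apply, restrictedDual_sum_apply]
  have e : ∀ p, (∑ q, (ρ x i p * ρ (HopfAlgebra.antipode k y) q j) • coeffDual ρ p q).1.ofConv h =
      ∑ q, ρ x i p * ρ (HopfAlgebra.antipode k y) q j * ρ h p q := fun p => by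
    rw [restrictedDual_sum_apply]; rfl
  simp only [e, sandwich_tmul, coeffDual_apply, map_mul, Matrix.mul_apply, Finset.mul_sum]
  exact Finset.sum_congr rfl fun p _ => Finset.sum_congr rfl fun q _ => by ring

lemma coeffDual_mul (ρ : H →ₐ[k] Matrix ι ι k) (σ : H →ₐ[k] Matrix κ κ k) (a b : ι × κ) :
    coeffDual ρ a.1 b.1 * coeffDual σ a.2 b.2 = coeffDual (tensRep ρ σ) a b := by
  refine restrictedDual_ext fun h => ?_
  rw [coeffDual_apply, tensRep_apply, conv_apply]
  change LinearMap.mul' k k (TensorProduct.map (coeffDual ρ a.1 b.1).1.ofConv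
    (coeffDual σ a.2 b.2).1.ofConv (Coalgebra.comul (R := k) h)) = _
  generalize Coalgebra.comul (R := k) h = X
  induction X with
  | zero => simp
  | add X Y hX hY => rw [map_add, map_add, hX, hY, leg_add, Matrix.add_apply]
  | tmul x y =>
    rw [leg_tmul]
    exact (fstHom_mul_sndHom_apply (k := k) _ _ _ _).symm

lemma coeffDual_intertwiner (ρ : H →ₐ[k] Matrix ι ι k) (σ : H →ₐ[k] Matrix κ κ k)
    (T : Matrix ι κ k) (h : ∀ h, ρ h * T = T * σ h) (i : ι) (l : κ) :
    ∑ j, T j l • coeffDual ρ i j = ∑ j, T i j • coeffDual σ j l := by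
  refine restrictedDual_ext fun x => ?_
  rw [restrictedDual_sum_apply, restrictedDual_sum_apply]
  have := congrFun (congrFun (h x) i) l
  rw [Matrix.mul_apply, Matrix.mul_apply] at this
  refine Eq.trans (Finset.sum_congr rfl fun j _ => ?_) this
  exact mul_comm _ _

variable {V : Type w} [Ring V] [Algebra k V]

lemma sided_left (m : restrictedDual k H →ₗ[k] V) (ρ : H →ₐ[k] Matrix ι ι k) (i j : ι) (x y : H) :
    m (dualAct (coeffDual ρ i j) (x ⊗ₜ[k] y)) =
      ∑ q, (∑ p, repL V ρ x i p * m (coeffDual ρ p q)) *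
        repL V ρ (HopfAlgebra.antipode k y) q j := by
  rw [dualAct_coeffDual]
  simp only [map_sum]
  rw [Finset.sum_comm]
  refine Finset.sum_congr rfl fun q _ => ?_
  rw [Finset.sum_mul]
  refine Finset.sum_congr rfl fun p _ => ?_
  rw [map_smul]
  change _ = algebraMap k V _ * _ * algebraMap k V _
  rw [← Algebra.commutes, ← mul_assoc, ← map_mul, Algebra.smul_def, mul_comm (ρ x i p)]
  rfl

/-- A bilinear map on matrix coefficients, acted upon on both arguments. -/
lemma sidedHom_coeffDual (m : restrictedDual k H →ₗ[k] restrictedDual k H →ₗ[k] V)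
    (ρ : H →ₐ[k] Matrix ι ι k) (σ : H →ₐ[k] Matrix κ κ k) (t : (H ⊗[k] H) ⊗[k] (H ⊗[k] H)) :
    sidedHom (repFst V κ ρ) (repSnd V ι σ) (commute_repFst_repSnd ρ σ) t
      (Matrix.of fun a b => m (coeffDual ρ a.1 b.1) (coeffDual σ a.2 b.2)) =
    Matrix.of fun a b => TensorProduct.lift m (TensorProduct.map
      (dualAct (coeffDual ρ a.1 b.1)) (dualAct (coeffDual σ a.2 b.2)) t) := by
  induction t with
  | zero => ext; simp
  | add X Y hX hY => ext; simp [hX, hY]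
  | tmul X Y =>
  induction X with
  | zero => ext; simp
  | add X X' hX hX' => simp only [TensorProduct.add_tmul, map_add, LinearMap.add_apply, hX, hX']; rfl
  | tmul x y =>
  induction Y with
  | zero => ext; simp
  | add X X' hX hX' => simp only [TensorProduct.tmul_add, map_add, LinearMap.add_apply, hX, hX']; rfl
  | tmul c d =>
    rw [sidedHom_tmul]
    ext a b
    rw [Matrix.of_apply, TensorProduct.map_tmul, TensorProduct.lift.tmul,
      ← LinearMap.flip_apply m, sided_left, ← mul_assoc]
    refine (mul_fstHom_apply (k := k) _ _ _ _).trans ?_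
    refine Finset.sum_congr rfl fun q _ => congrArg (· * _) ?_
    refine (fstHom_mul_apply (k := k) _ _ _ _).trans ?_
    refine Finset.sum_congr rfl fun p _ => congrArg (_ * ·) ?_
    rw [LinearMap.flip_apply, sided_left, ← mul_assoc]
    refine (mul_sndHom_apply (k := k) _ _ _ _).trans ?_
    refine Finset.sum_congr rfl fun q _ => congrArg (· * _) ?_
    exact (sndHom_mul_apply (k := k) _ _ _ _)

end MatrixCoefficients

/-! ### Families obtained from linear maps on the restricted dual -/

section CoefficientFamilies

variable {k : Type u} [Field k] {H : Type v} [Ring H] [HopfAlgebra k H]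
variable {V : Type w} [Ring V] [Algebra k V] (m : restrictedDual k H →ₗ[k] V)

/-- The images of the matrices of matrix coefficients under a linear map. -/
def coeffFamily : MatFamily k H V := fun _ _ _ ρ => Matrix.of fun i j => m (coeffDual ρ i j)

/-- An intertwiner between ρ and σ imposes linear relations between their coefficients, and a linear
map preserves them. The converse is `IsNatural.exists_linearMap`. -/
lemma isNatural_coeffFamily : IsNatural (coeffFamily m) := by
  intro ι κ _ _ _ _ ρ σ T h
  ext i l
  rw [Matrix.mul_apply, Matrix.mul_apply]
  have := congrArg m (coeffDual_intertwiner ρ σ T h i l)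
  simp only [map_sum, map_smul] at this
  refine Eq.trans (Finset.sum_congr rfl fun j _ => ?_)
    (this.trans (Finset.sum_congr rfl fun j _ => ?_))
  · rw [Matrix.map_apply, ← Algebra.commutes, ← Algebra.smul_def]; rfl
  · rw [Matrix.map_apply, ← Algebra.smul_def]; rfl

variable {m}

lemma sidedHom_F {E : Type w} [Ring E] [Algebra k E] (Q : RMatrix k H) (f g : H →ₐ[k] E)
    (hc : ∀ x y, Commute (f x) (g y)) : sidedHom f g hc Q.F =
      Q.at' (sidedOps f g) 2 1 * Q.at' (sidedOps f g) 3 1 := by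
  rw [RMatrix.F, RMatrix.Fat, map_mul,
    Q.map_at _ (sidedHom_leg4 f g hc 2) (sidedHom_leg4 f g hc 1),
    Q.map_at _ (sidedHom_leg4 f g hc 3) (sidedHom_leg4 f g hc 1)]

/-- The twist F = R₃₂R₄₂ acts by two operators. Brought to the left-hand side, R₃₂ inserts an R
between the factors, while R₄₂ multiplies `Z` by R on the right. The converse is
`mul_eq_sided_of_leg`. -/
lemma mul_leg_mul_of_sided {E : Type w} [Ring E] [Algebra k E] (Q : RMatrix k H) {f g : H →ₐ[k] E}
    (hc : ∀ x y, Commute (f x) (g y)) {X Y Z : E} (hX : ∀ x, Commute X (g x))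
    (hY : ∀ x, Commute Y (f x)) (h : X * Y = sidedHom f g hc Q.F Z) :
    X * leg Q.R g.toLinearMap f.toLinearMap * Y =
      Z * leg Q.R g.toLinearMap f.toLinearMap := by
  rw [sidedHom_F, Module.End.mul_apply] at h
  rw [← Q.invAt_opL_opR hX hY, h, ← Module.End.mul_apply,
    Q.inv_mul_at (sidedOps_commute hc) (by decide), Module.End.one_apply, Q.at_opR_opR hc]

variable {ι κ : Type} [Fintype ι] [DecidableEq ι] [Fintype κ] [DecidableEq κ]

lemma coeffFamily_triv (h1 : m 1 = 1) : coeffFamily m (trivRep k H) = 1 := by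
  ext i j
  have h : coeffDual (trivRep k H) i j = 1 := by
    refine restrictedDual_ext fun x => ?_
    rw [coeffDual_apply, trivRep_apply]
    simp
  change m (coeffDual (trivRep k H) i j) = _
  rw [h, Matrix.one_apply, if_pos rfl, h1]

/-- It serves two products: with `b` the convolution product and `t` the twist F for L_{0,1}, and
with `b` the reversed product and `t` the element γ for the handle algebra. -/
lemma fst_mul_snd_coeffFamily {m' : restrictedDual k H →ₗ[k] V}
    {b : restrictedDual k H →ₗ[k] restrictedDual k H →ₗ[k] V}
    {t : (H ⊗[k] H) ⊗[k] (H ⊗[k] H)} (hm : ∀ φ ψ, m φ * m' ψ =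
      TensorProduct.lift b (TensorProduct.map (dualAct φ) (dualAct ψ) t))
    (ρ : H →ₐ[k] Matrix ι ι k) (σ : H →ₐ[k] Matrix κ κ k) :
    fstHom k V ι κ (coeffFamily m ρ) * sndHom k V ι κ (coeffFamily m' σ) =
      sidedHom (repFst V κ ρ) (repSnd V ι σ) (commute_repFst_repSnd ρ σ) t
        (Matrix.of fun a c => b (coeffDual ρ a.1 c.1) (coeffDual σ a.2 c.2)) := by
  rw [sidedHom_coeffDual]
  ext a c
  rw [fstHom_mul_sndHom_apply]
  exact hm _ _

/-- The convolution product of two coefficients is a coefficient of the tensor product, so the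
product twisted by F, transcribed with R-matrices, is the fusion relation. -/
lemma isFused_coeffFamily (Q : RMatrix k H) (h1 : m 1 = 1) (hm : ∀ φ ψ, m φ * m ψ =
    TensorProduct.lift ((LinearMap.mul k (restrictedDual k H)).compr₂ m)
      (TensorProduct.map (dualAct φ) (dualAct ψ) Q.F)) : IsFused Q (coeffFamily m) where
  triv := coeffFamily_triv h1
  fusion ι κ _ _ _ _ ρ σ := by
    have e3 : coeffFamily m (tensRep ρ σ) = Matrix.of fun a b =>
        ((LinearMap.mul k (restrictedDual k H)).compr₂ m)
          (coeffDual ρ a.1 b.1) (coeffDual σ a.2 b.2) := by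
      ext a b
      change m (coeffDual (tensRep ρ σ) a b) = m (coeffDual ρ a.1 b.1 * coeffDual σ a.2 b.2)
      rw [coeffDual_mul]
    have h2 := fst_mul_snd_coeffFamily hm ρ σ
    rw [← e3] at h2
    exact mul_leg_mul_of_sided Q _ (commute_fstHom_repSnd σ _)
      (fun x => (commute_repFst_sndHom ρ x _).symm) h2

variable {L : ModAlg.{u, v, w} (Bialgebra.comulAlgHom k H) (Bialgebra.counitAlgHom k H)}

/-- The action on the matrix is h ↦ ∑ ρ(h₁) X ρ(S(h₂)), and convolution with ρ on the right cancels
the antipode. -/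
lemma isEquivariant_coeffFamily {m : restrictedDual k H →ₗ[k] L.carrier}
    (hm : ∀ φ h, L.act (m φ) h = m (dualAct φ (Coalgebra.comul (R := k) h)))
    (ρ : H →ₐ[k] Matrix ι ι k) : IsEquivariant L ρ (coeffFamily m ρ) := by
  set f := repL L.carrier ρ with hf
  have h1 : actMat L (coeffFamily m ρ) =
      conv (LinearMap.mulRight k (coeffFamily m ρ) ∘ₗ f.toLinearMap)
        (f.toLinearMap ∘ₗ HopfAlgebra.antipode k) := by
    ext h i j
    rw [actMat_apply, conv_apply]
    change L.act (m (coeffDual ρ i j)) h = _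
    rw [hm]
    generalize Coalgebra.comul (R := k) h = X
    induction X with
    | zero => simp
    | add X Y hX hY => rw [map_add, map_add, hX, hY, leg_add, Matrix.add_apply]
    | tmul x y =>
      rw [sided_left m, leg_tmul, Matrix.mul_apply]
      refine Finset.sum_congr rfl fun q _ => ?_
      rw [LinearMap.comp_apply, LinearMap.mulRight_apply, Matrix.mul_apply]
      rfl
  intro h
  rw [h1, conv_assoc, antipode_conv, conv_unitCounit]
  rfl

end CoefficientFamilies

/-! ### The loop algebra and the reflection equation -/

section LoopFamily

variable {k : Type u} [Field k] {H : Type v} [Ring H] [HopfAlgebra k H] (Q : RMatrix k H)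
variable {ι κ : Type} [Fintype ι] [DecidableEq ι] [Fintype κ] [DecidableEq κ]

namespace RMatrix

/-- `L_{0,1}` as a vector space. -/
def toLoop : restrictedDual k H →ₗ[k] Q.L01.carrier :=
  (LinearMap.id (R := k) (M := restrictedDual k H) :)

lemma exists_toLoop (x : Q.L01.carrier) : ∃ φ, Q.toLoop φ = x := ⟨(x : restrictedDual k H), rfl⟩

lemma toLoop_one : Q.toLoop 1 = 1 := rfl

/-- The matrices of matrix coefficients with entries in `L_{0,1}`. -/
def loopMat : MatFamily k H Q.L01.carrier := coeffFamily Q.toLoop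

lemma loop_mul (φ ψ : restrictedDual k H) : Q.toLoop φ * Q.toLoop ψ =
    TensorProduct.lift ((LinearMap.mul k (restrictedDual k H)).compr₂ Q.toLoop)
      (TensorProduct.map (dualAct φ) (dualAct ψ) Q.F) := by
  rw [TensorProduct.lift_compr₂]
  rfl

lemma loop_act (φ : restrictedDual k H) (h : H) :
    Q.L01.act (Q.toLoop φ) h = Q.toLoop (dualAct φ (Coalgebra.comul (R := k) h)) := rfl

lemma isNatural_loopMat : IsNatural Q.loopMat := isNatural_coeffFamily _

lemma isFused_loopMat : IsFused Q Q.loopMat := isFused_coeffFamily Q Q.toLoop_one Q.loop_mul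

lemma isEquivariant_loopMat (ρ : H →ₐ[k] Matrix ι ι k) :
    IsEquivariant Q.L01 ρ (Q.loopMat ρ) := isEquivariant_coeffFamily Q.loop_act ρ

lemma toLoop_mem_span (φ : restrictedDual k H) : Q.toLoop φ ∈ Submodule.span k
    {x | ∃ (d : ℕ) (ρ : H →ₐ[k] Matrix (Fin d) (Fin d) k) (i j : Fin d), x = Q.loopMat ρ i j} := by
  obtain ⟨φ, hφ⟩ := φ
  induction hφ using Submodule.span_induction with
  | mem φ h =>
    obtain ⟨d, ρ, i, j, rfl⟩ := h
    exact Submodule.subset_span ⟨d, ρ, i, j, rfl⟩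
  | zero => exact Submodule.zero_mem _
  | add φ ψ hφ hψ h h' => exact Submodule.add_mem _ h h'
  | smul c φ hφ h => exact Submodule.smul_mem _ c h

/-- Induction on the elements of `L_{0,1}`. -/
lemma loop_induction {P : Q.L01.carrier → Prop} (h0 : P 0) (hadd : ∀ x y, P x → P y → P (x + y))
    (hsmul : ∀ (c : k) x, P x → P (c • x))
    (h : ∀ (d : ℕ) (ρ : H →ₐ[k] Matrix (Fin d) (Fin d) k) (i j : Fin d), P (Q.loopMat ρ i j))
    (x : Q.L01.carrier) : P x := by
  obtain ⟨φ, rfl⟩ := Q.exists_toLoop x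
  have hx := Q.toLoop_mem_span φ
  generalize Q.toLoop φ = x at hx
  induction hx using Submodule.span_induction with
  | mem x hx => obtain ⟨d, ρ, i, j, rfl⟩ := hx; exact h d ρ i j
  | zero => exact h0
  | add x y _ _ hx hy => exact hadd x y hx hy
  | smul c x _ hx => exact hsmul c x hx

end RMatrix

variable {L : ModAlg.{u, v, w} (Bialgebra.comulAlgHom k H) (Bialgebra.counitAlgHom k H)} {Q}

/-- The reflection equation. -/
lemma IsFused.reflection {X : MatFamily k H L.carrier} (hX : IsFused Q X) (hn : IsNatural X)
    (he : ∀ ⦃ι : Type⦄ [Fintype ι] [DecidableEq ι] (ρ : H →ₐ[k] Matrix ι ι k),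
      IsEquivariant L ρ (X ρ))
    (ρ : H →ₐ[k] Matrix ι ι k) (σ : H →ₐ[k] Matrix κ κ k) :
    fstHom k L.carrier ι κ (X ρ) * Q.coactSnd L ρ (X σ) = X (tensRep ρ σ) ∧
    Q.opp.coactSnd L ρ (X σ) * fstHom k L.carrier ι κ (X ρ) = X (tensRep ρ σ) := by
  -- The coactions on the equivariant matrix `X σ` are conjugations. After multiplication by `sMat`
  -- the first half is the fusion relation, and after multiplication by `rMat` the second is
  -- `fusion'`.
  constructor
  · refine (Q.isUnit_sMat (L := L.carrier) ρ σ).mul_right_cancel ?_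
    rw [← hX.fusion, mul_assoc, Q.coactSnd_mul_sMat ρ (he σ), mul_assoc]
  · refine (Q.isUnit_rMat (L := L.carrier) ρ σ).mul_left_cancel ?_
    rw [← hX.fusion' hn, ← mul_assoc, Q.rMat_mul_opp_coactSnd ρ (he σ)]

/-- The entries of the coefficient matrices span L_{0,1}, and on them the moment equation is the
reflection equation, both of whose sides are the matrix of the tensor product. -/
lemma isMomentFamily_loopMat (Q : RMatrix k H) : IsMomentFamily Q Q.L01 Q.loopMat where
  natural := Q.isNatural_loopMat
  fused := Q.isFused_loopMat
  equivariant _ _ _ ρ := Q.isEquivariant_loopMat ρ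
  moment ι _ _ ρ x := by
    induction x using Q.loop_induction with
    | h0 => simp
    | hadd x y hx hy => rw [map_add, map_add, mul_add, add_mul, hx, hy]
    | hsmul c x hx => rw [map_smul, map_smul, mul_smul_comm, smul_mul_assoc, hx]
    | h d σ i j =>
      have h := Q.isFused_loopMat.reflection Q.isNatural_loopMat
        (fun _ _ _ ρ => Q.isEquivariant_loopMat ρ) ρ σ
      exact (Q.fst_mul_coactSnd_iff ρ Q.opp _ _ _).1 (h.1.trans h.2.symm) i j

end LoopFamily

/-! ### Word computations for a handle -/

section Words

variable {G : Type*} [Group G]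

/-- Here b₁ s b₂ s⁻¹ and r⁻¹ a₂ r a₁ stand for the values of B and A on a tensor product. The
exchange relations `h3`, `h4` and the commutation `h5` distribute the conjugate B A B⁻¹ over the two
legs, provided that the square (s r)² of the double braiding is inserted. -/
lemma word_handle {a1 a2 b1 b2 r s : G} (h3 : a1 * s * b2 = s * b2 * r * a1 * s)
    (h4 : a2 * r * b1 = r * b1 * s * a2 * r) (h5 : Commute b1 (s * b2 * r)) :
    (b1 * s * b2 * s⁻¹) * (s * r * (s * r)) * (r⁻¹ * a2 * r * a1) * (b1 * s * b2 * s⁻¹)⁻¹ =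
      s * (b2 * a2 * b2⁻¹) * s⁻¹ * (b1 * a1 * b1⁻¹) := by
  have e1 : a1 * (s * b2⁻¹ * s⁻¹) = r⁻¹ * b2⁻¹ * s⁻¹ * a1 := by
    have h : a1 = s * b2 * r * a1 * s * b2⁻¹ * s⁻¹ := by rw [← h3]; group
    conv_rhs => rw [h]
    group
  have e2 : b1 * s * a2 = r⁻¹ * a2 * r * b1 * r⁻¹ := by
    calc b1 * s * a2 = r⁻¹ * (r * b1 * s * a2 * r) * r⁻¹ := by group
      _ = _ := by rw [← h4]; group
  calc _ = (b1 * (s * b2 * r)) * s * a2 * r * (a1 * (s * b2⁻¹ * s⁻¹)) * b1⁻¹ := by group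
    _ = (s * b2 * r * b1) * s * a2 * r * (r⁻¹ * b2⁻¹ * s⁻¹ * a1) * b1⁻¹ := by rw [h5.eq, e1]
    _ = s * b2 * r * (b1 * s * a2) * b2⁻¹ * s⁻¹ * a1 * b1⁻¹ := by group
    _ = s * b2 * a2 * r * (b1 * (s * b2 * r)⁻¹) * a1 * b1⁻¹ := by rw [e2]; group
    _ = _ := by rw [h5.inv_right.eq]; group

/-- The factor c² by which the conjugates `g` fail to be multiplicative is the one by which the `w`
(the squares of the ribbon element) fail to be group-like. In the quotients w g⁻¹ the two defects
cancel. -/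
lemma word_ribbon {c s g1 g2 g12 w1 w2 w12 : G} (hw : w12 * (c * c) = w1 * w2)
    (hg : g12 * (c * c) = s * g2 * s⁻¹ * g1) (hs : Commute w2 s) (h1 : Commute w2 g1) :
    (w1 * g1⁻¹) * s * (w2 * g2⁻¹) = w12 * g12⁻¹ * s := by
  calc _ = w1 * g1⁻¹ * (s * w2) * g2⁻¹ := by group
    _ = w1 * (g1⁻¹ * w2) * s * g2⁻¹ := by rw [← hs.eq]; group
    _ = (w1 * w2) * (s * g2 * s⁻¹ * g1)⁻¹ * s := by rw [← h1.inv_right.eq]; group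
    _ = _ := by rw [← hw, ← hg]; group

/-- The fusion relation for v² B A⁻¹ B⁻¹. The exponent 2 of the ribbon element matches the square of
the double braiding in `word_handle`. -/
lemma word_fusion {E : Type*} [Ring E] {a1 b1 a2 b2 a12 b12 s r v1 v2 v12 : E}
    (ha1 : IsUnit a1) (hb1 : IsUnit b1) (ha2 : IsUnit a2) (hb2 : IsUnit b2) (ha12 : IsUnit a12)
    (hb12 : IsUnit b12) (hs : IsUnit s) (hr : IsUnit r) (hv1 : IsUnit v1) (hv2 : IsUnit v2)
    (hv12 : IsUnit v12) (x1 : a1 * s * b2 = s * b2 * r * a1 * s)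
    (x2 : a2 * r * b1 = r * b1 * s * a2 * r) (x3 : Commute b1 (s * b2 * r))
    (x4 : b1 * s * b2 = b12 * s) (x5 : a2 * r * a1 = r * a12) (x6 : Commute a12 (s * r))
    (x7 : Commute b12 (s * r)) (x8 : v12 * (s * r) = v1 * v2) (x9 : Commute v2 s)
    (x10 : Commute v2 a1) (x11 : Commute v2 b1) (x12 : Commute v12 (s * r)) (x13 : Commute v1 v2) :
    v1 ^ 2 * b1 * Ring.inverse a1 * Ring.inverse b1 * s *
        (v2 ^ 2 * b2 * Ring.inverse a2 * Ring.inverse b2) =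
      v12 ^ 2 * b12 * Ring.inverse a12 * Ring.inverse b12 * s := by
  -- All letters are invertible, so the computation takes place in the group of units.
  lift a1 to Eˣ using ha1
  lift b1 to Eˣ using hb1
  lift a2 to Eˣ using ha2
  lift b2 to Eˣ using hb2
  lift a12 to Eˣ using ha12
  lift b12 to Eˣ using hb12
  lift s to Eˣ using hs
  lift r to Eˣ using hr
  lift v1 to Eˣ using hv1
  lift v2 to Eˣ using hv2
  lift v12 to Eˣ using hv12
  simp only [Commute, SemiconjBy, Ring.inverse_unit] at *
  norm_cast at *
  replace x4 : b12 = b1 * s * b2 * s⁻¹ := by rw [x4]; group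
  replace x5 : a12 = r⁻¹ * a2 * r * a1 := by
    rw [mul_assoc, mul_assoc, ← mul_assoc a2, x5]; group
  have y := word_handle x1 x2 x3
  rw [← x4, ← x5] at y
  have c1 : Commute b12 (s * r * (s * r)) := Commute.mul_right x7 x7
  have c2 : Commute a12 (s * r * (s * r)) := Commute.mul_right x6 x6
  -- The square of the double braiding commutes with the values of A and B on the tensor product,
  -- and can be taken out of the conjugation.
  have y' : (b12 * a12 * b12⁻¹) * (s * r * (s * r)) =
      s * (b2 * a2 * b2⁻¹) * s⁻¹ * (b1 * a1 * b1⁻¹) := by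
    rw [← y, mul_assoc, c1.inv_left.eq, ← mul_assoc, mul_assoc b12 a12, c2.eq]
    simp only [mul_assoc]
  have h1 : Commute v2 (b1 * a1 * b1⁻¹) :=
    (Commute.mul_right x11 x10).mul_right (Commute.inv_right x11)
  have hw : v12 ^ 2 * (s * r * (s * r)) = v1 ^ 2 * v2 ^ 2 := by
    have c : Commute v1 v2 := x13
    rw [← c.mul_pow, ← x8, ← pow_two]
    exact (Commute.mul_pow x12 2).symm
  have z := word_ribbon (s := s) hw y' (Commute.pow_left x9 2) (h1.pow_left 2)
  simpa only [mul_inv_rev, inv_inv, mul_assoc] using z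

/-- Conjugation by b carries p to y; since p commutes with a, the conjugate b a⁻¹ b⁻¹ commutes with
y. -/
lemma word_conj_comm {E : Type*} [Ring E] {a b w y p : E} (ha : IsUnit a) (hb : IsUnit b)
    (h1 : y * b = b * p) (h2 : Commute a p) (hw : Commute w y) :
    Commute (w * b * Ring.inverse a * Ring.inverse b) y := by
  lift a to Eˣ using ha
  lift b to Eˣ using hb
  rw [Ring.inverse_unit, Ring.inverse_unit]
  have e1 : Commute ((b : E) * ↑a⁻¹ * ↑b⁻¹) y := by
    have h3 : (↑b⁻¹ : E) * y = p * ↑b⁻¹ := by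
      rw [Units.inv_mul_eq_iff_eq_mul, ← mul_assoc, ← h1, mul_assoc, Units.mul_inv, mul_one]
    change _ = _
    rw [mul_assoc, h3, ← mul_assoc, mul_assoc (b : E), h2.units_inv_left.eq, ← mul_assoc (b : E),
      ← h1]
    simp only [mul_assoc]
  simpa only [mul_assoc] using hw.mul_left e1

/-- Move p leftwards through the word: it commutes with b⁻¹, becomes z on passing a⁻¹ and y on
passing b, and y commutes with w. -/
lemma word_conj_slide {E : Type*} [Ring E] {a b w y z p : E} (ha : IsUnit a) (hb : IsUnit b)
    (h1 : a * z = p * a) (h2 : Commute b p) (h3 : b * z = y * b) (hw : Commute w y) :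
    w * b * Ring.inverse a * Ring.inverse b * p = y * (w * b * Ring.inverse a * Ring.inverse b) := by
  lift a to Eˣ using ha
  lift b to Eˣ using hb
  rw [Ring.inverse_unit, Ring.inverse_unit]
  have h4 : (↑a⁻¹ : E) * p = z * ↑a⁻¹ := by
    rw [Units.inv_mul_eq_iff_eq_mul, ← mul_assoc, h1, mul_assoc, Units.mul_inv, mul_one]
  rw [mul_assoc _ _ p, h2.units_inv_left.eq, ← mul_assoc, mul_assoc (w * b), h4, mul_assoc w,
    ← mul_assoc (b : E), h3, ← mul_assoc, ← mul_assoc, ← mul_assoc, ← mul_assoc, hw.eq]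
  simp only [mul_assoc]

end Words

/-! ### The exchange relation, the ribbon element and the conjugated family -/

section Handle

variable {k : Type u} [Field k] {H : Type v} [Ring H] [HopfAlgebra k H]
variable {L : Type w} [Ring L] [Algebra k L]
variable {ι κ : Type} [Fintype ι] [DecidableEq ι] [Fintype κ] [DecidableEq κ]

lemma RMatrix.swapHom_rMat (Q : RMatrix k H) (ρ : H →ₐ[k] Matrix ι ι k)
    (σ : H →ₐ[k] Matrix κ κ k) : swapHom k L ι κ (Q.rMat L σ ρ) = Q.sMat L ρ σ := by
  exact RMatrix.leg_eq_of_map _ _ (fun _ => rfl) (fun _ => swapHom_sndHom _)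

/-- The double braiding is an intertwiner of ρ ⊗ σ with itself, by RΔ = ΔᵒᵖR used twice. -/
lemma IsNatural.commute_sMat_mul_rMat {X : MatFamily k H L} (hX : IsNatural X) (Q : RMatrix k H)
    (ρ : H →ₐ[k] Matrix ι ι k) (σ : H →ₐ[k] Matrix κ κ k) :
    Commute (X (tensRep ρ σ)) (Q.sMat L ρ σ * Q.rMat L ρ σ) := by
  have h := hX (tensRep ρ σ) (tensRep ρ σ) (Q.sMat k ρ σ * Q.rMat k ρ σ) fun h => by
    have h1 := Q.leg_R_mul_conv _ _ (commute_repFst_repSnd (L := k) ρ σ) h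
    have h2 := Q.leg_R_mul_conv _ _ (commute_repSnd_repFst (L := k) ρ σ) h
    rw [tensRep_apply, ← mul_assoc, RMatrix.sMat, ← h2, mul_assoc, RMatrix.rMat, ← h1, mul_assoc]
  have e : (Q.sMat k ρ σ * Q.rMat k ρ σ).map (algebraMap k L) =
      Q.sMat L ρ σ * Q.rMat L ρ σ := by
    rw [← Q.scalarMat_rMat (L := L), ← Q.scalarMat_sMat (L := L), ← map_mul]; rfl
  rw [e] at h
  exact h

/-- `s X₂ r` commutes with `X₁`. -/
lemma IsFused.commute_conj {Q : RMatrix k H} {X : MatFamily k H L} (hX : IsFused Q X)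
    (hn : IsNatural X) (ρ : H →ₐ[k] Matrix ι ι k) (σ : H →ₐ[k] Matrix κ κ k) :
    Commute (fstHom k L ι κ (X ρ))
      (Q.sMat L ρ σ * sndHom k L ι κ (X σ) * Q.rMat L ρ σ) := by
  change _ = _
  calc _ = fstHom k L ι κ (X ρ) * Q.sMat L ρ σ * sndHom k L ι κ (X σ) * Q.rMat L ρ σ := by
        simp only [mul_assoc]
    _ = X (tensRep ρ σ) * (Q.sMat L ρ σ * Q.rMat L ρ σ) := by rw [hX.fusion]; simp only [mul_assoc]
    _ = Q.sMat L ρ σ * (Q.rMat L ρ σ * X (tensRep ρ σ)) := by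
        rw [(hn.commute_sMat_mul_rMat Q ρ σ).eq]; simp only [mul_assoc]
    _ = _ := by rw [← hX.fusion' hn]; simp only [mul_assoc]

/-- The exchange relation of the handle algebra. -/
def IsExchange (Q : RMatrix k H) (A B : MatFamily k H L) : Prop :=
  ∀ ⦃ι κ : Type⦄ [Fintype ι] [DecidableEq ι] [Fintype κ] [DecidableEq κ]
    (ρ : H →ₐ[k] Matrix ι ι k) (σ : H →ₐ[k] Matrix κ κ k),
    fstHom k L ι κ (A ρ) * Q.sMat L ρ σ * sndHom k L ι κ (B σ) =
      Q.sMat L ρ σ * sndHom k L ι κ (B σ) * Q.rMat L ρ σ * fstHom k L ι κ (A ρ) * Q.sMat L ρ σ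

lemma IsExchange.swap {Q : RMatrix k H} {A B : MatFamily k H L} (h : IsExchange Q A B)
    (ρ : H →ₐ[k] Matrix ι ι k) (σ : H →ₐ[k] Matrix κ κ k) :
    sndHom k L ι κ (A σ) * Q.rMat L ρ σ * fstHom k L ι κ (B ρ) =
      Q.rMat L ρ σ * fstHom k L ι κ (B ρ) * Q.sMat L ρ σ * sndHom k L ι κ (A σ) *
        Q.rMat L ρ σ := by
  have h1 := congrArg (swapHom k L ι κ) (h σ ρ)
  simpa only [map_mul, Q.swapHom_sMat, Q.swapHom_rMat, swapHom_fstHom, swapHom_sndHom] using h1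

lemma Ribbon.conv_v_mul (Q : Ribbon k H) (f g : H →ₐ[k] L) (h : ∀ x y, Commute (f x) (g y)) :
    conv f.toLinearMap g.toLinearMap Q.v *
        (leg Q.R g.toLinearMap f.toLinearMap * leg Q.R f.toLinearMap g.toLinearMap) =
      f Q.v * g Q.v := by
  rw [conv_apply, ← leg_comm Q.R f.toLinearMap g.toLinearMap h, ← leg_mul _ _ _ _ h,
    ← leg_mul _ _ _ _ h]
  refine (congrArg (fun X => leg X f.toLinearMap g.toLinearMap) Q.comul_v).trans ?_
  rw [leg_tmul]; rfl

lemma Ribbon.repL_v_mul (Q : Ribbon k H) (ρ : H →ₐ[k] Matrix ι ι k)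
    (σ : H →ₐ[k] Matrix κ κ k) :
    repL L (tensRep ρ σ) Q.v * (Q.sMat L ρ σ * Q.rMat L ρ σ) =
      repFst L κ ρ Q.v * repSnd L ι σ Q.v := by
  rw [repL_tensRep]
  exact Q.conv_v_mul _ _ (commute_repFst_repSnd ρ σ)

/-- The family `v² B A⁻¹ B⁻¹`. -/
def conjFamily (v : H) (A B : MatFamily k H L) : MatFamily k H L :=
  fun _ _ _ ρ => repL L ρ (v ^ 2) * B ρ * Ring.inverse (A ρ) * Ring.inverse (B ρ)

variable {A B : MatFamily k H L}

lemma isNatural_conjFamily (v : H) (hA : IsNatural A) (hB : IsNatural B)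
    (hAu : ∀ ⦃ι : Type⦄ [Fintype ι] [DecidableEq ι] (ρ : H →ₐ[k] Matrix ι ι k), IsUnit (A ρ))
    (hBu : ∀ ⦃ι : Type⦄ [Fintype ι] [DecidableEq ι] (ρ : H →ₐ[k] Matrix ι ι k), IsUnit (B ρ)) :
    IsNatural (conjFamily v A B) :=
  (((isNatural_repL (v ^ 2)).mul hB).mul (hA.inverse hAu)).mul (hB.inverse hBu)

lemma Ribbon.sq_central (Q : Ribbon k H) (h : H) : Q.v ^ 2 * h = h * Q.v ^ 2 := by
  exact (Commute.pow_left (Q.central h) 2).eq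

/-- Apply x ⊗ y ↦ S(x) y to Δ(v) = (v ⊗ v)(R'R)⁻¹. The left side is ε(v) = 1, while the right side
is a multiple of v because v is central and S(v) = v. -/
lemma Ribbon.isUnit_v (Q : Ribbon k H) : IsUnit Q.v := by
  have hu : IsUnit (Q.R' * Q.R) :=
    (IsUnit.map (Algebra.TensorProduct.comm k H H) Q.isUnit_R).mul Q.isUnit_R
  obtain ⟨Y, hY, -⟩ := isUnit_iff_exists.mp hu
  have h1 := congrArg (fun X => leg (X * Y) (HopfAlgebra.antipode k) LinearMap.id) Q.comul_v
  beta_reduce at h1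
  rw [mul_assoc, hY, mul_one] at h1
  have h2 : leg (Coalgebra.comul (R := k) Q.v) (HopfAlgebra.antipode k) LinearMap.id = 1 := by
    have := LinearMap.congr_fun (antipode_conv (AlgHom.id k H)) Q.v
    refine Eq.trans this ?_
    simp [unitCounit, Algebra.ofId_apply, Q.counit_v]
  have h3 : ∀ Y : H ⊗[k] H, leg (Q.v ⊗ₜ[k] Q.v * Y) (HopfAlgebra.antipode k) LinearMap.id =
      Q.v * (Q.v * leg Y (HopfAlgebra.antipode k) LinearMap.id) := by
    intro Y
    induction Y with
    | zero => simp
    | add X Y hX hY => rw [mul_add, leg_add, hX, hY, leg_add, mul_add, mul_add]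
    | tmul a b =>
      rw [Algebra.TensorProduct.tmul_mul_tmul, leg_tmul, leg_tmul,
        HopfAlgebra.antipode_mul_antidistrib, Q.antipode_v, LinearMap.id_apply, LinearMap.id_apply,
        ← Q.central, mul_assoc, ← mul_assoc (HopfAlgebra.antipode k a), ← Q.central, mul_assoc]
  rw [h2, h3] at h1
  exact ⟨⟨Q.v, _, h1.symm, by rw [← Q.central]; exact h1.symm⟩, rfl⟩

lemma map_inverse_of_isUnit {R S F : Type*} [Ring R] [Ring S] [FunLike F R S] [RingHomClass F R S]
    (f : F) {x : R} (hx : IsUnit x) : f (Ring.inverse x) = Ring.inverse (f x) := by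
  obtain ⟨u, rfl⟩ := hx
  rw [Ring.inverse_unit]
  exact (Ring.inverse_unit (Units.map (f : R →* S) u)).symm

/-- Without the factor v² the relation would be off by the square of the double braiding. -/
lemma isFused_conjFamily {Q : Ribbon k H} (hA : IsFused Q.toRMatrix A) (hAn : IsNatural A)
    (hB : IsFused Q.toRMatrix B) (hBn : IsNatural B) (hx : IsExchange Q.toRMatrix A B)
    (hAu : ∀ ⦃ι : Type⦄ [Fintype ι] [DecidableEq ι] (ρ : H →ₐ[k] Matrix ι ι k), IsUnit (A ρ))
    (hBu : ∀ ⦃ι : Type⦄ [Fintype ι] [DecidableEq ι] (ρ : H →ₐ[k] Matrix ι ι k), IsUnit (B ρ)) :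
    IsFused Q.toRMatrix (conjFamily Q.v A B) where
  triv := by
    have h : repL L (trivRep k H) (Q.v ^ 2) = 1 := by
      have : trivRep k H Q.v = 1 := by
        ext i j
        rw [trivRep_apply, Q.counit_v]
        simp
      rw [map_pow, repL, AlgHom.comp_apply, this, map_one, one_pow]
    simp [conjFamily, hA.triv, hB.triv, h]
  fusion ι κ _ _ _ _ ρ σ := by
    have x1 := hx ρ σ
    have x2 := hx.swap ρ σ
    have x3 := hB.commute_conj hBn ρ σ
    have x4 := hB.fusion ρ σ
    have x5 := hA.fusion' hAn ρ σ
    have x6 := hAn.commute_sMat_mul_rMat Q.toRMatrix ρ σ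
    have x7 := hBn.commute_sMat_mul_rMat Q.toRMatrix ρ σ
    have x8 := Q.repL_v_mul (L := L) ρ σ
    have x9 : Commute (repSnd L ι σ Q.v) (Q.sMat L ρ σ) :=
      commute_leg _ _ _ (fun x => by
        change _ * _ = _ * _
        rw [AlgHom.toLinearMap_apply, ← map_mul, Q.central, map_mul])
        (fun x => commute_repSnd_repFst ρ σ _ _)
    have x10 : Commute (repSnd L ι σ Q.v) (fstHom k L ι κ (A ρ)) :=
      (commute_fstHom_repSnd σ _ _).symm
    have x11 : Commute (repSnd L ι σ Q.v) (fstHom k L ι κ (B ρ)) :=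
      (commute_fstHom_repSnd σ _ _).symm
    have x12 : Commute (repL L (tensRep ρ σ) Q.v) (Q.sMat L ρ σ * Q.rMat L ρ σ) :=
      (isNatural_repL Q.v).commute_sMat_mul_rMat Q.toRMatrix ρ σ
    have x13 : Commute (repFst L κ ρ Q.v) (repSnd L ι σ Q.v) := commute_repFst_repSnd ρ σ _ _
    have e1 : fstHom k L ι κ (repL L ρ Q.v) = repFst L κ ρ Q.v := rfl
    have e2 : sndHom k L ι κ (repL L σ Q.v) = repSnd L ι σ Q.v := rfl
    have i1 := map_inverse_of_isUnit (fstHom k L ι κ) (hAu ρ)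
    have i2 := map_inverse_of_isUnit (fstHom k L ι κ) (hBu ρ)
    have i3 := map_inverse_of_isUnit (sndHom k L ι κ) (hAu σ)
    have i4 := map_inverse_of_isUnit (sndHom k L ι κ) (hBu σ)
    rw [conjFamily, conjFamily, conjFamily]
    rw [map_pow, map_pow, map_pow, map_mul, map_mul, map_mul, map_mul, map_mul, map_mul, i1, i2,
      i3, i4, map_pow, map_pow, e1, e2]
    exact word_fusion ((hAu ρ).map _) ((hBu ρ).map _) ((hAu σ).map _) ((hBu σ).map _)
      (hAu _) (hBu _) (Q.isUnit_sMat ρ σ) (Q.isUnit_rMat ρ σ) (Q.isUnit_v.map _)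
      (Q.isUnit_v.map _) (Q.isUnit_v.map _) x1 x2 x3 x4 x5 x6 x7 x8 x9 x10 x11 x12 x13

end Handle

/-! ### The moment equation for a handle -/

section HandleMoment

variable {k : Type u} [Field k] {H : Type v} [Ring H] [HopfAlgebra k H]
variable {L : ModAlg.{u, v, w} (Bialgebra.comulAlgHom k H) (Bialgebra.counitAlgHom k H)}
variable {A B : MatFamily k H L.carrier}
variable {ι κ : Type} [Fintype ι] [DecidableEq ι] [Fintype κ] [DecidableEq κ]

/-- Moving A past the coaction on B does not give the opposite coaction on B; it gives the
intermediate element s B₂ r. The conjugated family has to complete the passage. -/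
lemma IsExchange.fst_mul_coactSnd {Q : RMatrix k H} (hx : IsExchange Q A B)
    (ρ : H →ₐ[k] Matrix ι ι k) {σ : H →ₐ[k] Matrix κ κ k} (hB : IsEquivariant L σ (B σ)) :
    fstHom k L.carrier ι κ (A ρ) * Q.coactSnd L ρ (B σ) = Q.sMat L.carrier ρ σ *
      sndHom k L.carrier ι κ (B σ) * Q.rMat L.carrier ρ σ * fstHom k L.carrier ι κ (A ρ) := by
  refine (Q.isUnit_sMat (L := L.carrier) ρ σ).mul_right_cancel ?_
  rw [mul_assoc, Q.coactSnd_mul_sMat ρ hB, ← mul_assoc, hx]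

/-- The mirrored exchange relation, read through the conjugation formula for the opposite coaction.
-/
lemma IsExchange.opp_coactSnd_mul_fst {Q : RMatrix k H} (hx : IsExchange Q A B)
    (ρ : H →ₐ[k] Matrix ι ι k) {σ : H →ₐ[k] Matrix κ κ k} (hA : IsEquivariant L σ (A σ)) :
    Q.opp.coactSnd L ρ (A σ) * fstHom k L.carrier ι κ (B ρ) = fstHom k L.carrier ι κ (B ρ) *
      (Q.sMat L.carrier ρ σ * sndHom k L.carrier ι κ (A σ) * Q.rMat L.carrier ρ σ) := by
  refine (Q.isUnit_rMat (L := L.carrier) ρ σ).mul_left_cancel ?_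
  rw [← mul_assoc, Q.rMat_mul_opp_coactSnd ρ hA, hx.swap]
  simp only [mul_assoc]

lemma RMatrix.commute_central_coactSnd (Q : RMatrix k H) (ρ : H →ₐ[k] Matrix ι ι k) {z : H}
    (hz : ∀ h, z * h = h * z) (X : Matrix κ κ L.carrier) :
    Commute (repFst L.carrier κ ρ z) (Q.coactSnd L ρ X) :=
  commute_leg _ _ _ (fun _ => commute_repFst_sndHom ρ _ _) fun x => by
    change _ * repFst L.carrier κ ρ x = repFst L.carrier κ ρ x * _
    rw [← map_mul, hz, map_mul]

/-- The data of the two generating families of a handle. -/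
structure IsHandle (Q : RMatrix k H)
    (L : ModAlg.{u, v, w} (Bialgebra.comulAlgHom k H) (Bialgebra.counitAlgHom k H))
    (A B : MatFamily k H L.carrier) : Prop where
  naturalA : IsNatural A
  naturalB : IsNatural B
  fusedA : IsFused Q A
  fusedB : IsFused Q B
  equivariantA : ∀ ⦃ι : Type⦄ [Fintype ι] [DecidableEq ι] (ρ : H →ₐ[k] Matrix ι ι k),
    IsEquivariant L ρ (A ρ)
  equivariantB : ∀ ⦃ι : Type⦄ [Fintype ι] [DecidableEq ι] (ρ : H →ₐ[k] Matrix ι ι k),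
    IsEquivariant L ρ (B ρ)
  exchange : IsExchange Q A B
  generate : Algebra.adjoin k {x : L.carrier | ∃ (d : ℕ) (ρ : H →ₐ[k] Matrix (Fin d) (Fin d) k)
    (i j : Fin d), x = A ρ i j ∨ x = B ρ i j} = ⊤

lemma IsHandle.isUnitA {Q : RMatrix k H} (h : IsHandle Q L A B)
    (hS : Function.Bijective (HopfAlgebra.antipode k : H →ₗ[k] H)) (ρ : H →ₐ[k] Matrix ι ι k) :
    IsUnit (A ρ) := h.fusedA.isUnit h.naturalA hS ρ

lemma IsHandle.isUnitB {Q : RMatrix k H} (h : IsHandle Q L A B)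
    (hS : Function.Bijective (HopfAlgebra.antipode k : H →ₗ[k] H)) (ρ : H →ₐ[k] Matrix ι ι k) :
    IsUnit (B ρ) := h.fusedB.isUnit h.naturalB hS ρ

lemma IsHandle.fst_conjFamily {Q : RMatrix k H} (h : IsHandle Q L A B)
    (hS : Function.Bijective (HopfAlgebra.antipode k : H →ₗ[k] H)) (v : H)
    (ρ : H →ₐ[k] Matrix ι ι k) : fstHom k L.carrier ι κ (conjFamily v A B ρ) =
      repFst L.carrier κ ρ (v ^ 2) * fstHom k L.carrier ι κ (B ρ) *
        Ring.inverse (fstHom k L.carrier ι κ (A ρ)) *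
        Ring.inverse (fstHom k L.carrier ι κ (B ρ)) := by
  rw [conjFamily, map_mul, map_mul, map_mul,
    map_inverse_of_isUnit (fstHom k L.carrier ι κ) (h.isUnitA hS ρ),
    map_inverse_of_isUnit (fstHom k L.carrier ι κ) (h.isUnitB hS ρ)]
  rfl

/-- Conjugation by B₁ carries s A₂ r to the opposite coaction on A. Since A₁ commutes with s A₂ r,
the product B A⁻¹ B⁻¹ commutes with that coaction, and v² is central. -/
lemma IsHandle.commute_conjFamily {Q : Ribbon k H} (h : IsHandle Q.toRMatrix L A B)
    (hS : Function.Bijective (HopfAlgebra.antipode k : H →ₗ[k] H))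
    (ρ : H →ₐ[k] Matrix ι ι k) (σ : H →ₐ[k] Matrix κ κ k) :
    Commute (fstHom k L.carrier ι κ (conjFamily Q.v A B ρ)) (Q.opp.coactSnd L ρ (A σ)) := by
  rw [h.fst_conjFamily hS]
  exact word_conj_comm ((h.isUnitA hS ρ).map _) ((h.isUnitB hS ρ).map _)
    (h.exchange.opp_coactSnd_mul_fst ρ (h.equivariantA σ)) (h.fusedA.commute_conj h.naturalA ρ σ)
    (Q.opp.commute_central_coactSnd ρ Q.sq_central _)

/-- The element s B₂ r commutes with B₁ by fusion for B, A₁⁻¹ turns it back into the coaction on B,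
and the reflection equation for B turns this into the opposite coaction. -/
lemma IsHandle.conjFamily_mul {Q : Ribbon k H} (h : IsHandle Q.toRMatrix L A B)
    (hS : Function.Bijective (HopfAlgebra.antipode k : H →ₗ[k] H))
    (ρ : H →ₐ[k] Matrix ι ι k) (σ : H →ₐ[k] Matrix κ κ k) :
    fstHom k L.carrier ι κ (conjFamily Q.v A B ρ) * (Q.sMat L.carrier ρ σ *
        sndHom k L.carrier ι κ (B σ) * Q.rMat L.carrier ρ σ) =
      Q.opp.coactSnd L ρ (B σ) * fstHom k L.carrier ι κ (conjFamily Q.v A B ρ) := by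
  rw [h.fst_conjFamily hS]
  have h1 := h.fusedB.reflection h.naturalB h.equivariantB ρ σ
  exact word_conj_slide ((h.isUnitA hS ρ).map _) ((h.isUnitB hS ρ).map _)
    (h.exchange.fst_mul_coactSnd ρ (h.equivariantB σ)) (h.fusedB.commute_conj h.naturalB ρ σ)
    (h1.1.trans h1.2.symm) (Q.opp.commute_central_coactSnd ρ Q.sq_central _)

lemma IsHandle.equivariant_conjFamily {Q : Ribbon k H} (h : IsHandle Q.toRMatrix L A B)
    (hS : Function.Bijective (HopfAlgebra.antipode k : H →ₗ[k] H))
    (ρ : H →ₐ[k] Matrix ι ι k) : IsEquivariant L ρ (conjFamily Q.v A B ρ) :=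
  (((isEquivariant_central ρ Q.sq_central).mul (h.equivariantB ρ)).mul
    ((h.equivariantA ρ).inverse (h.isUnitA hS ρ))).mul
    ((h.equivariantB ρ).inverse (h.isUnitB hS ρ))

/-- The flip of `commute_conjFamily`: by equivariance of both families, the opposite coaction on A
in one leg is traded for the coaction on the conjugated family in the other. This is the hypothesis
under which `IsFused.mul` applies to the product. -/
lemma IsHandle.commute_coact_conjFamily {Q : Ribbon k H} (h : IsHandle Q.toRMatrix L A B)
    (hS : Function.Bijective (HopfAlgebra.antipode k : H →ₗ[k] H))
    (ρ : H →ₐ[k] Matrix ι ι k) (σ : H →ₐ[k] Matrix κ κ k) (p q : κ) :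
    Commute (A ρ) (Q.coact L ρ (conjFamily Q.v A B σ p q)) := by
  refine (Q.fst_mul_coactSnd_iff ρ Q.toRMatrix _ _ _).1 ?_ p q
  have h1 := congrArg (swapHom k L.carrier ι κ) (h.commute_conjFamily hS σ ρ).eq
  have h2 := congrArg (swapHom k L.carrier ι κ)
    (Q.rMat_mul_opp_coactSnd σ (h.equivariantA ρ))
  simp only [map_mul, Q.swapHom_rMat, swapHom_fstHom, swapHom_sndHom] at h1 h2
  have h3 := Q.coactSnd_mul_sMat ρ (h.equivariant_conjFamily hS σ)
  refine (Q.isUnit_sMat (L := L.carrier) ρ σ).mul_right_cancel ?_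
  rw [mul_assoc, h3, ← mul_assoc, ← h2, mul_assoc, ← h1, ← mul_assoc, ← h3, mul_assoc, h2,
    mul_assoc]

/-- Both coactions are algebra morphisms, so the moment equation needs to be checked only on the
entries of A and B, which generate. -/
lemma IsHandle.isMomentFamily {Q : Ribbon k H} (h : IsHandle Q.toRMatrix L A B)
    (hS : Function.Bijective (HopfAlgebra.antipode k : H →ₗ[k] H)) :
    IsMomentFamily Q.toRMatrix L (fun _ _ _ ρ => conjFamily Q.v A B ρ * A ρ) where
  natural := (isNatural_conjFamily Q.v h.naturalA h.naturalB (fun _ _ _ => h.isUnitA hS)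
    (fun _ _ _ => h.isUnitB hS)).mul h.naturalA
  fused := (isFused_conjFamily h.fusedA h.naturalA h.fusedB h.naturalB h.exchange
    (fun _ _ _ => h.isUnitA hS) (fun _ _ _ => h.isUnitB hS)).mul h.fusedA
    (fun _ _ _ => h.equivariant_conjFamily hS) fun _ _ _ _ _ _ => h.commute_coact_conjFamily hS
  equivariant _ _ _ ρ := (h.equivariant_conjFamily hS ρ).mul (h.equivariantA ρ)
  moment ι _ _ ρ x := by
    have hx : x ∈ Algebra.adjoin k {x : L.carrier | ∃ (d : ℕ)
      (ρ : H →ₐ[k] Matrix (Fin d) (Fin d) k) (i j : Fin d), x = A ρ i j ∨ x = B ρ i j} :=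
      h.generate ▸ Algebra.mem_top
    induction hx using Algebra.adjoin_induction with
    | algebraMap c => rw [AlgHom.commutes, AlgHom.commutes]; exact (Algebra.commutes _ _).symm
    | add x y _ _ hx hy => rw [map_add, map_add, mul_add, add_mul, hx, hy]
    | mul x y _ _ hx hy => rw [map_mul, map_mul, ← mul_assoc, hx, mul_assoc, hy, mul_assoc]
    | mem x hx =>
      obtain ⟨d, σ, p, q, rfl | rfl⟩ := hx
      -- On A: the reflection equation for A makes the coaction opposite, and the conjugated family
      -- commutes with the result.
      · refine (Q.fst_mul_coactSnd_iff ρ Q.opp _ _ _).1 ?_ p q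
        have h1 := h.fusedA.reflection h.naturalA h.equivariantA ρ σ
        rw [map_mul, mul_assoc, h1.1.trans h1.2.symm, ← mul_assoc,
          (h.commute_conjFamily hS ρ σ).eq, mul_assoc]
      -- On B: the factor A turns the coaction into s B₂ r, and the conjugated family turns that
      -- into the opposite coaction.
      · refine (Q.fst_mul_coactSnd_iff ρ Q.opp _ _ _).1 ?_ p q
        rw [map_mul, mul_assoc, h.exchange.fst_mul_coactSnd ρ (h.equivariantB σ), ← mul_assoc,
          h.conjFamily_mul hS, mul_assoc]

end HandleMoment

/-! ### The two factors of a twisted tensor product -/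

section TwistedTensorFactors

variable {k : Type u} [Field k] {H : Type v} [Ring H] [HopfAlgebra k H]
variable {D : Type v} [Ring D] [Algebra k D] {δ : D →ₐ[k] D ⊗[k] D} {ε : D →ₐ[k] k}
variable (f : H →ₐ[k] D) (M N : ModAlg.{u, v, w} δ ε)

namespace ModAlg

lemma twAct_one_right (hε : ∀ h, ε (f h) = Coalgebra.counit (R := k) h) (m : M.carrier) (h : H) :
    twAct M N f (m ⊗ₜ 1) h = M.act m (f h) ⊗ₜ[k] 1 := by
  have e : ∀ X : H ⊗[k] H, TensorProduct.map (M.act m) (N.act 1)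
      (Algebra.TensorProduct.map f f X) = M.act m (f
      (TensorProduct.rid k H ((Coalgebra.counit (R := k) (A := H)).lTensor H X))) ⊗ₜ[k] 1 := by
    intro X
    induction X with
    | zero => simp
    | add X Y hX hY => simp only [map_add, hX, hY, TensorProduct.add_tmul]
    | tmul a b => simp [N.one_act, hε, Algebra.algebraMap_eq_smul_one, TensorProduct.smul_tmul]
  rw [twAct_tmul]
  refine (e (Coalgebra.comul (R := k) h)).trans ?_
  rw [Coalgebra.lTensor_counit_comul]
  simp

lemma twAct_one_left (hε : ∀ h, ε (f h) = Coalgebra.counit (R := k) h) (n : N.carrier) (h : H) :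
    twAct M N f (1 ⊗ₜ n) h = 1 ⊗ₜ[k] N.act n (f h) := by
  have e : ∀ X : H ⊗[k] H, TensorProduct.map (M.act 1) (N.act n)
      (Algebra.TensorProduct.map f f X) = 1 ⊗ₜ[k] N.act n (f
      (TensorProduct.lid k H ((Coalgebra.counit (R := k) (A := H)).rTensor H X))) := by
    intro X
    induction X with
    | zero => simp
    | add X Y hX hY => simp only [map_add, hX, hY, TensorProduct.tmul_add]
    | tmul a b => simp [M.one_act, hε, Algebra.algebraMap_eq_smul_one, TensorProduct.smul_tmul]
  rw [twAct_tmul]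
  refine (e (Coalgebra.comul (R := k) h)).trans ?_
  rw [Coalgebra.rTensor_counit_comul]
  simp

variable {f M N} {χ : D ⊗[k] D} (hχ : IsBichar δ ε χ)
    (hδ : ∀ h, δ (f h) = comulMap f h) (hε : ∀ h, ε (f h) = Coalgebra.counit (R := k) h)
    (hf : ∀ h, comulMap f h * χ =
      χ * Algebra.TensorProduct.map f f (TensorProduct.comm k H H (Coalgebra.comul (R := k) h)))

/-- The exchange relation for a general bicharacter. The product is flipped because the normal order
puts the elements of `M` first, whereas χ has its first leg on `N`. -/
lemma inr_mul_inl (m : M.carrier) (n : N.carrier) :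
    inr hχ hδ hε hf n * inl hχ hδ hε hf m =
      TensorProduct.lift ((LinearMap.mul k (twTensor f M N hχ hδ hε hf).carrier).flip.compl₁₂
        (inr hχ hδ hε hf).toLinearMap (inl hχ hδ hε hf).toLinearMap)
        (TensorProduct.map (N.act n) (M.act m) χ) := by
  have h : ∀ X, (twCore M N X 1 n m 1 : (twTensor f M N hχ hδ hε hf).carrier) =
      TensorProduct.lift ((LinearMap.mul k (twTensor f M N hχ hδ hε hf).carrier).flip.compl₁₂
        (inr hχ hδ hε hf).toLinearMap (inl hχ hδ hε hf).toLinearMap)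
        (TensorProduct.map (N.act n) (M.act m) X) := by
    intro X
    induction X with
    | zero => rw [twCore_zero, map_zero, map_zero]; rfl
    | add X Y hX hY => rw [twCore_add, map_add, map_add, ← hX, ← hY]; rfl
    | tmul a b =>
      rw [twCore_tmul, one_mul, mul_one, TensorProduct.map_tmul, TensorProduct.lift.tmul]
      exact (twCore_one_one hχ _ _).symm
  exact h χ

end ModAlg
end TwistedTensorFactors

/-! ### The exchange relation from the element γ -/

section Exchange

variable {k : Type u} [Field k] {H : Type v} [Ring H] [HopfAlgebra k H] (Q : RMatrix k H)

lemma sidedHom_gam {E : Type w} [Ring E] [Algebra k E] (f g : H →ₐ[k] E)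
    (hc : ∀ x y, Commute (f x) (g y)) : sidedHom f g hc Q.gam =
      Q.at' (sidedOps f g) 2 1 * Q.at' (sidedOps f g) 2 0 * Q.at' (sidedOps f g) 3 1 *
        Q.invAt (sidedOps f g) 0 3 := by
  rw [RMatrix.gam, RMatrix.gamAt, map_mul, map_mul, map_mul,
    Q.map_at _ (sidedHom_leg4 f g hc 2) (sidedHom_leg4 f g hc 1),
    Q.map_at _ (sidedHom_leg4 f g hc 2) (sidedHom_leg4 f g hc 0),
    Q.map_at _ (sidedHom_leg4 f g hc 3) (sidedHom_leg4 f g hc 1),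
    Q.map_invAt _ (sidedHom_leg4 f g hc 0) (sidedHom_leg4 f g hc 3)]

/-- The four factors of γ = R₃₂R₃₁R₄₂R₁₄⁻¹ act in turn: R₁₄⁻¹ inserts an R between `Y` and `X`, R₄₂
multiplies by R on the right and R₃₁ on the left, and R₃₂, brought to the other side, inserts an R
between `X` and `Y`. -/
lemma mul_leg_mul_of_sided_gam {E : Type w} [Ring E] [Algebra k E] {f g : H →ₐ[k] E}
    (hc : ∀ x y, Commute (f x) (g y)) {X Y : E} (hX : ∀ x, Commute X (g x))
    (hY : ∀ x, Commute Y (f x)) (h : X * Y = sidedHom f g hc Q.gam (Y * X)) :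
    X * leg Q.R g.toLinearMap f.toLinearMap * Y = leg Q.R g.toLinearMap f.toLinearMap * Y *
      leg Q.R f.toLinearMap g.toLinearMap * X * leg Q.R g.toLinearMap f.toLinearMap := by
  rw [sidedHom_gam, mul_assoc, mul_assoc, Module.End.mul_apply, Module.End.mul_apply,
    Module.End.mul_apply, Q.invAt_opL_opR' hY hX, Q.at_opR_opR hc, Q.at_opL_opL] at h
  rw [← Q.invAt_opL_opR hX hY, h, ← Module.End.mul_apply,
    Q.inv_mul_at (sidedOps_commute hc) (by decide), Module.End.one_apply]
  simp only [mul_assoc]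

lemma isExchange_coeffFamily {V : Type w} [Ring V] [Algebra k V]
    {a b : restrictedDual k H →ₗ[k] V} (h : ∀ φ ψ, a φ * b ψ =
      TensorProduct.lift ((LinearMap.mul k V).flip.compl₁₂ a b)
        (TensorProduct.map (dualAct φ) (dualAct ψ) Q.gam)) :
    IsExchange Q (coeffFamily a) (coeffFamily b) := by
  intro ι κ _ _ _ _ ρ σ
  have h1 := fst_mul_snd_coeffFamily h ρ σ
  have e : (Matrix.of fun x y => ((LinearMap.mul k V).flip.compl₁₂ a b) (coeffDual ρ x.1 y.1)
      (coeffDual σ x.2 y.2)) = sndHom k V ι κ (coeffFamily b σ) *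
        fstHom k V ι κ (coeffFamily a ρ) := by
    ext x y
    rw [sndHom_mul_fstHom_apply]
    rfl
  rw [e] at h1
  exact mul_leg_mul_of_sided_gam Q _ (commute_fstHom_repSnd σ _)
    (fun x => (commute_repFst_sndHom ρ x _).symm) h1

end Exchange

/-! ### The handle algebra and the boundary matrices -/

section HandleAlgebra

variable {k : Type u} [Field k] {H : Type v} [Ring H] [HopfAlgebra k H] (Q : RMatrix k H)
variable {ι κ : Type} [Fintype ι] [DecidableEq ι] [Fintype κ] [DecidableEq κ]

namespace RMatrix

lemma iB_act (x : Q.L01.carrier) (h : H) : Q.iB (Q.L01.act x h) = Q.L10.act (Q.iB x) h :=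
  (ModAlg.twAct_one_right (Bialgebra.comulAlgHom k H) Q.L01A Q.L01A counitHH_comul x h).symm

lemma iA_act (x : Q.L01.carrier) (h : H) : Q.iA (Q.L01.act x h) = Q.L10.act (Q.iA x) h :=
  (ModAlg.twAct_one_left (Bialgebra.comulAlgHom k H) Q.L01A Q.L01A counitHH_comul x h).symm

lemma iB_mul_iA (x y : Q.L01.carrier) :
    @Eq Q.L10.carrier (Q.iB x * Q.iA y)
      (x ⊗ₜ[k] y : Q.L01A.carrier ⊗[k] Q.L01A.carrier) :=
  ModAlg.twCore_one_one (M := Q.L01A) (N := Q.L01A) Q.isBichar_gam x y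

/-- The first family of matrices of the handle algebra. -/
def linB : restrictedDual k H →ₗ[k] Q.L10.carrier := Q.iB.toLinearMap ∘ₗ Q.toLoop

/-- The second family of matrices of the handle algebra. -/
def linA : restrictedDual k H →ₗ[k] Q.L10.carrier := Q.iA.toLinearMap ∘ₗ Q.toLoop

lemma linA_mul_linB (φ ψ : restrictedDual k H) : Q.linA φ * Q.linB ψ =
    TensorProduct.lift ((LinearMap.mul k Q.L10.carrier).flip.compl₁₂ Q.linA Q.linB)
      (TensorProduct.map (dualAct φ) (dualAct ψ) Q.gam) :=
  ModAlg.inr_mul_inl (M := Q.L01A) (N := Q.L01A) _ _ _ _ _ _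

/-- The two families of matrices of the handle algebra. -/
lemma isHandle_L10 : IsHandle Q Q.L10 (coeffFamily Q.linA) (coeffFamily Q.linB) where
  naturalA := isNatural_coeffFamily _
  naturalB := isNatural_coeffFamily _
  fusedA := Q.isFused_loopMat.map Q.iA
  fusedB := Q.isFused_loopMat.map Q.iB
  equivariantA _ _ _ ρ := (Q.isEquivariant_loopMat ρ).map Q.iA_act
  equivariantB _ _ _ ρ := (Q.isEquivariant_loopMat ρ).map Q.iB_act
  exchange := isExchange_coeffFamily Q Q.linA_mul_linB
  generate := by
    refine top_le_iff.1 fun x _ => ?_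
    set S := Algebra.adjoin k {x : Q.L10.carrier | ∃ (d : ℕ) (ρ : H →ₐ[k] Matrix (Fin d) (Fin d) k)
      (i j : Fin d), x = coeffFamily Q.linA ρ i j ∨ x = coeffFamily Q.linB ρ i j} with hS
    have hA : ∀ y, Q.iA y ∈ S := fun y => by
      induction y using Q.loop_induction with
      | h0 => rw [map_zero]; exact S.zero_mem
      | hadd x y hx hy => rw [map_add]; exact S.add_mem hx hy
      | hsmul c x hx => rw [map_smul]; exact S.smul_mem hx c
      | h d ρ i j => exact Algebra.subset_adjoin ⟨d, ρ, i, j, Or.inl rfl⟩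
    have hB : ∀ y, Q.iB y ∈ S := fun y => by
      induction y using Q.loop_induction with
      | h0 => rw [map_zero]; exact S.zero_mem
      | hadd x y hx hy => rw [map_add]; exact S.add_mem hx hy
      | hsmul c x hx => rw [map_smul]; exact S.smul_mem hx c
      | h d ρ i j => exact Algebra.subset_adjoin ⟨d, ρ, i, j, Or.inr rfl⟩
    -- The products of an element of the B copy with one of the A copy are the pure tensors, so the
    -- two families generate.
    have hBA : ∀ (x y : Q.L01.carrier) (z : Q.L10.carrier), Q.iB x * Q.iA y = z → z ∈ S :=
      fun x y z h => h ▸ S.mul_mem (hB x) (hA y)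
    have h0 : (0 : Q.L10.carrier) ∈ S := S.zero_mem
    have hadd : ∀ x y : Q.L10.carrier, x ∈ S → y ∈ S → x + y ∈ S := fun _ _ => S.add_mem
    change Q.L01A.carrier ⊗[k] Q.L01A.carrier at x
    induction x with
    | zero => exact h0
    | add x y hx hy => exact hadd x y (hx trivial) (hy trivial)
    | tmul x y => exact hBA x y _ (Q.iB_mul_iA x y)

variable (g n : ℕ)

/-- The embedding of the `i`-th handle. -/
def embHandle (i : Fin g) : Q.L10.carrier →ₐ[k] (Q.graphAlg g n).carrier :=
  (Q.braidedInl _ _).comp (Q.powEmb Q.L10 g i)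

lemma matB_eq {d : ℕ} (ρ : H →ₐ[k] Matrix (Fin d) (Fin d) k) (i : Fin g) :
    Q.matB g n ρ i = (Q.embHandle g n i).mapMatrix (coeffFamily Q.linB ρ) := rfl

lemma matA_eq {d : ℕ} (ρ : H →ₐ[k] Matrix (Fin d) (Fin d) k) (i : Fin g) :
    Q.matA g n ρ i = (Q.embHandle g n i).mapMatrix (coeffFamily Q.linA ρ) := rfl

lemma isUnit_matB (hS : Function.Bijective (HopfAlgebra.antipode k : H →ₗ[k] H)) {d : ℕ}
    (ρ : H →ₐ[k] Matrix (Fin d) (Fin d) k) (i : Fin g) : IsUnit (Q.matB g n ρ i) :=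
  (Q.isHandle_L10.isUnitB hS ρ).map (Q.embHandle g n i).mapMatrix

lemma isUnit_matA (hS : Function.Bijective (HopfAlgebra.antipode k : H →ₗ[k] H)) {d : ℕ}
    (ρ : H →ₐ[k] Matrix (Fin d) (Fin d) k) (i : Fin g) : IsUnit (Q.matA g n ρ i) :=
  (Q.isHandle_L10.isUnitA hS ρ).map (Q.embHandle g n i).mapMatrix

/-- The boundary matrices, for representations indexed by arbitrary finite types. -/
def boundaryFamily (v : H) : MatFamily k H (Q.graphAlg g n).carrier := fun _ _ _ ρ =>
  ((List.ofFn fun i : Fin g => (conjFamily v (coeffFamily Q.linA) (coeffFamily Q.linB) ρ *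
    coeffFamily Q.linA ρ).map (Q.powEmb Q.L10 g i)).prod).map (Q.braidedInl _ _) *
  ((List.ofFn fun j : Fin n => (Q.loopMat ρ).map (Q.powEmb Q.L01 n j)).prod).map
    (Q.braidedInr _ _)

/-- The matrices A and B are invertible already over L_{1,0}, so `Ring.inverse` commutes with the
embeddings of the handles, and the boundary matrix is assembled from images of matrices over the
factors. -/
lemma boundaryMatrix_eq (hS : Function.Bijective (HopfAlgebra.antipode k : H →ₗ[k] H)) (v : H)
    {d : ℕ} (ρ : H →ₐ[k] Matrix (Fin d) (Fin d) k) :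
    Q.boundaryMatrix g n v ρ = Q.boundaryFamily g n v ρ := by
  have e1 : ∀ l : List (Matrix (Fin d) (Fin d) (Q.braidedPow Q.L10 g).carrier),
      Matrix.map l.prod (Q.braidedInl (Q.braidedPow Q.L10 g) (Q.braidedPow Q.L01 n)) =
      (l.map (Q.braidedInl (Q.braidedPow Q.L10 g) (Q.braidedPow Q.L01 n)).mapMatrix).prod :=
    fun l => map_list_prod (Q.braidedInl _ _).mapMatrix l
  have e2 : ∀ l : List (Matrix (Fin d) (Fin d) (Q.braidedPow Q.L01 n).carrier),
      Matrix.map l.prod (Q.braidedInr (Q.braidedPow Q.L10 g) (Q.braidedPow Q.L01 n)) =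
      (l.map (Q.braidedInr (Q.braidedPow Q.L10 g) (Q.braidedPow Q.L01 n)).mapMatrix).prod :=
    fun l => map_list_prod (Q.braidedInr _ _).mapMatrix l
  rw [boundaryMatrix, boundaryFamily, e1, e2, List.map_ofFn, List.map_ofFn]
  congr 2
  congr 1
  funext i
  have hA := Q.isHandle_L10.isUnitA hS ρ
  have hB := Q.isHandle_L10.isUnitB hS ρ
  change _ = (Q.embHandle g n i).mapMatrix (conjFamily v (coeffFamily Q.linA)
    (coeffFamily Q.linB) ρ * coeffFamily Q.linA ρ)
  rw [conjFamily, map_mul, map_mul, map_mul, map_mul, map_inverse_of_isUnit _ hA,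
    map_inverse_of_isUnit _ hB, matB_eq, matA_eq]
  congr 4
  exact (map_scalarMat (Q.embHandle g n i) _).symm

end RMatrix

/-- Handles and loops carry moment families, and these are stable under braided powers and products.
-/
lemma isMomentFamily_boundaryFamily (Q : Ribbon k H)
    (hS : Function.Bijective (HopfAlgebra.antipode k : H →ₗ[k] H)) (g n : ℕ) :
    IsMomentFamily Q.toRMatrix (Q.graphAlg g n) (Q.boundaryFamily g n Q.v) :=
  ((Q.isHandle_L10.isMomentFamily hS).pow g).braided ((isMomentFamily_loopMat Q.toRMatrix).pow n)

end HandleAlgebra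

/-! ### From natural families to morphisms on L_{0,1} -/

section Coefficients

variable {k : Type u} [Field k] {H : Type v} [Ring H] [HopfAlgebra k H]
variable {V : Type w} [Ring V] [Algebra k V]
variable {ι κ : Type} [Fintype ι] [DecidableEq ι] [Fintype κ] [DecidableEq κ]

/-- The direct sum of two matrix representations. -/
def sumRep (ρ : H →ₐ[k] Matrix ι ι k) (σ : H →ₐ[k] Matrix κ κ k) :
    H →ₐ[k] Matrix (ι ⊕ κ) (ι ⊕ κ) k :=
  AlgHom.ofLinearMap
    { toFun := fun h => Matrix.fromBlocks (ρ h) 0 0 (σ h)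
      map_add' := fun x y => by simp [Matrix.fromBlocks_add]
      map_smul' := fun c x => by simp [Matrix.fromBlocks_smul] }
    (by simp) (fun x y => by simp [Matrix.fromBlocks_multiply])

lemma sumRep_apply (ρ : H →ₐ[k] Matrix ι ι k) (σ : H →ₐ[k] Matrix κ κ k) (h : H) :
    sumRep ρ σ h = Matrix.fromBlocks (ρ h) 0 0 (σ h) := rfl

/-- Naturality for the inclusion of each summand determines the corresponding block column. -/
lemma IsNatural.sumRep {X : MatFamily k H V} (hX : IsNatural X) (ρ : H →ₐ[k] Matrix ι ι k)
    (σ : H →ₐ[k] Matrix κ κ k) :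
    X (sumRep ρ σ) = Matrix.fromBlocks (X ρ) 0 0 (X σ) := by
  have h1 := hX (GraphAlgebra.sumRep ρ σ) ρ (Matrix.fromRows 1 0) fun h => by
    rw [sumRep_apply, Matrix.fromBlocks_mul_fromRows]; simp [Matrix.fromRows_mul]
  have h2 := hX (GraphAlgebra.sumRep ρ σ) σ (Matrix.fromRows 0 1) fun h => by
    rw [sumRep_apply, Matrix.fromBlocks_mul_fromRows]; simp [Matrix.fromRows_mul]
  have e1 : (Matrix.fromRows (1 : Matrix ι ι k) (0 : Matrix κ ι k)).map (algebraMap k V) =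
      Matrix.fromRows 1 0 := by
    ext (i | i) j <;> simp [Matrix.one_apply]
  have e2 : (Matrix.fromRows (0 : Matrix ι κ k) (1 : Matrix κ κ k)).map (algebraMap k V) =
      Matrix.fromRows 0 1 := by
    ext (i | i) j <;> simp [Matrix.one_apply]
  rw [e1, ← Matrix.fromBlocks_toBlocks (X (GraphAlgebra.sumRep ρ σ)),
    Matrix.fromBlocks_mul_fromRows, Matrix.fromRows_mul] at h1
  rw [e2, ← Matrix.fromBlocks_toBlocks (X (GraphAlgebra.sumRep ρ σ)),
    Matrix.fromBlocks_mul_fromRows, Matrix.fromRows_mul] at h2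
  simp only [Matrix.mul_one, Matrix.mul_zero, add_zero, zero_add, Matrix.one_mul,
    Matrix.zero_mul, Matrix.fromRows_inj.eq_iff] at h1 h2
  rw [← Matrix.fromBlocks_toBlocks (X (GraphAlgebra.sumRep ρ σ)), h1.1, h1.2, h2.1, h2.2]

/-- If `ξ ρ(h) η = 0` for all `h`, then `ξ X_ρ η = 0` for a natural family `X`. -/
lemma IsNatural.eq_zero {X : MatFamily k H V} (hX : IsNatural X) (ρ : H →ₐ[k] Matrix ι ι k)
    (ξ : Matrix Unit ι k) (η : Matrix ι Unit k) (h : ∀ x, ξ * ρ x * η = 0) :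
    ξ.map (algebraMap k V) * X ρ * η.map (algebraMap k V) = 0 := by
  -- The orbit Hη is a subrepresentation contained in the kernel of ξ. Naturality for its inclusion
  -- forces X_ρ η into the span of Hη over `V`, which ξ kills.
  let orb : H →ₗ[k] (ι → k) :=
    { toFun := fun x i => (ρ x * η) i ()
      map_add' := fun x y => by ext; simp [Matrix.add_mul]
      map_smul' := fun c x => by ext; simp }
  let W := LinearMap.range orb
  let b := Module.finBasis k W
  let e := Module.finrank k W
  let inc : (Fin e → k) →ₗ[k] (ι → k) := W.subtype ∘ₗ b.equivFun.symm.toLinearMap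
  -- A left inverse of the inclusion that is only linear. It suffices: TP is the identity on Hη, so
  -- x ↦ P ρ(x) T is the subrepresentation written in a basis.
  obtain ⟨p, hp⟩ := LinearMap.exists_leftInverse_of_injective inc
    (LinearMap.ker_eq_bot.2 (W.injective_subtype.comp b.equivFun.symm.injective))
  let T : Matrix ι (Fin e) k := LinearMap.toMatrix' inc
  let P : Matrix (Fin e) ι k := LinearMap.toMatrix' p
  have hPT : P * T = 1 := by
    rw [← LinearMap.toMatrix'_comp, hp, LinearMap.toMatrix'_id]
  have hW : ∀ x, T * P * (ρ x * η) = ρ x * η := by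
    intro x
    have h1 : ρ x * η = T * Matrix.of fun i _ => b.equivFun ⟨orb x, x, rfl⟩ i := by
      ext i ⟨⟩
      have h2 := LinearMap.toMatrix'_mulVec inc (b.equivFun ⟨orb x, x, rfl⟩)
      have h3 : inc (b.equivFun ⟨orb x, x, rfl⟩) = orb x := by simp [inc]
      exact (congrFun (h2.trans h3) i).symm
    rw [h1, ← Matrix.mul_assoc, Matrix.mul_assoc T, hPT, Matrix.mul_one]
  have hcol : ∀ j, ∃ y, ∀ i, T i j = (ρ y * η) i () := by
    intro j
    obtain ⟨y, hy⟩ := (b j).2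
    refine ⟨y, fun i => ?_⟩
    have h2 : inc (Pi.single j 1) = orb y := by
      rw [hy]; simp [inc]
    refine Eq.trans ?_ (congrFun h2 i)
    change LinearMap.toMatrix' inc i j = _
    rw [LinearMap.toMatrix'_apply]
  have hmul : ∀ {μ : Type} [Fintype μ] (Z : Matrix μ ι k) j y, (∀ i, T i j = (ρ y * η) i ()) →
      ∀ i, (Z * T) i j = (Z * (ρ y * η)) i () := by
    intro μ _ Z j y hy i
    rw [Matrix.mul_apply, Matrix.mul_apply]
    exact Finset.sum_congr rfl fun l _ => by rw [hy]
  have hT : ∀ x, T * P * (ρ x * T) = ρ x * T := by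
    intro x
    ext i j
    obtain ⟨y, hy⟩ := hcol j
    rw [← Matrix.mul_assoc, hmul _ j y hy, hmul _ j y hy, ← Matrix.mul_assoc (ρ x), ← map_mul,
      Matrix.mul_assoc, ← Matrix.mul_assoc (ρ x), ← map_mul, hW]
  let σ : H →ₐ[k] Matrix (Fin e) (Fin e) k := AlgHom.ofLinearMap
    { toFun := fun x => P * (ρ x * T)
      map_add' := fun x y => by rw [map_add, Matrix.add_mul, Matrix.mul_add]
      map_smul' := fun c x => by simp }
    (by simp [hPT]) (fun x y => by
      change P * (ρ (x * y) * T) = P * (ρ x * T) * (P * (ρ y * T))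
      rw [map_mul, Matrix.mul_assoc (ρ x)]
      conv_lhs => rw [← hT y]
      simp only [Matrix.mul_assoc])
  have hσ := hX ρ σ T fun x => by
    change _ = T * (P * (ρ x * T))
    rw [← Matrix.mul_assoc, hT]
  -- At x = 1 this says that η itself lies in the orbit, so η = T(Pη).
  have h1 := hW 1
  rw [map_one, Matrix.one_mul, Matrix.mul_assoc] at h1
  -- Each column of T is some ρ(y)η, on which ξ vanishes by hypothesis.
  have h2 : ξ * T = 0 := by
    ext i j
    obtain ⟨y, hy⟩ := hcol j
    rw [hmul _ j y hy, ← Matrix.mul_assoc, h]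
    rfl
  have h3 : ξ.map (algebraMap k V) * T.map (algebraMap k V) = 0 := by
    rw [← Matrix.map_mul, h2, Matrix.map_zero _ (map_zero _)]
  rw [← h1, Matrix.map_mul, ← Matrix.mul_assoc, Matrix.mul_assoc (ξ.map _), hσ,
    ← Matrix.mul_assoc, h3, Matrix.zero_mul, Matrix.zero_mul]

/-- `φ(h) = ξ ρ(h) η` for all `h`. -/
def Represents (φ : restrictedDual k H) (ρ : H →ₐ[k] Matrix ι ι k) (ξ : Matrix Unit ι k)
    (η : Matrix ι Unit k) : Prop := ∀ h, ξ * ρ h * η = Matrix.of fun _ _ => φ.1.ofConv h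

/-- `ξ X_ρ η` -/
def pairing (X : MatFamily k H V) (ρ : H →ₐ[k] Matrix ι ι k) (ξ : Matrix Unit ι k)
    (η : Matrix ι Unit k) : V :=
  (ξ.map (algebraMap k V) * X ρ * η.map (algebraMap k V)) () ()

lemma Represents.add {φ ψ : restrictedDual k H} {ρ : H →ₐ[k] Matrix ι ι k}
    {σ : H →ₐ[k] Matrix κ κ k} {ξ : Matrix Unit ι k} {η : Matrix ι Unit k}
    {ξ' : Matrix Unit κ k} {η' : Matrix κ Unit k} (h : Represents φ ρ ξ η)
    (h' : Represents ψ σ ξ' η') :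
    Represents (φ + ψ) (sumRep ρ σ) (Matrix.fromCols ξ ξ') (Matrix.fromRows η η') := by
  intro x
  rw [sumRep_apply, Matrix.fromCols_mul_fromBlocks, Matrix.fromCols_mul_fromRows]
  simp only [Matrix.mul_zero, add_zero, zero_add]
  rw [h, h']
  rfl

lemma Represents.smul {φ : restrictedDual k H} {ρ : H →ₐ[k] Matrix ι ι k}
    {ξ : Matrix Unit ι k} {η : Matrix ι Unit k} (h : Represents φ ρ ξ η) (c : k) :
    Represents (c • φ) ρ (c • ξ) η := by
  intro x
  rw [Matrix.smul_mul, Matrix.smul_mul, h]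
  rfl

lemma IsNatural.pairing_add {X : MatFamily k H V} (hX : IsNatural X) (ρ : H →ₐ[k] Matrix ι ι k)
    (σ : H →ₐ[k] Matrix κ κ k) (ξ : Matrix Unit ι k) (η : Matrix ι Unit k)
    (ξ' : Matrix Unit κ k) (η' : Matrix κ Unit k) :
    pairing X (GraphAlgebra.sumRep ρ σ) (Matrix.fromCols ξ ξ') (Matrix.fromRows η η') =
      pairing X ρ ξ η + pairing X σ ξ' η' := by
  have e1 : (Matrix.fromCols ξ ξ').map (algebraMap k V) =
      Matrix.fromCols (ξ.map (algebraMap k V)) (ξ'.map (algebraMap k V)) := by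
    ext i (j | j) <;> rfl
  have e2 : (Matrix.fromRows η η').map (algebraMap k V) =
      Matrix.fromRows (η.map (algebraMap k V)) (η'.map (algebraMap k V)) := by
    ext (i | i) j <;> rfl
  rw [pairing, hX.sumRep, e1, e2, Matrix.fromCols_mul_fromBlocks, Matrix.fromCols_mul_fromRows]
  simp only [Matrix.mul_zero, add_zero, zero_add]
  rfl

lemma pairing_smul (X : MatFamily k H V) (ρ : H →ₐ[k] Matrix ι ι k) (ξ : Matrix Unit ι k)
    (η : Matrix ι Unit k) (c : k) : pairing X ρ (c • ξ) η = c • pairing X ρ ξ η := by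
  have e1 : (c • ξ).map (algebraMap k V) = c • ξ.map (algebraMap k V) := by
    ext; simp [Algebra.smul_def]
  rw [pairing, e1, Matrix.smul_mul, Matrix.smul_mul]
  rfl

/-- The difference of two presentations of φ is a presentation of 0 on the direct sum, where
`IsNatural.eq_zero` applies. This makes the value of the family at φ well defined. -/
lemma IsNatural.pairing_eq {X : MatFamily k H V} (hX : IsNatural X) {φ : restrictedDual k H}
    {ρ : H →ₐ[k] Matrix ι ι k} {σ : H →ₐ[k] Matrix κ κ k} {ξ : Matrix Unit ι k}
    {η : Matrix ι Unit k} {ξ' : Matrix Unit κ k} {η' : Matrix κ Unit k}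
    (h : Represents φ ρ ξ η) (h' : Represents φ σ ξ' η') :
    pairing X ρ ξ η = pairing X σ ξ' η' := by
  have h1 := h.add (h'.smul (-1))
  have h2 := hX.eq_zero _ _ _ fun x => (h1 x).trans (by
    ext i j
    change φ.1.ofConv x + (-1 : k) * φ.1.ofConv x = 0
    ring)
  have h3 := congrFun (congrFun h2 ()) ()
  change pairing X _ _ _ = 0 at h3
  rw [hX.pairing_add, pairing_smul, neg_one_smul] at h3
  exact add_neg_eq_zero.1 h3

lemma represents_coeffDual (ρ : H →ₐ[k] Matrix ι ι k) (i j : ι) : Represents (coeffDual ρ i j) ρ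
    (Matrix.of fun _ l => Pi.single (M := fun _ => k) i 1 l)
    (Matrix.of fun l _ => Pi.single (M := fun _ => k) j 1 l) := by
  intro h
  ext a b
  simp [Matrix.mul_apply, coeffDual_apply, Pi.single_apply]

lemma pairing_coeffDual (X : MatFamily k H V) (ρ : H →ₐ[k] Matrix ι ι k) (i j : ι) : pairing X ρ
    (Matrix.of fun _ l => Pi.single (M := fun _ => k) i 1 l)
    (Matrix.of fun l _ => Pi.single (M := fun _ => k) j 1 l) = X ρ i j := by
  simp [pairing, Matrix.mul_apply, Pi.single_apply, apply_ite (algebraMap k V)]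

lemma exists_represents (φ : restrictedDual k H) : ∃ (ι : Type) (_ : Fintype ι)
    (_ : DecidableEq ι) (ρ : H →ₐ[k] Matrix ι ι k) (ξ : Matrix Unit ι k) (η : Matrix ι Unit k),
    Represents φ ρ ξ η := by
  obtain ⟨φ, hφ⟩ := φ
  induction hφ using Submodule.span_induction with
  | mem φ h =>
    obtain ⟨d, ρ, i, j, rfl⟩ := h
    exact ⟨_, _, _, ρ, _, _, represents_coeffDual ρ i j⟩
  | zero =>
    refine ⟨Unit, inferInstance, inferInstance, trivRep k H, 0, 0, fun h => ?_⟩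
    ext; simp
  | add φ ψ hφ hψ h h' =>
    obtain ⟨ι, _, _, ρ, ξ, η, h⟩ := h
    obtain ⟨κ, _, _, σ, ξ', η', h'⟩ := h'
    exact ⟨ι ⊕ κ, inferInstance, inferInstance, _, _, _, h.add h'⟩
  | smul c φ hφ h =>
    obtain ⟨ι, _, _, ρ, ξ, η, h⟩ := h
    exact ⟨ι, _, _, ρ, _, _, h.smul c⟩

/-- A natural family is the image of the matrices of matrix coefficients under a linear map. -/
lemma IsNatural.exists_linearMap {X : MatFamily k H V} (hX : IsNatural X) :
    ∃ m : restrictedDual k H →ₗ[k] V, coeffFamily m = X := by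
  -- An arbitrary presentation of each functional; linearity follows because the pairing does not
  -- depend on it.
  choose ι f d ρ ξ η h using exists_represents (k := k) (H := H)
  refine ⟨{ toFun := fun φ => pairing X (ρ φ) (ξ φ) (η φ)
            map_add' := fun φ ψ => ?_
            map_smul' := fun c φ => ?_ }, ?_⟩
  · rw [hX.pairing_eq (h _) ((h φ).add (h ψ)), hX.pairing_add]
  · rw [hX.pairing_eq (h _) ((h φ).smul c), pairing_smul]; rfl
  · funext κ _ _ σ
    ext i j
    exact (hX.pairing_eq (h _) (represents_coeffDual σ i j)).trans (pairing_coeffDual X σ i j)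

/-- The operators involved are invertible, so the fusion relation is equivalent to the formula for
the product twisted by F. -/
lemma mul_eq_sided_of_leg {E : Type w} [Ring E] [Algebra k E] (Q : RMatrix k H) {f g : H →ₐ[k] E}
    (hc : ∀ x y, Commute (f x) (g y)) {X Y Z : E} (hX : ∀ x, Commute X (g x))
    (hY : ∀ x, Commute Y (f x)) (h : X * leg Q.R g.toLinearMap f.toLinearMap * Y =
      Z * leg Q.R g.toLinearMap f.toLinearMap) : X * Y = sidedHom f g hc Q.F Z := by
  rw [← Q.invAt_opL_opR hX hY, ← Q.at_opR_opR hc] at h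
  rw [sidedHom_F, Module.End.mul_apply, ← h, ← Module.End.mul_apply,
    Q.at_mul_inv (sidedOps_commute hc) (by decide), Module.End.one_apply]

/-- A natural family that satisfies the fusion relation is the image of the matrices of matrix
coefficients under a morphism of algebras on `L_{0,1}`. -/
lemma IsFused.exists_algHom {Q : RMatrix k H} {X : MatFamily k H V} (hX : IsFused Q X)
    (hn : IsNatural X) : ∃ m : Q.L01.carrier →ₐ[k] V,
      ∀ ⦃ι : Type⦄ [Fintype ι] [DecidableEq ι] (ρ : H →ₐ[k] Matrix ι ι k) (i j : ι),
        m (Q.loopMat ρ i j) = X ρ i j := by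
  obtain ⟨m, rfl⟩ := hn.exists_linearMap
  have h1 : m 1 = 1 := by
    have h := congrFun (congrFun hX.triv ()) ()
    have h2 : coeffDual (trivRep k H) () () = 1 := by
      refine restrictedDual_ext fun x => ?_
      rw [coeffDual_apply, trivRep_apply]
      simp
    change m (coeffDual (trivRep k H) () ()) = _ at h
    rw [h2] at h
    exact h
  let m' : Q.L01.carrier →ₗ[k] V := (m :)
  refine ⟨AlgHom.ofLinearMap m' h1 fun x y => ?_, fun _ _ _ _ _ _ => rfl⟩
  induction x using Q.loop_induction with
  | h0 => rw [zero_mul, map_zero, zero_mul]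
  | hadd x x' hx hx' => rw [add_mul, map_add, hx, hx', map_add, add_mul]
  | hsmul c x hx => rw [smul_mul_assoc, map_smul, hx, map_smul, smul_mul_assoc]
  | h d ρ i j =>
  induction y using Q.loop_induction with
  | h0 => rw [mul_zero, map_zero, mul_zero]
  | hadd x x' hx hx' => rw [mul_add, map_add, hx, hx', map_add, mul_add]
  | hsmul c x hx => rw [mul_smul_comm, map_smul, hx, map_smul, mul_smul_comm]
  | h e σ p q =>
    -- Read backwards, the fusion relation is multiplicativity of `m` on matrix coefficients, which
    -- span L_{0,1}.
    have h2 := mul_eq_sided_of_leg Q (commute_repFst_repSnd ρ σ)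
      (commute_fstHom_repSnd σ (coeffFamily m ρ))
      (fun x => (commute_repFst_sndHom ρ x (coeffFamily m σ)).symm) (hX.fusion ρ σ)
    have h3 : coeffFamily m (tensRep ρ σ) = Matrix.of fun a b =>
        ((LinearMap.mul k (restrictedDual k H)).compr₂ m)
          (coeffDual ρ a.1 b.1) (coeffDual σ a.2 b.2) := by
      ext a b
      change m (coeffDual (tensRep ρ σ) a b) = m (coeffDual ρ a.1 b.1 * coeffDual σ a.2 b.2)
      rw [coeffDual_mul]
    rw [h3, sidedHom_coeffDual, TensorProduct.lift_compr₂] at h2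
    have h4 := congrFun (congrFun h2 (i, p)) (j, q)
    rw [fstHom_mul_sndHom_apply] at h4
    exact h4.symm

end Coefficients

/-! ### The coproduct of Φ(M) and the quantum moment map identity -/

section MomentMap

variable {k : Type u} [Field k] {H : Type v} [Ring H] [HopfAlgebra k H]
variable {ι : Type} [Fintype ι] [DecidableEq ι]

namespace RMatrix
variable (Q : RMatrix k H)

lemma mapMatrix_scalarAlgHom {A B : Type*} [Ring A] [Ring B] [Algebra k A] [Algebra k B]
    (F : A →ₐ[k] B) (x : A) :
    F.mapMatrix (Matrix.scalarAlgHom ι k x) = Matrix.scalarAlgHom ι k (F x) := by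
  change (Matrix.scalar ι x).map F = Matrix.scalar ι (F x)
  rw [Matrix.scalar_apply, Matrix.scalar_apply, Matrix.diagonal_map (map_zero F)]

lemma commute_repL_scalarAlgHom {A : Type*} [Ring A] [Algebra k A] (ρ : H →ₐ[k] Matrix ι ι k)
    (h : H) (x : A) : Commute (repL A ρ h) (Matrix.scalarAlgHom ι k x) := by
  ext i j
  rw [scalar_mul_apply, mul_scalar_apply]
  exact Algebra.commutes _ _

lemma leg_includeLeft_includeRight (X : H ⊗[k] H) :
    leg X (Algebra.TensorProduct.includeLeft : H →ₐ[k] H ⊗[k] H).toLinearMap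
      (Algebra.TensorProduct.includeRight : H →ₐ[k] H ⊗[k] H).toLinearMap = X := by
  induction X with
  | zero => simp
  | add X Y hX hY => rw [leg_add, hX, hY]
  | tmul a b => simp

/-- RR' splits into one R with ρ in its first leg and one R with ρ in its second leg, so that both
coproduct rules for R can be applied to it. -/
lemma Phi_loopMat (ρ : H →ₐ[k] Matrix ι ι k) : (Q.loopMat ρ).map Q.Phi =
    leg Q.R (repL H ρ).toLinearMap (Matrix.scalarAlgHom ι k : H →ₐ[k] Matrix ι ι H).toLinearMap *
    leg Q.R (Matrix.scalarAlgHom ι k : H →ₐ[k] Matrix ι ι H).toLinearMap (repL H ρ).toLinearMap := by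
  have hc := commute_repL_scalarAlgHom (A := H) ρ
  have e : ∀ X : H ⊗[k] H, ∀ i j, applyLeft X (coeffDual ρ i j) = leg X (repL H ρ).toLinearMap
      (Matrix.scalarAlgHom ι k : H →ₐ[k] Matrix ι ι H).toLinearMap i j := by
    intro X i j
    induction X with
    | zero => simp [applyLeft]
    | add X Y hX hY => rw [applyLeft_add, hX, hY, leg_add, Matrix.add_apply]
    | tmul a b =>
      rw [leg_tmul]
      refine Eq.trans ?_ (mul_scalar_apply (k := k) _ _ _ _).symm
      change (ρ a i j) • b = algebraMap k H _ * b
      rw [Algebra.smul_def]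
      rfl
  rw [← leg_comm Q.R (repL H ρ).toLinearMap (Matrix.scalarAlgHom ι k).toLinearMap hc,
    ← leg_mul _ _ _ _ hc]
  ext i j
  exact e _ i j

/-- The matrix over `L_{0,1} ⊗ H` that corresponds to the coproduct of `Φ(M)`. -/
def coprodMat (ρ : H →ₐ[k] Matrix ι ι k) : Matrix ι ι (Q.L01.carrier ⊗[k] H) :=
  leg Q.R (repL (Q.L01.carrier ⊗[k] H) ρ).toLinearMap
      (((Matrix.scalarAlgHom ι k : _ →ₐ[k] Matrix ι ι (Q.L01.carrier ⊗[k] H))).comp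
        (Algebra.TensorProduct.includeRight : H →ₐ[k] Q.L01.carrier ⊗[k] H)).toLinearMap *
    (Q.loopMat ρ).map
      (Algebra.TensorProduct.includeLeft : Q.L01.carrier →ₐ[k] Q.L01.carrier ⊗[k] H) *
    leg Q.R (((Matrix.scalarAlgHom ι k : _ →ₐ[k] Matrix ι ι (Q.L01.carrier ⊗[k] H))).comp
        (Algebra.TensorProduct.includeRight : H →ₐ[k] Q.L01.carrier ⊗[k] H)).toLinearMap
      (repL (Q.L01.carrier ⊗[k] H) ρ).toLinearMap

/-- Expanding Δ in the H-leg of each R-matrix of Φ(M) doubles them. The rule for (id ⊗ Δ)(R) puts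
the second copy of H on the far left and the rule for (Δ ⊗ id)(R) puts it on the far right, while
the two inner factors recombine to Φ(M) in the first copy. -/
lemma map_coprodMat (ρ : H →ₐ[k] Matrix ι ι k) (i j : ι) :
    Algebra.TensorProduct.map Q.Phi (AlgHom.id k H) (Q.coprodMat ρ i j) =
      Coalgebra.comul (R := k) (Q.Phi (Q.loopMat ρ i j)) := by
  have hc := commute_repL_scalarAlgHom (A := H ⊗[k] H) ρ
  let Sc : H ⊗[k] H →ₐ[k] Matrix ι ι (H ⊗[k] H) := Matrix.scalarAlgHom ι k
  let iL : H →ₐ[k] H ⊗[k] H := Algebra.TensorProduct.includeLeft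
  let iR : H →ₐ[k] H ⊗[k] H := Algebra.TensorProduct.includeRight
  let G := Algebra.TensorProduct.map Q.Phi (AlgHom.id k H)
  let D := Bialgebra.comulAlgHom k H
  have hLR : ∀ x y, Commute (Sc (iR x)) (Sc (iL y)) := fun x y => by
    have : Commute (iR x) (iL y) := by simp [iL, iR, Commute, SemiconjBy]
    exact this.map Sc
  have hD : Sc.toLinearMap ∘ₗ D.toLinearMap =
      conv (Sc.comp iL).toLinearMap (Sc.comp iR).toLinearMap := by
    ext x : 1
    rw [conv_apply]
    refine (congrArg Sc (leg_includeLeft_includeRight (Coalgebra.comul (R := k) x)).symm).trans ?_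
    exact leg_eq_of_map' _ _ (fun _ => rfl) (fun _ => rfl)
  have e1 : iL.mapMatrix ((Q.loopMat ρ).map Q.Phi) =
      leg Q.R (repL _ ρ).toLinearMap (Sc.comp iL).toLinearMap *
        leg Q.R (Sc.comp iL).toLinearMap (repL _ ρ).toLinearMap := by
    rw [Phi_loopMat, map_mul]
    congr 1
    · exact leg_eq_of_map' _ _ (fun _ => map_scalarMat iL _) (fun _ => mapMatrix_scalarAlgHom iL _)
    · exact leg_eq_of_map' _ _ (fun _ => mapMatrix_scalarAlgHom iL _) (fun _ => map_scalarMat iL _)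
  have e2 : D.mapMatrix ((Q.loopMat ρ).map Q.Phi) =
      leg Q.R (repL _ ρ).toLinearMap (Sc.toLinearMap ∘ₗ D.toLinearMap) *
        leg Q.R (Sc.toLinearMap ∘ₗ D.toLinearMap) (repL _ ρ).toLinearMap := by
    rw [Phi_loopMat, map_mul]
    congr 1
    · exact leg_eq_of_map' _ _ (fun _ => map_scalarMat D _) (fun _ => mapMatrix_scalarAlgHom D _)
    · exact leg_eq_of_map' _ _ (fun _ => mapMatrix_scalarAlgHom D _) (fun _ => map_scalarMat D _)
  have e3 : G.mapMatrix (Q.coprodMat ρ) =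
      leg Q.R (repL _ ρ).toLinearMap (Sc.comp iR).toLinearMap *
        iL.mapMatrix ((Q.loopMat ρ).map Q.Phi) *
        leg Q.R (Sc.comp iR).toLinearMap (repL _ ρ).toLinearMap := by
    rw [coprodMat, map_mul, map_mul]
    have e4 : ∀ x : H, G (Algebra.TensorProduct.includeRight x) = iR x := fun x => by simp [G, iR]
    congr 1
    · congr 1
      · refine leg_eq_of_map' _ _ (fun _ => map_scalarMat G _) (fun x => ?_)
        exact (mapMatrix_scalarAlgHom G _).trans (congrArg (Matrix.scalarAlgHom ι k) (e4 x))
    · refine leg_eq_of_map' _ _ (fun x => ?_) (fun _ => map_scalarMat G _)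
      exact (mapMatrix_scalarAlgHom G _).trans (congrArg (Matrix.scalarAlgHom ι k) (e4 x))
  have e5 : G.mapMatrix (Q.coprodMat ρ) = D.mapMatrix ((Q.loopMat ρ).map Q.Phi) := by
    rw [e3, e1, e2, hD, Q.leg_R_conv_left (Sc.comp iL).toLinearMap (Sc.comp iR).toLinearMap
        (repL (H ⊗[k] H) ρ) (fun x y => (hc y _).symm),
      Q.leg_R_conv_right (repL (H ⊗[k] H) ρ) (Sc.comp iL).toLinearMap (Sc.comp iR).toLinearMap
        (fun x y => (hc y _).symm) hLR]
    simp only [mul_assoc]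
  exact congrFun (congrFun e5 i) j

end RMatrix

lemma map_scalarMat_mul_mul {U V : Type*} [Ring U] [Algebra k U] [Ring V] [Algebra k V]
    (Ψ : U →ₗ[k] V) (K K' : Matrix ι ι k) (N : Matrix ι ι U) :
    (scalarMat U K * N * scalarMat U K').map Ψ = scalarMat V K * N.map Ψ * scalarMat V K' := by
  ext i j
  rw [Matrix.map_apply, mul_scalarMat_apply, mul_scalarMat_apply, map_sum]
  refine Finset.sum_congr rfl fun q _ => ?_
  rw [map_smul, scalarMat_mul_apply, scalarMat_mul_apply, map_sum]
  congr 1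
  exact Finset.sum_congr rfl fun p _ => map_smul _ _ _

variable (hS : Function.Bijective (HopfAlgebra.antipode k : H →ₗ[k] H))

/-- The inverse of the antipode. -/
def antipodeInv : H →ₗ[k] H := (LinearEquiv.ofBijective (HopfAlgebra.antipode k) hS).symm

lemma antipodeInv_antipode (x : H) : antipodeInv hS (HopfAlgebra.antipode k x) = x :=
  (LinearEquiv.ofBijective (HopfAlgebra.antipode k) hS).symm_apply_apply x

lemma antipode_antipodeInv (x : H) : HopfAlgebra.antipode k (antipodeInv hS x) = x :=
  (LinearEquiv.ofBijective (HopfAlgebra.antipode k) hS).apply_symm_apply x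

lemma antipodeInv_mul_antipode (x y : H) :
    antipodeInv hS (x * HopfAlgebra.antipode k y) = y * antipodeInv hS x := by
  apply hS.1
  rw [antipode_antipodeInv, HopfAlgebra.antipode_mul_antidistrib, antipode_antipodeInv]

variable {L : ModAlg.{u, v, w} (Bialgebra.comulAlgHom k H) (Bialgebra.counitAlgHom k H)}
variable {A : Type*} [Ring A] [Algebra k A]

/-- `y ⊗ b ↦ (x · S⁻¹(b)) F(y)` -/
def actPairing (F : A →ₗ[k] L.carrier) (x : L.carrier) : A ⊗[k] H →ₗ[k] L.carrier :=
  LinearMap.mul' k L.carrier ∘ₗ TensorProduct.map (L.act x ∘ₗ antipodeInv hS) F ∘ₗ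
    (TensorProduct.comm k A H).toLinearMap

lemma actPairing_tmul (F : A →ₗ[k] L.carrier) (x : L.carrier) (y : A) (b : H) :
    actPairing hS F x (y ⊗ₜ[k] b) = L.act x (antipodeInv hS b) * F y := by
  simp [actPairing]

/-- The two outer R-matrices of `coprodMat` are replaced by a general `t` and by S(b) ⊗ b'. The
antipode is there because the pairing acts through S⁻¹, which reverses products and returns b; thus
x is acted on first by b and then by S⁻¹ of the second leg of `t`. -/
lemma map_actPairing (F : A →ₗ[k] L.carrier) (x : L.carrier) (ρ : H →ₐ[k] Matrix ι ι k)
    (M : Matrix ι ι A) (t : H ⊗[k] H) (b b' : H) :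
    (leg t (repL (A ⊗[k] H) ρ).toLinearMap
        (((Matrix.scalarAlgHom ι k : _ →ₐ[k] Matrix ι ι (A ⊗[k] H))).comp
          (Algebra.TensorProduct.includeRight : H →ₐ[k] A ⊗[k] H)).toLinearMap *
      M.map (Algebra.TensorProduct.includeLeft : A →ₐ[k] A ⊗[k] H) *
      (Matrix.scalarAlgHom ι k ((1 : A) ⊗ₜ[k] HopfAlgebra.antipode k b) *
        repL (A ⊗[k] H) ρ b')).map (actPairing hS F x) =
    leg t (repL L.carrier ρ).toLinearMap ((Matrix.scalarAlgHom ι k).toLinearMap ∘ₗ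
      L.act (L.act x b) ∘ₗ antipodeInv hS) * M.map F * repL L.carrier ρ b' := by
  induction t with
  | zero => ext; simp
  | add X Y hX hY =>
    rw [leg_add, leg_add, add_mul, add_mul, add_mul, add_mul, ← hX, ← hY]
    ext i j
    exact map_add (actPairing hS F x) _ _
  | tmul a a' =>
    have e : Matrix.scalarAlgHom ι k ((1 : A) ⊗ₜ[k] a') *
        M.map (Algebra.TensorProduct.includeLeft : A →ₐ[k] A ⊗[k] H) *
        Matrix.scalarAlgHom ι k ((1 : A) ⊗ₜ[k] HopfAlgebra.antipode k b) =
        M.map fun y => y ⊗ₜ[k] (a' * HopfAlgebra.antipode k b) := by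
      ext i j
      rw [mul_scalar_apply, scalar_mul_apply]
      simp
    have e' : (M.map fun y => y ⊗ₜ[k] (a' * HopfAlgebra.antipode k b)).map (actPairing hS F x) =
        Matrix.scalarAlgHom ι k (L.act (L.act x b) (antipodeInv hS a')) * M.map F := by
      ext i j
      rw [scalar_mul_apply]
      simp [actPairing_tmul, antipodeInv_mul_antipode, L.act_mul]
    have e2 := map_scalarMat_mul_mul (actPairing hS F x) (ρ a) (ρ b')
      (M.map fun y => y ⊗ₜ[k] (a' * HopfAlgebra.antipode k b))
    rw [e', ← e] at e2
    rw [leg_tmul, leg_tmul]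
    refine Eq.trans ?_ (e2.trans ?_)
    · refine congrArg (fun Z : Matrix ι ι (A ⊗[k] H) => Z.map (actPairing hS F x)) ?_
      simp only [← mul_assoc]
      rfl
    · simp only [← mul_assoc]
      rfl

/-- By (id ⊗ S)(R⁻¹) = R, acting through S⁻¹ of the second leg of R is acting through the second leg
of R⁻¹, that is, the first leg of R'⁻¹. -/
lemma opp_coact_eq (Q : RMatrix k H) (ρ : H →ₐ[k] Matrix ι ι k) (y : L.carrier) :
    leg Q.R (repL L.carrier ρ).toLinearMap ((Matrix.scalarAlgHom ι k).toLinearMap ∘ₗ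
      L.act y ∘ₗ antipodeInv hS) = Q.opp.coact L ρ y := by
  rw [RMatrix.coact_apply, Q.leg_opp _ _ (fun _ _ => commute_scalar_repL ρ _ _),
    ← Q.leg_Rinv_comp_antipode]
  congr 1
  ext h : 1
  simp [antipodeInv_antipode]

/-- It gathers the R of the coaction and the pair b ⊗ b' into one sandwich, which `sand_R` evaluates
when the pair is R. -/
lemma leg_sand_coact (ρ : H →ₐ[k] Matrix ι ι k) (x : L.carrier) (t : H ⊗[k] H) (b b' : H) :
    leg (RMatrix.sand (Algebra.TensorProduct.includeLeft : H →ₐ[k] H ⊗[k] H)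
        Algebra.TensorProduct.includeRight t (b ⊗ₜ[k] b'))
      ((Matrix.scalarAlgHom ι k).toLinearMap ∘ₗ L.act x) (repL L.carrier ρ).toLinearMap =
    leg t ((Matrix.scalarAlgHom ι k).toLinearMap ∘ₗ L.act (L.act x b))
      (repL L.carrier ρ).toLinearMap * repL L.carrier ρ (HopfAlgebra.antipode k b') := by
  induction t with
  | zero => rw [RMatrix.sand_tmul]; simp
  | add X Y hX hY => rw [RMatrix.sand_add, leg_add, hX, hY, leg_add, add_mul]
  | tmul c c' => simp [RMatrix.sand_tmul, L.act_mul, mul_assoc]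

/-- Write the trailing R of `coprodMat` as (S ⊗ S)(R) with legs S(b) and S(b'). The leading R then
produces the opposite coaction on x · b, the moment equation moves `X ρ` to the front, and the R of
the remaining coaction cancels against b ⊗ b'. -/
lemma IsMomentFamily.actPairing_coprodMat {Q : RMatrix k H} {X : MatFamily k H L.carrier}
    (hX : IsMomentFamily Q L X) (F : Q.L01.carrier →ₐ[k] L.carrier)
    (ρ : H →ₐ[k] Matrix ι ι k) (hF : (Q.loopMat ρ).map F = X ρ) (x : L.carrier) (i j : ι) :
    actPairing hS F.toLinearMap x (Q.coprodMat ρ i j) = X ρ i j * x := by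
  let ScR := ((Matrix.scalarAlgHom ι k : _ →ₐ[k] Matrix ι ι (Q.L01.carrier ⊗[k] H))).comp
    (Algebra.TensorProduct.includeRight : H →ₐ[k] Q.L01.carrier ⊗[k] H)
  have h : ∀ t : H ⊗[k] H, (leg Q.R (repL (Q.L01.carrier ⊗[k] H) ρ).toLinearMap ScR.toLinearMap *
      (Q.loopMat ρ).map
        (Algebra.TensorProduct.includeLeft : Q.L01.carrier →ₐ[k] Q.L01.carrier ⊗[k] H) *
      leg (TensorProduct.map (HopfAlgebra.antipode k) (HopfAlgebra.antipode k) t)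
        ScR.toLinearMap (repL (Q.L01.carrier ⊗[k] H) ρ).toLinearMap).map
          (actPairing hS F.toLinearMap x) =
      X ρ * leg (RMatrix.sand (Algebra.TensorProduct.includeLeft : H →ₐ[k] H ⊗[k] H)
        Algebra.TensorProduct.includeRight Q.R t)
      ((Matrix.scalarAlgHom ι k).toLinearMap ∘ₗ L.act x) (repL L.carrier ρ).toLinearMap := by
    intro t
    induction t with
    | zero => ext; simp
    | add X Y hX hY =>
      rw [map_add, map_add, leg_add, leg_add, mul_add, mul_add, ← hX, ← hY]
      ext i j
      exact map_add (actPairing hS F.toLinearMap x) _ _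
    | tmul b b' =>
      have h1 := map_actPairing hS F.toLinearMap x ρ (Q.loopMat ρ) Q.R b (HopfAlgebra.antipode k b')
      rw [TensorProduct.map_tmul, leg_tmul, leg_sand_coact, ← Q.coact_apply, ← mul_assoc (X ρ),
        hX.moment]
      refine h1.trans ?_
      rw [opp_coact_eq]
      exact congrArg (fun Z => Q.opp.coact L ρ (L.act x b) * Z * _) hF
  -- At t = R the left side is `coprodMat`, by (S ⊗ S)(R) = R, and on the right the sandwich equals
  -- 1, so only x is left beside `X ρ`.
  have h1 := h Q.R
  have h2 := Q.sand_R (Algebra.TensorProduct.includeLeft : H →ₐ[k] H ⊗[k] H)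
    Algebra.TensorProduct.includeRight
  rw [RMatrix.leg_includeLeft_includeRight] at h2
  rw [Q.map_antipode_R, h2, Algebra.TensorProduct.one_def, leg_tmul] at h1
  have h4 : ((Matrix.scalarAlgHom ι k).toLinearMap ∘ₗ L.act x) 1 *
      (repL L.carrier ρ).toLinearMap 1 = Matrix.scalarAlgHom ι k x := by
    rw [LinearMap.comp_apply, L.act_one, AlgHom.toLinearMap_apply (repL L.carrier ρ),
      map_one (repL L.carrier ρ), mul_one]
    rfl
  rw [h4] at h1
  exact (congrFun (congrFun h1 i) j).trans (mul_scalar_apply (k := k) _ _ _ _)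

/-- The coproduct of `Φ(y)` lifts to `L_{0,1} ⊗ H`, compatibly with the moment map equation. -/
lemma IsMomentFamily.exists_coproduct {Q : RMatrix k H} {X : MatFamily k H L.carrier}
    (hX : IsMomentFamily Q L X) (F : Q.L01.carrier →ₐ[k] L.carrier)
    (hF : ∀ ⦃ι : Type⦄ [Fintype ι] [DecidableEq ι] (ρ : H →ₐ[k] Matrix ι ι k) (i j : ι),
      F (Q.loopMat ρ i j) = X ρ i j) (y : Q.L01.carrier) :
    ∃ Θ : Q.L01.carrier ⊗[k] H,
      Algebra.TensorProduct.map Q.Phi (AlgHom.id k H) Θ = Coalgebra.comul (R := k) (Q.Phi y) ∧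
      ∀ x, actPairing hS F.toLinearMap x Θ = F y * x := by
  induction y using Q.loop_induction with
  | h0 => exact ⟨0, by simp, by simp⟩
  | hadd y z hy hz =>
    obtain ⟨Θ, h1, h2⟩ := hy
    obtain ⟨Θ', h1', h2'⟩ := hz
    exact ⟨Θ + Θ', by rw [map_add, map_add, map_add, h1, h1'], fun x => by
      rw [map_add, map_add, add_mul, h2, h2']⟩
  | hsmul c y hy =>
    obtain ⟨Θ, h1, h2⟩ := hy
    exact ⟨c • Θ, by rw [map_smul, map_smul, map_smul, h1], fun x => by
      rw [map_smul, map_smul, smul_mul_assoc, h2]⟩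
  | h d ρ i j =>
    refine ⟨_, Q.map_coprodMat ρ i j, fun x => ?_⟩
    rw [hX.actPairing_coprodMat hS F ρ (by ext; exact hF ρ _ _), hF]

end MomentMap

end GraphAlgebra

end

/-! ### Assembly of the theorem -/

theorem mainTheorem12 {k H : Type*} [Field k] [Ring H] [HopfAlgebra k H]
    (Q : GraphAlgebra.Ribbon k H)
    (hS : Function.Bijective (HopfAlgebra.antipode k : H →ₗ[k] H))
    (hΦ : Function.Injective Q.toRMatrix.Phi) (g n : ℕ) :
    -- the matrices `B(i)` and `A(i)`, inverted in the definition of `C`, are invertible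
    (∀ (d : ℕ) (ρ : H →ₐ[k] Matrix (Fin d) (Fin d) k) (i : Fin g),
      IsUnit (Q.toRMatrix.matB g n ρ i) ∧ IsUnit (Q.toRMatrix.matA g n ρ i)) ∧
    -- `Δ(H') ⊆ H' ⊗ H` for the image `H'` of `Φ_{0,1}`
    (∀ h' : Q.toRMatrix.Phi.range, ∃ (m : ℕ) (a : Fin m → Q.toRMatrix.Phi.range) (b : Fin m → H),
      Coalgebra.comul (R := k) (h' : H) = ∑ p, (a p : H) ⊗ₜ[k] b p) ∧
    -- the algebra morphism `μ` exists
    ∃ μ : Q.toRMatrix.Phi.range →ₐ[k] (Q.toRMatrix.graphAlg g n).carrier,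
      (∀ (d : ℕ) (ρ : H →ₐ[k] Matrix (Fin d) (Fin d) k) (i j : Fin d),
        μ (Q.toRMatrix.Phi.rangeRestrict (Q.toRMatrix.coeffMatrix ρ i j)) =
          Q.toRMatrix.boundaryMatrix g n Q.v ρ i j) ∧
      -- it is the only linear map with these values
      (∀ μ' : Q.toRMatrix.Phi.range →ₗ[k] (Q.toRMatrix.graphAlg g n).carrier,
        (∀ (d : ℕ) (ρ : H →ₐ[k] Matrix (Fin d) (Fin d) k) (i j : Fin d),
          μ' (Q.toRMatrix.Phi.rangeRestrict (Q.toRMatrix.coeffMatrix ρ i j)) =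
            Q.toRMatrix.boundaryMatrix g n Q.v ρ i j) → μ' = μ.toLinearMap) ∧
      -- the quantum moment map equation
      (∀ (h' : Q.toRMatrix.Phi.range) (x : (Q.toRMatrix.graphAlg g n).carrier)
        (m : ℕ) (a : Fin m → Q.toRMatrix.Phi.range) (b : Fin m → H),
        Coalgebra.comul (R := k) (h' : H) = ∑ p, (a p : H) ⊗ₜ[k] b p →
        μ h' * x = ∑ p, Q.toRMatrix.leftAct hS (b p) x * μ (a p)) := by
  obtain ⟨F, hF⟩ := (GraphAlgebra.isMomentFamily_boundaryFamily Q hS g n).fused.exists_algHom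
    (GraphAlgebra.isMomentFamily_boundaryFamily Q hS g n).natural
  have hM := GraphAlgebra.isMomentFamily_boundaryFamily Q hS g n
  -- Injectivity of Φ identifies L_{0,1} with H', and μ is the morphism `F` transported along this
  -- identification.
  let e := AlgEquiv.ofInjective Q.toRMatrix.Phi hΦ
  have he : ∀ x, e.symm (Q.toRMatrix.Phi.rangeRestrict x) = x := fun x => e.symm_apply_apply x
  have he' : ∀ y : Q.toRMatrix.Phi.range, Q.toRMatrix.Phi (e.symm y) = y := fun y =>
    congrArg Subtype.val (e.apply_symm_apply y)
  refine ⟨fun d ρ i => ⟨Q.toRMatrix.isUnit_matB g n hS ρ i, Q.toRMatrix.isUnit_matA g n hS ρ i⟩,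
    fun h' => ?_, F.comp e.symm.toAlgHom, fun d ρ i j => ?_, fun μ' hμ' => ?_,
    fun h' x m a b hab => ?_⟩
  · obtain ⟨Θ, hΘ, -⟩ := hM.exists_coproduct hS F hF (e.symm h')
    rw [he'] at hΘ
    rw [← hΘ]
    clear hΘ
    induction Θ with
    | zero => exact ⟨0, Fin.elim0, Fin.elim0, by simp⟩
    | tmul y z => exact ⟨1, fun _ => Q.toRMatrix.Phi.rangeRestrict y, fun _ => z, by simp⟩
    | add X Y hX hY =>
      obtain ⟨m, a, b, h⟩ := hX
      obtain ⟨m', a', b', h'⟩ := hY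
      refine ⟨m + m', Fin.append a a', Fin.append b b', ?_⟩
      rw [map_add, h, h', Fin.sum_univ_add]
      simp
  · change F (e.symm (Q.toRMatrix.Phi.rangeRestrict _)) = _
    rw [he, Q.toRMatrix.boundaryMatrix_eq g n hS, ← hF ρ i j]
    rfl
  · refine LinearMap.ext fun h' => ?_
    change μ' h' = F (e.symm h')
    -- The matrix coefficients span L_{0,1}, so their values determine a linear map on H'.
    have key : ∀ x, μ' (Q.toRMatrix.Phi.rangeRestrict x) = F x := fun x => by
      induction x using Q.toRMatrix.loop_induction with
      | h0 => simp
      | hadd x y hx hy => rw [map_add, map_add, map_add, hx, hy]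
      | hsmul c x hx => rw [map_smul, map_smul, map_smul, hx]
      | h d ρ i j =>
        rw [hF, ← Q.toRMatrix.boundaryMatrix_eq g n hS, ← hμ']
        rfl
    rw [← key]
    congr 1
    exact (Subtype.ext (he' h')).symm
  · obtain ⟨Θ, hΘ, hx⟩ := hM.exists_coproduct hS F hF (e.symm h')
    have h1 : Θ = ∑ p, e.symm (a p) ⊗ₜ[k] b p := by
      -- Over a field Φ ⊗ id is injective, so every decomposition of Δ(h') in H' ⊗ H lifts to the
      -- same element Θ, and the identity holds for the given one.
      have hinj : Function.Injective (LinearMap.rTensor H Q.toRMatrix.Phi.toLinearMap) :=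
        Module.Flat.rTensor_preserves_injective_linearMap _ hΦ
      apply hinj
      have h2 : LinearMap.rTensor H Q.toRMatrix.Phi.toLinearMap Θ =
        Coalgebra.comul (R := k) (h' : H) := by
        rw [he'] at hΘ
        exact hΘ
      rw [h2, hab, map_sum]
      exact Finset.sum_congr rfl fun p _ => congrArg (· ⊗ₜ[k] b p) (he' (a p)).symm
    change F (e.symm h') * x = _
    rw [← hx x, h1, map_sum]
    exact Finset.sum_congr rfl fun p _ => GraphAlgebra.actPairing_tmul hS _ _ _ _
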